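/- **Setting.** Let $p$ be a prime, let $K'/K$ be a finite tamely ramified Galois extension of finite extensions of $\mathbf Q_p$, let $k'$ be the residue field of $K'$, and let $\pi'$ be a uniformiser of $K'$ with $(\pi')^{e(K'/K)}\in K$. Let $L'/K'$ be an extension of degree prime to $p$ such that $L'/K$ is Galois, with residue field $l'$, and let $\pi''$ be a uniformiser of $L'$ with $(\pi'')^{e(L'/K')}=\pi'$. Let $E/\mathbf Q_p$ be a finite extension containing the image of every embedding $L'\hookrightarrow\overline{\mathbf Q}_p$, with ring of integers $\mathcal O$ and uniformiser $\varpi$. Below, $A$ runs over the $\mathcal O$-algebras in which $\varpi^a=0$ for some $a\ge 1$. Put $\mathfrak S_A=(W(k')\otimes_{\mathbf Z_p}A)[[u]]$, with the $A$-linear endomorphism $\varphi$ which is the Frobenius on $W(k')$ and sends $u$ to $u^p$, and with the $A$-linear action of $\mathrm{Gal}(K'/K)$ which is the natural one on $W(k')$ and sends $u$ to $h(g)u$, where $h(g)=g(\pi')/\pi'\in W(k')$. Let $E(u)$ be the minimal polynomial of $\pi'$ over $W(k')[1/p]$. Let $\mathfrak S'_A$ be the analogous ring for $(L',\pi'')$;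 it is an $\mathfrak S_A$-algebra via $u\mapsto u^{e(L'/K')}$. * $\mathcal C^{\mathrm{dd}}_{K'}(A)=\mathcal C^{\mathrm{dd}}_{d,h,K'}(A)$ is the groupoid of finitely generated projective $\mathfrak S_A$-modules $\mathfrak M$ of constant rank $d$ with a $\varphi$-semilinear map $\varphi_{\mathfrak M}$ whose linearisation $\Phi_{\mathfrak M}:\varphi^*\mathfrak M\to\mathfrak M$ is an isomorphism after inverting $E(u)$ and has cokernel killed by $E(u)^h$, and with a semilinear action of $\mathrm{Gal}(K'/K)$ commuting with $\varphi_{\mathfrak M}$. * $\mathcal M_{\mathrm{loc}}^{K'/K}(A)$ is the groupoid of pairs $(\mathfrak L,\mathfrak L^+)$, where $\mathfrak L$ is a finitely generated projective $\mathcal O_{K'}\otimes_{\mathbf Z_p}A$-module of constant rank $d$ with a semilinear, $A$-linear action of $\mathrm{Gal}(K'/K)$, and $\mathfrak L^+\subseteq\mathfrak L$ is a $\mathrm{Gal}(K'/K)$-stable submodule such that $\mathfrak L/\mathfrak L^+$ is projective over $A$. * $\Psi$ sends $\mathfrak M$ to $(\mathfrak M/E(u)\mathfrak M,\ \mathrm{im}\,\Phi_{\mathfrak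 M}/E(u)\mathfrak M)$; for $h=1$ it is a morphism $\mathcal C^{\mathrm{dd}}_{K'}\to\mathcal M_{\mathrm{loc}}^{K'/K}$. * For a $d$-dimensional $E$-representation $\tau$ of the inertia group $I(K'/K)$, with a stable $\mathcal O$-lattice $\tau^\circ$, $\mathcal C^\tau\subseteq\mathcal C^{\mathrm{dd}}_{K'}$ consists of the $\mathfrak M$ of type $\tau$: for each $\sigma:W(k')\to\mathcal O$, the part of $\mathfrak M/u\mathfrak M$ on which $W(k')$ acts through $\sigma$ is, Zariski locally on $\mathrm{Spec}\,A$, $I(K'/K)$-equivariantly isomorphic to $A\otimes_{\mathcal O}\tau^\circ$. * Let $N=K\cdot W(k')[1/p]$. A pair $(\mathfrak L,\mathfrak L^+)$ satisfies the strong determinant condition if, Zariski locally on $\mathrm{Spec}\,A$, for every character $\xi:I(K'/K)\to\mathcal O^\times$ one has $\det_A(a\mid\mathfrak L^+_\xi)=\prod_{\psi:N\hookrightarrow E}\psi(a)$ as polynomial functions of $a\in\mathcal O_N$, where $\mathfrak L^+_\xi\subseteq \mathfrak L^+$ is the part on which $I(K'/K)$ acts through $\xi$. For $d=2$, $h=1$,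 the substacks $\mathcal C^{\mathrm{dd},\mathrm{BT}}_{K'}\subseteq\mathcal C^{\mathrm{dd}}_{K'}$ and $\mathcal C^{\tau,\mathrm{BT}}\subseteq\mathcal C^\tau$ consist of the $\mathfrak M$ for which $\Psi(\mathfrak M)$ satisfies the strong determinant condition. The same definitions apply to $(L',\pi'')$. If $\tau$ is a representation of $I(K'/K)$, then $\tau'$ denotes its inflation to $I(L'/K)$. **Proposition.** 1. For all $d$ and $h$, the assignments $(\mathfrak L,\mathfrak L^+)\mapsto\mathcal O_{L'}\otimes_{\mathcal O_{K'}}(\mathfrak L,\mathfrak L^+)$ and $\mathfrak M\mapsto\mathfrak S'_A\otimes_{\mathfrak S_A}\mathfrak M$, with the diagonal actions of $\varphi$ and $\mathrm{Gal}(L'/K)$, induce monomorphisms of stacks $\mathcal M_{\mathrm{loc}}^{K'/K}\to\mathcal M_{\mathrm{loc}}^{L'/K}$ and $\mathcal C^{\mathrm{dd}}_{K'}\to\mathcal C^{\mathrm{dd}}_{L'}$, that is, functors that are fully faithful on $A$-points for all $A$ and are compatible with base change in $A$. They are compatible with each other via $\Psi$. 2. The second one induces an isomorphism $\mathcal C^\tau\to\mathcal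 C^{\tau'}$ for all $d$, $h$ and all $d$-dimensional $\tau$; and, for $d=2$ and $h=1$, a monomorphism $\mathcal C^{\mathrm{dd},\mathrm{BT}}_{K'}\to\mathcal C^{\mathrm{dd},\mathrm{BT}}_{L'}$ and, for all two-dimensional $\tau$, an isomorphism $\mathcal C^{\tau,\mathrm{BT}}\to\mathcal C^{\tau',\mathrm{BT}}$. (Isomorphisms of stacks are equivalences of groupoids on $A$-points for all $A$.) -/

import Mathlib

open scoped TensorProduct
open CategoryTheory

universe u

set_option linter.unusedSectionVars false

section LocalRing

variable (p : ℕ) [Fact p.Prime] (F : Type u) [Field F] [Algebra ℚ_[p] F] [Algebra ℤ_[p] F]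
  [IsScalarTower ℤ_[p] ℚ_[p] F] [FiniteDimensional ℚ_[p] F]

/-- The ring of integers of a finite extension `F` of `ℚ_p`. -/
abbrev OInt : Type u := integralClosure ℤ_[p] F

theorem OInt.mem_iff_spectralNorm_le_one (x : F) :
    x ∈ integralClosure ℤ_[p] F ↔ spectralNorm ℚ_[p] F x ≤ 1 := by
  have hx : IsIntegral ℚ_[p] x := Algebra.IsIntegral.isIntegral x
  rw [spectralNorm, spectralValue_le_one_iff (minpoly.monic hx)]
  constructor
  · intro h n
    have h1 := minpoly.isIntegrallyClosed_eq_field_fractions ℚ_[p] F h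
    rw [Algebra.algebraMap_self_apply] at h1
    rw [h1, Polynomial.coeff_map]
    exact PadicInt.norm_le_one _
  · intro h
    have : minpoly ℚ_[p] x ∈ Polynomial.lifts (algebraMap ℤ_[p] ℚ_[p]) := by
      rw [Polynomial.lifts_iff_coeff_lifts]
      intro n
      exact ⟨⟨_, h n⟩, rfl⟩
    obtain ⟨q, hq, -, hm⟩ := Polynomial.lifts_and_degree_eq_and_monic this (minpoly.monic hx)
    refine ⟨q, hm, ?_⟩
    have := minpoly.aeval ℚ_[p] x
    rwa [← hq, Polynomial.aeval_map_algebraMap] at this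

instance OInt.isLocalRing : IsLocalRing (OInt p F) := by
  have key : ∀ x : OInt p F, x ∈ nonunits (OInt p F) ↔ spectralNorm ℚ_[p] F (x : F) < 1 := by
    intro x
    have h1 := (OInt.mem_iff_spectralNorm_le_one p F x).1 x.2
    rw [mem_nonunits_iff, ← not_le, not_iff_not]
    constructor
    · rintro ⟨u, rfl⟩
      have h2 := (OInt.mem_iff_spectralNorm_le_one p F _).1 (↑u⁻¹ : OInt p F).2
      have h3 : spectralNorm ℚ_[p] F ((u : OInt p F) : F) *
          spectralNorm ℚ_[p] F ((↑u⁻¹ : OInt p F) : F) = 1 := by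
        rw [← spectralAlgNorm_def, ← spectralAlgNorm_def, ← spectralAlgNorm_mul,
          ← Subalgebra.coe_mul, Units.mul_inv, Subalgebra.coe_one, spectralAlgNorm_one]
      nlinarith [spectralNorm_nonneg (K := ℚ_[p]) ((u : OInt p F) : F)]
    · intro h
      have h0 : (x : F) ≠ 0 := by
        intro h0
        rw [h0, spectralNorm_zero] at h
        norm_num at h
      have h3 : spectralNorm ℚ_[p] F (x : F) * spectralNorm ℚ_[p] F ((x : F)⁻¹) = 1 := by
        rw [← spectralAlgNorm_def, ← spectralAlgNorm_def, ← spectralAlgNorm_mul,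
          mul_inv_cancel₀ h0, spectralAlgNorm_one]
      have h4 : (x : F)⁻¹ ∈ integralClosure ℤ_[p] F := by
        rw [OInt.mem_iff_spectralNorm_le_one]
        nlinarith [spectralNorm_nonneg (K := ℚ_[p]) ((x : F)⁻¹)]
      exact IsUnit.of_mul_eq_one ⟨_, h4⟩ (Subtype.ext (mul_inv_cancel₀ h0))
  refine IsLocalRing.of_nonunits_add fun a b ha hb => ?_
  rw [key] at ha hb ⊢
  exact (isNonarchimedean_spectralNorm (K := ℚ_[p]) (L := F) (a : F) (b : F)).trans_lt
    (max_lt ha hb)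

instance OInt.finite : Module.Finite ℤ_[p] (OInt p F) :=
  IsIntegralClosure.finite ℤ_[p] ℚ_[p] F (OInt p F)

instance OInt.isNoetherianRing : IsNoetherianRing (OInt p F) :=
  isNoetherian_of_tower ℤ_[p] inferInstance

theorem OInt.algebraMap_injective : Function.Injective (algebraMap ℤ_[p] (OInt p F)) := by
  intro a b h
  have h1 := congrArg (algebraMap (OInt p F) F) h
  rw [← IsScalarTower.algebraMap_apply, ← IsScalarTower.algebraMap_apply,
    IsScalarTower.algebraMap_apply ℤ_[p] ℚ_[p] F, IsScalarTower.algebraMap_apply ℤ_[p] ℚ_[p] F] at h1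
  exact IsFractionRing.injective ℤ_[p] ℚ_[p] ((algebraMap ℚ_[p] F).injective h1)

instance OInt.isLocalHom : IsLocalHom (algebraMap ℤ_[p] (OInt p F)) :=
  haveI : FaithfulSMul ℤ_[p] (OInt p F) :=
    (faithfulSMul_iff_algebraMap_injective _ _).2 (OInt.algebraMap_injective p F)
  Algebra.IsIntegral.isLocalHom _ _

instance OInt.isPrecomplete :
    IsPrecomplete (IsLocalRing.maximalIdeal ℤ_[p]) (OInt p F) := by
  rw [← AdicCompletion.of_surjective_iff]
  intro x
  obtain ⟨t, rfl⟩ := AdicCompletion.ofTensorProduct_surjective_of_finite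
    (IsLocalRing.maximalIdeal ℤ_[p]) (OInt p F) x
  induction t with
  | zero => exact ⟨0, by simp⟩
  | add a b ha hb =>
    obtain ⟨a', ha'⟩ := ha
    obtain ⟨b', hb'⟩ := hb
    exact ⟨a' + b', by rw [map_add, map_add, ha', hb']⟩
  | tmul r m =>
    obtain ⟨r', rfl⟩ := AdicCompletion.of_surjective (IsLocalRing.maximalIdeal ℤ_[p]) ℤ_[p] r
    refine ⟨r' • m, ?_⟩
    rw [AdicCompletion.ofTensorProduct_tmul, map_smul]
    ext n
    rfl

theorem OInt.map_maximalIdeal : (IsLocalRing.maximalIdeal ℤ_[p]).map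
    (algebraMap ℤ_[p] (OInt p F)) = Ideal.span {(p : OInt p F)} := by
  rw [PadicInt.maximalIdeal_eq_span_p, Ideal.map_span, Set.image_singleton, map_natCast]

theorem OInt.p_mem : (p : OInt p F) ∈ IsLocalRing.maximalIdeal (OInt p F) := by
  rw [IsLocalRing.mem_maximalIdeal, mem_nonunits_iff, ← map_natCast (algebraMap ℤ_[p] (OInt p F)),
    isUnit_map_iff]
  exact PadicInt.prime_p.not_isUnit

instance OInt.not_isUnit_p : Fact (¬ IsUnit (p : OInt p F)) := ⟨OInt.p_mem p F⟩

instance OInt.isAdicComplete : IsAdicComplete (Ideal.span {(p : OInt p F)}) (OInt p F) :=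
  haveI : IsHausdorff (Ideal.span {(p : OInt p F)}) (OInt p F) :=
    IsHausdorff.of_isDomain _ (fun h => (OInt.not_isUnit_p p F).1 (Ideal.span_singleton_eq_top.1 h))
  haveI : IsPrecomplete (Ideal.span {(p : OInt p F)}) (OInt p F) := by
    rw [← OInt.map_maximalIdeal, IsPrecomplete.map_algebraMap_iff]
    infer_instance
  { }

/-- The residue field of a finite extension `F` of `ℚ_p`. -/
abbrev ResF : Type u := IsLocalRing.ResidueField (OInt p F)

instance ResF.charP : CharP (ResF p F) p := by
  rw [CharP.charP_iff_prime_eq_zero (Fact.out : p.Prime),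
    ← map_natCast (IsLocalRing.residue (OInt p F)), IsLocalRing.residue_eq_zero_iff]
  exact OInt.p_mem p F

instance ResF.finite : Finite (ResF p F) := by
  have : Finite (IsLocalRing.ResidueField ℤ_[p]) :=
    Finite.of_equiv _ (PadicInt.residueField (p := p)).symm.toEquiv
  exact IsLocalRing.ResidueField.finite_of_finite (R := ℤ_[p]) this

theorem OInt.exists_pow_le : ∃ N : ℕ, IsLocalRing.maximalIdeal (OInt p F) ^ N ≤
    Ideal.span {(p : OInt p F)} := by
  refine Ideal.exists_pow_le_of_le_radical_of_fg ?_ (IsNoetherian.noetherian _)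
  rw [Ideal.radical_eq_sInf]
  refine le_sInf fun P hP => ?_
  obtain ⟨hP1, hP2⟩ := hP
  have h1 : IsLocalRing.maximalIdeal ℤ_[p] ≤ P.comap (algebraMap ℤ_[p] (OInt p F)) := by
    rw [← Ideal.map_le_iff_le_comap, OInt.map_maximalIdeal]
    exact hP1
  have h2 : P.comap (algebraMap ℤ_[p] (OInt p F)) = IsLocalRing.maximalIdeal ℤ_[p] :=
    ((IsLocalRing.maximalIdeal.isMaximal ℤ_[p]).eq_of_le
      (Ideal.IsPrime.comap (algebraMap ℤ_[p] (OInt p F))).ne_top h1).symm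
  have h3 : P.IsMaximal := Ideal.isMaximal_of_isIntegral_of_isMaximal_comap P
    (h2 ▸ IsLocalRing.maximalIdeal.isMaximal ℤ_[p])
  exact (IsLocalRing.eq_maximalIdeal h3).ge

end LocalRing

section Witt

variable (p : ℕ) [Fact p.Prime] (F : Type u) [Field F] [Algebra ℚ_[p] F] [Algebra ℤ_[p] F]
  [IsScalarTower ℤ_[p] ℚ_[p] F] [FiniteDimensional ℚ_[p] F]

/-- A ring homomorphism from the Witt vectors of a perfect ring to the ring of integers of `F` is
determined by its reduction to the residue field. -/
theorem OInt.wittHom_ext {k : Type u} [CommRing k] [CharP k p] [PerfectRing k p]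
    {f g : WittVector p k →+* OInt p F}
    (h : ∀ x, IsLocalRing.residue (OInt p F) (f x) = IsLocalRing.residue (OInt p F) (g x)) :
    f = g := by
  have key : ∀ n : ℕ, (Ideal.Quotient.mk (IsLocalRing.maximalIdeal (OInt p F) ^ n)).comp f =
      (Ideal.Quotient.mk (IsLocalRing.maximalIdeal (OInt p F) ^ n)).comp g := by
    intro n
    apply WittVector.eq_of_apply_teichmuller_eq
    · refine ⟨n, ?_⟩
      rw [← map_natCast (Ideal.Quotient.mk (IsLocalRing.maximalIdeal (OInt p F) ^ n)), ← map_pow,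
        Ideal.Quotient.eq_zero_iff_mem]
      exact Ideal.pow_mem_pow (OInt.p_mem p F) n
    · intro x
      obtain ⟨y, rfl⟩ := (iterateFrobeniusEquiv k p n).surjective x
      rw [iterateFrobeniusEquiv_apply, iterateFrobenius_def, map_pow, RingHom.comp_apply,
        RingHom.comp_apply, map_pow f, map_pow g, Ideal.Quotient.eq]
      have h1 : f (WittVector.teichmuller p y) ≡ g (WittVector.teichmuller p y)
          [SMOD IsLocalRing.maximalIdeal (OInt p F)] := by
        rw [SModEq.sub_mem, ← IsLocalRing.residue_eq_zero_iff, map_sub, h, sub_self]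
      have h2 := SModEq.pow_pow_add_one (OInt.p_mem p F) h1 n
      exact Ideal.pow_le_pow_right n.le_succ (SModEq.sub_mem.1 h2)
  ext1 x
  refine (IsHausdorff.eq_iff_smodEq (I := IsLocalRing.maximalIdeal (OInt p F))).2 fun n => ?_
  rw [smul_eq_mul, Ideal.mul_top, SModEq.sub_mem, ← Ideal.Quotient.eq]
  exact RingHom.congr_fun (key n) x

theorem OInt.exists_wittHom : ∃ ι : WittVector p (ResF p F) →+* OInt p F,
    ∀ x, IsLocalRing.residue (OInt p F) (ι x) = x.coeff 0 := by
  obtain ⟨N, hN⟩ := OInt.exists_pow_le p F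
  obtain ⟨n, hn⟩ : ∃ n, N ≤ p ^ n :=
    ⟨N, (Nat.lt_pow_self (Fact.out : p.Prime).one_lt).le⟩
  have hle : Ideal.span {(p : OInt p F)} ≤ IsLocalRing.maximalIdeal (OInt p F) :=
    (Ideal.span_singleton_le_iff_mem _).2 (OInt.p_mem p F)
  let t : ResF p F →+* ModP (OInt p F) p :=
    Ideal.Quotient.lift (IsLocalRing.maximalIdeal (OInt p F))
      ((iterateFrobenius (ModP (OInt p F) p) p n).comp
        (Ideal.Quotient.mk (Ideal.span {(p : OInt p F)}))) (fun a ha => by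
        rw [RingHom.comp_apply, iterateFrobenius_def, ← map_pow]
        exact Ideal.Quotient.eq_zero_iff_mem.2
          (hN (Ideal.pow_le_pow_right hn (Ideal.pow_mem_pow ha _))))
  let fac : ModP (OInt p F) p →+* ResF p F := Ideal.Quotient.factor hle
  have ht : ∀ y, fac (t y) = y ^ p ^ n := by
    intro y
    obtain ⟨x, rfl⟩ := Ideal.Quotient.mk_surjective y
    rfl
  let s : ResF p F →+* ModP (OInt p F) p :=
    t.comp (iterateFrobeniusEquiv (ResF p F) p n).symm
  have hs : ∀ y, fac (s y) = y := by
    intro y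
    change fac (t _) = y
    rw [ht]
    exact (iterateFrobeniusEquiv (ResF p F) p n).apply_symm_apply y
  refine ⟨(WittVector.fontaineTheta (OInt p F) p).comp
    (WittVector.map (Perfection.lift p (ResF p F) (ModP (OInt p F) p) s)), fun x => ?_⟩
  have h1 := WittVector.mk_fontaineTheta (R := OInt p F) (p := p)
    (WittVector.map (Perfection.lift p (ResF p F) (ModP (OInt p F) p) s) x)
  have h2 := congrArg fac h1
  refine h2.trans ?_
  rw [WittVector.map_coeff]
  exact hs _

/-- The canonical embedding of `W(k_F)` into the ring of integers of `F`: the unique ring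
homomorphism lifting the identity of the residue field `k_F`. -/
noncomputable def OInt.ofWitt : WittVector p (ResF p F) →+* OInt p F :=
  (OInt.exists_wittHom p F).choose

theorem OInt.residue_ofWitt (x : WittVector p (ResF p F)) :
    IsLocalRing.residue (OInt p F) (OInt.ofWitt p F x) = x.coeff 0 :=
  (OInt.exists_wittHom p F).choose_spec x

end Witt

section Series

variable {R S T : Type u} [CommRing R] [CommRing S] [CommRing T]

/-- The homomorphism `∑ aᵢ uⁱ ↦ ∑ ψ(aᵢ) (c uⁿ)ⁱ` of rings of power series. -/
noncomputable def PowerSeries.twist (ψ : R →+* S) (c : S) (n : ℕ) (hn : n ≠ 0) :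
    PowerSeries R →+* PowerSeries S :=
  (PowerSeries.expand n hn : PowerSeries S →ₐ[S] PowerSeries S).toRingHom.comp
    ((PowerSeries.rescale c).comp (PowerSeries.map ψ))

theorem PowerSeries.twist_apply (ψ : R →+* S) (c : S) (n : ℕ) (hn : n ≠ 0) (F : PowerSeries R) :
    PowerSeries.twist ψ c n hn F =
      PowerSeries.expand n hn (PowerSeries.rescale c (PowerSeries.map ψ F)) := rfl

theorem PowerSeries.twist_C (ψ : R →+* S) (c : S) (n : ℕ) (hn : n ≠ 0) (r : R) :
    PowerSeries.twist ψ c n hn (PowerSeries.C r) = PowerSeries.C (ψ r) := by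
  have h : PowerSeries.rescale c (PowerSeries.C (ψ r)) = PowerSeries.C (ψ r) := by
    ext i
    rw [PowerSeries.coeff_rescale, PowerSeries.coeff_C]
    split_ifs with hi
    · rw [hi, pow_zero, one_mul]
    · rw [mul_zero]
  rw [PowerSeries.twist_apply, PowerSeries.map_C, h, PowerSeries.expand_C]

theorem PowerSeries.twist_X (ψ : R →+* S) (c : S) (n : ℕ) (hn : n ≠ 0) :
    PowerSeries.twist ψ c n hn PowerSeries.X = PowerSeries.C c * PowerSeries.X ^ n := by
  rw [PowerSeries.twist_apply, PowerSeries.map_X, PowerSeries.rescale_X, map_mul,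
    PowerSeries.expand_C, PowerSeries.expand_X]

theorem PowerSeries.constantCoeff_twist (ψ : R →+* S) (c : S) (n : ℕ) (hn : n ≠ 0)
    (F : PowerSeries R) : PowerSeries.constantCoeff (PowerSeries.twist ψ c n hn F) =
      ψ (PowerSeries.constantCoeff F) := by
  rw [PowerSeries.twist_apply, PowerSeries.constantCoeff_expand,
    ← PowerSeries.coeff_zero_eq_constantCoeff_apply, PowerSeries.coeff_rescale, pow_zero, one_mul,
    PowerSeries.coeff_map, PowerSeries.coeff_zero_eq_constantCoeff_apply]

theorem PowerSeries.twist_twist {ψ : R →+* S} {c : S} {n : ℕ} {hn : n ≠ 0} {χ : S →+* T} {b : T}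
    {m : ℕ} {hm : m ≠ 0} (F : PowerSeries R) :
    PowerSeries.twist χ b m hm (PowerSeries.twist ψ c n hn F) =
      PowerSeries.twist (χ.comp ψ) (χ c * b ^ n) (m * n) (mul_ne_zero hm hn) F := by
  simp only [PowerSeries.twist_apply]
  rw [PowerSeries.map_expand, PowerSeries.expand_mul m hm n hn]
  congr 1
  ext i
  by_cases h : n ∣ i
  · obtain ⟨j, rfl⟩ := h
    rw [PowerSeries.coeff_rescale, PowerSeries.coeff_expand_mul, PowerSeries.coeff_expand_mul]
    simp only [PowerSeries.coeff_map, PowerSeries.coeff_rescale, map_mul, map_pow,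
      RingHom.comp_apply]
    ring
  · rw [PowerSeries.coeff_rescale, PowerSeries.coeff_expand_of_not_dvd _ _ _ h,
      PowerSeries.coeff_expand_of_not_dvd _ _ _ h, mul_zero]

theorem PowerSeries.twist_congr {ψ ψ' : R →+* S} {c c' : S} {n n' : ℕ} {hn : n ≠ 0} {hn' : n' ≠ 0}
    (h1 : ψ = ψ') (h2 : c = c') (h3 : n = n') (F : PowerSeries R) :
    PowerSeries.twist ψ c n hn F = PowerSeries.twist ψ' c' n' hn' F := by
  subst h1 h2 h3
  rfl

theorem PowerSeries.twist_id (F : PowerSeries R) :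
    PowerSeries.twist (RingHom.id R) 1 1 one_ne_zero F = F := by
  rw [PowerSeries.twist_apply, PowerSeries.map_id, PowerSeries.rescale_one,
    PowerSeries.expand_one_apply]
  rfl

theorem PowerSeries.ringHom_ext_of_isNilpotent {f g : PowerSeries R →+* S}
    (hC : ∀ r, f (PowerSeries.C r) = g (PowerSeries.C r))
    (hX : f PowerSeries.X = g PowerSeries.X) (hn : IsNilpotent (f PowerSeries.X)) : f = g := by
  obtain ⟨N, hN⟩ := hn
  have hp : ∀ P : Polynomial R, f (P : PowerSeries R) = g (P : PowerSeries R) := by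
    intro P
    induction P using Polynomial.induction_on' with
    | add a b ha hb => rw [Polynomial.coe_add, map_add, map_add, ha, hb]
    | monomial n a =>
      rw [Polynomial.coe_monomial, PowerSeries.monomial_eq_C_mul_X_pow, map_mul, map_mul, map_pow,
        map_pow, hC, hX]
  ext1 F
  rw [PowerSeries.eq_X_pow_mul_shift_add_trunc N F, map_add, map_add, map_mul, map_mul, map_pow,
    map_pow, ← hX, hN, zero_mul, zero_mul, hp]

/-- Evaluation `∑ bᵢ uⁱ ↦ ∑ ψ(bᵢ) aⁱ` (a finite sum) of a power series at a nilpotent element. -/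
noncomputable def PowerSeries.evalNil (ψ : R →+* S) (a : S) (ha : IsNilpotent a) :
    PowerSeries R →+* S where
  toFun F := (PowerSeries.trunc (ha.choose + 1) F).eval₂ ψ a
  map_one' := by rw [PowerSeries.trunc_one, Polynomial.eval₂_one]
  map_zero' := by rw [map_zero, Polynomial.eval₂_zero]
  map_add' F G := by rw [map_add, Polynomial.eval₂_add]
  map_mul' F G := by
    have key : ∀ P : Polynomial R, (PowerSeries.trunc (ha.choose + 1) (P : PowerSeries R)).eval₂ ψ a
        = P.eval₂ ψ a := by
      intro P
      have h0 : a ^ (ha.choose + 1) = 0 := by rw [pow_succ, ha.choose_spec, zero_mul]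
      have h : (Polynomial.X : Polynomial R) ^ (ha.choose + 1) ∣
          P - PowerSeries.trunc (ha.choose + 1) (P : PowerSeries R) := by
        rw [Polynomial.X_pow_dvd_iff]
        intro i hi
        rw [Polynomial.coeff_sub, PowerSeries.coeff_trunc, if_pos hi, Polynomial.coeff_coe,
          sub_self]
      obtain ⟨Q, hQ⟩ := h
      rw [eq_comm, ← sub_eq_zero, ← Polynomial.eval₂_sub, hQ, Polynomial.eval₂_mul,
        Polynomial.eval₂_X_pow, h0, zero_mul]
    rw [← PowerSeries.trunc_trunc_mul_trunc, ← Polynomial.coe_mul, key, Polynomial.eval₂_mul]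

theorem PowerSeries.evalNil_C (ψ : R →+* S) (a : S) (ha : IsNilpotent a) (r : R) :
    PowerSeries.evalNil ψ a ha (PowerSeries.C r) = ψ r := by
  change (PowerSeries.trunc (ha.choose + 1) (PowerSeries.C r)).eval₂ ψ a = _
  rw [PowerSeries.trunc_C, Polynomial.eval₂_C]

theorem PowerSeries.evalNil_X (ψ : R →+* S) (a : S) (ha : IsNilpotent a) :
    PowerSeries.evalNil ψ a ha PowerSeries.X = a := by
  change (PowerSeries.trunc (ha.choose + 1) PowerSeries.X).eval₂ ψ a = _
  by_cases h : ha.choose = 0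
  · have h1 := ha.choose_spec
    rw [h, pow_zero] at h1
    have := subsingleton_of_zero_eq_one h1.symm
    exact Subsingleton.elim _ _
  · rw [PowerSeries.trunc_X_of (by omega), Polynomial.eval₂_X]

theorem PowerSeries.evalNil_twist {R' S' : Type u} [CommRing R'] [CommRing S'] {ψ : R →+* S}
    {a : S} {ha : IsNilpotent a} {ψ' : R' →+* S'} {a' : S'} {ha' : IsNilpotent a'} {χ : R →+* R'}
    {c : R'} {n : ℕ} {hn : n ≠ 0} {σ : S →+* S'} (h1 : ∀ r, σ (ψ r) = ψ' (χ r))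
    (h2 : σ a = ψ' c * a' ^ n) (F : PowerSeries R) :
    PowerSeries.evalNil ψ' a' ha' (PowerSeries.twist χ c n hn F) =
      σ (PowerSeries.evalNil ψ a ha F) := by
  have := PowerSeries.ringHom_ext_of_isNilpotent
    (f := σ.comp (PowerSeries.evalNil ψ a ha))
    (g := (PowerSeries.evalNil ψ' a' ha').comp (PowerSeries.twist χ c n hn))
    (fun r => by
      rw [RingHom.comp_apply, RingHom.comp_apply, PowerSeries.evalNil_C, PowerSeries.twist_C,
        PowerSeries.evalNil_C, h1])
    (by
      rw [RingHom.comp_apply, RingHom.comp_apply, PowerSeries.evalNil_X, PowerSeries.twist_X,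
        map_mul, map_pow, PowerSeries.evalNil_C, PowerSeries.evalNil_X, h2])
    (by rw [RingHom.comp_apply, PowerSeries.evalNil_X]; exact ha.map σ)
  exact (RingHom.congr_fun this F).symm

end Series

section ScalarExt

variable {R S R' S' : Type u} [CommRing R] [CommRing S] [CommRing R'] [CommRing S']
  (f : R →+* S) (f' : R' →+* S')
  (M : Type u) [AddCommGroup M] [Module R M] (M' : Type u) [AddCommGroup M'] [Module R' M']

/-- The base change `S ⊗_R M` of an `R`-module along a ring homomorphism `f : R → S`. -/
def ScalarExt : Type u :=
  letI := f.toAlgebra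
  TensorProduct R S M

noncomputable instance ScalarExt.instAddCommGroup : AddCommGroup (ScalarExt f M) :=
  letI := f.toAlgebra
  (inferInstance : AddCommGroup (TensorProduct R S M))

noncomputable instance ScalarExt.instModule : Module S (ScalarExt f M) :=
  letI := f.toAlgebra
  (inferInstance : Module S (TensorProduct R S M))

variable {M M'}

/-- The pure tensor `s ⊗ m`. -/
noncomputable def ScalarExt.tmul (s : S) (m : M) : ScalarExt f M :=
  letI := f.toAlgebra
  TensorProduct.tmul R s m

variable {f}

theorem ScalarExt.tmul_add (s : S) (m n : M) :
    ScalarExt.tmul f s (m + n) = ScalarExt.tmul f s m + ScalarExt.tmul f s n :=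
  letI := f.toAlgebra
  TensorProduct.tmul_add (R := R) s m n

theorem ScalarExt.add_tmul (s t : S) (m : M) :
    ScalarExt.tmul f (s + t) m = ScalarExt.tmul f s m + ScalarExt.tmul f t m :=
  letI := f.toAlgebra
  TensorProduct.add_tmul (R := R) s t m

theorem ScalarExt.smul_tmul (s t : S) (m : M) :
    s • ScalarExt.tmul f t m = ScalarExt.tmul f (s * t) m := by
  let _ := f.toAlgebra
  exact TensorProduct.smul_tmul' (R := R) s t m

theorem ScalarExt.tmul_smul (s : S) (r : R) (m : M) :
    ScalarExt.tmul f s (r • m) = ScalarExt.tmul f (s * f r) m := by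
  let _ := f.toAlgebra
  have h := (TensorProduct.smul_tmul (R := R) r s m).symm
  rw [Algebra.smul_def, mul_comm] at h
  exact h

@[elab_as_elim]
theorem ScalarExt.induction_on {P : ScalarExt f M → Prop} (x : ScalarExt f M)
    (zero : P 0) (tmul : ∀ s m, P (ScalarExt.tmul f s m))
    (add : ∀ x y, P x → P y → P (x + y)) : P x := by
  let _ := f.toAlgebra
  exact TensorProduct.induction_on (motive := P) x zero tmul add

/-- The additive map out of `S ⊗_R M` induced by a balanced biadditive map. -/
noncomputable def ScalarExt.liftAdd {P : Type u} [AddCommGroup P] (β : S →+ M →+ P)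
    (h : ∀ s r m, β (s * f r) m = β s (r • m)) : ScalarExt f M →+ P :=
  letI := f.toAlgebra
  TensorProduct.liftAddHom (R := R) β (fun r s m => by
    rw [← h, Algebra.smul_def, mul_comm]
    rfl)

theorem ScalarExt.liftAdd_tmul {P : Type u} [AddCommGroup P] (β : S →+ M →+ P)
    (h : ∀ s r m, β (s * f r) m = β s (r • m)) (s : S) (m : M) :
    ScalarExt.liftAdd β h (ScalarExt.tmul f s m) = β s m := by
  let _ := f.toAlgebra
  exact TensorProduct.liftAddHom_tmul (R := R) β _ s m

/-- The semilinear map `s ⊗ m ↦ σ(s) ⊗ μ(m)`. -/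
noncomputable def ScalarExt.map {f' : R' →+* S'} (τ : R →+* R') (σ : S →+* S')
    (h : ∀ r, σ (f r) = f' (τ r)) (μ : M →+ M') (hμ : ∀ r m, μ (r • m) = τ r • μ m) :
    ScalarExt f M →+ ScalarExt f' M' :=
  ScalarExt.liftAdd
    (AddMonoidHom.mk' (fun s => AddMonoidHom.mk' (fun m => ScalarExt.tmul f' (σ s) (μ m))
      (fun a b => by rw [map_add, ScalarExt.tmul_add]))
      (fun a b => by
        ext m
        change ScalarExt.tmul f' (σ (a + b)) (μ m) = ScalarExt.tmul f' (σ a) (μ m) +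
          ScalarExt.tmul f' (σ b) (μ m)
        rw [map_add, ScalarExt.add_tmul]))
    (fun s r m => by
      change ScalarExt.tmul f' (σ (s * f r)) (μ m) = ScalarExt.tmul f' (σ s) (μ (r • m))
      rw [hμ, ScalarExt.tmul_smul, map_mul, h])

theorem ScalarExt.map_tmul {f' : R' →+* S'} (τ : R →+* R') (σ : S →+* S')
    (h : ∀ r, σ (f r) = f' (τ r)) (μ : M →+ M') (hμ : ∀ r m, μ (r • m) = τ r • μ m)
    (s : S) (m : M) : ScalarExt.map τ σ h μ hμ (ScalarExt.tmul f s m) =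
      ScalarExt.tmul f' (σ s) (μ m) :=
  ScalarExt.liftAdd_tmul _ _ s m

theorem ScalarExt.map_smul {f' : R' →+* S'} (τ : R →+* R') (σ : S →+* S')
    (h : ∀ r, σ (f r) = f' (τ r)) (μ : M →+ M') (hμ : ∀ r m, μ (r • m) = τ r • μ m)
    (s : S) (x : ScalarExt f M) : ScalarExt.map τ σ h μ hμ (s • x) =
      σ s • ScalarExt.map τ σ h μ hμ x := by
  induction x using ScalarExt.induction_on with
  | zero => simp only [smul_zero, map_zero]
  | tmul t m => rw [ScalarExt.smul_tmul, ScalarExt.map_tmul, ScalarExt.map_tmul,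
      ScalarExt.smul_tmul, map_mul]
  | add x y hx hy => rw [smul_add, map_add, hx, hy, map_add, smul_add]

theorem ScalarExt.addHom_ext {P : Type u} [AddCommGroup P] {a b : ScalarExt f M →+ P}
    (h : ∀ s m, a (ScalarExt.tmul f s m) = b (ScalarExt.tmul f s m)) : a = b := by
  ext x
  induction x using ScalarExt.induction_on with
  | zero => rw [map_zero, map_zero]
  | tmul s m => exact h s m
  | add x y hx hy => rw [map_add, map_add, hx, hy]

theorem ScalarExt.map_map_comm {τ₁ τ₂ : R →+* R} {σ₁ σ₂ : S →+* S}
    {h₁ : ∀ r, σ₁ (f r) = f (τ₁ r)} {h₂ : ∀ r, σ₂ (f r) = f (τ₂ r)} {μ₁ μ₂ : M →+ M}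
    {hμ₁ : ∀ r m, μ₁ (r • m) = τ₁ r • μ₁ m} {hμ₂ : ∀ r m, μ₂ (r • m) = τ₂ r • μ₂ m}
    (hσ : ∀ s, σ₁ (σ₂ s) = σ₂ (σ₁ s)) (hμ : ∀ m, μ₁ (μ₂ m) = μ₂ (μ₁ m)) (x : ScalarExt f M) :
    ScalarExt.map τ₁ σ₁ h₁ μ₁ hμ₁ (ScalarExt.map τ₂ σ₂ h₂ μ₂ hμ₂ x) =
      ScalarExt.map τ₂ σ₂ h₂ μ₂ hμ₂ (ScalarExt.map τ₁ σ₁ h₁ μ₁ hμ₁ x) := by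
  induction x using ScalarExt.induction_on with
  | zero => simp only [map_zero]
  | tmul s m => simp only [ScalarExt.map_tmul, hσ, hμ]
  | add x y hx hy => simp only [map_add, hx, hy]

variable (f)

/-- The isomorphism `S ⊗_R M ≃ S ⊗_R N` induced by an isomorphism `M ≃ N`. -/
noncomputable def ScalarExt.congr {N : Type u} [AddCommGroup N] [Module R N] (e : M ≃ₗ[R] N) :
    ScalarExt f M ≃ₗ[S] ScalarExt f N :=
  letI := f.toAlgebra
  TensorProduct.AlgebraTensorModule.congr (LinearEquiv.refl S S) e

theorem ScalarExt.congr_tmul {N : Type u} [AddCommGroup N] [Module R N] (e : M ≃ₗ[R] N)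
    (s : S) (m : M) : ScalarExt.congr f e (ScalarExt.tmul f s m) = ScalarExt.tmul f s (e m) :=
  rfl

theorem ScalarExt.congr_map {N : Type u} [AddCommGroup N] [Module R N] (e : M ≃ₗ[R] N)
    {τ : R →+* R} {σ : S →+* S} {h : ∀ r, σ (f r) = f (τ r)} {μ : M →+ M} {ν : N →+ N}
    {hμ : ∀ r m, μ (r • m) = τ r • μ m} {hν : ∀ r m, ν (r • m) = τ r • ν m}
    (he : ∀ m, e (μ m) = ν (e m)) (x : ScalarExt f M) :
    ScalarExt.congr f e (ScalarExt.map τ σ h μ hμ x) =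
      ScalarExt.map τ σ h ν hν (ScalarExt.congr f e x) := by
  induction x using ScalarExt.induction_on with
  | zero => simp only [map_zero]
  | tmul s m => simp only [ScalarExt.map_tmul, ScalarExt.congr_tmul, he]
  | add x y hx hy => simp only [map_add, hx, hy]

theorem ScalarExt.congr_refl : ScalarExt.congr (M := M) (N := M) f (LinearEquiv.refl R M) =
    LinearEquiv.refl S (ScalarExt f M) := by
  refine LinearEquiv.ext fun x => ?_
  induction x using ScalarExt.induction_on with
  | zero => rw [map_zero, map_zero]
  | tmul s m => rfl
  | add x y hx hy => rw [map_add, map_add, hx, hy]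

theorem ScalarExt.congr_trans {N P : Type u} [AddCommGroup N] [Module R N] [AddCommGroup P]
    [Module R P] (e : M ≃ₗ[R] N) (e' : N ≃ₗ[R] P) :
    ScalarExt.congr f (e.trans e') = (ScalarExt.congr f e).trans (ScalarExt.congr f e') := by
  refine LinearEquiv.ext fun x => ?_
  induction x using ScalarExt.induction_on with
  | zero => rw [map_zero, map_zero]
  | tmul s m => rfl
  | add x y hx hy => rw [map_add, map_add, hx, hy]

/-- The biadditive map `(s, m) ↦ s β(m)`. -/
def ScalarExt.smulHom {P : Type u} [AddCommGroup P] [Module S P] (β : M →+ P) : S →+ M →+ P :=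
  AddMonoidHom.mk' (fun s => AddMonoidHom.mk' (fun m => s • β m)
    (fun a b => by rw [map_add, smul_add]))
    (fun a b => by ext m; exact add_smul a b (β m))

theorem ScalarExt.smulHom_balanced {P : Type u} [AddCommGroup P] [Module S P] (β : M →+ P)
    (hβ : ∀ r m, β (r • m) = f r • β m) (s : S) (r : R) (m : M) :
    ScalarExt.smulHom β (s * f r) m = ScalarExt.smulHom (S := S) β s (r • m) := by
  change (s * f r) • β m = s • β (r • m)
  rw [hβ, mul_smul]

/-- The `S`-linear map `s ⊗ m ↦ s β(m)` attached to a semilinear map `β : M → P`. -/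
noncomputable def ScalarExt.lift {P : Type u} [AddCommGroup P] [Module S P] (β : M →+ P)
    (hβ : ∀ r m, β (r • m) = f r • β m) : ScalarExt f M →ₗ[S] P where
  __ := ScalarExt.liftAdd (ScalarExt.smulHom β) (ScalarExt.smulHom_balanced f β hβ)
  map_smul' s x := by
    simp only [ZeroHom.toFun_eq_coe, AddMonoidHom.toZeroHom_coe, RingHom.id_apply]
    induction x using ScalarExt.induction_on with
    | zero => simp only [smul_zero, map_zero]
    | tmul t m =>
      rw [ScalarExt.smul_tmul, ScalarExt.liftAdd_tmul, ScalarExt.liftAdd_tmul]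
      exact mul_smul s t (β m)
    | add x y hx hy => rw [smul_add, map_add, hx, hy, map_add, smul_add]

theorem ScalarExt.lift_tmul {P : Type u} [AddCommGroup P] [Module S P] (β : M →+ P)
    (hβ : ∀ r m, β (r • m) = f r • β m) (s : S) (m : M) :
    ScalarExt.lift f β hβ (ScalarExt.tmul f s m) = s • β m :=
  ScalarExt.liftAdd_tmul (ScalarExt.smulHom β) (ScalarExt.smulHom_balanced f β hβ) s m

end ScalarExt

section Equivariant

/-- A commutative ring with an action of the group `G`. -/
structure GRing (G : Type u) [Group G] where
  carrier : Type u
  [commRing : CommRing carrier]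
  act : G → carrier →+* carrier
  act_one : ∀ r, act 1 r = r
  act_mul : ∀ g h r, act (g * h) r = act g (act h r)

attribute [instance] GRing.commRing

/-- A commutative ring with commuting actions of the group `G` and of a Frobenius `phi`. -/
structure PhiRing (G : Type u) [Group G] extends GRing G where
  phi : carrier →+* carrier
  phi_act : ∀ g r, phi (act g r) = act g (phi r)

/-- A ring homomorphism which is equivariant along a homomorphism `α` of groups. -/
structure GRing.Hom {G G' : Type u} [Group G] [Group G'] (α : G' →* G) (X : GRing G)
    (Y : GRing G') where
  toRingHom : X.carrier →+* Y.carrier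
  map_act : ∀ g r, toRingHom (X.act (α g) r) = Y.act g (toRingHom r)

/-- A ring homomorphism compatible with the Frobenius maps and equivariant along `α`. -/
structure PhiRing.Hom {G G' : Type u} [Group G] [Group G'] (α : G' →* G) (X : PhiRing G)
    (Y : PhiRing G') extends GRing.Hom α X.toGRing Y.toGRing where
  map_phi : ∀ r, toRingHom (X.phi r) = Y.phi (toRingHom r)

/-- A module over a ring with `G`-action, with a semilinear action of `G`. -/
structure GModule {G : Type u} [Group G] (X : GRing G) where
  carrier : Type u
  [addCommGroup : AddCommGroup carrier]
  [module : Module X.carrier carrier]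
  act : G → carrier →+ carrier
  act_one : ∀ m, act 1 m = m
  act_mul : ∀ g h m, act (g * h) m = act g (act h m)
  act_smul : ∀ g r m, act g (r • m) = X.act g r • act g m

attribute [instance] GModule.addCommGroup GModule.module

/-- A module with commuting semilinear actions of `G` and of a semilinear Frobenius. -/
structure PhiModule {G : Type u} [Group G] (X : PhiRing G) extends GModule X.toGRing where
  phi : carrier →+ carrier
  phi_smul : ∀ r m, phi (r • m) = X.phi r • phi m
  phi_act : ∀ g m, phi (act g m) = act g (phi m)

/-- A module with a semilinear action of `G` and a `G`-stable submodule. -/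
structure FilModule {G : Type u} [Group G] (X : GRing G) extends GModule X where
  fil : Submodule X.carrier carrier
  act_fil : ∀ g m, m ∈ fil → act g m ∈ fil

variable {G G' : Type u} [Group G] [Group G']

/-- Isomorphisms of modules with Frobenius and `G`-action. -/
@[ext]
structure PhiModule.Iso {X : PhiRing G} (M N : PhiModule X) where
  equiv : M.carrier ≃ₗ[X.carrier] N.carrier
  map_act : ∀ g m, equiv (M.act g m) = N.act g (equiv m)
  map_phi : ∀ m, equiv (M.phi m) = N.phi (equiv m)

/-- Isomorphisms of pairs consisting of a module with `G`-action and a submodule. -/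
@[ext]
structure FilModule.Iso {X : GRing G} (M N : FilModule X) where
  equiv : M.carrier ≃ₗ[X.carrier] N.carrier
  map_act : ∀ g m, equiv (M.act g m) = N.act g (equiv m)
  map_fil : ∀ m, equiv m ∈ N.fil ↔ m ∈ M.fil

/-- The groupoid of modules with Frobenius and `G`-action. -/
instance PhiModule.category (X : PhiRing G) : Category (PhiModule X) where
  Hom := PhiModule.Iso
  id M := ⟨LinearEquiv.refl _ _, fun _ _ => rfl, fun _ => rfl⟩
  comp e e' := ⟨e.equiv.trans e'.equiv,
    fun g m => by simp only [LinearEquiv.trans_apply, e.map_act, e'.map_act],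
    fun m => by simp only [LinearEquiv.trans_apply, e.map_phi, e'.map_phi]⟩

/-- The groupoid of pairs consisting of a module with `G`-action and a submodule. -/
instance FilModule.category (X : GRing G) : Category (FilModule X) where
  Hom := FilModule.Iso
  id M := ⟨LinearEquiv.refl _ _, fun _ _ => rfl, fun _ => Iff.rfl⟩
  comp e e' := ⟨e.equiv.trans e'.equiv,
    fun g m => by simp only [LinearEquiv.trans_apply, e.map_act, e'.map_act],
    fun m => by simp only [LinearEquiv.trans_apply, e'.map_fil, e.map_fil]⟩

/-- Base change of a module with semilinear action, with the diagonal action. -/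
noncomputable def GModule.baseChange {α : G' →* G} {X : GRing G} {Y : GRing G'}
    (f : GRing.Hom α X Y) (M : GModule X) : GModule Y where
  carrier := ScalarExt f.toRingHom M.carrier
  act g := ScalarExt.map (X.act (α g)) (Y.act g) (fun r => (f.map_act g r).symm)
    (M.act (α g)) (M.act_smul (α g))
  act_one x := by
    induction x using ScalarExt.induction_on with
    | zero => rw [map_zero]
    | tmul s m =>
      rw [ScalarExt.map_tmul, map_one, Y.act_one, M.act_one]
    | add x y hx hy => rw [map_add, hx, hy]
  act_mul g h x := by
    induction x using ScalarExt.induction_on with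
    | zero => simp only [map_zero]
    | tmul s m => rw [ScalarExt.map_tmul, ScalarExt.map_tmul, ScalarExt.map_tmul, map_mul, Y.act_mul,
        M.act_mul]
    | add x y hx hy => simp only [map_add, hx, hy]
  act_smul g s x := ScalarExt.map_smul _ _ _ _ _ s x

/-- The pure tensor `s ⊗ m` in the base change of a module. -/
noncomputable def GModule.tmul {α : G' →* G} {X : GRing G} {Y : GRing G'}
    (f : GRing.Hom α X Y) (M : GModule X) (s : Y.carrier) (m : M.carrier) :
    (M.baseChange f).carrier :=
  ScalarExt.tmul f.toRingHom s m

theorem GModule.baseChange_act {α : G' →* G} {X : GRing G} {Y : GRing G'}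
    (f : GRing.Hom α X Y) (M : GModule X) (g : G') (s : Y.carrier) (m : M.carrier) :
    (M.baseChange f).act g (M.tmul f s m) = M.tmul f (Y.act g s) (M.act (α g) m) :=
  ScalarExt.map_tmul (hμ := M.act_smul (α g)) (h := fun r => (f.map_act g r).symm) _ _ _ s m

theorem GModule.congr_act {α : G' →* G} {X : GRing G} {Y : GRing G'} (f : GRing.Hom α X Y)
    {M N : GModule X} (e : M.carrier ≃ₗ[X.carrier] N.carrier)
    (he : ∀ g m, e (M.act g m) = N.act g (e m)) (g : G') (x : (M.baseChange f).carrier) :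
    ScalarExt.congr f.toRingHom e ((M.baseChange f).act g x) =
      (N.baseChange f).act g (ScalarExt.congr f.toRingHom e x) :=
  ScalarExt.congr_map (h := fun r => (f.map_act g r).symm) (hμ := M.act_smul (α g))
    (hν := N.act_smul (α g)) _ e (he (α g)) x

/-- Base change of a module with Frobenius and `G`-action, with the diagonal actions. -/
noncomputable def PhiModule.baseChangeObj {α : G' →* G} {X : PhiRing G} {Y : PhiRing G'}
    (f : PhiRing.Hom α X Y) (M : PhiModule X) : PhiModule Y where
  toGModule := M.toGModule.baseChange f.toHom
  phi := ScalarExt.map X.phi Y.phi (fun r => (f.map_phi r).symm) M.phi M.phi_smul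
  phi_smul s x := ScalarExt.map_smul _ _ _ _ _ s x
  phi_act g x := ScalarExt.map_map_comm (h₂ := fun r => (f.map_act g r).symm)
    (hμ₂ := M.act_smul (α g)) (Y.phi_act g) (M.phi_act (α g)) x

/-- Base change, as a functor. -/
noncomputable def PhiModule.baseChange {α : G' →* G} {X : PhiRing G} {Y : PhiRing G'}
    (f : PhiRing.Hom α X Y) : PhiModule X ⥤ PhiModule Y where
  obj M := M.baseChangeObj f
  map e :=
    { equiv := ScalarExt.congr f.toRingHom e.equiv
      map_act := GModule.congr_act f.toHom e.equiv e.map_act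
      map_phi := ScalarExt.congr_map (h := fun r => (f.map_phi r).symm)
        (hμ := PhiModule.phi_smul _) (hν := PhiModule.phi_smul _) _ e.equiv e.map_phi }
  map_id _ := by
    apply PhiModule.Iso.ext
    exact ScalarExt.congr_refl _
  map_comp e e' := by
    apply PhiModule.Iso.ext
    exact ScalarExt.congr_trans _ e.equiv e'.equiv

theorem ScalarExt.map_mem_span {R S : Type u} [CommRing R] [CommRing S] {f : R →+* S} {M : Type u}
    [AddCommGroup M] [Module R M] {P : Type u} [AddCommGroup P] [Module S P] (σ : S →+* S)
    (μ : ScalarExt f M →+ P) (hμ : ∀ s x, μ (s • x) = σ s • μ x) {V : Set (ScalarExt f M)}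
    {W : Set P} (hV : ∀ x ∈ V, μ x ∈ W) {x : ScalarExt f M} (hx : x ∈ Submodule.span S V) :
    μ x ∈ Submodule.span S W := by
  induction hx using Submodule.span_induction with
  | mem x hx => exact Submodule.subset_span (hV x hx)
  | zero => rw [map_zero]; exact zero_mem _
  | add x y _ _ hx hy => rw [map_add]; exact add_mem hx hy
  | smul s x _ hx => rw [hμ]; exact Submodule.smul_mem _ _ hx

theorem ScalarExt.congr_mem_span {R S : Type u} [CommRing R] [CommRing S] {f : R →+* S}
    {M N : Type u} [AddCommGroup M] [Module R M] [AddCommGroup N] [Module R N] (e : M ≃ₗ[R] N)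
    {V : Set M} {W : Set N} (h : ∀ m, e m ∈ W ↔ m ∈ V) (x : ScalarExt f M) :
    ScalarExt.congr f e x ∈ Submodule.span S (ScalarExt.tmul f 1 '' W) ↔
      x ∈ Submodule.span S (ScalarExt.tmul f 1 '' V) := by
  constructor
  · intro hx
    have h1 := ScalarExt.map_mem_span (RingHom.id S)
      (ScalarExt.congr f e.symm).toLinearMap.toAddMonoidHom (LinearEquiv.map_smul _)
      (V := ScalarExt.tmul f 1 '' W) (W := ScalarExt.tmul f 1 '' V) (by
        rintro _ ⟨n, hn, rfl⟩
        exact ⟨e.symm n, (h _).1 (by rwa [e.apply_symm_apply]), rfl⟩) hx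
    have h2 : (ScalarExt.congr f e.symm) (ScalarExt.congr f e x) = x := by
      change ((ScalarExt.congr f e).trans (ScalarExt.congr f e.symm)) x = x
      rw [← ScalarExt.congr_trans, LinearEquiv.self_trans_symm, ScalarExt.congr_refl]
      rfl
    rw [← h2]
    exact h1
  · intro hx
    exact ScalarExt.map_mem_span (RingHom.id S)
      (ScalarExt.congr f e).toLinearMap.toAddMonoidHom (LinearEquiv.map_smul _)
      (V := ScalarExt.tmul f 1 '' V) (W := ScalarExt.tmul f 1 '' W) (by
        rintro _ ⟨n, hn, rfl⟩
        exact ⟨e n, (h _).2 hn, rfl⟩) hx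

/-- Base change of pairs `(L, L⁺)`, with the diagonal action: the submodule of the base change
is the image of the base change of the submodule. -/
noncomputable def FilModule.baseChangeObj {α : G' →* G} {X : GRing G} {Y : GRing G'}
    (f : GRing.Hom α X Y) (M : FilModule X) : FilModule Y where
  toGModule := M.toGModule.baseChange f
  fil := Submodule.span Y.carrier (M.tmul f 1 '' (M.fil : Set M.carrier))
  act_fil g x hx := by
    refine ScalarExt.map_mem_span (Y.act g) _ ((M.toGModule.baseChange f).act_smul g) ?_ hx
    rintro _ ⟨m, hm, rfl⟩
    refine ⟨M.act (α g) m, M.act_fil _ m hm, ?_⟩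
    have h := M.toGModule.baseChange_act f g 1 m
    rw [map_one] at h
    exact h.symm

/-- Base change of pairs, as a functor. -/
noncomputable def FilModule.baseChange {α : G' →* G} {X : GRing G} {Y : GRing G'}
    (f : GRing.Hom α X Y) : FilModule X ⥤ FilModule Y where
  obj M := M.baseChangeObj f
  map e :=
    { equiv := ScalarExt.congr f.toRingHom e.equiv
      map_act := GModule.congr_act f e.equiv e.map_act
      map_fil := fun x => ScalarExt.congr_mem_span e.equiv e.map_fil x }
  map_id _ := by
    apply FilModule.Iso.ext
    exact ScalarExt.congr_refl _
  map_comp e e' := by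
    apply FilModule.Iso.ext
    exact ScalarExt.congr_trans _ e.equiv e'.equiv

/-- The linearisation `Φ : φ^*M → M`, `s ⊗ m ↦ s φ(m)` of the Frobenius of `M`. -/
noncomputable def PhiModule.linPhi {X : PhiRing G} (M : PhiModule X) :
    ScalarExt X.phi M.carrier →ₗ[X.carrier] M.carrier :=
  ScalarExt.lift X.phi M.phi M.phi_smul

theorem PhiModule.mem_range_linPhi {X : PhiRing G} (M : PhiModule X) (m : M.carrier) :
    M.phi m ∈ LinearMap.range M.linPhi :=
  ⟨ScalarExt.tmul X.phi 1 m, by rw [PhiModule.linPhi, ScalarExt.lift_tmul, one_smul]⟩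

theorem PhiModule.act_mem_range {X : PhiRing G} (M : PhiModule X) (g : G) (m : M.carrier)
    (hm : m ∈ LinearMap.range M.linPhi) : M.act g m ∈ LinearMap.range M.linPhi := by
  obtain ⟨x, rfl⟩ := hm
  induction x using ScalarExt.induction_on with
  | zero => rw [map_zero, map_zero]; exact zero_mem _
  | tmul s m =>
    rw [PhiModule.linPhi, ScalarExt.lift_tmul, M.act_smul, ← M.phi_act]
    exact Submodule.smul_mem _ _ (M.mem_range_linPhi _)
  | add x y hx hy => rw [map_add, map_add]; exact add_mem hx hy

theorem PhiModule.Iso.map_range {X : PhiRing G} {M N : PhiModule X} (e : M.Iso N) (m : M.carrier)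
    (hm : m ∈ LinearMap.range M.linPhi) : e.equiv m ∈ LinearMap.range N.linPhi := by
  obtain ⟨x, rfl⟩ := hm
  induction x using ScalarExt.induction_on with
  | zero => rw [map_zero, map_zero]; exact zero_mem _
  | tmul s m =>
    have h : M.linPhi (ScalarExt.tmul X.phi s m) = s • M.phi m := ScalarExt.lift_tmul _ _ _ s m
    rw [h, map_smul, e.map_phi]
    exact Submodule.smul_mem _ _ (N.mem_range_linPhi _)
  | add x y hx hy => rw [map_add, map_add]; exact add_mem hx hy

/-- The inverse of an isomorphism. -/
def PhiModule.Iso.symm {X : PhiRing G} {M N : PhiModule X} (e : M.Iso N) : N.Iso M where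
  equiv := e.equiv.symm
  map_act g m := by rw [LinearEquiv.symm_apply_eq, e.map_act, LinearEquiv.apply_symm_apply]
  map_phi m := by rw [LinearEquiv.symm_apply_eq, e.map_phi, LinearEquiv.apply_symm_apply]

/-- For a surjection `θ : X → Y` with kernel `I`, this is `M ↦ (M / I M, image of im Φ)`: the base
change of `M` along `θ`, with the submodule generated by the image of `im Φ`. -/
noncomputable def PhiModule.toFil {α : G' →* G} {X : PhiRing G} {Y : GRing G'}
    (θ : GRing.Hom α X.toGRing Y) : PhiModule X ⥤ FilModule Y where
  obj M := FilModule.baseChangeObj θ ⟨M.toGModule, LinearMap.range M.linPhi, M.act_mem_range⟩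
  map {M N} e :=
    { equiv := ScalarExt.congr θ.toRingHom e.equiv
      map_act := GModule.congr_act θ e.equiv e.map_act
      map_fil := fun x => ScalarExt.congr_mem_span e.equiv (fun m => ⟨fun h => by
        have h1 := PhiModule.Iso.map_range (PhiModule.Iso.symm e) _ h
        rw [← e.equiv.symm_apply_apply m]
        exact h1, PhiModule.Iso.map_range e m⟩) x }
  map_id _ := by
    apply FilModule.Iso.ext
    exact ScalarExt.congr_refl _
  map_comp e e' := by
    apply FilModule.Iso.ext
    exact ScalarExt.congr_trans _ e.equiv e'.equiv

end Equivariant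

section PadicWitt

variable (p : ℕ) [Fact p.Prime]

/-- The Witt vectors of a ring of characteristic `p` form an algebra over `W(𝔽_p) = ℤ_p`. -/
noncomputable instance WittVector.algebraPadicInt (k : Type u) [CommRing k] [CharP k p] :
    Algebra ℤ_[p] (WittVector p k) :=
  ((WittVector.map (ZMod.castHom (dvd_refl p) k)).comp
    (WittVector.equiv p).symm.toRingHom).toAlgebra

/-- Functoriality of the Witt vectors. -/
noncomputable def WittVector.mapAlg {k l : Type u} [CommRing k] [CharP k p] [CommRing l] [CharP l p]
    (f : k →+* l) : WittVector p k →ₐ[ℤ_[p]] WittVector p l where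
  __ := WittVector.map f
  commutes' x := by
    change WittVector.map f (WittVector.map _ _) = WittVector.map _ _
    ext n
    rw [WittVector.map_coeff, WittVector.map_coeff, WittVector.map_coeff, ← RingHom.comp_apply,
      Subsingleton.elim (f.comp (ZMod.castHom (dvd_refl p) k)) (ZMod.castHom (dvd_refl p) l)]

variable {p}

theorem WittVector.mapAlg_apply {k l : Type u} [CommRing k] [CharP k p] [CommRing l] [CharP l p]
    (f : k →+* l) (x : WittVector p k) : WittVector.mapAlg p f x = WittVector.map f x := rfl

theorem WittVector.mapAlg_id {k : Type u} [CommRing k] [CharP k p] :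
    WittVector.mapAlg p (RingHom.id k) = AlgHom.id _ _ := by
  ext x n
  rfl

theorem WittVector.mapAlg_comp {k l m : Type u} [CommRing k] [CharP k p] [CommRing l] [CharP l p]
    [CommRing m] [CharP m p] (g : l →+* m) (f : k →+* l) :
    (WittVector.mapAlg p g).comp (WittVector.mapAlg p f) = WittVector.mapAlg p (g.comp f) := by
  ext x n
  rfl

theorem WittVector.mapAlg_teichmuller {k l : Type u} [CommRing k] [CharP k p] [CommRing l]
    [CharP l p] (f : k →+* l) (x : k) : WittVector.mapAlg p f (WittVector.teichmuller p x) =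
      WittVector.teichmuller p (f x) :=
  WittVector.map_teichmuller p f x

end PadicWitt

section Arithmetic

variable (p : ℕ) [Fact p.Prime]
  (F : Type u) [Field F] [Algebra ℚ_[p] F] [Algebra ℤ_[p] F]
  [IsScalarTower ℤ_[p] ℚ_[p] F] [FiniteDimensional ℚ_[p] F]
  {F₁ : Type u} [Field F₁] [Algebra ℚ_[p] F₁] [Algebra ℤ_[p] F₁]
  [IsScalarTower ℤ_[p] ℚ_[p] F₁] [FiniteDimensional ℚ_[p] F₁]
  {F₂ : Type u} [Field F₂] [Algebra ℚ_[p] F₂] [Algebra ℤ_[p] F₂]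
  [IsScalarTower ℤ_[p] ℚ_[p] F₂] [FiniteDimensional ℚ_[p] F₂]
  {F₃ : Type u} [Field F₃] [Algebra ℚ_[p] F₃] [Algebra ℤ_[p] F₃]
  [IsScalarTower ℤ_[p] ℚ_[p] F₃] [FiniteDimensional ℚ_[p] F₃]

/-- The ring `W(k_F)`. -/
abbrev WInt : Type u := WittVector p (ResF p F)

theorem OInt.padicInt_hom_ext (f g : ℤ_[p] →+* OInt p F) : f = g := by
  ext1 x
  refine (IsHausdorff.eq_iff_smodEq (I := IsLocalRing.maximalIdeal (OInt p F))).2 fun n => ?_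
  obtain ⟨z, hz⟩ := Ideal.mem_span_singleton.1 (PadicInt.appr_spec n x)
  obtain hx : x = (x.appr n : ℤ_[p]) + (p : ℤ_[p]) ^ n * z := by rw [← hz]; ring
  have h : f x - g x = (p : OInt p F) ^ n * (f z - g z) := by
    rw [hx]
    simp only [map_add, map_mul, map_pow, map_natCast]
    ring
  rw [smul_eq_mul, Ideal.mul_top, SModEq.sub_mem, h]
  exact Ideal.mul_mem_right _ _ (Ideal.pow_mem_pow (OInt.p_mem p F) n)

/-- The embedding of `W(k_F)` into the ring of integers of `F`, as a `ℤ_p`-algebra map. -/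
noncomputable def OInt.ofWittAlg : WInt p F →ₐ[ℤ_[p]] OInt p F where
  __ := OInt.ofWitt p F
  commutes' x := RingHom.congr_fun (OInt.padicInt_hom_ext p F
    ((OInt.ofWitt p F).comp (algebraMap ℤ_[p] (WInt p F))) (algebraMap ℤ_[p] (OInt p F))) x

variable {p}

/-- The map on rings of integers induced by an embedding of fields. -/
noncomputable def OInt.map (f : F₁ →ₐ[ℤ_[p]] F₂) : OInt p F₁ →ₐ[ℤ_[p]] OInt p F₂ :=
  f.mapIntegralClosure

theorem OInt.coe_map (f : F₁ →ₐ[ℤ_[p]] F₂) (x : OInt p F₁) : (OInt.map f x : F₂) = f x := rfl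

instance OInt.isLocalHom_map (f : F₁ →ₐ[ℤ_[p]] F₂) :
    IsLocalHom (OInt.map f : OInt p F₁ →+* OInt p F₂) where
  map_nonunit a ha := by
    obtain ⟨u, hu⟩ := ha
    have h0 : f (a : F₁) * ((↑u⁻¹ : OInt p F₂) : F₂) = 1 := by
      have h1 : (u : OInt p F₂) * (↑u⁻¹ : OInt p F₂) = 1 := Units.mul_inv u
      rw [hu] at h1
      exact congrArg (Subtype.val) h1
    have hne : (a : F₁) ≠ 0 := by
      intro h
      rw [h, map_zero, zero_mul] at h0
      exact zero_ne_one h0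
    have h2 : f ((a : F₁)⁻¹) = ((↑u⁻¹ : OInt p F₂) : F₂) := by
      rw [map_inv₀]
      exact inv_eq_of_mul_eq_one_right h0
    have h3 : IsIntegral ℤ_[p] ((a : F₁)⁻¹) := by
      rw [← isIntegral_algHom_iff f f.toRingHom.injective, h2]
      exact (↑u⁻¹ : OInt p F₂).2
    exact IsUnit.of_mul_eq_one ⟨(a : F₁)⁻¹, h3⟩ (Subtype.ext (mul_inv_cancel₀ hne))

/-- The map on residue fields induced by an embedding of fields. -/
noncomputable def ResF.map (f : F₁ →ₐ[ℤ_[p]] F₂) : ResF p F₁ →+* ResF p F₂ :=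
  IsLocalRing.ResidueField.map (OInt.map f : OInt p F₁ →+* OInt p F₂)

theorem ResF.map_residue (f : F₁ →ₐ[ℤ_[p]] F₂) (x : OInt p F₁) :
    ResF.map f (IsLocalRing.residue _ x) = IsLocalRing.residue _ (OInt.map f x) := rfl

theorem ResF.map_id : ResF.map (AlgHom.id ℤ_[p] F₁) = RingHom.id _ := by
  ext x
  obtain ⟨x, rfl⟩ := IsLocalRing.residue_surjective x
  rfl

theorem ResF.map_comp (g : F₂ →ₐ[ℤ_[p]] F₃) (f : F₁ →ₐ[ℤ_[p]] F₂) :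
    ResF.map (g.comp f) = (ResF.map g).comp (ResF.map f) := by
  ext x
  obtain ⟨x, rfl⟩ := IsLocalRing.residue_surjective x
  rfl

/-- The map on Witt vectors of residue fields induced by an embedding of fields. -/
noncomputable def WInt.map (f : F₁ →ₐ[ℤ_[p]] F₂) : WInt p F₁ →ₐ[ℤ_[p]] WInt p F₂ :=
  WittVector.mapAlg p (ResF.map f)

theorem WInt.map_id : WInt.map (AlgHom.id ℤ_[p] F₁) = AlgHom.id _ _ := by
  rw [WInt.map, ResF.map_id, WittVector.mapAlg_id]

theorem WInt.map_comp (g : F₂ →ₐ[ℤ_[p]] F₃) (f : F₁ →ₐ[ℤ_[p]] F₂) :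
    WInt.map (g.comp f) = (WInt.map g).comp (WInt.map f) := by
  rw [WInt.map, ResF.map_comp, ← WittVector.mapAlg_comp]
  rfl

theorem OInt.map_ofWitt (f : F₁ →ₐ[ℤ_[p]] F₂) (x : WInt p F₁) :
    OInt.map f (OInt.ofWittAlg p F₁ x) = OInt.ofWittAlg p F₂ (WInt.map f x) := by
  have key := OInt.wittHom_ext p F₂ (k := ResF p F₁)
    (f := (OInt.map f : OInt p F₁ →+* OInt p F₂).comp (OInt.ofWitt p F₁))
    (g := (OInt.ofWitt p F₂).comp (WInt.map f : WInt p F₁ →+* WInt p F₂)) (fun y => by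
      change IsLocalRing.residue _ (OInt.map f (OInt.ofWitt p F₁ y)) =
        IsLocalRing.residue _ (OInt.ofWitt p F₂ (WInt.map f y))
      rw [← ResF.map_residue, OInt.residue_ofWitt, OInt.residue_ofWitt]
      rfl)
  exact RingHom.congr_fun key x

/-- A root of unity of order prime to `p` in `F` is a Teichmüller representative. -/
theorem OInt.ofWitt_teichmuller {c : OInt p F} {e : ℕ} (hc : c ^ e = 1) (he : ¬ p ∣ e) :
    OInt.ofWittAlg p F (WittVector.teichmuller p (IsLocalRing.residue (OInt p F) c)) = c := by
  set b := OInt.ofWittAlg p F (WittVector.teichmuller p (IsLocalRing.residue (OInt p F) c)) with hb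
  have h1 : b ^ e = 1 := by
    rw [hb, ← map_pow, ← map_pow, ← map_pow, hc, map_one, map_one, map_one]
  have h2 : IsLocalRing.residue (OInt p F) b = IsLocalRing.residue (OInt p F) c := by
    change IsLocalRing.residue (OInt p F) (OInt.ofWitt p F _) = _
    rw [OInt.residue_ofWitt, WittVector.teichmuller_coeff_zero]
  have h3 : (∑ i ∈ Finset.range e, b ^ i * c ^ (e - 1 - i)) * (b - c) = 0 := by
    rw [geom_sum₂_mul, h1, hc, sub_self]
  rcases mul_eq_zero.1 h3 with h4 | h4
  · exfalso
    have h5 := congrArg (IsLocalRing.residue (OInt p F)) h4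
    rw [map_sum, map_zero] at h5
    simp only [map_mul, map_pow, h2] at h5
    have h6 : ∀ i ∈ Finset.range e, IsLocalRing.residue (OInt p F) c ^ i *
        IsLocalRing.residue (OInt p F) c ^ (e - 1 - i) =
          IsLocalRing.residue (OInt p F) c ^ (e - 1) := by
      intro i hi
      rw [Finset.mem_range] at hi
      rw [← pow_add]
      congr 1
      omega
    rw [Finset.sum_congr rfl h6, Finset.sum_const, Finset.card_range, nsmul_eq_mul] at h5
    rcases mul_eq_zero.1 h5 with h7 | h7
    · exact he ((CharP.cast_eq_zero_iff (ResF p F) p e).1 h7)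
    · have h8 : IsLocalRing.residue (OInt p F) c ^ e = 1 := by rw [← map_pow, hc, map_one]
      have h9 : IsLocalRing.residue (OInt p F) c = 0 := eq_zero_of_pow_eq_zero h7
      rw [h9] at h8
      refine he ?_
      rcases Nat.eq_zero_or_pos e with h10 | h10
      · rw [h10]; exact dvd_zero p
      · rw [zero_pow h10.ne'] at h8
        exact absurd h8 zero_ne_one
  · exact sub_eq_zero.1 h4

variable (p) in
/-- The ramification index of a finite extension `F₂ / F₁` of `p`-adic fields. -/
noncomputable def ramIdx (F₁ F₂ : Type u) [Field F₁] [Algebra ℚ_[p] F₁] [Algebra ℤ_[p] F₁]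
    [IsScalarTower ℤ_[p] ℚ_[p] F₁] [FiniteDimensional ℚ_[p] F₁]
    [Field F₂] [Algebra ℚ_[p] F₂] [Algebra ℤ_[p] F₂]
    [IsScalarTower ℤ_[p] ℚ_[p] F₂] [FiniteDimensional ℚ_[p] F₂] [Algebra F₁ F₂]
    [IsScalarTower ℤ_[p] F₁ F₂] : ℕ :=
  sSup {n | (IsLocalRing.maximalIdeal (OInt p F₁)).map
    (OInt.map (IsScalarTower.toAlgHom ℤ_[p] F₁ F₂)) ≤ IsLocalRing.maximalIdeal (OInt p F₂) ^ n}

end Arithmetic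

section KisinRings

variable (p : ℕ) [Fact p.Prime]
  (K : Type u) [Field K] [Algebra ℚ_[p] K] [Algebra ℤ_[p] K]
  [IsScalarTower ℤ_[p] ℚ_[p] K] [FiniteDimensional ℚ_[p] K]
  (K' : Type u) [Field K'] [Algebra ℚ_[p] K'] [Algebra ℤ_[p] K']
  [IsScalarTower ℤ_[p] ℚ_[p] K'] [FiniteDimensional ℚ_[p] K']
  [Algebra K K'] [IsScalarTower ℤ_[p] K K']

/-- A uniformiser `π` of the tamely ramified extension `K' / K` whose `e(K'/K)`-th power lies
in `K`. -/
structure TameUniformiser where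
  pi : OInt p K'
  span_pi : Ideal.span {pi} = IsLocalRing.maximalIdeal (OInt p K')
  tame : ¬ p ∣ ramIdx p K K'
  pow_mem : ∃ x : K, algebraMap K K' x = (pi : K') ^ ramIdx p K K'

variable {K K'}

/-- An element of the Galois group as a homomorphism of `ℤ_p`-algebras. -/
noncomputable def galHom (g : K' ≃ₐ[K] K') : K' →ₐ[ℤ_[p]] K' :=
  (g : K' →ₐ[K] K').restrictScalars ℤ_[p]

theorem galHom_one : galHom p (1 : K' ≃ₐ[K] K') = AlgHom.id _ _ := rfl

theorem galHom_mul (g h : K' ≃ₐ[K] K') : galHom p (g * h) = (galHom p g).comp (galHom p h) := rfl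

variable {p}

namespace TameUniformiser

variable (ϖ : TameUniformiser p K K')

theorem pi_ne_zero : ϖ.pi ≠ 0 := by
  intro h
  have h1 := ϖ.span_pi
  rw [h] at h1
  have h2 := OInt.p_mem p K'
  rw [← h1, Ideal.mem_span_singleton, zero_dvd_iff] at h2
  have h3 : ((p : ℤ_[p]) : ℤ_[p]) = 0 := by
    apply OInt.algebraMap_injective p K'
    rw [map_natCast, h2, map_zero]
  exact (Fact.out : p.Prime).ne_zero (by exact_mod_cast h3)

theorem exists_cocycle (g : K' ≃ₐ[K] K') :
    ∃ c : OInt p K', OInt.map (galHom p g) ϖ.pi = c * ϖ.pi := by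
  have h : OInt.map (galHom p g) ϖ.pi ∈ IsLocalRing.maximalIdeal (OInt p K') := by
    rw [IsLocalRing.mem_maximalIdeal, mem_nonunits_iff]
    intro hu
    have h1 : IsUnit ϖ.pi :=
      isUnit_of_map_unit (OInt.map (galHom p g) : OInt p K' →+* OInt p K') _ hu
    have h2 : ϖ.pi ∈ IsLocalRing.maximalIdeal (OInt p K') := by
      rw [← ϖ.span_pi]
      exact Ideal.mem_span_singleton_self _
    exact h2 h1
  rw [← ϖ.span_pi, Ideal.mem_span_singleton] at h
  obtain ⟨c, hc⟩ := h
  exact ⟨c, by rw [hc, mul_comm]⟩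

/-- The element `g(π) / π` of the ring of integers. -/
noncomputable def cocycle (g : K' ≃ₐ[K] K') : OInt p K' := (ϖ.exists_cocycle g).choose

theorem map_pi (g : K' ≃ₐ[K] K') : OInt.map (galHom p g) ϖ.pi = ϖ.cocycle g * ϖ.pi :=
  (ϖ.exists_cocycle g).choose_spec

theorem cocycle_eq {g : K' ≃ₐ[K] K'} {c : OInt p K'}
    (h : OInt.map (galHom p g) ϖ.pi = c * ϖ.pi) : ϖ.cocycle g = c :=
  mul_right_cancel₀ ϖ.pi_ne_zero ((ϖ.map_pi g).symm.trans h)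

theorem cocycle_one : ϖ.cocycle 1 = 1 := ϖ.cocycle_eq (by rw [one_mul]; rfl)

theorem cocycle_mul (g h : K' ≃ₐ[K] K') :
    ϖ.cocycle (g * h) = OInt.map (galHom p g) (ϖ.cocycle h) * ϖ.cocycle g := by
  apply ϖ.cocycle_eq
  change OInt.map (galHom p g) (OInt.map (galHom p h) ϖ.pi) = _
  rw [ϖ.map_pi h, map_mul, ϖ.map_pi g]
  ring

theorem cocycle_pow (g : K' ≃ₐ[K] K') : ϖ.cocycle g ^ ramIdx p K K' = 1 := by
  have h1 : OInt.map (galHom p g) (ϖ.pi ^ ramIdx p K K') = ϖ.pi ^ ramIdx p K K' := by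
    obtain ⟨x, hx⟩ := ϖ.pow_mem
    apply Subtype.ext
    change g ((ϖ.pi ^ ramIdx p K K' : OInt p K') : K') = _
    rw [SubmonoidClass.coe_pow, ← hx, AlgEquiv.commutes]
  rw [map_pow, ϖ.map_pi, mul_pow] at h1
  exact mul_right_cancel₀ (pow_ne_zero _ ϖ.pi_ne_zero) (h1.trans (one_mul _).symm)

/-- The element `h(g) = g(π) / π` of `W(k')`: the Teichmüller lift of the class of `g(π) / π`. -/
noncomputable def teich (g : K' ≃ₐ[K] K') : WInt p K' :=
  WittVector.teichmuller p (IsLocalRing.residue (OInt p K') (ϖ.cocycle g))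

theorem ofWitt_teich (g : K' ≃ₐ[K] K') : OInt.ofWittAlg p K' (ϖ.teich g) = ϖ.cocycle g :=
  OInt.ofWitt_teichmuller K' (ϖ.cocycle_pow g) ϖ.tame

theorem teich_one : ϖ.teich 1 = 1 := by
  rw [teich, cocycle_one, map_one, map_one]

theorem teich_mul (g h : K' ≃ₐ[K] K') :
    ϖ.teich (g * h) = WInt.map (galHom p g) (ϖ.teich h) * ϖ.teich g := by
  rw [teich, cocycle_mul, map_mul, map_mul, WInt.map, teich, WittVector.mapAlg_teichmuller,
    ResF.map_residue]
  rfl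

end TameUniformiser

section TensMap

variable {B C D A A' A'' : Type u} [CommRing B] [Algebra ℤ_[p] B] [CommRing C] [Algebra ℤ_[p] C]
  [CommRing D] [Algebra ℤ_[p] D] [CommRing A] [Algebra ℤ_[p] A] [CommRing A'] [Algebra ℤ_[p] A']
  [CommRing A''] [Algebra ℤ_[p] A'']

/-- The ring homomorphism `b ⊗ a ↦ f(b) ⊗ g(a)`. -/
noncomputable def tensMap (f : B →ₐ[ℤ_[p]] C) (g : A →ₐ[ℤ_[p]] A') :
    B ⊗[ℤ_[p]] A →+* C ⊗[ℤ_[p]] A' :=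
  (Algebra.TensorProduct.map f g).toRingHom

theorem tensMap_tmul (f : B →ₐ[ℤ_[p]] C) (g : A →ₐ[ℤ_[p]] A') (b : B) (a : A) :
    tensMap f g (b ⊗ₜ a) = f b ⊗ₜ g a := rfl

theorem tensMap_id : tensMap (AlgHom.id ℤ_[p] B) (AlgHom.id ℤ_[p] A) = RingHom.id _ := by
  rw [tensMap, Algebra.TensorProduct.map_id]
  rfl

theorem tensMap_comp (f' : C →ₐ[ℤ_[p]] D) (g' : A' →ₐ[ℤ_[p]] A'') (f : B →ₐ[ℤ_[p]] C)
    (g : A →ₐ[ℤ_[p]] A') :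
    (tensMap f' g').comp (tensMap f g) = tensMap (f'.comp f) (g'.comp g) := by
  rw [tensMap, tensMap, tensMap, Algebra.TensorProduct.map_comp]
  rfl

theorem tensMap_tensMap (f' : C →ₐ[ℤ_[p]] D) (g' : A' →ₐ[ℤ_[p]] A'') (f : B →ₐ[ℤ_[p]] C)
    (g : A →ₐ[ℤ_[p]] A') (x : B ⊗[ℤ_[p]] A) :
    tensMap f' g' (tensMap f g x) = tensMap (f'.comp f) (g'.comp g) x :=
  RingHom.congr_fun (tensMap_comp f' g' f g) x

theorem tensMap_square {C' : Type u} [CommRing C'] [Algebra ℤ_[p] C'] {f : B →ₐ[ℤ_[p]] C}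
    {f' : C →ₐ[ℤ_[p]] D} {k : B →ₐ[ℤ_[p]] C'} {k' : C' →ₐ[ℤ_[p]] D} (h : f'.comp f = k'.comp k)
    {g : A →ₐ[ℤ_[p]] A'} (x : B ⊗[ℤ_[p]] A) :
    tensMap f' (AlgHom.id ℤ_[p] A') (tensMap f g x) =
      tensMap k' g (tensMap k (AlgHom.id ℤ_[p] A) x) := by
  rw [tensMap_tensMap, tensMap_tensMap, h, AlgHom.id_comp, AlgHom.comp_id]

theorem tmul_one_mul (x y : B) : (x * y) ⊗ₜ[ℤ_[p]] (1 : A) = (x ⊗ₜ 1) * (y ⊗ₜ 1) := by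
  rw [Algebra.TensorProduct.tmul_mul_tmul, one_mul]

theorem tmul_one_pow (x : B) (n : ℕ) : (x ^ n) ⊗ₜ[ℤ_[p]] (1 : A) = (x ⊗ₜ 1) ^ n := by
  rw [Algebra.TensorProduct.tmul_pow, one_pow]

theorem tensMap_tmul_one (f : B →ₐ[ℤ_[p]] C) (g : A →ₐ[ℤ_[p]] A') (b : B) :
    tensMap f g (b ⊗ₜ 1) = f b ⊗ₜ 1 := by
  rw [tensMap_tmul, map_one]

/-- The ring `B ⊗ A`, for a `ℤ_p`-algebra `B` with an action of `G`. -/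
noncomputable def GRing.tens {G : Type u} [Group G] (act : G → B →ₐ[ℤ_[p]] B)
    (h1 : act 1 = AlgHom.id _ _) (h2 : ∀ g h, act (g * h) = (act g).comp (act h)) (A : Type u)
    [CommRing A] [Algebra ℤ_[p] A] : GRing G where
  carrier := B ⊗[ℤ_[p]] A
  act g := tensMap (act g) (AlgHom.id ℤ_[p] A)
  act_one r := by
    rw [h1, tensMap_id]
    rfl
  act_mul g h r := by
    rw [h2, tensMap_tensMap, AlgHom.comp_id]

end TensMap

/-- The ring `R[[u]]`, for a ring `R` with an action of `G` and a commuting Frobenius `φ`, with the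
actions `g(u) = χ(g) u` and `φ(u) = u ^ p`. -/
noncomputable def PhiRing.series {G : Type u} [Group G] (R : GRing G)
    (phi : R.carrier →+* R.carrier) (hphi : ∀ g r, phi (R.act g r) = R.act g (phi r))
    (chi : G → R.carrier) (h1 : chi 1 = 1) (h2 : ∀ g h, chi (g * h) = R.act g (chi h) * chi g)
    (n : ℕ) (hn : n ≠ 0) (h3 : ∀ g, phi (chi g) = chi g ^ n) : PhiRing G where
  carrier := PowerSeries R.carrier
  act g := PowerSeries.twist (R.act g) (chi g) 1 one_ne_zero
  act_one x := by
    refine (PowerSeries.twist_congr ?_ h1 rfl x).trans (PowerSeries.twist_id x)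
    exact RingHom.ext R.act_one
  act_mul g h x := by
    refine Eq.trans ?_ (PowerSeries.twist_twist x).symm
    refine PowerSeries.twist_congr ?_ ?_ rfl x
    · exact RingHom.ext (R.act_mul g h)
    · rw [pow_one, h2]
  phi := PowerSeries.twist phi 1 n hn
  phi_act g x := by
    refine (PowerSeries.twist_twist x).trans (Eq.trans ?_ (PowerSeries.twist_twist x).symm)
    refine PowerSeries.twist_congr ?_ ?_ (mul_comm _ _) x
    · ext1 r
      exact hphi g r
    · rw [h3, map_one, one_pow, mul_one, one_mul]

variable (p) in
/-- The ring `W(k_F) ⊗ A`. -/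
abbrev WCoeff (F : Type u) [Field F] [Algebra ℚ_[p] F] [Algebra ℤ_[p] F]
    [IsScalarTower ℤ_[p] ℚ_[p] F] [FiniteDimensional ℚ_[p] F] (A : Type u) [CommRing A]
    [Algebra ℤ_[p] A] : Type u := WInt p F ⊗[ℤ_[p]] A

variable (A : Type u) [CommRing A] [Algebra ℤ_[p] A]

variable (p K K') in
/-- The ring `W(k') ⊗ A` with the action of the Galois group on the first factor. -/
noncomputable def wRing : GRing (K' ≃ₐ[K] K') :=
  GRing.tens (fun g => WInt.map (galHom p g)) (by rw [galHom_one, WInt.map_id])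
    (fun g h => by rw [galHom_mul, WInt.map_comp]) A

theorem wRing_act_tmul (g : K' ≃ₐ[K] K') (w : WInt p K') (a : A) :
    (wRing p K K' A).act g (w ⊗ₜ a : WCoeff p K' A) =
      (WInt.map (galHom p g) w ⊗ₜ a : WCoeff p K' A) := rfl

variable (p K K') in
/-- The ring `O_{K'} ⊗ A` with the action of the Galois group on the first factor. -/
noncomputable def oRing : GRing (K' ≃ₐ[K] K') :=
  GRing.tens (fun g => OInt.map (galHom p g)) rfl (fun _ _ => rfl) A

/-- The Frobenius of `W(k_F)`. -/
noncomputable def WInt.frob (F : Type u) [Field F] [Algebra ℚ_[p] F] [Algebra ℤ_[p] F]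
    [IsScalarTower ℤ_[p] ℚ_[p] F] [FiniteDimensional ℚ_[p] F] : WInt p F →ₐ[ℤ_[p]] WInt p F :=
  WittVector.mapAlg p (frobenius (ResF p F) p)

theorem WInt.frob_map {F₁ : Type u} [Field F₁] [Algebra ℚ_[p] F₁] [Algebra ℤ_[p] F₁]
    [IsScalarTower ℤ_[p] ℚ_[p] F₁] [FiniteDimensional ℚ_[p] F₁]
    {F₂ : Type u} [Field F₂] [Algebra ℚ_[p] F₂] [Algebra ℤ_[p] F₂]
    [IsScalarTower ℤ_[p] ℚ_[p] F₂] [FiniteDimensional ℚ_[p] F₂] (f : F₁ →ₐ[ℤ_[p]] F₂) :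
    (WInt.frob F₂).comp (WInt.map f) = (WInt.map f).comp (WInt.frob F₁) := by
  rw [WInt.map, WInt.frob, WInt.frob, WittVector.mapAlg_comp, WittVector.mapAlg_comp]
  congr 1
  ext x
  exact map_pow (ResF.map f) x p |>.symm

namespace TameUniformiser

variable (ϖ : TameUniformiser p K K')

theorem frob_teich (g : K' ≃ₐ[K] K') : WInt.frob K' (ϖ.teich g) = ϖ.teich g ^ p := by
  rw [WInt.frob, teich, WittVector.mapAlg_teichmuller, frobenius_def, map_pow]

/-- The ring `𝔖_A = (W(k') ⊗ A)[[u]]`, on which `φ` acts as the Frobenius of `W(k')` and by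
`φ(u) = u ^ p`, and on which `g` acts through its action on `W(k')` and by `g(u) = h(g) u`. -/
noncomputable def sRing : PhiRing (K' ≃ₐ[K] K') :=
  PhiRing.series (wRing p K K' A) (tensMap (WInt.frob K') (AlgHom.id ℤ_[p] A))
    (fun g r => tensMap_square (WInt.frob_map (galHom p g)) r)
    (fun g => ϖ.teich g ⊗ₜ[ℤ_[p]] (1 : A))
    (by rw [ϖ.teich_one]; rfl)
    (fun g h => by
      rw [ϖ.teich_mul]
      exact tmul_one_mul (WInt.map (galHom p g) (ϖ.teich h)) (ϖ.teich g))
    p (Fact.out : p.Prime).ne_zero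
    (fun g => by
      refine (tensMap_tmul_one (WInt.frob K') _ (ϖ.teich g)).trans ?_
      rw [ϖ.frob_teich]
      exact tmul_one_pow (ϖ.teich g) p)

/-- Reduction modulo `u`. -/
noncomputable def modU : GRing.Hom (MonoidHom.id (K' ≃ₐ[K] K')) (ϖ.sRing A).toGRing
    (wRing p K K' A) where
  toRingHom := (PowerSeries.constantCoeff : PowerSeries (WCoeff p K' A) →+* WCoeff p K' A)
  map_act _ x := PowerSeries.constantCoeff_twist _ _ _ _ x

theorem isNilpotent_pi (hA : IsNilpotent (p : A)) :
    IsNilpotent (ϖ.pi ⊗ₜ[ℤ_[p]] (1 : A)) := by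
  obtain ⟨N, hN⟩ := OInt.exists_pow_le p K'
  obtain ⟨n, hn⟩ := hA
  have h1 : ϖ.pi ^ N ∈ Ideal.span {(p : OInt p K')} := by
    apply hN
    apply Ideal.pow_mem_pow
    rw [← ϖ.span_pi]
    exact Ideal.mem_span_singleton_self _
  obtain ⟨c, hc⟩ := Ideal.mem_span_singleton.1 h1
  refine ⟨N * n, ?_⟩
  have h2 : (c ^ n * (p : OInt p K') ^ n) ⊗ₜ[ℤ_[p]] (1 : A) = 0 := by
    have h3 : c ^ n * (p : OInt p K') ^ n = ((p : ℤ_[p]) ^ n) • c ^ n := by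
      rw [Algebra.smul_def, map_pow, map_natCast, mul_comm]
    rw [h3, TensorProduct.smul_tmul, Algebra.smul_def, map_pow, map_natCast, hn, zero_mul,
      TensorProduct.tmul_zero]
  rw [Algebra.TensorProduct.tmul_pow, one_pow, pow_mul, hc, mul_pow, mul_comm, h2]

/-- The surjection `𝔖_A → O_{K'} ⊗ A`, `u ↦ π`, which is the reduction modulo `E(u)`. -/
noncomputable def modE (hA : IsNilpotent (p : A)) :
    GRing.Hom (MonoidHom.id (K' ≃ₐ[K] K')) (ϖ.sRing A).toGRing (oRing p K K' A) where
  toRingHom := PowerSeries.evalNil (tensMap (OInt.ofWittAlg p K') (AlgHom.id ℤ_[p] A))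
    (ϖ.pi ⊗ₜ 1) (ϖ.isNilpotent_pi A hA)
  map_act g x := by
    refine PowerSeries.evalNil_twist (ha := ϖ.isNilpotent_pi A hA)
      (fun r => tensMap_square (AlgHom.ext (OInt.map_ofWitt (galHom p g))) r) ?_ x
    refine (tensMap_tmul_one (OInt.map (galHom p g)) _ ϖ.pi).trans ?_
    rw [ϖ.map_pi, pow_one, tmul_one_mul, ← ϖ.ofWitt_teich]
    rfl

/-- The minimal polynomial `E(u)` of the uniformiser over `W(k')`. -/
noncomputable def eisenstein : Polynomial (WInt p K') :=
  letI := (OInt.ofWitt p K').toAlgebra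
  minpoly (WInt p K') ϖ.pi

/-- The element `E(u)` of `𝔖_A`. -/
noncomputable def eisensteinS : (ϖ.sRing A).carrier :=
  PowerSeries.map (Algebra.TensorProduct.includeLeftRingHom : WInt p K' →+* WCoeff p K' A)
    (ϖ.eisenstein : PowerSeries (WInt p K'))

end TameUniformiser

end KisinRings

section Change

variable {p : ℕ} [Fact p.Prime]
  {K : Type u} [Field K] [Algebra ℚ_[p] K] [Algebra ℤ_[p] K]
  [IsScalarTower ℤ_[p] ℚ_[p] K] [FiniteDimensional ℚ_[p] K]
  {K' : Type u} [Field K'] [Algebra ℚ_[p] K'] [Algebra ℤ_[p] K']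
  [IsScalarTower ℤ_[p] ℚ_[p] K'] [FiniteDimensional ℚ_[p] K']
  [Algebra K K'] [IsScalarTower ℤ_[p] K K']
  {L' : Type u} [Field L'] [Algebra ℚ_[p] L'] [Algebra ℤ_[p] L']
  [IsScalarTower ℤ_[p] ℚ_[p] L'] [FiniteDimensional ℚ_[p] L']
  [Algebra K L'] [IsScalarTower ℤ_[p] K L'] [Algebra K' L'] [IsScalarTower ℤ_[p] K' L']
  [IsScalarTower K K' L'] [Normal K K']

theorem PowerSeries.twist_one_aux {R S T : Type u} [CommRing R] [CommRing S] [CommRing T]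
    (ψ : R →+* S) (χ : T →+* S) (m n : ℕ) : ψ 1 * 1 ^ m = χ 1 * 1 ^ n := by
  rw [map_one, map_one, one_pow, one_pow]

section Coeff

variable {A B : Type u} [CommRing A] [Algebra ℤ_[p] A] [CommRing B] [Algebra ℤ_[p] B]

variable (K K') in
/-- The map `O_{K'} ⊗ A → O_{K'} ⊗ B` induced by `A → B`. -/
noncomputable def oRingCoeff (f : A →ₐ[ℤ_[p]] B) :
    GRing.Hom (MonoidHom.id (K' ≃ₐ[K] K')) (oRing p K K' A) (oRing p K K' B) where
  toRingHom := tensMap (AlgHom.id ℤ_[p] (OInt p K')) f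
  map_act g r := (tensMap_square (f := AlgHom.id ℤ_[p] (OInt p K')) (k := OInt.map (galHom p g))
    (f' := OInt.map (galHom p g)) (k' := AlgHom.id ℤ_[p] (OInt p K')) rfl r).symm

/-- The map `𝔖_A → 𝔖_B` induced by `A → B`. -/
noncomputable def TameUniformiser.sRingCoeff (ϖ : TameUniformiser p K K') (f : A →ₐ[ℤ_[p]] B) :
    PhiRing.Hom (MonoidHom.id (K' ≃ₐ[K] K')) (ϖ.sRing A) (ϖ.sRing B) where
  toRingHom := PowerSeries.twist (tensMap (AlgHom.id ℤ_[p] (WInt p K')) f) 1 1 one_ne_zero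
  map_act g x := by
    refine (PowerSeries.twist_twist x).trans (Eq.trans ?_ (PowerSeries.twist_twist x).symm)
    refine PowerSeries.twist_congr ?_ ?_ rfl x
    · refine RingHom.ext fun r => (tensMap_square (f := AlgHom.id ℤ_[p] (WInt p K'))
        (k := WInt.map (galHom p g)) (f' := WInt.map (galHom p g))
        (k' := AlgHom.id ℤ_[p] (WInt p K')) rfl r).symm
    · rw [one_pow, mul_one, map_one, one_mul]
      exact (tensMap_tmul_one (AlgHom.id ℤ_[p] (WInt p K')) f (ϖ.teich g)).trans (pow_one _).symm
  map_phi x := by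
    refine (PowerSeries.twist_twist x).trans (Eq.trans ?_ (PowerSeries.twist_twist x).symm)
    refine PowerSeries.twist_congr ?_ ?_ (mul_comm _ _) x
    · refine RingHom.ext fun r => (tensMap_square (f := AlgHom.id ℤ_[p] (WInt p K'))
        (k := WInt.frob K') (f' := WInt.frob K')
        (k' := AlgHom.id ℤ_[p] (WInt p K')) rfl r).symm
    · exact PowerSeries.twist_one_aux _ _ _ _

end Coeff

section Extension

variable (A : Type u) [CommRing A] [Algebra ℤ_[p] A]

variable (p K' L') in
/-- The embedding `K' → L'` as a map of `ℤ_p`-algebras. -/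
noncomputable def extHom : K' →ₐ[ℤ_[p]] L' := IsScalarTower.toAlgHom ℤ_[p] K' L'

variable (K K' L') in
/-- The restriction map `Gal(L'/K) → Gal(K'/K)`. -/
noncomputable def galRes : (L' ≃ₐ[K] L') →* (K' ≃ₐ[K] K') := AlgEquiv.restrictNormalHom K'

theorem galHom_comp_extHom (g : L' ≃ₐ[K] L') :
    (galHom p g).comp (extHom p K' L') = (extHom p K' L').comp (galHom p (galRes K K' L' g)) :=
  AlgHom.ext fun x => (AlgEquiv.restrictNormal_commutes g K' x).symm

variable (K K' L') in
/-- The map `O_{K'} ⊗ A → O_{L'} ⊗ A`. -/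
noncomputable def oRingExt : GRing.Hom (galRes K K' L') (oRing p K K' A) (oRing p K L' A) where
  toRingHom := tensMap (OInt.map (extHom p K' L')) (AlgHom.id ℤ_[p] A)
  map_act g r := by
    refine tensMap_square ?_ r
    ext x
    exact (congrArg (fun f => f (x : K')) (galHom_comp_extHom (p := p) g)).symm

/-- Compatibility of the uniformisers `π'` of `K'` and `π''` of `L'`. -/
def TameUniformiser.Compatible (ϖ : TameUniformiser p K K') (ϖ' : TameUniformiser p K L') : Prop :=
  ϖ'.pi ^ ramIdx p K' L' = OInt.map (extHom p K' L') ϖ.pi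

namespace TameUniformiser

variable {ϖ : TameUniformiser p K K'} {ϖ' : TameUniformiser p K L'} 

theorem Compatible.ramIdx_ne_zero (hϖ : ϖ.Compatible ϖ') : ramIdx p K' L' ≠ 0 := by
  intro h
  have h1 : ϖ'.pi ^ ramIdx p K' L' = OInt.map (extHom p K' L') ϖ.pi := hϖ
  rw [h, pow_zero] at h1
  have h2 : IsUnit ϖ.pi := by
    refine isUnit_of_map_unit (OInt.map (extHom p K' L') : OInt p K' →+* OInt p L') _ ?_
    change IsUnit (OInt.map (extHom p K' L') ϖ.pi)
    rw [← h1]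
    exact isUnit_one
  have h3 : ϖ.pi ∈ IsLocalRing.maximalIdeal (OInt p K') := by
    rw [← ϖ.span_pi]
    exact Ideal.mem_span_singleton_self _
  exact h3 h2

theorem Compatible.cocycle_pow (hϖ : ϖ.Compatible ϖ') (g : L' ≃ₐ[K] L') :
    ϖ'.cocycle g ^ ramIdx p K' L' = OInt.map (extHom p K' L') (ϖ.cocycle (galRes K K' L' g)) := by
  have h1 : ϖ'.pi ^ ramIdx p K' L' = OInt.map (extHom p K' L') ϖ.pi := hϖ
  have h2 : OInt.map (galHom p g) (OInt.map (extHom p K' L') ϖ.pi) =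
      OInt.map (extHom p K' L') (OInt.map (galHom p (galRes K K' L' g)) ϖ.pi) :=
    Subtype.ext (congrArg (fun f => f (ϖ.pi : K')) (galHom_comp_extHom (p := p) g))
  rw [ϖ.map_pi, map_mul, ← h1, map_pow, ϖ'.map_pi, mul_pow] at h2
  exact mul_right_cancel₀ (pow_ne_zero _ ϖ'.pi_ne_zero) h2

theorem Compatible.teich_pow (hϖ : ϖ.Compatible ϖ') (g : L' ≃ₐ[K] L') :
    ϖ'.teich g ^ ramIdx p K' L' = WInt.map (extHom p K' L') (ϖ.teich (galRes K K' L' g)) := by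
  rw [teich, teich, ← map_pow, ← map_pow, hϖ.cocycle_pow, WInt.map, WittVector.mapAlg_teichmuller,
    ResF.map_residue]

/-- The map `𝔖_A → 𝔖'_A`, `u ↦ u ^ e(L'/K')`. -/
noncomputable def Compatible.sRingExt (hϖ : ϖ.Compatible ϖ') :
    PhiRing.Hom (galRes K K' L') (ϖ.sRing A) (ϖ'.sRing A) where
  toRingHom := PowerSeries.twist (tensMap (WInt.map (extHom p K' L')) (AlgHom.id ℤ_[p] A)) 1
    (ramIdx p K' L') hϖ.ramIdx_ne_zero
  map_act g x := by
    refine (PowerSeries.twist_twist x).trans (Eq.trans ?_ (PowerSeries.twist_twist x).symm)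
    refine PowerSeries.twist_congr ?_ ?_ (mul_comm _ _) x
    · refine RingHom.ext fun r => tensMap_square ?_ r
      rw [← WInt.map_comp, ← WInt.map_comp, galHom_comp_extHom]
    · rw [one_pow, mul_one, map_one, one_mul]
      refine (tensMap_tmul_one (WInt.map (extHom p K' L')) _ _).trans ?_
      rw [← hϖ.teich_pow]
      exact tmul_one_pow _ _
  map_phi x := by
    refine (PowerSeries.twist_twist x).trans (Eq.trans ?_ (PowerSeries.twist_twist x).symm)
    refine PowerSeries.twist_congr ?_ ?_ (mul_comm _ _) x
    · exact RingHom.ext fun r => tensMap_square (WInt.frob_map (extHom p K' L')).symm r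
    · exact PowerSeries.twist_one_aux _ _ _ _

end TameUniformiser

end Extension

end Change

/-- The `A`-module underlying an `S`-module `N`, for a ring homomorphism `f : A → S`. -/
def RestrictAlong {A S : Type u} [CommRing A] [CommRing S] (_ : A →+* S) (N : Type u) : Type u := N

instance RestrictAlong.instAddCommGroup {A S : Type u} [CommRing A] [CommRing S] (f : A →+* S)
    (N : Type u) [AddCommGroup N] : AddCommGroup (RestrictAlong f N) :=
  (inferInstance : AddCommGroup N)

noncomputable instance RestrictAlong.instModule {A S : Type u} [CommRing A] [CommRing S]
    (f : A →+* S) (N : Type u) [AddCommGroup N] [Module S N] : Module A (RestrictAlong f N) :=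
  Module.compHom N f

/-- The identity map from `RestrictAlong f N` to `N`. -/
def RestrictAlong.val {A S : Type u} [CommRing A] [CommRing S] {f : A →+* S} {N : Type u}
    [AddCommGroup N] : RestrictAlong f N ≃+ N := AddEquiv.refl N

theorem RestrictAlong.val_smul {A S : Type u} [CommRing A] [CommRing S] {f : A →+* S} {N : Type u}
    [AddCommGroup N] [Module S N] (a : A) (x : RestrictAlong f N) :
    RestrictAlong.val (a • x) = f a • RestrictAlong.val x := rfl

/-- Two `A`-modules with endomorphisms indexed by `I` are isomorphic Zariski locally on the spectrum
of `A`. -/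
def LocallyIsomorphic {A X Y I : Type u} [CommRing A] [AddCommGroup X] [Module A X] [AddCommGroup Y]
    [Module A Y] (a : I → Module.End A X) (b : I → Module.End A Y) : Prop :=
  ∃ s : Set A, Ideal.span s = ⊤ ∧ ∀ f ∈ s,
    ∃ e : LocalizedModule (Submonoid.powers f) X ≃ₗ[Localization (Submonoid.powers f)]
      LocalizedModule (Submonoid.powers f) Y,
      ∀ g x, e (LocalizedModule.map (Submonoid.powers f) (a g) x) =
        LocalizedModule.map (Submonoid.powers f) (b g) (e x)

section Conditions

variable {p : ℕ} [Fact p.Prime]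
  {K : Type u} [Field K] [Algebra ℚ_[p] K] [Algebra ℤ_[p] K]
  [IsScalarTower ℤ_[p] ℚ_[p] K] [FiniteDimensional ℚ_[p] K]
  {K' : Type u} [Field K'] [Algebra ℚ_[p] K'] [Algebra ℤ_[p] K']
  [IsScalarTower ℤ_[p] ℚ_[p] K'] [FiniteDimensional ℚ_[p] K']
  [Algebra K K'] [IsScalarTower ℤ_[p] K K']

section Inertia

variable (p K K') in
/-- The inertia subgroup `I(K'/K)` of the Galois group. -/
noncomputable def inertiaSubgroup : Subgroup (K' ≃ₐ[K] K') where
  carrier := {g | ResF.map (galHom p g) = RingHom.id _}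
  one_mem' := ResF.map_id
  mul_mem' {a b} ha hb := (ResF.map_comp (galHom p a) (galHom p b)).trans
    ((congrArg₂ RingHom.comp ha hb).trans (RingHom.comp_id _))
  inv_mem' {a} ha := by
    have h : ResF.map (galHom p (a⁻¹ * a)) = RingHom.id _ := by
      rw [inv_mul_cancel, galHom_one, ResF.map_id]
    have ha' : ResF.map (galHom p a) = RingHom.id _ := ha
    rw [galHom_mul, ResF.map_comp, ha'] at h
    exact h

theorem WInt.map_of_mem_inertia {g : K' ≃ₐ[K] K'} (hg : g ∈ inertiaSubgroup p K K')
    (w : WInt p K') : WInt.map (galHom p g) w = w := by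
  have h : ResF.map (galHom p g) = RingHom.id _ := hg
  rw [WInt.map, h, WittVector.mapAlg_id]
  rfl

variable {L' : Type u} [Field L'] [Algebra ℚ_[p] L'] [Algebra ℤ_[p] L']
  [IsScalarTower ℤ_[p] ℚ_[p] L'] [FiniteDimensional ℚ_[p] L']
  [Algebra K L'] [IsScalarTower ℤ_[p] K L'] [Algebra K' L'] [IsScalarTower ℤ_[p] K' L']
  [IsScalarTower K K' L'] [Normal K K']

theorem galRes_mem_inertia {g : L' ≃ₐ[K] L'} (hg : g ∈ inertiaSubgroup p K L') :
    galRes K K' L' g ∈ inertiaSubgroup p K K' := by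
  have h1 : ResF.map (galHom p g) = RingHom.id _ := hg
  have h2 := congrArg ResF.map (galHom_comp_extHom (p := p) (K' := K') g)
  rw [ResF.map_comp, ResF.map_comp, h1] at h2
  refine RingHom.ext fun x => ?_
  exact (ResF.map (extHom p K' L')).injective (RingHom.congr_fun h2 x).symm

variable (p K K' L') in
/-- The restriction map `I(L'/K) → I(K'/K)`, along which types are inflated. -/
noncomputable def inertiaRes : inertiaSubgroup p K L' →* inertiaSubgroup p K K' :=
  ((galRes K K' L').comp (inertiaSubgroup p K L').subtype).codRestrict _
    fun g => galRes_mem_inertia g.2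

end Inertia

section Objects

variable {A : Type u} [CommRing A] [Algebra ℤ_[p] A]

/-- Breuil-Kisin modules of rank `d` and height at most `h` with `A`-coefficients and descent data
from `K'` to `K`. -/
def TameUniformiser.IsBK (ϖ : TameUniformiser p K K') (d h : ℕ) (M : PhiModule (ϖ.sRing A)) :
    Prop :=
  Module.Finite (ϖ.sRing A).carrier M.carrier ∧
  Module.Projective (ϖ.sRing A).carrier M.carrier ∧
  (∀ P : PrimeSpectrum (ϖ.sRing A).carrier, Module.rankAtStalk M.carrier P = d) ∧
  Function.Bijective
    (LocalizedModule.map (Submonoid.powers (ϖ.eisensteinS A)) M.linPhi) ∧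
  ∀ m : M.carrier, ϖ.eisensteinS A ^ h • m ∈ LinearMap.range M.linPhi

variable (p K K' A) in
/-- The homomorphism `A → W(k') ⊗ A`, `a ↦ 1 ⊗ a`. -/
noncomputable def wRing.ofCoeff : A →+* (wRing p K K' A).carrier :=
  (Algebra.TensorProduct.includeRight : A →ₐ[ℤ_[p]] WCoeff p K' A).toRingHom

variable (p K K' A) in
/-- The homomorphism `A → O_{K'} ⊗ A`, `a ↦ 1 ⊗ a`. -/
noncomputable def oRing.ofCoeff : A →+* (oRing p K K' A).carrier :=
  (Algebra.TensorProduct.includeRight : A →ₐ[ℤ_[p]] OInt p K' ⊗[ℤ_[p]] A).toRingHom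

theorem wRing.act_ofCoeff (g : K' ≃ₐ[K] K') (a : A) :
    (wRing p K K' A).act g (wRing.ofCoeff p K K' A a) = wRing.ofCoeff p K K' A a :=
  (tensMap_tmul (WInt.map (galHom p g)) (AlgHom.id ℤ_[p] A) 1 a).trans (by rw [map_one]; rfl)

theorem oRing.act_ofCoeff (g : K' ≃ₐ[K] K') (a : A) :
    (oRing p K K' A).act g (oRing.ofCoeff p K K' A a) = oRing.ofCoeff p K K' A a :=
  (tensMap_tmul (OInt.map (galHom p g)) (AlgHom.id ℤ_[p] A) 1 a).trans (by rw [map_one]; rfl)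

variable (p K K' A) in
/-- The homomorphism `W(k') → W(k') ⊗ A`, `w ↦ w ⊗ 1`. -/
noncomputable def wRing.ofWitt : WInt p K' →+* (wRing p K K' A).carrier :=
  (Algebra.TensorProduct.includeLeftRingHom : WInt p K' →+* WCoeff p K' A)

theorem wRing.act_ofWitt {g : K' ≃ₐ[K] K'} (hg : g ∈ inertiaSubgroup p K K') (w : WInt p K') :
    (wRing p K K' A).act g (wRing.ofWitt p K K' A w) = wRing.ofWitt p K K' A w :=
  (tensMap_tmul (WInt.map (galHom p g)) (AlgHom.id ℤ_[p] A) w 1).trans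
    (by rw [WInt.map_of_mem_inertia hg]; rfl)

variable (p K K' A) in
/-- The homomorphism `O_{K'} → O_{K'} ⊗ A`, `x ↦ x ⊗ 1`. -/
noncomputable def oRing.ofInt : OInt p K' →+* (oRing p K K' A).carrier :=
  (Algebra.TensorProduct.includeLeftRingHom : OInt p K' →+* OInt p K' ⊗[ℤ_[p]] A)

theorem oRing.act_ofInt (g : K' ≃ₐ[K] K') (x : OInt p K') :
    (oRing p K K' A).act g (oRing.ofInt p K K' A x) =
      oRing.ofInt p K K' A (OInt.map (galHom p g) x) :=
  tensMap_tmul_one (OInt.map (galHom p g)) (AlgHom.id ℤ_[p] A) x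

/-- The pairs `(L, L⁺)` which form the local model: `L` is a projective `O_{K'} ⊗ A`-module of rank
`d` and `L / L⁺` is projective over `A`. -/
def FilModule.IsLM (d : ℕ) (L : FilModule (oRing p K K' A)) : Prop :=
  Module.Finite (oRing p K K' A).carrier L.carrier ∧
  Module.Projective (oRing p K K' A).carrier L.carrier ∧
  (∀ P : PrimeSpectrum (oRing p K K' A).carrier, Module.rankAtStalk L.carrier P = d) ∧
  Module.Projective A (RestrictAlong (oRing.ofCoeff p K K' A) (L.carrier ⧸ L.fil))

end Objects

section Coefficients

variable {E : Type u} [Field E] [Algebra ℚ_[p] E] [Algebra ℤ_[p] E]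
  [IsScalarTower ℤ_[p] ℚ_[p] E] [FiniteDimensional ℚ_[p] E]
  {A : Type u} [CommRing A] [Algebra ℤ_[p] A] [Algebra (OInt p E) A]
  [IsScalarTower ℤ_[p] (OInt p E) A]

variable (p E A) in
/-- The `O_E`-algebra `A` is killed by a power of the maximal ideal of `O_E`. -/
def IsTestAlg : Prop :=
  ∃ a : ℕ, IsLocalRing.maximalIdeal (OInt p E) ^ a ≤ RingHom.ker (algebraMap (OInt p E) A)

theorem IsTestAlg.isNilpotent (hA : IsTestAlg p E A) : IsNilpotent (p : A) := by
  obtain ⟨a, ha⟩ := hA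
  refine ⟨a, ?_⟩
  have h := ha (Ideal.pow_mem_pow (OInt.p_mem p E) a)
  rw [RingHom.mem_ker, map_pow, map_natCast] at h
  exact h

section InertialType

/-- For a module `D` over `W(k') ⊗ A` and a homomorphism `σ : W(k') → O_E`, the `A`-submodule of
`D` on which `W(k')` acts through `σ`. -/
def GModule.component (D : GModule (wRing p K K' A)) (σ : WInt p K' →+* OInt p E) :
    Submodule A (RestrictAlong (wRing.ofCoeff p K K' A) D.carrier) where
  carrier := {x | ∀ w, wRing.ofWitt p K K' A w • RestrictAlong.val x =
    wRing.ofCoeff p K K' A (algebraMap (OInt p E) A (σ w)) • RestrictAlong.val x}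
  zero_mem' w := by rw [map_zero, smul_zero, smul_zero]
  add_mem' {x y} hx hy w := by rw [map_add, smul_add, smul_add, hx w, hy w]
  smul_mem' a x hx w := by
    rw [RestrictAlong.val_smul, smul_comm, hx w, smul_comm]

/-- The action of the inertia group on a component. -/
noncomputable def GModule.componentAct (D : GModule (wRing p K K' A)) (σ : WInt p K' →+* OInt p E)
    (g : inertiaSubgroup p K K') : Module.End A (D.component σ) where
  toFun x := ⟨RestrictAlong.val.symm (D.act g.1 (RestrictAlong.val x.1)), fun w => by
    have h := congrArg (D.act g.1) (x.2 w)
    rw [D.act_smul, D.act_smul, wRing.act_ofWitt g.2, wRing.act_ofCoeff] at h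
    exact h⟩
  map_add' x y := Subtype.ext (map_add (D.act g.1) (RestrictAlong.val x.1) (RestrictAlong.val y.1))
  map_smul' a x := Subtype.ext (by
    refine (D.act_smul g.1 (wRing.ofCoeff p K K' A a) (RestrictAlong.val x.1)).trans ?_
    rw [wRing.act_ofCoeff]
    rfl)

/-- The module `D` has (unmixed) type `ρ`: for a lattice `T` of the representation `ρ` of the
inertia group and for every `σ`, the `σ`-component of `D` is, Zariski locally on the spectrum of
`A`, isomorphic to `A ⊗ T`. -/
def GModule.HasType {V : Type u} [AddCommGroup V] [Module E V] (D : GModule (wRing p K K' A))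
    (ρ : Representation E (inertiaSubgroup p K K') V) : Prop :=
  ∃ (T : Submodule (OInt p E) V) (hT : ∀ g, ∀ v ∈ T, ρ g v ∈ T), T.IsLattice E ∧
    ∀ σ : WInt p K' →+* OInt p E,
      LocallyIsomorphic (D.componentAct σ) (fun g =>
        ((((ρ g).restrictScalars (OInt p E)).restrict (hT g)).baseChange A :
          Module.End A (A ⊗[OInt p E] T)))

/-- The Breuil-Kisin module `M` has type `ρ`. -/
def TameUniformiser.HasType (ϖ : TameUniformiser p K K') {V : Type u} [AddCommGroup V] [Module E V]
    (ρ : Representation E (inertiaSubgroup p K K') V) (M : PhiModule (ϖ.sRing A)) : Prop :=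
  (M.toGModule.baseChange (ϖ.modU A)).HasType ρ

end InertialType

section Determinant

variable [IsScalarTower ℚ_[p] K K']

variable (p K K') in
/-- The subfield `K ⬝ W(k')[1/p]` of `K'`. -/
noncomputable def unramField : IntermediateField K K' :=
  IntermediateField.adjoin K (Set.range fun w : WInt p K' => (OInt.ofWittAlg p K' w : K'))

theorem unramField_fixed {g : K' ≃ₐ[K] K'} (hg : g ∈ inertiaSubgroup p K K') {x : K'}
    (hx : x ∈ unramField p K K') : g x = x := by
  have h : unramField p K K' ≤ IntermediateField.fixedField (Subgroup.zpowers g) := by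
    refine IntermediateField.adjoin_le_iff.2 ?_
    rintro _ ⟨w, rfl⟩
    rw [SetLike.mem_coe, IntermediateField.mem_fixedField_iff]
    intro f hf
    have h2 : f ∈ inertiaSubgroup p K K' := (Subgroup.zpowers_le.2 hg) hf
    have h3 := OInt.map_ofWitt (galHom p f) w
    rw [WInt.map_of_mem_inertia h2] at h3
    exact congrArg Subtype.val h3
  exact (IntermediateField.mem_fixedField_iff _ _).1 (h hx) g (Subgroup.mem_zpowers g)

variable (p K K') in
/-- The inclusion of `N = K ⬝ W(k')[1/p]` into `K'`. -/
noncomputable def unramFieldVal : unramField p K K' →ₐ[ℤ_[p]] K' :=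
  (unramField p K K').val.restrictScalars ℤ_[p]

instance unramField.isScalarTower : IsScalarTower ℤ_[p] ℚ_[p] (unramField p K K') :=
  IsScalarTower.of_algebraMap_eq fun x => Subtype.ext
    (IsScalarTower.algebraMap_apply ℤ_[p] ℚ_[p] K' x)

instance unramField.finiteDimensional : FiniteDimensional ℚ_[p] (unramField p K K') :=
  FiniteDimensional.of_injective
    ((unramField p K K').val.restrictScalars ℚ_[p]).toLinearMap Subtype.val_injective

/-- The part of `L⁺` on which the inertia group acts through the character `ξ`. -/
def FilModule.isotypic (L : FilModule (oRing p K K' A))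
    (ξ : inertiaSubgroup p K K' →* (OInt p E)ˣ) :
    Submodule A (RestrictAlong (oRing.ofCoeff p K K' A) L.carrier) where
  carrier := {x | RestrictAlong.val x ∈ L.fil ∧ ∀ g : inertiaSubgroup p K K',
    L.act g.1 (RestrictAlong.val x) =
      oRing.ofCoeff p K K' A (algebraMap (OInt p E) A (ξ g)) • RestrictAlong.val x}
  zero_mem' := ⟨L.fil.zero_mem, fun g => by rw [map_zero, map_zero, smul_zero]⟩
  add_mem' {x y} hx hy := ⟨L.fil.add_mem hx.1 hy.1, fun g => by
    rw [map_add, map_add, smul_add, hx.2 g, hy.2 g]⟩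
  smul_mem' a x hx := ⟨L.fil.smul_mem _ hx.1, fun g => by
    rw [RestrictAlong.val_smul, L.act_smul, oRing.act_ofCoeff, hx.2 g, smul_comm]⟩

/-- Multiplication by an element of `O_N`, for `N = K ⬝ W(k')[1/p]`, on an isotypic part. -/
noncomputable def FilModule.isotypicMul (L : FilModule (oRing p K K' A))
    (ξ : inertiaSubgroup p K K' →* (OInt p E)ˣ)
    (a : integralClosure ℤ_[p] (unramField p K K')) : Module.End A (L.isotypic ξ) where
  toFun x := ⟨RestrictAlong.val.symm (oRing.ofInt p K K' A
      ((unramFieldVal p K K').mapIntegralClosure a) • RestrictAlong.val x.1),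
    L.fil.smul_mem _ x.2.1, fun g => by
      have h : OInt.map (galHom p g.1) ((unramFieldVal p K K').mapIntegralClosure a) =
          (unramFieldVal p K K').mapIntegralClosure a :=
        Subtype.ext (unramField_fixed g.2 a.1.2)
      rw [AddEquiv.apply_symm_apply, L.act_smul, oRing.act_ofInt, h, x.2.2 g, smul_comm]⟩
  map_add' x y := Subtype.ext (smul_add _ (RestrictAlong.val x.1) (RestrictAlong.val y.1))
  map_smul' c x := Subtype.ext (smul_comm _ (oRing.ofCoeff p K K' A c) (RestrictAlong.val x.1))

/-- The strong determinant condition: for every character `ξ` of the inertia group,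
`det_A(a | L⁺_ξ) = ∏ ψ(a)`, where `ψ` runs over the embeddings of `N = K ⬝ W(k')[1/p]` into `E`, as
an identity of polynomial functions of `a ∈ O_N`. That is, the identity holds Zariski locally on
the spectrum of `A` and for all `a` in `O_N ⊗ R`, for all `A`-algebras `R`. -/
def FilModule.StrongDet (E : Type u) [Field E] [Algebra ℚ_[p] E] [Algebra ℤ_[p] E]
    [IsScalarTower ℤ_[p] ℚ_[p] E] [FiniteDimensional ℚ_[p] E] [Algebra (OInt p E) A]
    (L : FilModule (oRing p K K' A)) : Prop :=
  ∀ (ξ : inertiaSubgroup p K K' →* (OInt p E)ˣ) (R : Type u) [CommRing R] [Algebra A R],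
    Module.Free R (R ⊗[A] L.isotypic ξ) →
    ∀ (n : ℕ) (a : Fin n → integralClosure ℤ_[p] (unramField p K K')) (r : Fin n → R),
      LinearMap.det (∑ i, r i • (L.isotypicMul ξ (a i)).baseChange R) =
        ∏ ψ : unramField p K K' →ₐ[ℚ_[p]] E, ∑ i, r i * algebraMap A R
          (algebraMap (OInt p E) A ((ψ.restrictScalars ℤ_[p]).mapIntegralClosure (a i)))

end Determinant

end Coefficients

end Conditions

/-- The functor `T` induces a fully faithful functor between the full subcategories of objects
with the properties `P` and `Q`. -/
def InducesFullyFaithful {C D : Type*} [Category C] [Category D] (T : C ⥤ D)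
    (P : ObjectProperty C) (Q : ObjectProperty D) : Prop :=
  ∃ h : ∀ X, P X → Q (T.obj X),
    (Q.lift (P.ι ⋙ T) fun X => h X.obj X.property).Full ∧
    (Q.lift (P.ι ⋙ T) fun X => h X.obj X.property).Faithful

/-- The functor `T` induces an equivalence between the full subcategories of objects with the
properties `P` and `Q`. -/
def InducesEquivalence {C D : Type*} [Category C] [Category D] (T : C ⥤ D)
    (P : ObjectProperty C) (Q : ObjectProperty D) : Prop :=
  ∃ h : ∀ X, P X → Q (T.obj X),
    (Q.lift (P.ι ⋙ T) fun X => h X.obj X.property).IsEquivalence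

section Stacks

variable {p : ℕ} [Fact p.Prime]
  {K : Type u} [Field K] [Algebra ℚ_[p] K] [Algebra ℤ_[p] K]
  [IsScalarTower ℤ_[p] ℚ_[p] K] [FiniteDimensional ℚ_[p] K]
  {K' : Type u} [Field K'] [Algebra ℚ_[p] K'] [Algebra ℤ_[p] K']
  [IsScalarTower ℤ_[p] ℚ_[p] K'] [FiniteDimensional ℚ_[p] K']
  [Algebra K K'] [IsScalarTower ℤ_[p] K K'] [IsScalarTower ℚ_[p] K K']
  {E : Type u} [Field E] [Algebra ℚ_[p] E] [Algebra ℤ_[p] E]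
  [IsScalarTower ℤ_[p] ℚ_[p] E] [FiniteDimensional ℚ_[p] E]
  {A : Type u} [CommRing A] [Algebra ℤ_[p] A] [Algebra (OInt p E) A]
  [IsScalarTower ℤ_[p] (OInt p E) A]

/-- The functor `Ψ : M ↦ (M / E(u) M, im Φ / E(u) M)`. -/
noncomputable def TameUniformiser.Psi (ϖ : TameUniformiser p K K') (hA : IsTestAlg p E A) :
    PhiModule (ϖ.sRing A) ⥤ FilModule (oRing p K K' A) :=
  PhiModule.toFil (ϖ.modE A hA.isNilpotent)

/-- The objects of `C^{dd}(A)`, in rank `d` and height at most `h`. -/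
def TameUniformiser.Cdd (ϖ : TameUniformiser p K K') (A : Type u) [CommRing A] [Algebra ℤ_[p] A]
    (d h : ℕ) : ObjectProperty (PhiModule (ϖ.sRing A)) :=
  fun M => ϖ.IsBK d h M

/-- The objects of `C^τ(A)`, in rank `d` and height at most `h`. -/
def TameUniformiser.Ctype (ϖ : TameUniformiser p K K') (A : Type u) [CommRing A] [Algebra ℤ_[p] A]
    [Algebra (OInt p E) A] (d h : ℕ) {V : Type u} [AddCommGroup V]
    [Module E V] (τ : Representation E (inertiaSubgroup p K K') V) :
    ObjectProperty (PhiModule (ϖ.sRing A)) :=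
  fun M => ϖ.IsBK d h M ∧ ϖ.HasType τ M

/-- The objects of `C^{dd,BT}(A)`. -/
def TameUniformiser.CddBT (ϖ : TameUniformiser p K K') (hA : IsTestAlg p E A) :
    ObjectProperty (PhiModule (ϖ.sRing A)) :=
  fun M => ϖ.IsBK 2 1 M ∧ ((ϖ.Psi hA).obj M).StrongDet E

/-- The objects of `C^{τ,BT}(A)`. -/
def TameUniformiser.CtypeBT (ϖ : TameUniformiser p K K') (hA : IsTestAlg p E A) {V : Type u}
    [AddCommGroup V] [Module E V] (τ : Representation E (inertiaSubgroup p K K') V) :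
    ObjectProperty (PhiModule (ϖ.sRing A)) :=
  fun M => ϖ.IsBK 2 1 M ∧ ϖ.HasType τ M ∧ ((ϖ.Psi hA).obj M).StrongDet E

/-- The objects of the local model `M_loc^{K'/K}(A)`, in rank `d`. -/
def Mloc (p : ℕ) [Fact p.Prime] (K K' : Type u) [Field K] [Algebra ℚ_[p] K] [Algebra ℤ_[p] K]
    [IsScalarTower ℤ_[p] ℚ_[p] K] [FiniteDimensional ℚ_[p] K]
    [Field K'] [Algebra ℚ_[p] K'] [Algebra ℤ_[p] K']
    [IsScalarTower ℤ_[p] ℚ_[p] K'] [FiniteDimensional ℚ_[p] K']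
    [Algebra K K'] [IsScalarTower ℤ_[p] K K'] (A : Type u) [CommRing A] [Algebra ℤ_[p] A]
    (d : ℕ) : ObjectProperty (FilModule (oRing p K K' A)) :=
  fun L => L.IsLM d

end Stacks

attribute [reducible] GModule.baseChange PhiModule.baseChangeObj FilModule.baseChangeObj
  GRing.tens PhiRing.series wRing

section ScalarExtBasics

variable {R S T S' P : Type u} [CommRing R] [CommRing S] [CommRing T] [CommRing S']
  {M : Type u} [AddCommGroup M] [Module R M] [AddCommGroup P]

/-- The map `m ↦ 1 ⊗ m`. -/
noncomputable def ScalarExt.of (f : R →+* S) (M : Type u) [AddCommGroup M] [Module R M] :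
    M →+ ScalarExt f M :=
  AddMonoidHom.mk' (ScalarExt.tmul f 1) (ScalarExt.tmul_add 1)

theorem ScalarExt.of_apply (f : R →+* S) (m : M) : ScalarExt.of f M m = ScalarExt.tmul f 1 m := rfl

theorem ScalarExt.of_smul (f : R →+* S) (r : R) (m : M) :
    ScalarExt.of f M (r • m) = f r • ScalarExt.of f M m := by
  rw [of_apply, of_apply, ScalarExt.tmul_smul, ScalarExt.smul_tmul, one_mul, mul_one]

theorem ScalarExt.tmul_eq (f : R →+* S) (s : S) (m : M) :
    ScalarExt.tmul f s m = s • ScalarExt.of f M m := by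
  rw [of_apply, ScalarExt.smul_tmul, mul_one]

theorem ScalarExt.congr_of (f : R →+* S) {N : Type u} [AddCommGroup N] [Module R N]
    (e : M ≃ₗ[R] N) (m : M) :
    ScalarExt.congr f e (ScalarExt.of f M m) = ScalarExt.of f N (e m) := rfl

@[elab_as_elim]
theorem ScalarExt.induction_of {f : R →+* S} {C : ScalarExt f M → Prop} (x : ScalarExt f M)
    (zero : C 0) (smul_of : ∀ (s : S) (m : M), C (s • ScalarExt.of f M m))
    (add : ∀ x y, C x → C y → C (x + y)) : C x := by
  induction x using ScalarExt.induction_on with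
  | zero => exact zero
  | tmul s m => rw [ScalarExt.tmul_eq]; exact smul_of s m
  | add x y hx hy => exact add x y hx hy

theorem ScalarExt.span_range_of (f : R →+* S) :
    Submodule.span S (Set.range (ScalarExt.of f M)) = ⊤ := by
  rw [eq_top_iff]
  rintro x -
  induction x using ScalarExt.induction_of with
  | zero => exact zero_mem _
  | smul_of s m => exact Submodule.smul_mem _ _ (Submodule.subset_span ⟨m, rfl⟩)
  | add x y hx hy => exact add_mem hx hy

/-- Semilinear maps out of `S ⊗_R M` are determined by the images of the `1 ⊗ m`. -/
theorem ScalarExt.semilinear_ext {f : R →+* S} [Module T P] (σ : S →+* T) {a b : ScalarExt f M →+ P}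
    (ha : ∀ s x, a (s • x) = σ s • a x) (hb : ∀ s x, b (s • x) = σ s • b x)
    (h : ∀ m, a (ScalarExt.of f M m) = b (ScalarExt.of f M m)) : a = b := by
  ext x
  induction x using ScalarExt.induction_of with
  | zero => rw [map_zero, map_zero]
  | smul_of s m => rw [ha, hb, h]
  | add x y hx hy => rw [map_add, map_add, hx, hy]

theorem ScalarExt.linear_ext {f : R →+* S} [Module S P] {a b : ScalarExt f M →ₗ[S] P}
    (h : ∀ m, a (ScalarExt.of f M m) = b (ScalarExt.of f M m)) : a = b := by
  have := ScalarExt.semilinear_ext (f := f) (RingHom.id S) (a := a.toAddMonoidHom)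
    (b := b.toAddMonoidHom) (fun s x => a.map_smul s x) (fun s x => b.map_smul s x) h
  exact LinearMap.ext fun x => DFunLike.congr_fun this x

/-- The `σ`-semilinear map `S ⊗_R M → P` attached to a map `M → P`. -/
noncomputable def ScalarExt.slift (f : R →+* S) [Module T P] (σ : S →+* T) (β : M →+ P)
    (hβ : ∀ r m, β (r • m) = σ (f r) • β m) : ScalarExt f M →+ P :=
  letI := Module.compHom P σ
  (ScalarExt.lift f β hβ).toAddMonoidHom

theorem ScalarExt.slift_smul_of (f : R →+* S) [Module T P] (σ : S →+* T) (β : M →+ P)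
    (hβ : ∀ r m, β (r • m) = σ (f r) • β m) (s : S) (m : M) :
    ScalarExt.slift f σ β hβ (s • ScalarExt.of f M m) = σ s • β m := by
  let _ := Module.compHom P σ
  rw [← ScalarExt.tmul_eq]
  exact ScalarExt.lift_tmul f β hβ s m

theorem ScalarExt.slift_of (f : R →+* S) [Module T P] (σ : S →+* T) (β : M →+ P)
    (hβ : ∀ r m, β (r • m) = σ (f r) • β m) (m : M) :
    ScalarExt.slift f σ β hβ (ScalarExt.of f M m) = β m := by
  have := ScalarExt.slift_smul_of f σ β hβ 1 m
  rwa [one_smul, map_one, one_smul] at this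

theorem ScalarExt.slift_smul (f : R →+* S) [Module T P] (σ : S →+* T) (β : M →+ P)
    (hβ : ∀ r m, β (r • m) = σ (f r) • β m) (s : S) (x : ScalarExt f M) :
    ScalarExt.slift f σ β hβ (s • x) = σ s • ScalarExt.slift f σ β hβ x := by
  induction x using ScalarExt.induction_of with
  | zero => simp only [smul_zero, map_zero]
  | smul_of t m => rw [smul_smul, slift_smul_of, slift_smul_of, map_mul, mul_smul]
  | add x y hx hy => simp only [smul_add, map_add, hx, hy]

theorem ScalarExt.lift_of (f : R →+* S) [Module S P] (β : M →+ P)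
    (hβ : ∀ r m, β (r • m) = f r • β m) (m : M) :
    ScalarExt.lift f β hβ (ScalarExt.of f M m) = β m := by
  rw [of_apply, ScalarExt.lift_tmul, one_smul]

/-- The comparison of iterated base changes along the two sides of a commutative square. -/
noncomputable def ScalarExt.squareHom (f : R →+* S) (g : S →+* T) (f' : R →+* S') (g' : S' →+* T)
    (h : ∀ r, g (f r) = g' (f' r)) (M : Type u) [AddCommGroup M] [Module R M] :
    ScalarExt g (ScalarExt f M) →ₗ[T] ScalarExt g' (ScalarExt f' M) :=
  ScalarExt.lift g (ScalarExt.slift f g ((ScalarExt.of g' _).comp (ScalarExt.of f' M))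
    (fun r m => by
      rw [AddMonoidHom.comp_apply, AddMonoidHom.comp_apply, ScalarExt.of_smul, ScalarExt.of_smul,
        h])) (fun r m => ScalarExt.slift_smul _ _ _ _ r m)

theorem ScalarExt.squareHom_of (f : R →+* S) (g : S →+* T) (f' : R →+* S') (g' : S' →+* T)
    (h : ∀ r, g (f r) = g' (f' r)) (m : M) :
    ScalarExt.squareHom f g f' g' h M (ScalarExt.of g _ (ScalarExt.of f M m)) =
      ScalarExt.of g' _ (ScalarExt.of f' M m) := by
  rw [squareHom, lift_of, slift_of]
  rfl

theorem ScalarExt.linear_ext₂ {f : R →+* S} {g : S →+* T} [Module T P]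
    {a b : ScalarExt g (ScalarExt f M) →ₗ[T] P}
    (h : ∀ m, a (ScalarExt.of g _ (ScalarExt.of f M m)) =
      b (ScalarExt.of g _ (ScalarExt.of f M m))) : a = b := by
  refine ScalarExt.linear_ext fun x => ?_
  refine DFunLike.congr_fun (ScalarExt.semilinear_ext g
    (a := a.toAddMonoidHom.comp (ScalarExt.of g (ScalarExt f M)))
    (b := b.toAddMonoidHom.comp (ScalarExt.of g (ScalarExt f M))) ?_ ?_ h) x
  · intro s x
    change a (ScalarExt.of g _ (s • x)) = g s • a (ScalarExt.of g _ x)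
    rw [ScalarExt.of_smul, _root_.map_smul]
  · intro s x
    change b (ScalarExt.of g _ (s • x)) = g s • b (ScalarExt.of g _ x)
    rw [ScalarExt.of_smul, _root_.map_smul]

/-- Iterated base changes along the two sides of a commutative square are isomorphic. -/
noncomputable def ScalarExt.square (f : R →+* S) (g : S →+* T) (f' : R →+* S') (g' : S' →+* T)
    (h : ∀ r, g (f r) = g' (f' r)) (M : Type u) [AddCommGroup M] [Module R M] :
    ScalarExt g (ScalarExt f M) ≃ₗ[T] ScalarExt g' (ScalarExt f' M) :=
  LinearEquiv.ofLinearMap (ScalarExt.squareHom f g f' g' h M)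
    (ScalarExt.squareHom f' g' f g (fun r => (h r).symm) M)
    (ScalarExt.linear_ext₂ fun m => by
      rw [LinearMap.comp_apply, squareHom_of, squareHom_of]; rfl)
    (ScalarExt.linear_ext₂ fun m => by
      rw [LinearMap.comp_apply, squareHom_of, squareHom_of]; rfl)

theorem ScalarExt.square_of (f : R →+* S) (g : S →+* T) (f' : R →+* S') (g' : S' →+* T)
    (h : ∀ r, g (f r) = g' (f' r)) (m : M) :
    ScalarExt.square f g f' g' h M (ScalarExt.of g _ (ScalarExt.of f M m)) =
      ScalarExt.of g' _ (ScalarExt.of f' M m) :=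
  ScalarExt.squareHom_of f g f' g' h m

theorem ScalarExt.square_symm (f : R →+* S) (g : S →+* T) (f' : R →+* S') (g' : S' →+* T)
    (h : ∀ r, g (f r) = g' (f' r)) : (ScalarExt.square f g f' g' h M).symm =
      ScalarExt.square f' g' f g (fun r => (h r).symm) M := rfl

theorem ScalarExt.square_congr (f : R →+* S) (g : S →+* T) (f' : R →+* S') (g' : S' →+* T)
    (h : ∀ r, g (f r) = g' (f' r)) {N : Type u} [AddCommGroup N] [Module R N] (e : M ≃ₗ[R] N) :
    (ScalarExt.congr g (ScalarExt.congr f e)).trans (ScalarExt.square f g f' g' h N) =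
      (ScalarExt.square f g f' g' h M).trans (ScalarExt.congr g' (ScalarExt.congr f' e)) := by
  have : ((ScalarExt.congr g (ScalarExt.congr f e)).trans
      (ScalarExt.square f g f' g' h N)).toLinearMap =
      ((ScalarExt.square f g f' g' h M).trans
        (ScalarExt.congr g' (ScalarExt.congr f' e))).toLinearMap := by
    refine ScalarExt.linear_ext₂ fun m => ?_
    simp only [LinearEquiv.coe_coe, LinearEquiv.trans_apply, congr_of, square_of]
  exact LinearEquiv.toLinearMap_injective this

/-- The square isomorphism commutes with compatible semilinear maps. -/
theorem ScalarExt.square_semilinear {f : R →+* S} {g : S →+* T} {f' : R →+* S'} {g' : S' →+* T}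
    {h : ∀ r, g (f r) = g' (f' r)} (σT : T →+* T)
    {a : ScalarExt g (ScalarExt f M) →+ ScalarExt g (ScalarExt f M)}
    {b : ScalarExt g' (ScalarExt f' M) →+ ScalarExt g' (ScalarExt f' M)}
    (ha : ∀ s x, a (s • x) = σT s • a x) (hb : ∀ s x, b (s • x) = σT s • b x)
    (H : ∀ m, ScalarExt.square f g f' g' h M (a (ScalarExt.of g _ (ScalarExt.of f M m))) =
      b (ScalarExt.of g' _ (ScalarExt.of f' M m)))
    (x : ScalarExt g (ScalarExt f M)) :
    ScalarExt.square f g f' g' h M (a x) = b (ScalarExt.square f g f' g' h M x) := by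
  let e : ScalarExt g (ScalarExt f M) →+ ScalarExt g' (ScalarExt f' M) :=
    (ScalarExt.square f g f' g' h M).toLinearMap.toAddMonoidHom
  have he : ∀ y, e y = ScalarExt.square f g f' g' h M y := fun _ => rfl
  refine DFunLike.congr_fun (ScalarExt.semilinear_ext σT (a := e.comp a) (b := b.comp e) ?_ ?_ ?_) x
  · intro s x
    rw [AddMonoidHom.comp_apply, AddMonoidHom.comp_apply, ha, he, he, _root_.map_smul]
  · intro s x
    rw [AddMonoidHom.comp_apply, AddMonoidHom.comp_apply, he, he, _root_.map_smul, hb]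
  · intro y
    refine DFunLike.congr_fun (ScalarExt.semilinear_ext (σT.comp g)
      (a := (e.comp a).comp (ScalarExt.of g (ScalarExt f M)))
      (b := (b.comp e).comp (ScalarExt.of g (ScalarExt f M))) ?_ ?_ ?_) y
    · intro s x
      simp only [AddMonoidHom.comp_apply]
      rw [ScalarExt.of_smul, ha, he, he, _root_.map_smul]
      rfl
    · intro s x
      simp only [AddMonoidHom.comp_apply]
      rw [ScalarExt.of_smul, he, he, _root_.map_smul, hb]
      rfl
    · intro m
      simp only [AddMonoidHom.comp_apply]
      rw [he, he, H, square_of]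

/-- For surjective `θ`, the kernel of `M → S ⊗_R M` is `(ker θ) M`. -/
theorem ScalarExt.of_eq_zero_iff {θ : R →+* S} (hθ : Function.Surjective θ) (m : M) :
    ScalarExt.of θ M m = 0 ↔ m ∈ RingHom.ker θ • (⊤ : Submodule R M) := by
  constructor
  · intro hm
    let Q := M ⧸ (RingHom.ker θ • (⊤ : Submodule R M))
    have key : ∀ a b : R, θ a = θ b → ∀ x : M, (Submodule.Quotient.mk (a • x) : Q) =
        Submodule.Quotient.mk (b • x) := by
      intro a b hab x
      rw [Submodule.Quotient.eq, ← sub_smul]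
      exact Submodule.smul_mem_smul (RingHom.mem_ker.2 (by rw [map_sub, hab, sub_self])) trivial
    let σ := Function.surjInv hθ
    have hσ : ∀ s, θ (σ s) = s := Function.surjInv_eq hθ
    let β : S →+ M →+ Q := AddMonoidHom.mk' (fun s => AddMonoidHom.mk'
      (fun x => (Submodule.Quotient.mk (σ s • x) : Q))
      (fun a b => by rw [smul_add, Submodule.Quotient.mk_add]))
      (fun a b => by
        ext x
        change (Submodule.Quotient.mk (σ (a + b) • x) : Q) = Submodule.Quotient.mk (σ a • x) +
          Submodule.Quotient.mk (σ b • x)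
        rw [← Submodule.Quotient.mk_add, ← add_smul]
        exact key _ _ (by rw [map_add, hσ, hσ, hσ]) x)
    have h1 := ScalarExt.liftAdd_tmul (f := θ) β (fun s r x => by
      change (Submodule.Quotient.mk (σ (s * θ r) • x) : Q) = Submodule.Quotient.mk (σ s • r • x)
      rw [smul_smul]
      exact key _ _ (by rw [map_mul, hσ, hσ]) x) 1 m
    rw [← ScalarExt.of_apply, hm, map_zero] at h1
    have h2 : (Submodule.Quotient.mk m : Q) = Submodule.Quotient.mk (σ 1 • m) := by
      have := key 1 (σ 1) (by rw [hσ, map_one]) m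
      rwa [one_smul] at this
    rw [← Submodule.Quotient.mk_eq_zero, h2]
    exact h1.symm
  · intro hm
    refine Submodule.smul_induction_on hm (fun r hr x _ => ?_) (fun x y hx hy => ?_)
    · rw [of_smul, RingHom.mem_ker.1 hr, zero_smul]
    · rw [map_add, hx, hy, add_zero]

theorem ScalarExt.of_surjective {θ : R →+* S} (hθ : Function.Surjective θ) :
    Function.Surjective (ScalarExt.of θ M) := by
  intro x
  induction x using ScalarExt.induction_of with
  | zero => exact ⟨0, map_zero _⟩
  | smul_of s m =>
    obtain ⟨r, rfl⟩ := hθ s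
    exact ⟨r • m, ScalarExt.of_smul _ _ _⟩
  | add x y hx hy =>
    obtain ⟨a, rfl⟩ := hx
    obtain ⟨b, rfl⟩ := hy
    exact ⟨a + b, map_add _ _ _⟩

end ScalarExtBasics

section SquareIso

variable {G H K : Type u} [Group G] [Group H] [Group K]

theorem GModule.baseChange_act_of {α : H →* G} {X : GRing G} {Y : GRing H}
    (f : GRing.Hom α X Y) (M : GModule X) (g : H) (m : M.carrier) :
    (M.baseChange f).act g (ScalarExt.of f.toRingHom M.carrier m) =
      ScalarExt.of f.toRingHom M.carrier (M.act (α g) m) := by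
  have := M.baseChange_act f g 1 m
  rw [map_one] at this
  exact this

theorem PhiModule.baseChange_phi_of {α : H →* G} {X : PhiRing G} {Y : PhiRing H}
    (f : PhiRing.Hom α X Y) (M : PhiModule X) (m : M.carrier) :
    (M.baseChangeObj f).phi (ScalarExt.of f.toRingHom M.carrier m) =
      ScalarExt.of f.toRingHom M.carrier (M.phi m) := by
  have := ScalarExt.map_tmul X.phi Y.phi (fun r => (f.map_phi r).symm) M.phi M.phi_smul 1 m
  rw [map_one] at this
  exact this

theorem GModule.square_act {H' : Type u} [Group H'] {X : GRing G} {Y : GRing H} {Y' : GRing H'}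
    {Z : GRing K} {α : H →* G} {β : K →* H} {α' : H' →* G} {β' : K →* H'}
    (f : GRing.Hom α X Y) (g : GRing.Hom β Y Z) (f' : GRing.Hom α' X Y') (g' : GRing.Hom β' Y' Z)
    (h : ∀ r, g.toRingHom (f.toRingHom r) = g'.toRingHom (f'.toRingHom r))
    (hα : ∀ k, α (β k) = α' (β' k)) (M : GModule X) (k : K)
    (x : ((M.baseChange f).baseChange g).carrier) :
    ScalarExt.square f.toRingHom g.toRingHom f'.toRingHom g'.toRingHom h M.carrier
      (((M.baseChange f).baseChange g).act k x) =
    ((M.baseChange f').baseChange g').act k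
      (ScalarExt.square f.toRingHom g.toRingHom f'.toRingHom g'.toRingHom h M.carrier x) := by
  refine ScalarExt.square_semilinear (Z.act k)
    (((M.baseChange f).baseChange g).act_smul k) (((M.baseChange f').baseChange g').act_smul k)
    (fun m => ?_) x
  refine (congrArg (ScalarExt.square f.toRingHom g.toRingHom f'.toRingHom g'.toRingHom h M.carrier)
    ((GModule.baseChange_act_of g (M.baseChange f) k _).trans
      (congrArg _ (GModule.baseChange_act_of f M (β k) m)))).trans ?_
  rw [ScalarExt.square_of, hα]
  exact ((GModule.baseChange_act_of g' (M.baseChange f') k _).trans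
      (congrArg _ (GModule.baseChange_act_of f' M (β' k) m))).symm

theorem FilModule.mem_baseChange_fil {α : H →* G} {X : GRing G} {Y : GRing H}
    (f : GRing.Hom α X Y) (L : FilModule X) {m : L.carrier} (hm : m ∈ L.fil) :
    ScalarExt.of f.toRingHom L.carrier m ∈ (L.baseChangeObj f).fil :=
  Submodule.subset_span ⟨m, hm, rfl⟩

theorem FilModule.square_mem_fil {H' : Type u} [Group H'] {X : GRing G} {Y : GRing H} {Y' : GRing H'}
    {Z : GRing K} {α : H →* G} {β : K →* H} {α' : H' →* G} {β' : K →* H'}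
    (f : GRing.Hom α X Y) (g : GRing.Hom β Y Z) (f' : GRing.Hom α' X Y') (g' : GRing.Hom β' Y' Z)
    (h : ∀ r, g.toRingHom (f.toRingHom r) = g'.toRingHom (f'.toRingHom r)) (L : FilModule X)
    (x : ((L.baseChangeObj f).baseChangeObj g).carrier)
    (hx : x ∈ ((L.baseChangeObj f).baseChangeObj g).fil) :
    ScalarExt.square f.toRingHom g.toRingHom f'.toRingHom g'.toRingHom h L.carrier x ∈
      ((L.baseChangeObj f').baseChangeObj g').fil := by
  refine Submodule.span_induction (fun x hx => ?_) ?_ (fun x y _ _ hx hy => ?_)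
    (fun s x _ hx => ?_) hx
  · obtain ⟨y, hy, rfl⟩ := hx
    change ScalarExt.square f.toRingHom g.toRingHom f'.toRingHom g'.toRingHom h L.carrier
      (ScalarExt.of g.toRingHom _ y) ∈ _
    refine Submodule.span_induction (p := fun y _ => ScalarExt.square f.toRingHom g.toRingHom
      f'.toRingHom g'.toRingHom h L.carrier (ScalarExt.of g.toRingHom _ y) ∈
        ((L.baseChangeObj f').baseChangeObj g').fil) (fun y hy => ?_) ?_ (fun x y _ _ hx hy => ?_)
      (fun s x _ hx => ?_) hy
    · obtain ⟨m, hm, rfl⟩ := hy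
      change ScalarExt.square f.toRingHom g.toRingHom f'.toRingHom g'.toRingHom h L.carrier
        (ScalarExt.of g.toRingHom _ (ScalarExt.of f.toRingHom _ m)) ∈ _
      rw [ScalarExt.square_of]
      exact (L.baseChangeObj f').mem_baseChange_fil g' (L.mem_baseChange_fil f' hm)
    · rw [map_zero, map_zero]; exact zero_mem _
    · rw [map_add, map_add]; exact add_mem hx hy
    · rw [ScalarExt.of_smul, _root_.map_smul]; exact Submodule.smul_mem _ _ hx
  · rw [map_zero]; exact zero_mem _
  · rw [map_add]; exact add_mem hx hy
  · rw [_root_.map_smul]; exact Submodule.smul_mem _ _ hx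

/-- The inverse of an isomorphism of pairs. -/
def FilModule.Iso.symm {X : GRing G} {M N : FilModule X} (e : M.Iso N) : N.Iso M where
  equiv := e.equiv.symm
  map_act g m := by rw [LinearEquiv.symm_apply_eq, e.map_act, LinearEquiv.apply_symm_apply]
  map_fil m := by rw [← e.map_fil, LinearEquiv.apply_symm_apply]

/-- An isomorphism of pairs, as an isomorphism in the category of pairs. -/
def FilModule.Iso.toIso {X : GRing G} {M N : FilModule X} (e : M.Iso N) : M ≅ N where
  hom := e
  inv := e.symm
  hom_inv_id := FilModule.Iso.ext (LinearEquiv.self_trans_symm e.equiv)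
  inv_hom_id := FilModule.Iso.ext (LinearEquiv.symm_trans_self e.equiv)

/-- An isomorphism of modules with Frobenius, as an isomorphism in the category. -/
def PhiModule.Iso.toIso {X : PhiRing G} {M N : PhiModule X} (e : M.Iso N) : M ≅ N where
  hom := e
  inv := e.symm
  hom_inv_id := PhiModule.Iso.ext (LinearEquiv.self_trans_symm e.equiv)
  inv_hom_id := PhiModule.Iso.ext (LinearEquiv.symm_trans_self e.equiv)

/-- Iterated base changes of a pair along the two sides of a commutative square. -/
noncomputable def FilModule.squareIso {H' : Type u} [Group H'] {X : GRing G} {Y : GRing H} {Y' : GRing H'}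
    {Z : GRing K} {α : H →* G} {β : K →* H} {α' : H' →* G} {β' : K →* H'}
    (f : GRing.Hom α X Y) (g : GRing.Hom β Y Z) (f' : GRing.Hom α' X Y') (g' : GRing.Hom β' Y' Z)
    (h : ∀ r, g.toRingHom (f.toRingHom r) = g'.toRingHom (f'.toRingHom r))
    (hα : ∀ k, α (β k) = α' (β' k)) (L : FilModule X) :
    ((L.baseChangeObj f).baseChangeObj g).Iso ((L.baseChangeObj f').baseChangeObj g') where
  equiv := ScalarExt.square f.toRingHom g.toRingHom f'.toRingHom g'.toRingHom h L.carrier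
  map_act := GModule.square_act f g f' g' h hα L.toGModule
  map_fil x := by
    refine ⟨fun hx => ?_, FilModule.square_mem_fil f g f' g' h L x⟩
    have := FilModule.square_mem_fil f' g' f g (fun r => (h r).symm) L _ hx
    rw [← ScalarExt.square_symm f.toRingHom g.toRingHom f'.toRingHom g'.toRingHom h] at this
    erw [LinearEquiv.symm_apply_apply] at this
    exact this

theorem PhiModule.square_phi {H' : Type u} [Group H'] {X : PhiRing G} {Y : PhiRing H}
    {Y' : PhiRing H'}
    {Z : PhiRing K} {α : H →* G} {β : K →* H} {α' : H' →* G} {β' : K →* H'}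
    (f : PhiRing.Hom α X Y) (g : PhiRing.Hom β Y Z) (f' : PhiRing.Hom α' X Y')
    (g' : PhiRing.Hom β' Y' Z)
    (h : ∀ r, g.toRingHom (f.toRingHom r) = g'.toRingHom (f'.toRingHom r)) (M : PhiModule X)
    (x : ((M.baseChangeObj f).baseChangeObj g).carrier) :
    ScalarExt.square f.toRingHom g.toRingHom f'.toRingHom g'.toRingHom h M.carrier
      (((M.baseChangeObj f).baseChangeObj g).phi x) =
    ((M.baseChangeObj f').baseChangeObj g').phi
      (ScalarExt.square f.toRingHom g.toRingHom f'.toRingHom g'.toRingHom h M.carrier x) := by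
  refine ScalarExt.square_semilinear Z.phi
    ((M.baseChangeObj f).baseChangeObj g).phi_smul ((M.baseChangeObj f').baseChangeObj g').phi_smul
    (fun m => ?_) x
  refine (congrArg (ScalarExt.square f.toRingHom g.toRingHom f'.toRingHom g'.toRingHom h M.carrier)
    ((PhiModule.baseChange_phi_of g (M.baseChangeObj f) _).trans
      (congrArg _ (PhiModule.baseChange_phi_of f M m)))).trans ?_
  rw [ScalarExt.square_of]
  exact ((PhiModule.baseChange_phi_of g' (M.baseChangeObj f') _).trans
      (congrArg _ (PhiModule.baseChange_phi_of f' M m))).symm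

/-- Iterated base changes of a Frobenius module along the two sides of a commutative square. -/
noncomputable def PhiModule.squareIso {H' : Type u} [Group H'] {X : PhiRing G} {Y : PhiRing H}
    {Y' : PhiRing H'}
    {Z : PhiRing K} {α : H →* G} {β : K →* H} {α' : H' →* G} {β' : K →* H'}
    (f : PhiRing.Hom α X Y) (g : PhiRing.Hom β Y Z) (f' : PhiRing.Hom α' X Y')
    (g' : PhiRing.Hom β' Y' Z)
    (h : ∀ r, g.toRingHom (f.toRingHom r) = g'.toRingHom (f'.toRingHom r))
    (hα : ∀ k, α (β k) = α' (β' k)) (M : PhiModule X) :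
    ((M.baseChangeObj f).baseChangeObj g).Iso ((M.baseChangeObj f').baseChangeObj g') where
  equiv := ScalarExt.square f.toRingHom g.toRingHom f'.toRingHom g'.toRingHom h M.carrier
  map_act := GModule.square_act f.toHom g.toHom f'.toHom g'.toHom h hα M.toGModule
  map_phi := PhiModule.square_phi f g f' g' h M

/-- The pair `(M, im Φ)`. -/
noncomputable abbrev PhiModule.imFil {X : PhiRing G} (M : PhiModule X) : FilModule X.toGRing :=
  ⟨M.toGModule, LinearMap.range M.linPhi, M.act_mem_range⟩

theorem PhiModule.range_linPhi {X : PhiRing G} (M : PhiModule X) :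
    LinearMap.range M.linPhi = Submodule.span X.carrier (Set.range M.phi) := by
  apply le_antisymm
  · rintro _ ⟨x, rfl⟩
    induction x using ScalarExt.induction_on with
    | zero => rw [map_zero]; exact zero_mem _
    | tmul s m =>
      rw [PhiModule.linPhi, ScalarExt.lift_tmul]
      exact Submodule.smul_mem _ _ (Submodule.subset_span ⟨m, rfl⟩)
    | add x y hx hy => rw [map_add]; exact add_mem hx hy
  · rw [Submodule.span_le]
    rintro _ ⟨m, rfl⟩
    exact M.mem_range_linPhi m

theorem PhiModule.range_linPhi_baseChange {X : PhiRing G} {Y : PhiRing H} {α : H →* G}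
    (f : PhiRing.Hom α X Y) (M : PhiModule X) :
    LinearMap.range (M.baseChangeObj f).linPhi = (M.imFil.baseChangeObj f.toHom).fil := by
  rw [PhiModule.range_linPhi]
  apply le_antisymm
  · rw [Submodule.span_le]
    rintro _ ⟨x, rfl⟩
    change (M.baseChangeObj f).phi x ∈ (M.imFil.baseChangeObj f.toHom).fil
    have hx : x ∈ (⊤ : Submodule Y.carrier (M.baseChangeObj f).carrier) := trivial
    rw [show (⊤ : Submodule Y.carrier (M.baseChangeObj f).carrier) = _ from
      (ScalarExt.span_range_of (M := M.carrier) f.toRingHom).symm] at hx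
    induction hx using Submodule.span_induction with
    | mem x hx =>
      obtain ⟨m, rfl⟩ := hx
      erw [PhiModule.baseChange_phi_of]
      exact FilModule.mem_baseChange_fil f.toHom M.imFil (M.mem_range_linPhi m)
    | zero => rw [map_zero]; exact zero_mem _
    | add x y _ _ hx hy => rw [map_add]; exact add_mem hx hy
    | smul s x _ hx => rw [PhiModule.phi_smul]; exact Submodule.smul_mem _ _ hx
  · refine Submodule.span_le.2 ?_
    rintro _ ⟨m, hm, rfl⟩
    have hm' : m ∈ LinearMap.range M.linPhi := hm
    rw [PhiModule.range_linPhi] at hm'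
    change ScalarExt.of f.toRingHom M.carrier m ∈ _
    induction hm' using Submodule.span_induction with
    | mem x hx =>
      obtain ⟨m, rfl⟩ := hx
      rw [← PhiModule.baseChange_phi_of]
      exact Submodule.subset_span ⟨_, rfl⟩
    | zero => rw [map_zero]; exact zero_mem _
    | add x y hx' hy' hx hy =>
      rw [map_add]
      rw [← PhiModule.range_linPhi] at hx' hy'
      exact add_mem (hx hx') (hy hy')
    | smul s x hx' hx =>
      rw [ScalarExt.of_smul]
      rw [← PhiModule.range_linPhi] at hx'
      exact Submodule.smul_mem _ _ (hx hx')

end SquareIso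

section Retraction

/-- The kernel of a homomorphism from a finite group, as a finite set. -/
noncomputable def MonoidHom.kerFinset {G G' : Type u} [Group G] [Group G'] [Finite G']
    (α : G' →* G) : Finset G' := (Set.toFinite (α.ker : Set G')).toFinset

theorem MonoidHom.mem_kerFinset {G G' : Type u} [Group G] [Group G'] [Finite G'] {α : G' →* G}
    {g : G'} : g ∈ α.kerFinset ↔ α g = 1 := by
  rw [kerFinset, Set.Finite.mem_toFinset]
  rfl

theorem MonoidHom.card_kerFinset {G G' : Type u} [Group G] [Group G'] [Finite G'] (α : G' →* G) :
    α.kerFinset.card = Nat.card α.ker := by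
  rw [kerFinset, ← Set.ncard_eq_toFinset_card]
  rfl

theorem MonoidHom.sum_kerFinset_mul_left {G G' P : Type u} [Group G] [Group G'] [Finite G']
    [AddCommMonoid P] (α : G' →* G) {g : G'} (hg : α g = 1) (F : G' → P) :
    ∑ h ∈ α.kerFinset, F (g * h) = ∑ h ∈ α.kerFinset, F h := by
  refine Finset.sum_nbij' (fun h => g * h) (fun h => g⁻¹ * h) ?_ ?_ ?_ ?_ ?_
  · intro h hh
    rw [mem_kerFinset] at hh ⊢
    rw [map_mul, hg, hh, one_mul]
  · intro h hh
    rw [mem_kerFinset] at hh ⊢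
    rw [map_mul, map_inv, hg, hh, inv_one, one_mul]
  · intro h _
    exact inv_mul_cancel_left g h
  · intro h _
    exact mul_inv_cancel_left g h
  · intro h _
    rfl

variable {G G' : Type u} [Group G] [Group G'] [Finite G'] {α : G' →* G}

/-- An equivariant ring homomorphism `f : X → Y` for which the average over `ker α` is a
retraction of `f`. -/
structure GRing.Retraction {X : GRing G} {Y : GRing G'} (f : GRing.Hom α X Y) where
  tr : Y.carrier →+ X.carrier
  tr_mul : ∀ r y, tr (f.toRingHom r * y) = r * tr y
  tr_one : tr 1 = 1
  card_mul : ∀ y, (Nat.card α.ker : Y.carrier) * f.toRingHom (tr y) = ∑ h ∈ α.kerFinset, Y.act h y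
  isUnit_card : IsUnit (Nat.card α.ker : X.carrier)

namespace GRing.Retraction

variable {X : GRing G} {Y : GRing G'} {f : GRing.Hom α X Y} (t : GRing.Retraction f)

include t in
theorem isUnit_card' : IsUnit (Nat.card α.ker : Y.carrier) := by
  have := t.isUnit_card.map f.toRingHom
  rwa [map_natCast] at this

theorem tr_apply (r : X.carrier) : t.tr (f.toRingHom r) = r := by
  have := t.tr_mul r 1
  rwa [mul_one, t.tr_one, mul_one] at this

/-- The retraction of `M → Y ⊗_X M`. -/
noncomputable def trM (M : Type u) [AddCommGroup M] [Module X.carrier M] :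
    ScalarExt f.toRingHom M →+ M :=
  ScalarExt.liftAdd (AddMonoidHom.mk' (fun s => AddMonoidHom.mk' (fun m => t.tr s • m)
    (fun a b => smul_add _ a b)) (fun a b => by
      ext m
      change t.tr (a + b) • m = t.tr a • m + t.tr b • m
      rw [map_add, add_smul])) (fun s r m => by
      change t.tr (s * f.toRingHom r) • m = t.tr s • r • m
      rw [mul_comm, t.tr_mul, mul_comm, mul_smul])

theorem trM_smul_of {M : Type u} [AddCommGroup M] [Module X.carrier M] (s : Y.carrier) (m : M) :
    t.trM M (s • ScalarExt.of f.toRingHom M m) = t.tr s • m := by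
  rw [← ScalarExt.tmul_eq]
  exact ScalarExt.liftAdd_tmul _ _ s m

theorem trM_of {M : Type u} [AddCommGroup M] [Module X.carrier M] (m : M) :
    t.trM M (ScalarExt.of f.toRingHom M m) = m := by
  have := t.trM_smul_of 1 m
  rwa [one_smul, t.tr_one, one_smul] at this

theorem trM_smul {M : Type u} [AddCommGroup M] [Module X.carrier M] (r : X.carrier)
    (x : ScalarExt f.toRingHom M) : t.trM M (f.toRingHom r • x) = r • t.trM M x := by
  induction x using ScalarExt.induction_of with
  | zero => rw [smul_zero, map_zero, smul_zero]
  | smul_of s m => rw [smul_smul, trM_smul_of, trM_smul_of, t.tr_mul, mul_smul]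
  | add x y hx hy => rw [smul_add, map_add, hx, hy, map_add, smul_add]

include t in
theorem of_injective {M : Type u} [AddCommGroup M] [Module X.carrier M] :
    Function.Injective (ScalarExt.of f.toRingHom M) := fun a b h => by
  rw [← t.trM_of a, h, t.trM_of]

theorem card_smul_of_trM (M : GModule X) (x : (M.baseChange f).carrier) :
    (Nat.card α.ker : Y.carrier) • ScalarExt.of f.toRingHom M.carrier (t.trM M.carrier x) =
      ∑ h ∈ α.kerFinset, (M.baseChange f).act h x := by
  induction x using ScalarExt.induction_of with
  | zero => simp only [map_zero, smul_zero, Finset.sum_const_zero]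
  | smul_of s m =>
    rw [trM_smul_of, ScalarExt.of_smul, smul_smul, t.card_mul, Finset.sum_smul]
    refine Finset.sum_congr rfl fun h hh => ?_
    refine Eq.trans ?_ ((M.baseChange f).act_smul h s _).symm
    rw [M.baseChange_act_of, MonoidHom.mem_kerFinset.1 hh, M.act_one]
  | add x y hx hy =>
    rw [map_add, map_add, smul_add, hx, hy, ← Finset.sum_add_distrib]
    exact Finset.sum_congr rfl fun h _ => (map_add _ x y).symm

theorem of_trM_of_fixed (M : GModule X) {x : (M.baseChange f).carrier}
    (hx : ∀ h, α h = 1 → (M.baseChange f).act h x = x) :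
    ScalarExt.of f.toRingHom M.carrier (t.trM M.carrier x) = x := by
  have h1 := t.card_smul_of_trM M x
  rw [Finset.sum_congr rfl fun h hh => hx h (MonoidHom.mem_kerFinset.1 hh), Finset.sum_const,
    MonoidHom.card_kerFinset, ← Nat.cast_smul_eq_nsmul Y.carrier] at h1
  exact t.isUnit_card'.smul_left_cancel.1 h1

section Descend

variable {M N : GModule X}

theorem of_trM_equiv (e : (M.baseChange f).carrier ≃ₗ[Y.carrier] (N.baseChange f).carrier)
    (he : ∀ g m, e ((M.baseChange f).act g m) = (N.baseChange f).act g (e m)) (m : M.carrier) :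
    ScalarExt.of f.toRingHom N.carrier (t.trM N.carrier (e (ScalarExt.of f.toRingHom M.carrier m))) =
      e (ScalarExt.of f.toRingHom M.carrier m) := by
  refine t.of_trM_of_fixed N fun h hh => ?_
  refine (he h _).symm.trans ?_
  rw [M.baseChange_act_of, hh, M.act_one]

theorem trM_equiv_symm (e : (M.baseChange f).carrier ≃ₗ[Y.carrier] (N.baseChange f).carrier)
    (he : ∀ g m, e ((M.baseChange f).act g m) = (N.baseChange f).act g (e m)) (m : M.carrier) :
    t.trM M.carrier (e.symm (ScalarExt.of f.toRingHom N.carrier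
      (t.trM N.carrier (e (ScalarExt.of f.toRingHom M.carrier m))))) = m := by
  rw [t.of_trM_equiv e he, LinearEquiv.symm_apply_apply]
  exact t.trM_of m

/-- Equivariant isomorphisms between base changes come from isomorphisms. -/
noncomputable def descendEquiv
    (e : (M.baseChange f).carrier ≃ₗ[Y.carrier] (N.baseChange f).carrier)
    (he : ∀ g m, e ((M.baseChange f).act g m) = (N.baseChange f).act g (e m)) :
    M.carrier ≃ₗ[X.carrier] N.carrier where
  toFun m := t.trM N.carrier (e (ScalarExt.of f.toRingHom M.carrier m))
  map_add' a b := by rw [map_add, map_add, map_add]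
  map_smul' r m := by
    rw [ScalarExt.of_smul]
    exact (congrArg _ (map_smul e _ _)).trans (t.trM_smul r _)
  invFun n := t.trM M.carrier (e.symm (ScalarExt.of f.toRingHom N.carrier n))
  left_inv m := t.trM_equiv_symm e he m
  right_inv n := t.trM_equiv_symm e.symm (fun g m => by
    rw [LinearEquiv.symm_apply_eq, he, LinearEquiv.apply_symm_apply]) n

theorem of_descendEquiv
    (e : (M.baseChange f).carrier ≃ₗ[Y.carrier] (N.baseChange f).carrier)
    (he : ∀ g m, e ((M.baseChange f).act g m) = (N.baseChange f).act g (e m)) (m : M.carrier) :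
    ScalarExt.of f.toRingHom N.carrier (t.descendEquiv e he m) =
      e (ScalarExt.of f.toRingHom M.carrier m) :=
  t.of_trM_equiv e he m

theorem congr_descendEquiv
    (e : (M.baseChange f).carrier ≃ₗ[Y.carrier] (N.baseChange f).carrier)
    (he : ∀ g m, e ((M.baseChange f).act g m) = (N.baseChange f).act g (e m)) :
    ScalarExt.congr f.toRingHom (t.descendEquiv e he) = e :=
  LinearEquiv.toLinearMap_injective (ScalarExt.linear_ext fun m => t.of_descendEquiv e he m)

theorem descendEquiv_act (hα : Function.Surjective α)
    (e : (M.baseChange f).carrier ≃ₗ[Y.carrier] (N.baseChange f).carrier)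
    (he : ∀ g m, e ((M.baseChange f).act g m) = (N.baseChange f).act g (e m)) (g : G)
    (m : M.carrier) : t.descendEquiv e he (M.act g m) = N.act g (t.descendEquiv e he m) := by
  obtain ⟨g, rfl⟩ := hα g
  apply t.of_injective
  rw [t.of_descendEquiv, ← N.baseChange_act_of, t.of_descendEquiv, ← M.baseChange_act_of, he]

end Descend

end GRing.Retraction

theorem FilModule.mem_fil_iff {X : GRing G} {Y : GRing G'} {f : GRing.Hom α X Y}
    (t : GRing.Retraction f) (L : FilModule X) (m : L.carrier) :
    ScalarExt.of f.toRingHom L.carrier m ∈ (L.baseChangeObj f).fil ↔ m ∈ L.fil := by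
  refine ⟨fun h => ?_, L.mem_baseChange_fil f⟩
  rw [← t.trM_of m]
  have key : ∀ x ∈ (L.baseChangeObj f).fil, ∀ s : Y.carrier, t.trM L.carrier (s • x) ∈ L.fil := by
    intro x hx
    refine Submodule.span_induction (p := fun x _ => ∀ s : Y.carrier,
      t.trM L.carrier (s • x) ∈ L.fil) (fun x hx s => ?_) (fun s => ?_)
      (fun x y _ _ hx hy s => ?_) (fun r x _ hx s => ?_) hx
    · obtain ⟨m, hm, rfl⟩ := hx
      exact (t.trM_smul_of s m).symm ▸ L.fil.smul_mem _ hm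
    · rw [smul_zero, map_zero]; exact zero_mem _
    · rw [smul_add, map_add]; exact add_mem (hx s) (hy s)
    · rw [smul_smul]; exact hx _
  have := key _ h 1
  rwa [one_smul] at this

theorem FilModule.full_baseChange {X : GRing G} {Y : GRing G'} {f : GRing.Hom α X Y}
    (t : GRing.Retraction f) (hα : Function.Surjective α) : (FilModule.baseChange f).Full where
  map_surjective {M N} e := by
    let e : (M.baseChangeObj f).Iso (N.baseChangeObj f) := e
    refine ⟨⟨t.descendEquiv e.equiv e.map_act, t.descendEquiv_act hα e.equiv e.map_act,
      fun m => ?_⟩, FilModule.Iso.ext (t.congr_descendEquiv e.equiv e.map_act)⟩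
    rw [← N.mem_fil_iff t, ← M.mem_fil_iff t, t.of_descendEquiv]
    exact e.map_fil _

theorem FilModule.faithful_baseChange {X : GRing G} {Y : GRing G'} {f : GRing.Hom α X Y}
    (t : GRing.Retraction f) : (FilModule.baseChange f).Faithful where
  map_injective {M N} a b h := by
    refine FilModule.Iso.ext (LinearEquiv.ext fun m => t.of_injective ?_)
    have h1 : ScalarExt.congr f.toRingHom a.equiv = ScalarExt.congr f.toRingHom b.equiv :=
      congrArg FilModule.Iso.equiv h
    exact DFunLike.congr_fun h1 (ScalarExt.of f.toRingHom M.carrier m)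

theorem PhiModule.full_baseChange {X : PhiRing G} {Y : PhiRing G'} {f : PhiRing.Hom α X Y}
    (t : GRing.Retraction f.toHom) (hα : Function.Surjective α) :
    (PhiModule.baseChange f).Full where
  map_surjective {M N} e := by
    let e : (M.baseChangeObj f).Iso (N.baseChangeObj f) := e
    refine ⟨⟨t.descendEquiv e.equiv e.map_act, t.descendEquiv_act hα e.equiv e.map_act,
      fun m => ?_⟩, PhiModule.Iso.ext (t.congr_descendEquiv e.equiv e.map_act)⟩
    apply t.of_injective
    rw [t.of_descendEquiv, ← N.baseChange_phi_of, t.of_descendEquiv, ← M.baseChange_phi_of]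
    exact e.map_phi _

theorem PhiModule.faithful_baseChange {X : PhiRing G} {Y : PhiRing G'} {f : PhiRing.Hom α X Y}
    (t : GRing.Retraction f.toHom) : (PhiModule.baseChange f).Faithful where
  map_injective {M N} a b h := by
    refine PhiModule.Iso.ext (LinearEquiv.ext fun m => t.of_injective ?_)
    have h1 : ScalarExt.congr f.toRingHom a.equiv = ScalarExt.congr f.toRingHom b.equiv :=
      congrArg PhiModule.Iso.equiv h
    exact DFunLike.congr_fun h1 (ScalarExt.of f.toRingHom M.carrier m)

end Retraction

section Invariants

variable {G G' : Type u} [Group G] [Group G'] {α : G' →* G}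

/-- The invariants of a module under the kernel of `α`. -/
noncomputable def GModule.inv {X : GRing G} {Y : GRing G'} (f : GRing.Hom α X Y) (M : GModule Y) :
    Submodule X.carrier (RestrictAlong f.toRingHom M.carrier) where
  carrier := {m | ∀ h, α h = 1 → M.act h m.val = m.val}
  zero_mem' h _ := map_zero _
  add_mem' {a b} ha hb h hh := by
    rw [map_add, map_add, ha h hh, hb h hh]
  smul_mem' r m hm h hh := by
    rw [RestrictAlong.val_smul, M.act_smul, hm h hh, ← f.map_act, hh, X.act_one]

theorem GModule.inv_act {X : GRing G} {Y : GRing G'} (f : GRing.Hom α X Y) (M : GModule Y)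
    {m : RestrictAlong f.toRingHom M.carrier} (hm : m ∈ M.inv f) {g g' : G'} (h : α g = α g') :
    M.act g m.val = M.act g' m.val := by
  have h1 := hm (g'⁻¹ * g) (by rw [map_mul, map_inv, h, inv_mul_cancel])
  calc M.act g m.val = M.act (g' * (g'⁻¹ * g)) m.val := by rw [mul_inv_cancel_left]
    _ = M.act g' m.val := by rw [M.act_mul, h1]

theorem GModule.act_mem_inv {X : GRing G} {Y : GRing G'} (f : GRing.Hom α X Y) (M : GModule Y)
    {m : RestrictAlong f.toRingHom M.carrier} (hm : m ∈ M.inv f) (g : G') :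
    RestrictAlong.val.symm (M.act g m.val) ∈ M.inv f := by
  intro h hh
  rw [AddEquiv.apply_symm_apply, ← M.act_mul]
  exact M.inv_act f hm (by rw [map_mul, hh, one_mul])

/-- The inclusion of the invariants. -/
noncomputable def GModule.invVal {X : GRing G} {Y : GRing G'} (f : GRing.Hom α X Y) (M : GModule Y) :
    M.inv f →+ M.carrier :=
  RestrictAlong.val.toAddMonoidHom.comp (M.inv f).subtype.toAddMonoidHom

theorem GModule.invVal_injective {X : GRing G} {Y : GRing G'} (f : GRing.Hom α X Y)
    (M : GModule Y) : Function.Injective (M.invVal f) :=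
  RestrictAlong.val.injective.comp Subtype.val_injective

theorem GModule.invVal_smul {X : GRing G} {Y : GRing G'} (f : GRing.Hom α X Y) (M : GModule Y)
    (r : X.carrier) (m : M.inv f) : M.invVal f (r • m) = f.toRingHom r • M.invVal f m := rfl

theorem GModule.act_invVal {X : GRing G} {Y : GRing G'} (f : GRing.Hom α X Y) (M : GModule Y)
    (m : M.inv f) {h : G'} (hh : α h = 1) : M.act h (M.invVal f m) = M.invVal f m :=
  m.2 h hh

theorem GModule.exists_invVal {X : GRing G} {Y : GRing G'} (f : GRing.Hom α X Y) (M : GModule Y)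
    (m : M.carrier) (hm : ∀ h, α h = 1 → M.act h m = m) : ∃ x, M.invVal f x = m :=
  ⟨⟨RestrictAlong.val.symm m, hm⟩, rfl⟩

/-- The invariants under the kernel of a surjection `α`, as a module with an action of the
quotient. -/
noncomputable def GModule.invariants {X : GRing G} {Y : GRing G'} (f : GRing.Hom α X Y)
    (hα : Function.Surjective α) (M : GModule Y) : GModule X where
  carrier := M.inv f
  act g := AddMonoidHom.mk' (fun m => ⟨RestrictAlong.val.symm
      (M.act (Function.surjInv hα g) (M.invVal f m)), M.act_mem_inv f m.2 _⟩)
    (fun a b => Subtype.ext ((congrArg (M.act _) (map_add (M.invVal f) a b)).trans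
      (map_add (M.act _) _ _)))
  act_one m := M.invVal_injective f (by
    refine (M.inv_act f m.2 (g' := 1) ?_).trans (M.act_one _)
    rw [Function.surjInv_eq hα, map_one])
  act_mul g h m := M.invVal_injective f (by
    refine (M.inv_act f m.2 (g' := Function.surjInv hα g * Function.surjInv hα h) ?_).trans
      (M.act_mul _ _ _)
    rw [map_mul, Function.surjInv_eq hα, Function.surjInv_eq hα, Function.surjInv_eq hα])
  act_smul g r m := M.invVal_injective f (by
    have h := M.act_smul (Function.surjInv hα g) (f.toRingHom r) (M.invVal f m)
    rw [← f.map_act, Function.surjInv_eq hα] at h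
    exact h)

attribute [reducible] GModule.invariants

theorem GModule.invVal_act {X : GRing G} {Y : GRing G'} (f : GRing.Hom α X Y)
    (hα : Function.Surjective α) (M : GModule Y) (g : G') (m : M.inv f) :
    M.invVal f ((M.invariants f hα).act (α g) m) = M.act g (M.invVal f m) :=
  M.inv_act f m.2 (Function.surjInv_eq hα _)

/-- The invariants of a module with Frobenius. -/
noncomputable def PhiModule.invariants {X : PhiRing G} {Y : PhiRing G'} (f : PhiRing.Hom α X Y)
    (hα : Function.Surjective α) (M : PhiModule Y) : PhiModule X where
  toGModule := M.toGModule.invariants f.toHom hα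
  phi := AddMonoidHom.mk' (fun m => ⟨RestrictAlong.val.symm (M.phi (M.invVal f.toHom m)),
      fun h hh => by
        rw [AddEquiv.apply_symm_apply, ← M.phi_act]
        exact congrArg M.phi (m.2 h hh)⟩)
    (fun a b => Subtype.ext ((congrArg M.phi (map_add (M.invVal f.toHom) a b)).trans
      (map_add M.phi _ _)))
  phi_smul r m := M.invVal_injective f.toHom (by
    have h := M.phi_smul (f.toRingHom r) (M.invVal f.toHom m)
    rw [← f.map_phi] at h
    exact h)
  phi_act g m := M.invVal_injective f.toHom (M.phi_act _ _)

attribute [reducible] PhiModule.invariants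

theorem PhiModule.invVal_phi {X : PhiRing G} {Y : PhiRing G'} (f : PhiRing.Hom α X Y)
    (hα : Function.Surjective α) (M : PhiModule Y) (m : M.inv f.toHom) :
    M.invVal f.toHom ((M.invariants f hα).phi m) = M.phi (M.invVal f.toHom m) := rfl

variable {X : GRing G} {Y : GRing G'} {f : GRing.Hom α X Y}

/-- The comparison map `Y ⊗_X M^{ker α} → M`. -/
noncomputable def GModule.invComp (f : GRing.Hom α X Y) (M : GModule Y) :
    ScalarExt f.toRingHom (M.inv f) →ₗ[Y.carrier] M.carrier :=
  ScalarExt.lift f.toRingHom (M.invVal f) (M.invVal_smul f)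

theorem GModule.invComp_of (M : GModule Y) (m : M.inv f) :
    M.invComp f (ScalarExt.of f.toRingHom _ m) = M.invVal f m :=
  ScalarExt.lift_of _ _ _ m

variable [Finite G']

theorem GModule.exists_dualBasis (t : GRing.Retraction f) (M : GModule Y)
    [Module.Finite Y.carrier M.carrier] [Module.Projective Y.carrier M.carrier]
    (hM : Submodule.span Y.carrier (Set.range (M.invVal f)) = ⊤) :
    ∃ (n : ℕ) (b : Fin n → M.inv f) (l : Fin n → M.inv f →ₗ[X.carrier] X.carrier)
      (s : Fin n → M.carrier →ₗ[Y.carrier] Y.carrier),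
      (∀ m, ∑ k, l k m • b k = m) ∧
      ∀ k m, s k (M.invVal f m) = (Nat.card α.ker : Y.carrier) * f.toRingHom (l k m) := by
  have hfg : (Submodule.span Y.carrier (Set.range (M.invVal f))).FG := hM ▸ Module.Finite.fg_top
  obtain ⟨S, hS1, hS2⟩ := (Submodule.fg_span_iff_fg_span_finset_subset _).1 hfg
  rw [hM] at hS2
  choose b0 hb0 using fun x : S => hS1 x.2
  let F : (S → Y.carrier) →ₗ[Y.carrier] M.carrier :=
    Fintype.linearCombination Y.carrier (fun x : S => (x : M.carrier))
  have hF : Function.Surjective F := by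
    rw [← LinearMap.range_eq_top, Fintype.range_linearCombination, hS2]
    exact congrArg _ Subtype.range_coe
  obtain ⟨σ, hσ⟩ := Module.projective_lifting_property F LinearMap.id hF
  let n := S.card
  let ε : Fin n ≃ S := S.equivFin.symm
  have hsum : ∀ m, ∑ k : Fin n, σ m (ε k) • M.invVal f (b0 (ε k)) = m := by
    intro m
    have h1 : F (σ m) = m := DFunLike.congr_fun hσ m
    rw [Fintype.linearCombination_apply] at h1
    rw [Equiv.sum_comp ε (fun x => σ m x • M.invVal f (b0 x))]
    simp only [hb0]
    exact h1
  have hact1 : ∀ g x, Y.act g (Y.act g⁻¹ x) = x := fun g x => by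
    rw [← Y.act_mul, mul_inv_cancel, Y.act_one]
  refine ⟨n, fun k => b0 (ε k), fun k =>
    { toFun := fun m => t.tr (σ (M.invVal f m) (ε k))
      map_add' := fun a b => by rw [map_add, map_add, Pi.add_apply, map_add]
      map_smul' := fun r m => by
        rw [M.invVal_smul, map_smul, Pi.smul_apply, smul_eq_mul, t.tr_mul]
        rfl }, fun k =>
    { toFun := fun m => ∑ h ∈ α.kerFinset, Y.act h (σ (M.act h⁻¹ m) (ε k))
      map_add' := fun a b => by
        rw [← Finset.sum_add_distrib]
        refine Finset.sum_congr rfl fun h _ => ?_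
        rw [map_add, map_add, Pi.add_apply, map_add]
      map_smul' := fun y m => by
        rw [RingHom.id_apply, Finset.smul_sum]
        refine Finset.sum_congr rfl fun h _ => ?_
        rw [M.act_smul, map_smul, Pi.smul_apply, smul_eq_mul, map_mul, hact1, smul_eq_mul] },
    fun m => ?_, fun k m => ?_⟩
  · apply M.invVal_injective f
    rw [map_sum]
    simp only [LinearMap.coe_mk, AddHom.coe_mk, M.invVal_smul]
    refine t.isUnit_card'.smul_left_cancel.1 ?_
    rw [Finset.smul_sum]
    simp only [smul_smul, t.card_mul, Finset.sum_smul]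
    rw [Finset.sum_comm, ← MonoidHom.card_kerFinset, Nat.cast_smul_eq_nsmul, ← Finset.sum_const]
    refine Finset.sum_congr rfl fun h hh => ?_
    have h2 := congrArg (M.act h) (hsum (M.invVal f m))
    rw [map_sum, M.act_invVal f m (MonoidHom.mem_kerFinset.1 hh)] at h2
    refine Eq.trans (Finset.sum_congr rfl fun k _ => ?_) h2
    rw [M.act_smul, M.act_invVal f _ (MonoidHom.mem_kerFinset.1 hh)]
  · simp only [LinearMap.coe_mk, AddHom.coe_mk]
    rw [t.card_mul]
    refine Finset.sum_congr rfl fun h hh => ?_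
    have h3 : M.act h⁻¹ (M.invVal f m) = M.invVal f m :=
      M.act_invVal f m (by rw [map_inv, MonoidHom.mem_kerFinset.1 hh, inv_one])
    rw [h3]

theorem GModule.finite_inv (t : GRing.Retraction f) (M : GModule Y)
    [Module.Finite Y.carrier M.carrier] [Module.Projective Y.carrier M.carrier]
    (hM : Submodule.span Y.carrier (Set.range (M.invVal f)) = ⊤) :
    Module.Finite X.carrier (M.inv f) := by
  obtain ⟨n, b, l, s, h1, -⟩ := M.exists_dualBasis t hM
  refine Module.Finite.of_surjective (Fintype.linearCombination X.carrier b) fun m => ?_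
  exact ⟨fun k => l k m, by rw [Fintype.linearCombination_apply]; exact h1 m⟩

theorem GModule.projective_inv (t : GRing.Retraction f) (M : GModule Y)
    [Module.Finite Y.carrier M.carrier] [Module.Projective Y.carrier M.carrier]
    (hM : Submodule.span Y.carrier (Set.range (M.invVal f)) = ⊤) :
    Module.Projective X.carrier (M.inv f) := by
  obtain ⟨n, b, l, s, h1, -⟩ := M.exists_dualBasis t hM
  refine Module.Projective.of_split (LinearMap.pi l) (Fintype.linearCombination X.carrier b) ?_
  ext1 m
  rw [LinearMap.comp_apply, Fintype.linearCombination_apply]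
  exact h1 m

theorem GModule.bijective_invComp (t : GRing.Retraction f) (M : GModule Y)
    [Module.Finite Y.carrier M.carrier] [Module.Projective Y.carrier M.carrier]
    (hM : Submodule.span Y.carrier (Set.range (M.invVal f)) = ⊤) :
    Function.Bijective (M.invComp f) := by
  obtain ⟨n, b, l, s, h1, h2⟩ := M.exists_dualBasis t hM
  constructor
  · let B : M.carrier →ₗ[Y.carrier] ScalarExt f.toRingHom (M.inv f) :=
      ∑ k, (s k).smulRight (ScalarExt.of f.toRingHom _ (b k))
    have hB : B ∘ₗ M.invComp f = (Nat.card α.ker : Y.carrier) • LinearMap.id := by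
      refine ScalarExt.linear_ext fun m => ?_
      rw [LinearMap.comp_apply, M.invComp_of, LinearMap.smul_apply, LinearMap.id_apply]
      conv_rhs => rw [← h1 m, map_sum, Finset.smul_sum]
      rw [LinearMap.sum_apply]
      refine Finset.sum_congr rfl fun k _ => ?_
      rw [LinearMap.smulRight_apply, h2, mul_smul, ScalarExt.of_smul]
    intro x y hxy
    have h3 := congrArg B hxy
    rw [← LinearMap.comp_apply, ← LinearMap.comp_apply, hB] at h3
    exact t.isUnit_card'.smul_left_cancel.1 h3
  · rw [← LinearMap.range_eq_top, eq_top_iff, ← hM, Submodule.span_le]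
    rintro _ ⟨m, rfl⟩
    exact ⟨_, M.invComp_of m⟩

/-- Galois descent: a module generated by invariants is the base change of its invariants. -/
noncomputable def PhiModule.descentIso {X : PhiRing G} {Y : PhiRing G'} {f : PhiRing.Hom α X Y}
    (t : GRing.Retraction f.toHom) (hα : Function.Surjective α) (M : PhiModule Y)
    [Module.Finite Y.carrier M.carrier] [Module.Projective Y.carrier M.carrier]
    (hM : Submodule.span Y.carrier (Set.range (M.invVal f.toHom)) = ⊤) :
    ((M.invariants f hα).baseChangeObj f).Iso M where
  equiv := LinearEquiv.ofBijective (M.invComp f.toHom) (M.toGModule.bijective_invComp t hM)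
  map_act g x := by
    change M.invComp f.toHom (((M.invariants f hα).baseChangeObj f).act g x) =
      M.act g (M.invComp f.toHom x)
    induction x using ScalarExt.induction_of with
    | zero => simp only [map_zero]
    | smul_of s m =>
      have h1 := (((M.invariants f hα).baseChangeObj f).act_smul g s
        (ScalarExt.of f.toRingHom _ m)).trans
          (congrArg _ ((M.invariants f hα).baseChange_act_of f.toHom g m))
      have h2 : M.invComp f.toHom (s • ScalarExt.of f.toRingHom (M.inv f.toHom) m) =
        s • M.invVal f.toHom m := (map_smul _ s _).trans (congrArg _ (M.invComp_of m))
      refine (congrArg (M.invComp f.toHom) h1).trans ((map_smul (M.invComp f.toHom) _ _).trans ?_)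
      refine Eq.trans ?_ (congrArg (M.act g) h2).symm
      rw [M.act_smul, ← M.invVal_act f.toHom hα]
      exact congrArg _ (M.invComp_of _)
    | add x y hx hy =>
      refine (congrArg (M.invComp f.toHom) (map_add _ x y)).trans
        ((map_add (M.invComp f.toHom) _ _).trans ?_)
      rw [hx, hy, ← map_add]
      exact congrArg _ (map_add (M.invComp f.toHom) x y).symm
  map_phi x := by
    change M.invComp f.toHom (((M.invariants f hα).baseChangeObj f).phi x) =
      M.phi (M.invComp f.toHom x)
    induction x using ScalarExt.induction_of with
    | zero => simp only [map_zero]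
    | smul_of s m =>
      have h1 := (((M.invariants f hα).baseChangeObj f).phi_smul s
        (ScalarExt.of f.toRingHom _ m)).trans
          (congrArg _ ((M.invariants f hα).baseChange_phi_of f m))
      have h2 : M.invComp f.toHom (s • ScalarExt.of f.toRingHom (M.inv f.toHom) m) =
        s • M.invVal f.toHom m := (map_smul _ s _).trans (congrArg _ (M.invComp_of m))
      refine (congrArg (M.invComp f.toHom) h1).trans ((map_smul (M.invComp f.toHom) _ _).trans ?_)
      refine Eq.trans ?_ (congrArg (M.phi) h2).symm
      rw [M.phi_smul, ← M.invVal_phi f hα]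
      exact congrArg _ (M.invComp_of _)
    | add x y hx hy =>
      refine (congrArg (M.invComp f.toHom) (map_add _ x y)).trans
        ((map_add (M.invComp f.toHom) _ _).trans ?_)
      rw [hx, hy, ← map_add]
      exact congrArg _ (map_add (M.invComp f.toHom) x y).symm

end Invariants

section ModuleTheory

variable {R S : Type u} [CommRing R] [CommRing S] (f : R →+* S)
  {M N : Type u} [AddCommGroup M] [Module R M] [AddCommGroup N] [Module R N]

instance ScalarExt.finite [Module.Finite R M] : Module.Finite S (ScalarExt f M) :=
  letI := f.toAlgebra
  (inferInstance : Module.Finite S (S ⊗[R] M))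

instance ScalarExt.projective [Module.Projective R M] : Module.Projective S (ScalarExt f M) :=
  letI := f.toAlgebra
  (inferInstance : Module.Projective S (S ⊗[R] M))

theorem ScalarExt.rankAtStalk [Module.Finite R M] [Module.Projective R M] (P : PrimeSpectrum S) :
    Module.rankAtStalk (ScalarExt f M) P = Module.rankAtStalk M (P.comap f) :=
  letI := f.toAlgebra
  Module.rankAtStalk_baseChange (R := R) (M := M) P

/-- The linear map `S ⊗_R M → S ⊗_R N` induced by a linear map `M → N`. -/
noncomputable def ScalarExt.mapLin (μ : M →ₗ[R] N) : ScalarExt f M →ₗ[S] ScalarExt f N :=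
  ScalarExt.lift f ((ScalarExt.of f N).comp μ.toAddMonoidHom) (fun r m => by
    change ScalarExt.of f N (μ (r • m)) = f r • ScalarExt.of f N (μ m)
    rw [_root_.map_smul, ScalarExt.of_smul])

theorem ScalarExt.mapLin_of (μ : M →ₗ[R] N) (m : M) :
    ScalarExt.mapLin f μ (ScalarExt.of f M m) = ScalarExt.of f N (μ m) :=
  ScalarExt.lift_of f _ _ m

theorem Module.Projective.mem_smul_top_of_smul_mem [Module.Projective R M] {J : Ideal R} {E : R}
    (hE : ∀ y, E * y ∈ J → y ∈ J) {m : M} (hm : E • m ∈ J • (⊤ : Submodule R M)) :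
    m ∈ J • (⊤ : Submodule R M) := by
  obtain ⟨s, hs⟩ := Module.projective_def'.1 (inferInstance : Module.Projective R M)
  have key : ∀ x ∈ J • (⊤ : Submodule R M), ∀ i, s x i ∈ J := by
    intro x hx
    refine Submodule.smul_induction_on hx (fun r hr x _ i => ?_) (fun x y hx hy i => ?_)
    · rw [_root_.map_smul, Finsupp.smul_apply, smul_eq_mul]
      exact J.mul_mem_right _ hr
    · rw [map_add, Finsupp.add_apply]
      exact add_mem (hx i) (hy i)
  have h1 : ∀ i, s m i ∈ J := fun i => hE _ (by
    have := key _ hm i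
    rwa [_root_.map_smul, Finsupp.smul_apply, smul_eq_mul] at this)
  have h2 : Finsupp.linearCombination R id (s m) = m := DFunLike.congr_fun hs m
  rw [← h2, Finsupp.linearCombination_apply]
  exact Submodule.sum_mem _ fun i _ => Submodule.smul_mem_smul (h1 i) trivial

theorem Module.Projective.eq_zero_of_smul_eq_zero [Module.Projective R M] {E : R}
    (hE : ∀ y, E * y = 0 → y = 0) {m : M} (hm : E • m = 0) : m = 0 := by
  have := Module.Projective.mem_smul_top_of_smul_mem (J := ⊥) (E := E) (m := m) (by simpa using hE)
    (by rw [hm]; exact zero_mem _)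
  simpa using this

theorem LocalizedModule.bijective_map_powers_iff (E : R) (μ : M →ₗ[R] N) :
    Function.Bijective (LocalizedModule.map (Submonoid.powers E) μ) ↔
      (∀ x, μ x = 0 → ∃ k : ℕ, E ^ k • x = 0) ∧ ∀ y, ∃ k : ℕ, E ^ k • y ∈ LinearMap.range μ := by
  constructor
  · rintro ⟨h1, h2⟩
    refine ⟨fun x hx => ?_, fun y => ?_⟩
    · have h3 : LocalizedModule.map (Submonoid.powers E) μ (LocalizedModule.mk x 1) =
          LocalizedModule.map (Submonoid.powers E) μ 0 := by
        rw [LocalizedModule.map_mk, hx, LocalizedModule.zero_mk, map_zero]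
      have h4 := h1 h3
      rw [← LocalizedModule.zero_mk 1, LocalizedModule.mk_eq] at h4
      obtain ⟨⟨_, k, rfl⟩, hk⟩ := h4
      refine ⟨k, ?_⟩
      simpa [Submonoid.smul_def] using hk
    · obtain ⟨z, hz⟩ := h2 (LocalizedModule.mk y 1)
      induction z using LocalizedModule.induction_on with
      | _ x t =>
      obtain ⟨_, n, rfl⟩ := t
      rw [LocalizedModule.map_mk, LocalizedModule.mk_eq] at hz
      obtain ⟨⟨_, k, rfl⟩, hk⟩ := hz
      refine ⟨k + n, E ^ k • x, ?_⟩
      rw [_root_.map_smul, pow_add, mul_smul]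
      simpa [Submonoid.smul_def] using hk
  · rintro ⟨h1, h2⟩
    constructor
    · rw [injective_iff_map_eq_zero]
      intro z hz
      induction z using LocalizedModule.induction_on with
      | _ x t =>
      rw [LocalizedModule.map_mk, ← LocalizedModule.zero_mk 1, LocalizedModule.mk_eq] at hz
      obtain ⟨⟨_, k, rfl⟩, hk⟩ := hz
      have hk' : μ (E ^ k • x) = 0 := by
        rw [_root_.map_smul]
        simpa [Submonoid.smul_def] using hk
      obtain ⟨n, hn⟩ := h1 _ hk'
      rw [← LocalizedModule.zero_mk 1, LocalizedModule.mk_eq]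
      refine ⟨⟨E ^ (n + k), n + k, rfl⟩, ?_⟩
      rw [smul_smul, ← pow_add] at hn
      simpa [Submonoid.smul_def] using hn
    · intro z
      induction z using LocalizedModule.induction_on with
      | _ y t =>
      obtain ⟨k, x, hx⟩ := h2 y
      refine ⟨LocalizedModule.mk x (⟨E ^ k, k, rfl⟩ * t), ?_⟩
      rw [LocalizedModule.map_mk, hx]
      exact LocalizedModule.mk_cancel_common_left (⟨E ^ k, k, rfl⟩ : Submonoid.powers E) t y

end ModuleTheory

section Kisin

variable {G G' : Type u} [Group G] [Group G'] {α : G' →* G}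

/-- Kisin modules of rank `d` and height at most `h` with respect to `E`. -/
def PhiModule.IsKisin {X : PhiRing G} (E : X.carrier) (d h : ℕ) (M : PhiModule X) : Prop :=
  Module.Finite X.carrier M.carrier ∧ Module.Projective X.carrier M.carrier ∧
  (∀ P : PrimeSpectrum X.carrier, Module.rankAtStalk M.carrier P = d) ∧
  Function.Bijective (LocalizedModule.map (Submonoid.powers E) M.linPhi) ∧
  ∀ m : M.carrier, E ^ h • m ∈ LinearMap.range M.linPhi

theorem PhiModule.isKisin_iff {X : PhiRing G} (E : X.carrier) (d h : ℕ) (M : PhiModule X) :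
    M.IsKisin E d h ↔ Module.Finite X.carrier M.carrier ∧ Module.Projective X.carrier M.carrier ∧
      (∀ P : PrimeSpectrum X.carrier, Module.rankAtStalk M.carrier P = d) ∧
      (∀ x, M.linPhi x = 0 → ∃ k : ℕ, E ^ k • x = 0) ∧
      ∀ m : M.carrier, E ^ h • m ∈ LinearMap.range M.linPhi := by
  rw [PhiModule.IsKisin, LocalizedModule.bijective_map_powers_iff]
  exact ⟨fun ⟨h1, h2, h3, ⟨h4, _⟩, h5⟩ => ⟨h1, h2, h3, h4, h5⟩,
    fun ⟨h1, h2, h3, h4, h5⟩ => ⟨h1, h2, h3, ⟨h4, fun y => ⟨h, h5 y⟩⟩, h5⟩⟩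

theorem PhiModule.linPhi_of {X : PhiRing G} (M : PhiModule X) (m : M.carrier) :
    M.linPhi (ScalarExt.of X.phi M.carrier m) = M.phi m :=
  ScalarExt.lift_of _ _ _ m

theorem PhiModule.IsKisin.injective_linPhi {X : PhiRing G} {E : X.carrier} {d h : ℕ}
    {M : PhiModule X} (hM : M.IsKisin E d h) (hE : ∀ y, E * y = 0 → y = 0) :
    Function.Injective M.linPhi := by
  rw [PhiModule.isKisin_iff] at hM
  obtain ⟨_, _, _, h4, _⟩ := hM
  rw [injective_iff_map_eq_zero]
  intro x hx
  obtain ⟨k, hk⟩ := h4 x hx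
  induction k with
  | zero => rwa [pow_zero, one_smul] at hk
  | succ k ih =>
    rw [pow_succ', mul_smul] at hk
    exact ih (Module.Projective.eq_zero_of_smul_eq_zero hE hk)

/-- The Verschiebung of a Kisin module of height `h`. -/
theorem PhiModule.IsKisin.exists_verschiebung {X : PhiRing G} {E : X.carrier} {d h : ℕ}
    {M : PhiModule X} (hM : M.IsKisin E d h) (hE : ∀ y, E * y = 0 → y = 0) :
    ∃ V : M.carrier →ₗ[X.carrier] ScalarExt X.phi M.carrier,
      (∀ m, M.linPhi (V m) = E ^ h • m) ∧ ∀ x, V (M.linPhi x) = E ^ h • x := by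
  have hinj := hM.injective_linPhi hE
  obtain ⟨_, _, _, _, h5⟩ := hM
  obtain ⟨V, hV⟩ := Module.projective_lifting_property M.linPhi.rangeRestrict
    ((LinearMap.lsmul X.carrier M.carrier (E ^ h)).codRestrict _ h5)
    (LinearMap.surjective_rangeRestrict _)
  have h1 : ∀ m, M.linPhi (V m) = E ^ h • m := fun m =>
    congrArg Subtype.val (DFunLike.congr_fun hV m)
  exact ⟨V, h1, fun x => hinj (by rw [h1, map_smul])⟩

section BaseChange

variable {X : PhiRing G} {Y : PhiRing G'} (f : PhiRing.Hom α X Y) (M : PhiModule X)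

/-- The compatibility of base change with Frobenius pull-backs. -/
noncomputable def PhiModule.pullbackEquiv :
    ScalarExt Y.phi (ScalarExt f.toRingHom M.carrier) ≃ₗ[Y.carrier]
      ScalarExt f.toRingHom (ScalarExt X.phi M.carrier) :=
  ScalarExt.square f.toRingHom Y.phi X.phi f.toRingHom (fun r => (f.map_phi r).symm) M.carrier

theorem PhiModule.mapLin_pullbackEquiv
    (x : ScalarExt Y.phi (ScalarExt f.toRingHom M.carrier)) :
    ScalarExt.mapLin f.toRingHom M.linPhi (M.pullbackEquiv f x) =
      (M.baseChangeObj f).linPhi x := by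
  refine DFunLike.congr_fun (ScalarExt.linear_ext₂
    (a := ScalarExt.mapLin f.toRingHom M.linPhi ∘ₗ (M.pullbackEquiv f).toLinearMap)
    (b := (M.baseChangeObj f).linPhi) fun m => ?_) x
  refine Eq.trans ?_ (((M.baseChangeObj f).linPhi_of _).trans (M.baseChange_phi_of f m)).symm
  rw [LinearMap.comp_apply, LinearEquiv.coe_coe, PhiModule.pullbackEquiv, ScalarExt.square_of,
    ScalarExt.mapLin_of, PhiModule.linPhi_of]

theorem PhiModule.IsKisin.baseChange {E : X.carrier} {E' v : Y.carrier} {d h : ℕ}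
    {M : PhiModule X} (hM : M.IsKisin E d h) (hE : ∀ y, E * y = 0 → y = 0)
    (hEE : E' = v * f.toRingHom E) : (M.baseChangeObj f).IsKisin E' d h := by
  obtain ⟨V, hV1, hV2⟩ := hM.exists_verschiebung hE
  rw [PhiModule.isKisin_iff] at hM ⊢
  obtain ⟨h1, h2, h3, h4, h5⟩ := hM
  refine ⟨ScalarExt.finite f.toRingHom, ScalarExt.projective f.toRingHom, fun P => ?_, fun x hx => ?_,
    fun m => ?_⟩
  · rw [← h3 (P.comap f.toRingHom)]
    exact ScalarExt.rankAtStalk f.toRingHom P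
  · refine ⟨h, ?_⟩
    have hVV : ∀ y, ScalarExt.mapLin f.toRingHom V (ScalarExt.mapLin f.toRingHom M.linPhi y) =
        f.toRingHom E ^ h • y := by
      intro y
      refine DFunLike.congr_fun (ScalarExt.linear_ext
        (a := ScalarExt.mapLin f.toRingHom V ∘ₗ ScalarExt.mapLin f.toRingHom M.linPhi)
        (b := f.toRingHom E ^ h • LinearMap.id) fun m => ?_) y
      rw [LinearMap.comp_apply, ScalarExt.mapLin_of, ScalarExt.mapLin_of, hV2, ScalarExt.of_smul,
        map_pow, LinearMap.smul_apply, LinearMap.id_apply]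
    have h6 := hVV (M.pullbackEquiv f x)
    rw [M.mapLin_pullbackEquiv f, hx, map_zero, ← map_smul] at h6
    have h7 := (LinearEquiv.map_eq_zero_iff _).1 h6.symm
    rw [hEE, mul_pow, mul_smul]
    exact (congrArg _ h7).trans (smul_zero _)
  · rw [PhiModule.range_linPhi_baseChange]
    have key : ∀ m : ScalarExt f.toRingHom M.carrier, f.toRingHom E ^ h • m ∈
        (M.imFil.baseChangeObj f.toHom).fil := by
      intro m
      induction m using ScalarExt.induction_of with
      | zero => rw [smul_zero]; exact zero_mem _
      | smul_of s m =>
        rw [smul_comm, ← map_pow, ← ScalarExt.of_smul]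
        exact Submodule.smul_mem _ _ (FilModule.mem_baseChange_fil f.toHom M.imFil (h5 m))
      | add x y hx hy => rw [smul_add]; exact add_mem hx hy
    rw [hEE, mul_pow, mul_smul]
    exact Submodule.smul_mem _ _ (key m)

theorem PhiModule.IsKisin.of_baseChange [Finite G'] (t : GRing.Retraction f.toHom) {E : X.carrier}
    {E' v : Y.carrier} {d h : ℕ} {M : PhiModule X} [Module.Finite X.carrier M.carrier]
    [Module.Projective X.carrier M.carrier] (hM : (M.baseChangeObj f).IsKisin E' d h)
    (hv : IsUnit v) (hEE : E' = v * f.toRingHom E) : M.IsKisin E d h := by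
  rw [PhiModule.isKisin_iff] at hM ⊢
  obtain ⟨h1, h2, h3, h4, h5⟩ := hM
  refine ⟨inferInstance, inferInstance, fun P => ?_, fun x hx => ?_, fun m => ?_⟩
  · obtain ⟨Q, rfl⟩ : P ∈ Set.range (PrimeSpectrum.comap f.toRingHom) := by
      rw [PrimeSpectrum.mem_range_comap_iff]
      refine le_antisymm (fun r hr => ?_) Ideal.le_comap_map
      have key : ∀ y ∈ P.asIdeal.map f.toRingHom, t.tr y ∈ P.asIdeal := by
        intro y hy
        refine Submodule.span_induction (p := fun y _ => ∀ s, t.tr (s * y) ∈ P.asIdeal)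
          (fun x hx s => ?_) (fun s => ?_) (fun x y _ _ hx hy s => ?_) (fun a x _ hx s => ?_) hy 1
          |> (one_mul y ▸ ·)
        · obtain ⟨r, hr, rfl⟩ := hx
          rw [mul_comm]
          exact (t.tr_mul r s).symm ▸ Ideal.mul_mem_right _ _ hr
        · rw [mul_zero, map_zero]; exact zero_mem _
        · rw [mul_add, map_add]; exact add_mem (hx s) (hy s)
        · rw [smul_eq_mul, ← mul_assoc]; exact hx _
      have := key _ (Ideal.mem_comap.1 hr)
      rwa [t.tr_apply] at this
    rw [← h3 Q]
    exact (ScalarExt.rankAtStalk f.toRingHom Q).symm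
  · have h6 : (M.baseChangeObj f).linPhi ((M.pullbackEquiv f).symm
        (ScalarExt.of f.toRingHom _ x)) = 0 := by
      rw [← M.mapLin_pullbackEquiv f, LinearEquiv.apply_symm_apply, ScalarExt.mapLin_of, hx,
        map_zero]
    obtain ⟨k, hk⟩ := h4 _ h6
    refine ⟨k, t.of_injective ?_⟩
    have h7 : E' ^ k • ScalarExt.of f.toRingHom _ x = 0 := by
      rw [← LinearEquiv.map_eq_zero_iff (M.pullbackEquiv f).symm, map_smul]
      exact hk
    rw [hEE, mul_pow, mul_smul] at h7
    rw [ScalarExt.of_smul, map_pow, map_zero]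
    exact (hv.pow k).smul_eq_zero.1 h7
  · have h6 : E' ^ h • ScalarExt.of f.toRingHom M.carrier m ∈
        (M.imFil.baseChangeObj f.toHom).fil := by
      rw [← PhiModule.range_linPhi_baseChange]
      exact h5 (ScalarExt.of f.toRingHom M.carrier m)
    rw [hEE, mul_pow, mul_smul] at h6
    have h7 := (Submodule.smul_mem_iff_of_isUnit _ (hv.pow h)).1 h6
    rw [← map_pow, ← ScalarExt.of_smul] at h7
    exact (FilModule.mem_fil_iff t M.imFil _).1 h7

end BaseChange

theorem PhiModule.Iso.range_iff {X : PhiRing G} {M N : PhiModule X} (e : M.Iso N) (m : M.carrier) :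
    e.equiv m ∈ LinearMap.range N.linPhi ↔ m ∈ LinearMap.range M.linPhi := by
  refine ⟨fun h => ?_, PhiModule.Iso.map_range e m⟩
  have h1 := PhiModule.Iso.map_range (PhiModule.Iso.symm e) _ h
  rw [← e.equiv.symm_apply_apply m]
  exact h1

theorem PhiModule.IsKisin.of_iso {X : PhiRing G} {E : X.carrier} {d h : ℕ} {M N : PhiModule X}
    (e : M.Iso N) (hM : M.IsKisin E d h) : N.IsKisin E d h := by
  rw [PhiModule.isKisin_iff] at hM ⊢
  obtain ⟨h1, h2, h3, h4, h5⟩ := hM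
  refine ⟨Module.Finite.equiv e.equiv, Module.Projective.of_equiv e.equiv, fun P => ?_,
    fun x hx => ?_, fun m => ?_⟩
  · rw [← Module.rankAtStalk_eq_of_equiv e.equiv, h3]
  · have h6 : ∀ y, N.linPhi (ScalarExt.congr X.phi e.equiv y) = e.equiv (M.linPhi y) := fun y =>
      DFunLike.congr_fun (ScalarExt.linear_ext
        (a := N.linPhi ∘ₗ (ScalarExt.congr X.phi e.equiv).toLinearMap)
        (b := e.equiv.toLinearMap ∘ₗ M.linPhi) fun m => by
          simp only [LinearMap.comp_apply, LinearEquiv.coe_coe]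
          rw [ScalarExt.congr_of, linPhi_of, linPhi_of, e.map_phi]) y
    obtain ⟨y, rfl⟩ := (ScalarExt.congr X.phi e.equiv).surjective x
    rw [h6, LinearEquiv.map_eq_zero_iff] at hx
    obtain ⟨k, hk⟩ := h4 y hx
    exact ⟨k, by rw [← map_smul, hk, map_zero]⟩
  · obtain ⟨m, rfl⟩ := e.equiv.surjective m
    rw [← map_smul, e.range_iff]
    exact h5 m

end Kisin

section Eisenstein

open Polynomial

theorem Polynomial.degree_C_mul_lt {R : Type*} [CommRing R] {a : R} {Q : R[X]} {m : ℕ}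
    (hQ : Q.degree < m) : (C a * Q).degree < m :=
  (degree_mul_le _ _).trans_lt ((add_le_add_left degree_C_le _).trans_lt (by rwa [zero_add]))

theorem Polynomial.monic_X_pow_sub_C_mul {R : Type*} [CommRing R] {a : R} {Q : R[X]} {m : ℕ}
    (hQ : Q.degree < m) : (X ^ m - C a * Q).Monic :=
  monic_X_pow_sub (degree_C_mul_lt hQ)

theorem Polynomial.degree_X_pow_sub_C_mul {R : Type*} [CommRing R] [Nontrivial R] {a : R}
    {Q : R[X]} {m : ℕ} (hQ : Q.degree < m) : (X ^ m - C a * Q).degree = (m : WithBot ℕ) := by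
  rw [degree_sub_eq_left_of_degree_lt, degree_X_pow]
  rw [degree_X_pow]
  exact degree_C_mul_lt hQ

theorem minpoly.eq_X_pow_sub_C_mul {W O : Type*} [CommRing W] [IsDomain W] [IsIntegrallyClosed W]
    [CommRing O] [IsDomain O] [Algebra W O] [FaithfulSMul W O] {a : W} (ha : Prime a) {x : O}
    {m : ℕ} (hm : 0 < m) {Q : W[X]} (hQ : Q.degree < m) (hQ0 : IsUnit (Q.coeff 0))
    (hx : Polynomial.aeval x (X ^ m - C a * Q) = 0) : minpoly W x = X ^ m - C a * Q := by
  have hmon := monic_X_pow_sub_C_mul (a := a) hQ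
  have hgd : (X ^ m - C a * Q).natDegree = m :=
    natDegree_eq_of_degree_eq_some (degree_X_pow_sub_C_mul hQ)
  have hint : IsIntegral W x := ⟨_, hmon, hx⟩
  have heis : (X ^ m - C a * Q).IsEisensteinAt (Ideal.span {a}) := by
    refine ⟨?_, fun {n} hn => ?_, ?_⟩
    · rw [hmon.leadingCoeff, ← Ideal.ne_top_iff_one, Ne, Ideal.span_singleton_eq_top]
      exact ha.not_isUnit
    · rw [hgd] at hn
      rw [coeff_sub, coeff_X_pow, if_neg hn.ne, zero_sub, coeff_C_mul]
      exact neg_mem (Ideal.mul_mem_right _ _ (Ideal.mem_span_singleton_self _))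
    · rw [coeff_sub, coeff_X_pow, if_neg hm.ne, zero_sub, coeff_C_mul, Ideal.span_singleton_pow,
        Ideal.mem_span_singleton, dvd_neg, sq, mul_dvd_mul_iff_left ha.ne_zero]
      exact fun h => ha.not_isUnit (isUnit_of_dvd_unit h hQ0)
  have hirr := heis.irreducible ((Ideal.span_singleton_prime ha.ne_zero).2 ha) hmon.isPrimitive
    (by rwa [hgd])
  exact eq_of_monic_of_associated (minpoly.monic hint) hmon
    (((minpoly.prime_of_isIntegrallyClosed hint).irreducible.associated_of_dvd hirr
      (minpoly.isIntegrallyClosed_dvd hint hx)))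

end Eisenstein

section Uniformiser

variable {p : ℕ} [Fact p.Prime] {F : Type u} [Field F] [Algebra ℚ_[p] F] [Algebra ℤ_[p] F]
  [IsScalarTower ℤ_[p] ℚ_[p] F] [FiniteDimensional ℚ_[p] F]

theorem OInt.p_ne_zero : (p : OInt p F) ≠ 0 := by
  rw [← map_natCast (algebraMap ℤ_[p] (OInt p F)), Ne,
    map_eq_zero_iff _ (OInt.algebraMap_injective p F)]
  exact PadicInt.prime_p.ne_zero

theorem OInt.ofWittAlg_injective : Function.Injective (OInt.ofWittAlg p F) := by
  rw [injective_iff_map_eq_zero]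
  intro w hw
  by_contra h
  obtain ⟨n, v, rfl⟩ := WittVector.exists_eq_pow_p_mul' w h
  rw [map_mul, map_pow, map_natCast] at hw
  exact mul_ne_zero (pow_ne_zero n OInt.p_ne_zero) ((v.isUnit.map (OInt.ofWittAlg p F)).ne_zero) hw

theorem OInt.isUnit_algebraMap_natCast {n : ℕ} (hn : ¬ p ∣ n) : IsUnit (n : ℤ_[p]) := by
  rw [PadicInt.isUnit_iff, PadicInt.norm_natCast_eq_one_iff]
  exact (Fact.out : p.Prime).coprime_iff_not_dvd.2 hn

variable {π : OInt p F} (hπ : Ideal.span {π} = IsLocalRing.maximalIdeal (OInt p F))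

include hπ

theorem OInt.uniformiser_ne_zero : π ≠ 0 := by
  rintro rfl
  have h2 := OInt.p_mem p F
  rw [← hπ, Ideal.mem_span_singleton, zero_dvd_iff] at h2
  exact OInt.p_ne_zero h2

theorem OInt.dvd_iff_residue_eq_zero (y : OInt p F) : π ∣ y ↔ IsLocalRing.residue _ y = 0 := by
  rw [IsLocalRing.residue_eq_zero_iff, ← hπ, Ideal.mem_span_singleton]

theorem OInt.isDiscreteValuationRing : IsDiscreteValuationRing (OInt p F) := by
  have h0 := OInt.uniformiser_ne_zero hπ
  have hnf : ¬ IsField (OInt p F) := by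
    intro h
    rw [IsLocalRing.isField_iff_maximalIdeal_eq, ← hπ, Ideal.span_singleton_eq_bot] at h
    exact h0 h
  exact ((IsDiscreteValuationRing.TFAE (OInt p F) hnf).out 0 4).2 ((Submodule.isPrincipal_iff _).2 ⟨π, hπ.symm⟩)

theorem OInt.exists_eq_pow_mul {y : OInt p F} (hy : y ≠ 0) : ∃ (n : ℕ) (v : (OInt p F)ˣ),
    y = π ^ n * v := by
  have := OInt.isDiscreteValuationRing hπ
  obtain ⟨n, v, h⟩ := IsDiscreteValuationRing.eq_unit_mul_pow_irreducible hy
    ((IsDiscreteValuationRing.irreducible_iff_uniformizer π).2 hπ.symm)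
  exact ⟨n, v, by rw [h, mul_comm]⟩

theorem OInt.not_isUnit_uniformiser : ¬ IsUnit π := by
  have : π ∈ IsLocalRing.maximalIdeal (OInt p F) := hπ ▸ Ideal.mem_span_singleton_self π
  exact this

theorem OInt.pow_mul_unit_injective {m n : ℕ} {v w : OInt p F} (hv : IsUnit v) (hw : IsUnit w)
    (h : π ^ m * v = π ^ n * w) : m = n := by
  have key : ∀ (m n : ℕ) (v w : OInt p F), IsUnit v → π ^ m * v = π ^ n * w → n ≤ m := by
    intro m n v w hv h
    by_contra! hmn
    obtain ⟨k, rfl⟩ := Nat.exists_eq_add_of_lt hmn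
    rw [add_assoc, pow_add, mul_assoc] at h
    have h1 := mul_left_cancel₀ (pow_ne_zero m (OInt.uniformiser_ne_zero hπ)) h
    refine OInt.not_isUnit_uniformiser hπ (isUnit_of_dvd_unit ?_ hv)
    rw [h1, pow_succ', mul_assoc]
    exact dvd_mul_right _ _
  exact le_antisymm (key _ _ _ _ hw h.symm) (key _ _ _ _ hv h)

theorem OInt.exists_p_eq : ∃ (m : ℕ) (v : (OInt p F)ˣ), 0 < m ∧ (p : OInt p F) = π ^ m * v := by
  obtain ⟨m, v, h⟩ := OInt.exists_eq_pow_mul hπ (OInt.p_ne_zero (p := p) (F := F))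
  refine ⟨m, v, Nat.pos_of_ne_zero ?_, h⟩
  rintro rfl
  have h2 := OInt.p_mem p F
  rw [h, pow_zero, one_mul] at h2
  exact h2 v.isUnit

theorem OInt.exists_ofWitt_add_mul (y : OInt p F) : ∃ (w : WInt p F) (z : OInt p F),
    y = OInt.ofWittAlg p F w + π * z := by
  have h : π ∣ y - OInt.ofWittAlg p F (WittVector.teichmuller p (IsLocalRing.residue _ y)) := by
    rw [OInt.dvd_iff_residue_eq_zero hπ, map_sub, sub_eq_zero]
    exact ((OInt.residue_ofWitt p F _).trans (WittVector.teichmuller_coeff_zero p _)).symm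
  obtain ⟨z, hz⟩ := h
  exact ⟨_, z, by rw [← hz]; ring⟩

theorem OInt.exists_sum_add_pow_mul (n : ℕ) (y : OInt p F) :
    ∃ (w : ℕ → WInt p F) (z : OInt p F),
      y = ∑ i ∈ Finset.range n, OInt.ofWittAlg p F (w i) * π ^ i + π ^ n * z := by
  induction n with
  | zero => exact ⟨0, y, by simp⟩
  | succ n ih =>
    obtain ⟨w, z, h⟩ := ih
    obtain ⟨a, z', h'⟩ := OInt.exists_ofWitt_add_mul hπ z
    refine ⟨fun i => if i = n then a else w i, z', ?_⟩
    have : ∀ i ∈ Finset.range n, OInt.ofWittAlg p F (if i = n then a else w i) * π ^ i =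
        OInt.ofWittAlg p F (w i) * π ^ i := fun i hi => by
      rw [if_neg (Finset.mem_range.1 hi).ne]
    rw [Finset.sum_range_succ]
    dsimp only
    rw [if_pos rfl, Finset.sum_congr rfl this, h, h']
    ring

theorem OInt.exists_eq_sum {m : ℕ} {v : (OInt p F)ˣ} (hp : (p : OInt p F) = π ^ m * v)
    (y : OInt p F) : ∃ w : ℕ → WInt p F,
      y = ∑ i ∈ Finset.range m, OInt.ofWittAlg p F (w i) * π ^ i := by
  let N : Submodule ℤ_[p] (OInt p F) := 
    { carrier := {y | ∃ w : ℕ → WInt p F,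
        y = ∑ i ∈ Finset.range m, OInt.ofWittAlg p F (w i) * π ^ i}
      zero_mem' := ⟨0, by simp⟩
      add_mem' := by
        rintro _ _ ⟨w, rfl⟩ ⟨w', rfl⟩
        exact ⟨w + w', by simp [add_mul, Finset.sum_add_distrib]⟩
      smul_mem' := by
        rintro c _ ⟨w, rfl⟩
        exact ⟨c • w, by simp [Finset.smul_sum]⟩ }
  have h : (⊤ : Submodule ℤ_[p] (OInt p F)) ≤ N := by
    refine Submodule.le_of_le_smul_of_le_jacobson_bot (I := IsLocalRing.maximalIdeal ℤ_[p])
      Module.Finite.fg_top (IsLocalRing.maximalIdeal_le_jacobson _) fun y _ => ?_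
    obtain ⟨w, z, h⟩ := OInt.exists_sum_add_pow_mul hπ m y
    refine Submodule.mem_sup.2 ⟨_, ⟨w, rfl⟩, π ^ m * z, ?_, h.symm⟩
    have h2 : π ^ m * z = (p : ℤ_[p]) • ((v⁻¹ : (OInt p F)ˣ) * z) := by
      rw [Algebra.smul_def, map_natCast, hp, mul_assoc, ← mul_assoc (v : OInt p F), Units.mul_inv,
        one_mul]
    rw [h2]
    refine Submodule.smul_mem_smul ?_ trivial
    rw [PadicInt.maximalIdeal_eq_span_p]
    exact Ideal.mem_span_singleton_self _
  exact h (Submodule.mem_top (x := y))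

theorem OInt.exists_minpoly_eq {m : ℕ} {v : (OInt p F)ˣ} (hm : 0 < m)
    (hp : (p : OInt p F) = π ^ m * v) : ∃ Q : Polynomial (WInt p F), Q.degree < m ∧
      IsUnit (Q.coeff 0) ∧ (letI := (OInt.ofWitt p F).toAlgebra; minpoly (WInt p F) π) =
        Polynomial.X ^ m - Polynomial.C (p : WInt p F) * Q := by
  obtain ⟨w, hw⟩ := OInt.exists_eq_sum hπ hp (v⁻¹ : (OInt p F)ˣ)
  let Q : Polynomial (WInt p F) :=
    ∑ i ∈ Finset.range m, Polynomial.C (w i) * Polynomial.X ^ i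
  have hQd : Q.degree < m := by
    refine (Polynomial.degree_sum_le _ _).trans_lt ((Finset.sup_lt_iff (WithBot.bot_lt_coe m)).2
      fun i hi => ?_)
    exact (Polynomial.degree_C_mul_X_pow_le i _).trans_lt
      (WithBot.coe_lt_coe.2 (Finset.mem_range.1 hi))
  have hQ0 : Q.coeff 0 = w 0 := by
    simp only [Q, Polynomial.finsetSum_coeff, Polynomial.coeff_C_mul, Polynomial.coeff_X_pow]
    rw [Finset.sum_eq_single 0 (fun i _ hi => by rw [if_neg hi.symm, mul_zero])
      (fun h => absurd (Finset.mem_range.2 hm) h), if_pos rfl, mul_one]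
  have hu : IsUnit (w 0) := by
    refine WittVector.isUnit_of_coeff_zero_ne_zero _ fun h0 => ?_
    have h1 : IsLocalRing.residue (OInt p F) (v⁻¹ : (OInt p F)ˣ) = (w 0).coeff 0 := by
      rw [hw, map_sum, Finset.sum_eq_single 0]
      · rw [pow_zero, mul_one]
        exact OInt.residue_ofWitt p F _
      · intro i _ hi
        rw [← OInt.dvd_iff_residue_eq_zero hπ]
        exact Dvd.dvd.mul_left (dvd_pow_self π hi) _
      · exact fun h => absurd (Finset.mem_range.2 hm) h
    rw [h0, IsLocalRing.residue_eq_zero_iff] at h1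
    exact h1 (v⁻¹).isUnit
  refine ⟨Q, hQd, hQ0 ▸ hu, ?_⟩
  let _ := (OInt.ofWitt p F).toAlgebra
  have : FaithfulSMul (WInt p F) (OInt p F) :=
    (faithfulSMul_iff_algebraMap_injective _ _).2 OInt.ofWittAlg_injective
  refine minpoly.eq_X_pow_sub_C_mul (WittVector.irreducible p).prime hm hQd (hQ0 ▸ hu) ?_
  have hmap : ∀ w, algebraMap (WInt p F) (OInt p F) w = OInt.ofWittAlg p F w := fun _ => rfl
  simp only [Q, map_sub, map_mul, map_pow, Polynomial.aeval_X, map_sum, Polynomial.aeval_C,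
    hmap, map_natCast]
  rw [← hw, hp, mul_assoc, Units.mul_inv, mul_one, sub_self]

theorem OInt.eq_zero_of_sum_eq_zero {m : ℕ} {v : (OInt p F)ˣ} (hm : 0 < m)
    (hp : (p : OInt p F) = π ^ m * v) {w : ℕ → WInt p F}
    (h : ∑ i ∈ Finset.range m, OInt.ofWittAlg p F (w i) * π ^ i = 0) {i : ℕ} (hi : i < m) :
    w i = 0 := by
  obtain ⟨Q, hQ, -, hE⟩ := OInt.exists_minpoly_eq hπ hm hp
  let _ := (OInt.ofWitt p F).toAlgebra
  have hmap : ∀ w, algebraMap (WInt p F) (OInt p F) w = OInt.ofWittAlg p F w := fun _ => rfl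
  have : FaithfulSMul (WInt p F) (OInt p F) :=
    (faithfulSMul_iff_algebraMap_injective _ _).2 OInt.ofWittAlg_injective
  let P : Polynomial (WInt p F) := ∑ i ∈ Finset.range m, Polynomial.C (w i) * Polynomial.X ^ i
  have hP : P = 0 := by
    by_contra hP
    have h1 := minpoly.IsIntegrallyClosed.degree_le_of_ne_zero (s := π) hP (by
      simp only [P, map_mul, map_pow, Polynomial.aeval_X, map_sum, Polynomial.aeval_C,
        hmap, h])
    have h2 : P.degree < m := by
      refine (Polynomial.degree_sum_le _ _).trans_lt ((Finset.sup_lt_iff (WithBot.bot_lt_coe m)).2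
        fun i hi => ?_)
      exact (Polynomial.degree_C_mul_X_pow_le i _).trans_lt
        (WithBot.coe_lt_coe.2 (Finset.mem_range.1 hi))
    have h3 : (minpoly (WInt p F) π).degree = m := by
      rw [hE, Polynomial.degree_X_pow_sub_C_mul hQ]
    exact absurd (h3 ▸ h1) (not_le.2 h2)
  have h4 : P.coeff i = w i := by
    simp only [P, Polynomial.finsetSum_coeff, Polynomial.coeff_C_mul, Polynomial.coeff_X_pow]
    rw [Finset.sum_eq_single i (fun j _ hj => by rw [if_neg hj.symm, mul_zero])
      (fun h => absurd (Finset.mem_range.2 hi) h), if_pos rfl, mul_one]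
  rw [← h4, hP, Polynomial.coeff_zero]

end Uniformiser

section EisensteinSeries

theorem PowerSeries.twist_coe {R S : Type u} [CommRing R] [CommRing S] (ψ : R →+* S) (n : ℕ)
    (hn : n ≠ 0) (P : Polynomial R) : PowerSeries.twist ψ 1 n hn (P : PowerSeries R) =
      ((Polynomial.expand S n (P.map ψ) : Polynomial S) : PowerSeries S) := by
  induction P using Polynomial.induction_on' with
  | add P Q hP hQ => rw [Polynomial.coe_add, map_add, hP, hQ, Polynomial.map_add, map_add,
      Polynomial.coe_add]
  | monomial k a =>
    rw [Polynomial.coe_monomial, PowerSeries.monomial_eq_C_mul_X_pow, map_mul, map_pow,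
      PowerSeries.twist_C, PowerSeries.twist_X, map_one, one_mul, Polynomial.map_monomial,
      Polynomial.expand_monomial, Polynomial.coe_monomial, PowerSeries.monomial_eq_C_mul_X_pow,
      ← pow_mul, mul_comm k]

/-- Multiplication by `u ^ m - a g` reflects membership of the coefficients in an ideal if `a` is
nilpotent. -/
theorem PowerSeries.coeff_mem_of_coeff_mul_mem {R : Type*} [CommRing R] {J : Ideal R} {a : R}
    (ha : IsNilpotent a) (m : ℕ) (g F : PowerSeries R)
    (h : ∀ i, PowerSeries.coeff i ((PowerSeries.X ^ m - PowerSeries.C a * g) * F) ∈ J) (i : ℕ) :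
    PowerSeries.coeff i F ∈ J := by
  obtain ⟨N, hN⟩ := ha
  have key : ∀ n i, PowerSeries.coeff i F ∈ J ⊔ Ideal.span {a ^ n} := by
    intro n
    induction n with
    | zero => simp
    | succ n ih =>
      intro i
      have h1 : PowerSeries.coeff i F =
          PowerSeries.coeff (i + m) ((PowerSeries.X ^ m - PowerSeries.C a * g) * F) +
            a * PowerSeries.coeff (i + m) (g * F) := by
        rw [sub_mul, map_sub, mul_assoc, PowerSeries.coeff_C_mul, PowerSeries.coeff_X_pow_mul]
        ring
      rw [h1]
      refine add_mem (Ideal.mem_sup_left (h _)) ?_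
      rw [PowerSeries.coeff_mul, Finset.mul_sum]
      refine sum_mem fun x _ => ?_
      obtain ⟨y, hy, z, hz, hyz⟩ := Submodule.mem_sup.1 (ih x.2)
      obtain ⟨w, rfl⟩ := Ideal.mem_span_singleton.1 hz
      rw [← hyz, mul_add, mul_add]
      refine add_mem (Ideal.mem_sup_left (J.mul_mem_left _ (J.mul_mem_left _ hy)))
        (Ideal.mem_sup_right (Ideal.mem_span_singleton.2 ⟨PowerSeries.coeff x.1 g * w, by ring⟩))
  have := key N i
  rwa [hN, Ideal.span_singleton_zero, sup_bot_eq] at this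

/-- Division by an Eisenstein polynomial with nilpotent lower coefficients. -/
theorem PowerSeries.exists_eq_mul_add {R : Type*} [CommRing R] {a : R} (ha : IsNilpotent a)
    {m : ℕ} {Q : Polynomial R} (hQ : Q.degree < m) (F : PowerSeries R) :
    ∃ (G : PowerSeries R) (w : ℕ → R), F =
      ((Polynomial.X ^ m - Polynomial.C a * Q : Polynomial R) : PowerSeries R) * G +
        ∑ i ∈ Finset.range m, PowerSeries.C (w i) * PowerSeries.X ^ i := by
  set E : Polynomial R := Polynomial.X ^ m - Polynomial.C a * Q with hE
  obtain ⟨N, hN⟩ := ha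
  have h1 : (E : PowerSeries R) ∣ PowerSeries.X ^ (m * N) := by
    have h2 : E ∣ Polynomial.X ^ (m * N) := by
      have := sub_dvd_pow_sub_pow ((Polynomial.X : Polynomial R) ^ m) (Polynomial.C a * Q) N
      rwa [← pow_mul, mul_pow, ← map_pow, hN, map_zero, zero_mul, sub_zero] at this
    obtain ⟨q, hq⟩ := h2
    exact ⟨q, by rw [← Polynomial.coe_mul, ← hq, Polynomial.coe_pow, Polynomial.coe_X]⟩
  obtain ⟨q, hq⟩ := h1
  have hmon : E.Monic := Polynomial.monic_X_pow_sub_C_mul hQ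
  nontriviality R
  have hdeg : E.degree = (m : WithBot ℕ) := Polynomial.degree_X_pow_sub_C_mul hQ
  set P := PowerSeries.trunc (m * N) F
  have h3 := Polynomial.modByMonic_add_div P E
  have h4 := (Polynomial.degree_modByMonic_lt P hmon).trans_eq hdeg
  refine ⟨q * PowerSeries.mk (fun i => PowerSeries.coeff (i + m * N) F) + (P /ₘ E : Polynomial R),
    (P %ₘ E).coeff, ?_⟩
  conv_lhs => rw [PowerSeries.eq_X_pow_mul_shift_add_trunc (m * N) F]
  have h5 : ∑ i ∈ Finset.range m, PowerSeries.C ((P %ₘ E).coeff i) * PowerSeries.X ^ i =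
      ((P %ₘ E : Polynomial R) : PowerSeries R) := by
    ext j
    rw [Polynomial.coeff_coe, map_sum]
    simp only [PowerSeries.coeff_C_mul, PowerSeries.coeff_X_pow]
    by_cases hj : j < m
    · rw [Finset.sum_eq_single j (fun i _ hi => by rw [if_neg hi.symm, mul_zero])
        (fun h => absurd (Finset.mem_range.2 hj) h), if_pos rfl, mul_one]
    · rw [Finset.sum_eq_zero fun i hi => ?_]
      · rw [Polynomial.coeff_eq_zero_of_degree_lt (h4.trans_le (by exact_mod_cast not_lt.1 hj))]
      · rw [if_neg (by rw [Finset.mem_range] at hi; omega), mul_zero]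
  rw [h5, mul_add, ← mul_assoc, ← hq, add_assoc, ← Polynomial.coe_mul, ← Polynomial.coe_add,
    add_comm (E * _), h3]

end EisensteinSeries

section Arithmetic

variable {p : ℕ} [Fact p.Prime]
  {K : Type u} [Field K] [Algebra ℚ_[p] K] [Algebra ℤ_[p] K]
  [IsScalarTower ℤ_[p] ℚ_[p] K] [FiniteDimensional ℚ_[p] K]
  {K' : Type u} [Field K'] [Algebra ℚ_[p] K'] [Algebra ℤ_[p] K']
  [IsScalarTower ℤ_[p] ℚ_[p] K'] [FiniteDimensional ℚ_[p] K']
  [Algebra K K'] [IsScalarTower ℤ_[p] K K']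

namespace TameUniformiser

variable (ϖ : TameUniformiser p K K')

theorem exists_eisenstein_eq : ∃ (m : ℕ) (v : (OInt p K')ˣ) (Q : Polynomial (WInt p K')),
    0 < m ∧ (p : OInt p K') = ϖ.pi ^ m * v ∧ Q.degree < m ∧ ϖ.eisenstein =
      Polynomial.X ^ m - Polynomial.C (p : WInt p K') * Q := by
  obtain ⟨m, v, hm, hv⟩ := OInt.exists_p_eq ϖ.span_pi
  obtain ⟨Q, hQ, -, h⟩ := OInt.exists_minpoly_eq ϖ.span_pi hm hv
  exact ⟨m, v, Q, hm, hv, hQ, h⟩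

variable (A : Type u) [CommRing A] [Algebra ℤ_[p] A]

theorem eisensteinS_eq : ϖ.eisensteinS A =
    ((ϖ.eisenstein.map (wRing.ofWitt p K K' A) : Polynomial (WCoeff p K' A)) :
      PowerSeries (WCoeff p K' A)) := by
  rw [eisensteinS, ← Polynomial.polynomial_map_coe]
  rfl

theorem exists_eisensteinS_eq : ∃ (m : ℕ) (v : (OInt p K')ˣ) (Q : Polynomial (WCoeff p K' A)),
    0 < m ∧ (p : OInt p K') = ϖ.pi ^ m * v ∧ Q.degree < m ∧ ϖ.eisensteinS A =
      ((Polynomial.X ^ m - Polynomial.C (p : WCoeff p K' A) * Q : Polynomial (WCoeff p K' A)) :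
        PowerSeries (WCoeff p K' A)) := by
  obtain ⟨m, v, Q, hm, hv, hQ, h⟩ := ϖ.exists_eisenstein_eq
  refine ⟨m, v, Q.map (wRing.ofWitt p K K' A), hm, hv,
    (Polynomial.degree_map_le).trans_lt hQ, ?_⟩
  rw [eisensteinS_eq, h]
  congr 1
  simp

theorem isNilpotent_p (F : Type u) [Field F] [Algebra ℚ_[p] F] [Algebra ℤ_[p] F]
    [IsScalarTower ℤ_[p] ℚ_[p] F] [FiniteDimensional ℚ_[p] F] {A : Type u} [CommRing A]
    [Algebra ℤ_[p] A] (hA : IsNilpotent (p : A)) : IsNilpotent (p : WCoeff p F A) := by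
  have := hA.map (Algebra.TensorProduct.includeRight : A →ₐ[ℤ_[p]] WCoeff p F A)
  rwa [map_natCast] at this

variable {A}

theorem eisensteinS_coeff_mem (hA : IsNilpotent (p : A)) {J : Ideal (WCoeff p K' A)}
    (F : (ϖ.sRing A).carrier)
    (h : ∀ i, PowerSeries.coeff (R := WCoeff p K' A) i
      (HMul.hMul (ϖ.eisensteinS A) F : (ϖ.sRing A).carrier) ∈ J)
    (i : ℕ) : PowerSeries.coeff (R := WCoeff p K' A) i F ∈ J := by
  obtain ⟨m, v, Q, hm, hv, hQ, hE⟩ := ϖ.exists_eisensteinS_eq A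
  refine PowerSeries.coeff_mem_of_coeff_mul_mem (isNilpotent_p K' hA) m Q F (fun i => ?_) i
  have : PowerSeries.coeff i (((Polynomial.X ^ m - Polynomial.C (p : WCoeff p K' A) * Q :
      Polynomial (WCoeff p K' A)) : PowerSeries (WCoeff p K' A)) *
        (show PowerSeries (WCoeff p K' A) from F)) ∈ J := by
    rw [← hE]
    exact h i
  simpa only [Polynomial.coe_sub, Polynomial.coe_mul, Polynomial.coe_pow, Polynomial.coe_X,
    Polynomial.coe_C] using this

theorem eq_zero_of_eisensteinS_mul (hA : IsNilpotent (p : A)) (F : (ϖ.sRing A).carrier)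
    (h : ϖ.eisensteinS A * F = 0) : F = 0 := by
  refine PowerSeries.ext fun i => ?_
  have := ϖ.eisensteinS_coeff_mem hA (J := ⊥) F (fun i => by
    have h1 := congrArg (PowerSeries.coeff i : PowerSeries (WCoeff p K' A) → WCoeff p K' A) h
    exact h1.trans (map_zero _)) i
  exact this

theorem modE_C (hA : IsNilpotent (p : A)) (x : WCoeff p K' A) :
    (ϖ.modE A hA).toRingHom (PowerSeries.C x) =
      tensMap (OInt.ofWittAlg p K') (AlgHom.id ℤ_[p] A) x :=
  PowerSeries.evalNil_C _ _ _ x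

theorem modE_X (hA : IsNilpotent (p : A)) :
    (ϖ.modE A hA).toRingHom PowerSeries.X = oRing.ofInt p K K' A ϖ.pi :=
  PowerSeries.evalNil_X _ _ _

variable (K A) in
/-- The homomorphism `B ⊗ A → O_{K'} ⊗ A` induced by a homomorphism `B → O_{K'}`. -/
noncomputable def _root_.oRing.map {B : Type u} [CommRing B] [Algebra ℤ_[p] B]
    (v : B →ₐ[ℤ_[p]] OInt p K') : B ⊗[ℤ_[p]] A →+* (oRing p K K' A).carrier :=
  tensMap v (AlgHom.id ℤ_[p] A)

theorem _root_.oRing.map_tmul_mul_ofInt_pow {B : Type u} [CommRing B] [Algebra ℤ_[p] B]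
    (v : B →ₐ[ℤ_[p]] OInt p K') (b : B) (a : A) (x : OInt p K') (k : ℕ) :
    oRing.map K A v (b ⊗ₜ a) * oRing.ofInt p K K' A x ^ k = (v b * x ^ k) ⊗ₜ a := by
  rw [← map_pow]
  exact (Algebra.TensorProduct.tmul_mul_tmul (v b) (x ^ k) a 1).trans (by rw [mul_one])

theorem modE_C_mul_X_pow (hA : IsNilpotent (p : A)) (x : WCoeff p K' A) (k : ℕ) :
    (ϖ.modE A hA).toRingHom (PowerSeries.C x * PowerSeries.X ^ k : PowerSeries (WCoeff p K' A)) =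
      oRing.map K A (OInt.ofWittAlg p K') x * oRing.ofInt p K K' A ϖ.pi ^ k := by
  refine (map_mul (ϖ.modE A hA).toRingHom _ _).trans ?_
  refine congrArg₂ (· * ·) (ϖ.modE_C hA x) ?_
  exact (map_pow (ϖ.modE A hA).toRingHom _ k).trans (congrArg (· ^ k) (ϖ.modE_X hA))

theorem modE_sum (hA : IsNilpotent (p : A)) (m : ℕ) (w : ℕ → WCoeff p K' A) :
    (ϖ.modE A hA).toRingHom (∑ i ∈ Finset.range m, PowerSeries.C (w i) * PowerSeries.X ^ i :
        PowerSeries (WCoeff p K' A)) =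
      ∑ i ∈ Finset.range m, oRing.map K A (OInt.ofWittAlg p K') (w i) *
        oRing.ofInt p K K' A ϖ.pi ^ i := by
  exact (map_sum (ϖ.modE A hA).toRingHom _ _).trans
    (Finset.sum_congr rfl fun i _ => ϖ.modE_C_mul_X_pow hA _ i)

theorem modE_eisensteinS (hA : IsNilpotent (p : A)) :
    (ϖ.modE A hA).toRingHom (ϖ.eisensteinS A) = 0 := by
  have key : ∀ P : Polynomial (WInt p K'), (ϖ.modE A hA).toRingHom
      ((P.map (wRing.ofWitt p K K' A) : Polynomial (WCoeff p K' A)) :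
        PowerSeries (WCoeff p K' A)) =
      oRing.ofInt p K K' A (P.eval₂ (OInt.ofWitt p K') ϖ.pi) := by
    intro P
    induction P using Polynomial.induction_on' with
    | add P Q hP hQ =>
      rw [Polynomial.map_add, Polynomial.coe_add, Polynomial.eval₂_add, map_add, ← hP, ← hQ]
      exact map_add (ϖ.modE A hA).toRingHom _ _
    | monomial k a =>
      rw [Polynomial.map_monomial, Polynomial.coe_monomial, PowerSeries.monomial_eq_C_mul_X_pow,
        Polynomial.eval₂_monomial, map_mul, map_pow]
      refine (ϖ.modE_C_mul_X_pow hA _ k).trans (congrArg (· * _) ?_)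
      exact tensMap_tmul_one (OInt.ofWittAlg p K') (AlgHom.id ℤ_[p] A) a
  rw [eisensteinS_eq, key]
  let _ := (OInt.ofWitt p K').toAlgebra
  have h : Polynomial.aeval ϖ.pi (minpoly (WInt p K') ϖ.pi) = 0 := minpoly.aeval _ _
  exact (congrArg _ h).trans (map_zero _)

/-- The coordinates of an integer with respect to the basis `1, π, …, π ^ (m - 1)` over the Witt
vectors. -/
theorem exists_coord {m : ℕ} {v : (OInt p K')ˣ} (hm : 0 < m)
    (hv : (p : OInt p K') = ϖ.pi ^ m * v) : ∃ c : ℕ → OInt p K' →ₗ[ℤ_[p]] WInt p K',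
      (∀ i < m, ∀ k < m, ∀ w, c i (OInt.ofWittAlg p K' w * ϖ.pi ^ k) = if i = k then w else 0) ∧
      ∀ y, ∑ i ∈ Finset.range m, OInt.ofWittAlg p K' (c i y) * ϖ.pi ^ i = y := by
  let T : (Fin m → WInt p K') →ₗ[ℤ_[p]] OInt p K' :=
    { toFun := fun w => ∑ i : Fin m, OInt.ofWittAlg p K' (w i) * ϖ.pi ^ (i : ℕ)
      map_add' := fun w w' => by simp [add_mul, Finset.sum_add_distrib]
      map_smul' := fun c w => by simp [Finset.smul_sum] }
  have hT : ∀ w : ℕ → WInt p K', T (fun i => w i) =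
      ∑ i ∈ Finset.range m, OInt.ofWittAlg p K' (w i) * ϖ.pi ^ i := fun w =>
    Fin.sum_univ_eq_sum_range (fun i => OInt.ofWittAlg p K' (w i) * ϖ.pi ^ i) m
  have hext : ∀ w : Fin m → WInt p K', ∃ w' : ℕ → WInt p K', w = fun i : Fin m => w' i := fun w =>
    ⟨fun i => if h : i < m then w ⟨i, h⟩ else 0, by ext1 i; simp⟩
  have hbij : Function.Bijective T := by
    constructor
    · rw [injective_iff_map_eq_zero]
      intro w hw
      obtain ⟨w', rfl⟩ := hext w
      rw [hT] at hw
      ext1 i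
      exact OInt.eq_zero_of_sum_eq_zero ϖ.span_pi hm hv hw i.2
    · intro y
      obtain ⟨w, hw⟩ := OInt.exists_eq_sum ϖ.span_pi hv y
      exact ⟨fun i => w i, by rw [hT, hw]⟩
  let e := LinearEquiv.ofBijective T hbij
  refine ⟨fun i => if h : i < m then LinearMap.proj (⟨i, h⟩ : Fin m) ∘ₗ e.symm.toLinearMap else 0,
    fun i hi k hk w => ?_, fun y => ?_⟩
  · have h1 : e (Pi.single ⟨k, hk⟩ w) = OInt.ofWittAlg p K' w * ϖ.pi ^ k := by
      change ∑ i : Fin m, OInt.ofWittAlg p K' ((Pi.single ⟨k, hk⟩ w : Fin m → WInt p K') i) *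
        ϖ.pi ^ (i : ℕ) = _
      rw [Finset.sum_eq_single ⟨k, hk⟩ (fun i _ hi => by
        rw [Pi.single_eq_of_ne hi, map_zero, zero_mul]) (fun h => absurd (Finset.mem_univ _) h),
        Pi.single_eq_same]
    dsimp only
    rw [dif_pos hi, ← h1, LinearMap.comp_apply, LinearEquiv.coe_coe, LinearEquiv.symm_apply_apply,
      LinearMap.proj_apply, Pi.single_apply]
    simp only [Fin.mk.injEq]
  · have h1 : e (e.symm y) = y := e.apply_symm_apply y
    obtain ⟨w', hw⟩ := hext (e.symm y)
    refine Eq.trans (Finset.sum_congr rfl fun i hi => ?_) ((hT w').symm.trans (hw ▸ h1))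
    dsimp only
    rw [dif_pos (Finset.mem_range.1 hi)]
    exact congrArg (fun z => OInt.ofWittAlg p K' z * ϖ.pi ^ i)
      (congrFun hw ⟨i, Finset.mem_range.1 hi⟩)

theorem modE_surjective (hA : IsNilpotent (p : A)) :
    Function.Surjective (ϖ.modE A hA).toRingHom := by
  intro y
  induction y using TensorProduct.induction_on with
  | zero => exact ⟨0, map_zero _⟩
  | add x y hx hy =>
    obtain ⟨x', rfl⟩ := hx
    obtain ⟨y', rfl⟩ := hy
    exact ⟨x' + y', map_add _ _ _⟩
  | tmul x a =>
    obtain ⟨m, v, hm, hv⟩ := OInt.exists_p_eq ϖ.span_pi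
    obtain ⟨w, rfl⟩ := OInt.exists_eq_sum ϖ.span_pi hv x
    refine ⟨(∑ i ∈ Finset.range m, PowerSeries.C (w i ⊗ₜ a) * PowerSeries.X ^ i :
        PowerSeries (WCoeff p K' A)), ?_⟩
    rw [modE_sum, TensorProduct.sum_tmul]
    exact Finset.sum_congr rfl fun i _ => oRing.map_tmul_mul_ofInt_pow _ _ _ _ _

theorem mem_ker_modE (hA : IsNilpotent (p : A)) (x : (ϖ.sRing A).carrier) :
    (ϖ.modE A hA).toRingHom x = 0 ↔ ∃ y, x = ϖ.eisensteinS A * y := by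
  constructor
  · intro hx
    obtain ⟨m, v, Q, hm, hv, hQ, hE⟩ := ϖ.exists_eisensteinS_eq A
    obtain ⟨c, hc, -⟩ := ϖ.exists_coord hm hv
    obtain ⟨G, w, hGw⟩ := PowerSeries.exists_eq_mul_add (isNilpotent_p K' hA) hQ
      (x : PowerSeries (WCoeff p K' A))
    rw [← hE] at hGw
    refine ⟨G, ?_⟩
    have h1 : ∑ i ∈ Finset.range m, oRing.map K A (OInt.ofWittAlg p K') (w i) *
        oRing.ofInt p K K' A ϖ.pi ^ i = 0 := by
      rw [← ϖ.modE_sum hA]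
      refine (congrArg _ (eq_sub_of_add_eq' hGw.symm)).trans ?_
      refine (map_sub (ϖ.modE A hA).toRingHom x
        (ϖ.eisensteinS A * (show (ϖ.sRing A).carrier from G))).trans ?_
      rw [map_mul, modE_eisensteinS, hx, zero_mul, sub_zero]
    have h2 : ∀ i ∈ Finset.range m, w i = 0 := by
      intro i hi
      have key : ∀ k < m, ∀ z : WCoeff p K' A, (c i).rTensor A
          (oRing.map K A (OInt.ofWittAlg p K') z * oRing.ofInt p K K' A ϖ.pi ^ k :) =
            if i = k then z else 0 := by
        intro k hk z
        induction z using TensorProduct.induction_on with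
        | zero =>
          rw [map_zero, zero_mul, ite_self]
          exact map_zero _
        | add x y hx hy =>
          rw [map_add, add_mul]
          refine (map_add ((c i).rTensor A) _ _).trans ((congrArg₂ (· + ·) hx hy).trans ?_)
          split_ifs
          · rfl
          · rw [add_zero]
        | tmul x a =>
          refine (congrArg ((c i).rTensor A) (oRing.map_tmul_mul_ofInt_pow _ _ _ _ _)).trans ?_
          rw [LinearMap.rTensor_tmul, hc i (Finset.mem_range.1 hi) k hk]
          split_ifs
          · rfl
          · rw [TensorProduct.zero_tmul]
      have h3 := congrArg ((c i).rTensor A) h1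
      have h4 : ∑ k ∈ Finset.range m, (c i).rTensor A
          (oRing.map K A (OInt.ofWittAlg p K') (w k) * oRing.ofInt p K K' A ϖ.pi ^ k :) = w i := by
        refine (Finset.sum_eq_single i (fun k hk hki => ?_) (fun h => absurd hi h)).trans ?_
        · exact (key k (Finset.mem_range.1 hk) _).trans (if_neg hki.symm)
        · exact (key i (Finset.mem_range.1 hi) _).trans (if_pos rfl)
      exact h4.symm.trans ((map_sum ((c i).rTensor A) _ _).symm.trans
        (h3.trans (map_zero ((c i).rTensor A))))
    refine hGw.trans ((congrArg (_ + ·) ?_).trans (add_zero _))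
    exact Finset.sum_eq_zero fun i hi => by rw [h2 i hi, map_zero, zero_mul]
  · rintro ⟨y, rfl⟩
    rw [map_mul, modE_eisensteinS, zero_mul]

end TameUniformiser

end Arithmetic

section Trace

/-- The normalised trace onto the invariants of a finite group whose order is invertible. -/
theorem exists_normalised_trace {R B C ι : Type*} [CommRing R] [CommRing B] [CommRing C]
    [Algebra R B] [Algebra R C] (j : B →ₐ[R] C) (hj : Function.Injective j) (s : Finset ι)
    (act : ι → C →ₐ[R] C) (hact : ∀ h ∈ s, ∀ b, act h (j b) = j b)
    (hfix : ∀ c, ∃ b, j b = ∑ h ∈ s, act h c) (hs : IsUnit (s.card : R)) :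
    ∃ t : C →ₗ[R] B, (∀ b c, t (j b * c) = b * t c) ∧ t 1 = 1 ∧
      ∀ c, (s.card : C) * j (t c) = ∑ h ∈ s, act h c := by
  choose g hg using hfix
  obtain ⟨v, hv⟩ := hs
  have hvC : (s.card : C) = algebraMap R C v := by rw [hv, map_natCast]
  refine ⟨{ toFun := fun c => (↑v⁻¹ : R) • g c
            map_add' := fun x y => by
              rw [← smul_add]
              congr 1
              apply hj
              rw [map_add, hg, hg, hg, ← Finset.sum_add_distrib]
              exact Finset.sum_congr rfl fun h _ => map_add _ _ _
            map_smul' := fun r x => by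
              rw [RingHom.id_apply, smul_comm r]
              congr 1
              apply hj
              rw [map_smul, hg, hg, Finset.smul_sum]
              exact Finset.sum_congr rfl fun h _ => map_smul _ _ _ },
    fun b c => ?_, ?_, fun c => ?_⟩
  · change (↑v⁻¹ : R) • g (j b * c) = b * (↑v⁻¹ : R) • g c
    rw [mul_smul_comm]
    congr 1
    apply hj
    rw [map_mul, hg, hg, Finset.mul_sum]
    exact Finset.sum_congr rfl fun h hh => by rw [map_mul, hact h hh]
  · change (↑v⁻¹ : R) • g 1 = 1
    apply hj
    rw [map_smul, hg, Finset.sum_congr rfl fun h _ => map_one (act h), Finset.sum_const,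
      nsmul_eq_mul, mul_one, hvC, Algebra.smul_def, ← map_mul, Units.inv_mul, map_one, map_one]
  · change (s.card : C) * j ((↑v⁻¹ : R) • g c) = _
    rw [map_smul, hg, hvC, ← Algebra.smul_def, smul_smul, Units.mul_inv, one_smul]

variable {p : ℕ} [Fact p.Prime] {B C A ι : Type u} [CommRing B] [Algebra ℤ_[p] B] [CommRing C]
  [Algebra ℤ_[p] C] [CommRing A] [Algebra ℤ_[p] A]

theorem rTensor_tensMap_mul {j : B →ₐ[ℤ_[p]] C} {t : C →ₗ[ℤ_[p]] B}
    (ht : ∀ b c, t (j b * c) = b * t c) (r : B ⊗[ℤ_[p]] A) (y : C ⊗[ℤ_[p]] A) :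
    t.rTensor A (tensMap j (AlgHom.id ℤ_[p] A) r * y) = r * t.rTensor A y := by
  induction r using TensorProduct.induction_on with
  | zero => rw [map_zero, zero_mul, map_zero, zero_mul]
  | add r s hr hs => rw [map_add, add_mul, map_add, hr, hs, add_mul]
  | tmul b a =>
    induction y using TensorProduct.induction_on with
    | zero => rw [mul_zero, map_zero, mul_zero]
    | add r s hr hs => rw [mul_add, map_add, hr, hs, map_add, mul_add]
    | tmul c a' =>
      rw [tensMap_tmul, Algebra.TensorProduct.tmul_mul_tmul, LinearMap.rTensor_tmul, ht,
        LinearMap.rTensor_tmul, Algebra.TensorProduct.tmul_mul_tmul]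
      rfl

theorem natCast_mul_tensMap_rTensor {j : B →ₐ[ℤ_[p]] C} {t : C →ₗ[ℤ_[p]] B} {n : ℕ}
    {s : Finset ι} {act : ι → C →ₐ[ℤ_[p]] C} (hn : ∀ c, (n : C) * j (t c) = ∑ h ∈ s, act h c)
    (y : C ⊗[ℤ_[p]] A) : (n : C ⊗[ℤ_[p]] A) * tensMap j (AlgHom.id ℤ_[p] A) (t.rTensor A y) =
      ∑ h ∈ s, tensMap (act h) (AlgHom.id ℤ_[p] A) y := by
  induction y using TensorProduct.induction_on with
  | zero => simp
  | add r s hr hs =>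
    rw [map_add, map_add, mul_add, hr, hs, ← Finset.sum_add_distrib]
    exact Finset.sum_congr rfl fun h _ => (map_add _ _ _).symm
  | tmul c a =>
    have h1 : (n : C ⊗[ℤ_[p]] A) = (n : C) ⊗ₜ 1 :=
      (map_natCast (Algebra.TensorProduct.includeLeftRingHom : C →+* C ⊗[ℤ_[p]] A) n).symm
    rw [LinearMap.rTensor_tmul, tensMap_tmul, h1, Algebra.TensorProduct.tmul_mul_tmul, hn,
      one_mul, TensorProduct.sum_tmul]
    exact Finset.sum_congr rfl fun h _ => (tensMap_tmul _ _ _ _).symm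

end Trace

section Galois

variable {p : ℕ} [Fact p.Prime]
  {K : Type u} [Field K] [Algebra ℚ_[p] K] [Algebra ℤ_[p] K]
  [IsScalarTower ℤ_[p] ℚ_[p] K] [FiniteDimensional ℚ_[p] K]
  {K' : Type u} [Field K'] [Algebra ℚ_[p] K'] [Algebra ℤ_[p] K']
  [IsScalarTower ℤ_[p] ℚ_[p] K'] [FiniteDimensional ℚ_[p] K']
  [Algebra K K'] [IsScalarTower ℤ_[p] K K']
  {L' : Type u} [Field L'] [Algebra ℚ_[p] L'] [Algebra ℤ_[p] L']
  [IsScalarTower ℤ_[p] ℚ_[p] L'] [FiniteDimensional ℚ_[p] L']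
  [Algebra K L'] [IsScalarTower ℤ_[p] K L'] [Algebra K' L'] [IsScalarTower ℤ_[p] K' L']
  [IsScalarTower K K' L'] [Normal K K']

theorem galRes_eq_one_iff {h : L' ≃ₐ[K] L'} :
    galRes K K' L' h = 1 ↔ ∀ x : K', h (algebraMap K' L' x) = algebraMap K' L' x := by
  have key : ∀ x : K', algebraMap K' L' (galRes K K' L' h x) = h (algebraMap K' L' x) := fun x =>
    AlgEquiv.restrictNormal_commutes h K' x
  constructor
  · intro hh x
    rw [← key, hh, AlgEquiv.one_apply]
  · intro hh
    ext x
    exact (algebraMap K' L').injective ((key x).trans (hh x))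

theorem galRes_surjective [Normal K L'] : Function.Surjective (galRes K K' L') :=
  AlgEquiv.restrictNormalHom_surjective L'

theorem galHom_comp_extHom_of_mem_ker {h : L' ≃ₐ[K] L'} (hh : galRes K K' L' h = 1) :
    (galHom p h).comp (extHom p K' L') = extHom p K' L' := by
  rw [galHom_comp_extHom, hh, galHom_one, AlgHom.comp_id]

theorem OInt.map_comp_apply (g : K' →ₐ[ℤ_[p]] L') (h : L' →ₐ[ℤ_[p]] L') (x : OInt p K') :
    OInt.map h (OInt.map g x) = OInt.map (h.comp g) x := rfl

theorem OInt.map_injective (g : K' →ₐ[ℤ_[p]] L') : Function.Injective (OInt.map g) := by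
  intro a b h
  exact Subtype.ext (g.toRingHom.injective (congrArg Subtype.val h))

/-- The Galois group of `L' / K'` as the kernel of the restriction map. -/
noncomputable def kerGalResEquiv : (galRes K K' L').ker ≃ (L' ≃ₐ[K'] L') where
  toFun h := AlgEquiv.ofRingEquiv (f := h.1.toRingEquiv) (galRes_eq_one_iff.1 h.2)
  invFun g := ⟨g.restrictScalars K, galRes_eq_one_iff.2 fun x => g.commutes x⟩
  left_inv h := by ext x; rfl
  right_inv g := by ext x; rfl

theorem card_ker_galRes [IsGalois K L'] [FiniteDimensional K L'] :
    Nat.card (galRes K K' L').ker = Module.finrank K' L' := by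
  have : IsGalois K' L' := IsGalois.tower_top_of_isGalois K K' L'
  have : FiniteDimensional K' L' := FiniteDimensional.right K K' L'
  rw [Nat.card_congr kerGalResEquiv, IsGalois.card_aut_eq_finrank]

theorem exists_algebraMap_of_fixed [IsGalois K L'] [FiniteDimensional K L'] (x : L')
    (hx : ∀ h : L' ≃ₐ[K] L', galRes K K' L' h = 1 → h x = x) : ∃ y, algebraMap K' L' y = x := by
  have : IsGalois K' L' := IsGalois.tower_top_of_isGalois K K' L'
  have : FiniteDimensional K' L' := FiniteDimensional.right K K' L'
  exact (IsGalois.mem_range_algebraMap_iff_fixed x).2 fun g =>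
    hx (g.restrictScalars K) (galRes_eq_one_iff.2 fun x => g.commutes x)

theorem OInt.exists_map_of_fixed [IsGalois K L'] [FiniteDimensional K L'] (x : OInt p L')
    (hx : ∀ h : L' ≃ₐ[K] L', galRes K K' L' h = 1 → OInt.map (galHom p h) x = x) :
    ∃ y, OInt.map (extHom p K' L') y = x := by
  obtain ⟨y, hy⟩ := exists_algebraMap_of_fixed (K := K) (K' := K') (x : L') fun h hh =>
    congrArg Subtype.val (hx h hh)
  have hy' : extHom p K' L' y = x := hy
  refine ⟨⟨y, ?_⟩, Subtype.ext hy⟩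
  have h1 : IsIntegral ℤ_[p] (extHom p K' L' y) := by rw [hy']; exact x.2
  exact (isIntegral_algHom_iff (extHom p K' L') (extHom p K' L').toRingHom.injective).1 h1

theorem OInt.map_extHom_of_mem_ker {h : L' ≃ₐ[K] L'} (hh : galRes K K' L' h = 1) (y : OInt p K') :
    OInt.map (galHom p h) (OInt.map (extHom p K' L') y) = OInt.map (extHom p K' L') y := by
  rw [OInt.map_comp_apply, galHom_comp_extHom_of_mem_ker hh]

theorem WInt.map_extHom_of_mem_ker {h : L' ≃ₐ[K] L'} (hh : galRes K K' L' h = 1) (y : WInt p K') :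
    WInt.map (galHom p h) (WInt.map (extHom p K' L') y) = WInt.map (extHom p K' L') y := by
  rw [← AlgHom.comp_apply, ← WInt.map_comp, galHom_comp_extHom_of_mem_ker hh]

theorem ResF.exists_map_of_fixed [IsGalois K L'] [FiniteDimensional K L'] (r : ResF p L')
    (hr : ∀ h : L' ≃ₐ[K] L', galRes K K' L' h = 1 → ResF.map (galHom p h) r = r) :
    ∃ s, ResF.map (extHom p K' L') s = r := by
  obtain ⟨y, hy⟩ := OInt.exists_map_of_fixed (K := K) (K' := K')
    (OInt.ofWittAlg p L' (WittVector.teichmuller p r)) fun h hh => by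
      rw [OInt.map_ofWitt, WInt.map, WittVector.mapAlg_teichmuller, hr h hh]
  refine ⟨IsLocalRing.residue _ y, ?_⟩
  rw [ResF.map_residue, hy]
  exact (OInt.residue_ofWitt p L' _).trans (WittVector.teichmuller_coeff_zero p r)

theorem WInt.map_injective (g : K' →ₐ[ℤ_[p]] L') : Function.Injective (WInt.map g) := by
  intro a b h
  ext i
  exact (ResF.map g).injective (congrArg (fun w => WittVector.coeff w i) h)

theorem WInt.exists_map_of_fixed [IsGalois K L'] [FiniteDimensional K L'] (w : WInt p L')
    (hw : ∀ h : L' ≃ₐ[K] L', galRes K K' L' h = 1 → WInt.map (galHom p h) w = w) :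
    ∃ v, WInt.map (extHom p K' L') v = w := by
  have h1 : ∀ i, ∃ s, ResF.map (extHom p K' L') s = w.coeff i := fun i =>
    ResF.exists_map_of_fixed (K := K) _ fun h hh => congrArg (fun w => WittVector.coeff w i) (hw h hh)
  choose s hs using h1
  exact ⟨WittVector.mk p s, by ext i; exact hs i⟩

section Tame

variable [IsGalois K L'] [FiniteDimensional K L'] (hdeg : ¬ p ∣ Module.finrank K' L')

include hdeg

theorem isUnit_card_ker : IsUnit (Nat.card (galRes K K' L').ker : ℤ_[p]) := by
  rw [card_ker_galRes]
  exact OInt.isUnit_algebraMap_natCast hdeg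

theorem isUnit_card_ker' (B : Type*) [CommRing B] [Algebra ℤ_[p] B] :
    IsUnit (Nat.card (galRes K K' L').ker : B) := by
  have := (isUnit_card_ker (K := K) (K' := K') (L' := L') hdeg).map (algebraMap ℤ_[p] B)
  rwa [map_natCast] at this

theorem OInt.exists_trace : ∃ t : OInt p L' →ₗ[ℤ_[p]] OInt p K',
    (∀ b c, t (OInt.map (extHom p K' L') b * c) = b * t c) ∧ t 1 = 1 ∧
    ∀ c, (Nat.card (galRes K K' L').ker : OInt p L') * OInt.map (extHom p K' L') (t c) =
      ∑ h ∈ (galRes K K' L').kerFinset, OInt.map (galHom p h) c := by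
  have := isUnit_card_ker (p := p) (K := K) (K' := K') (L' := L') hdeg
  rw [← MonoidHom.card_kerFinset] at this ⊢
  refine exists_normalised_trace _ (OInt.map_injective _) _ (fun h => OInt.map (galHom p h))
    (fun h hh b => OInt.map_extHom_of_mem_ker ((MonoidHom.mem_kerFinset).1 hh) b) (fun c => ?_) this
  refine OInt.exists_map_of_fixed (K := K) _ fun g hg => ?_
  rw [map_sum]
  exact MonoidHom.sum_kerFinset_mul_left _ hg (fun h => OInt.map (galHom p h) c)

theorem WInt.exists_trace : ∃ t : WInt p L' →ₗ[ℤ_[p]] WInt p K',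
    (∀ b c, t (WInt.map (extHom p K' L') b * c) = b * t c) ∧ t 1 = 1 ∧
    ∀ c, (Nat.card (galRes K K' L').ker : WInt p L') * WInt.map (extHom p K' L') (t c) =
      ∑ h ∈ (galRes K K' L').kerFinset, WInt.map (galHom p h) c := by
  have := isUnit_card_ker (p := p) (K := K) (K' := K') (L' := L') hdeg
  rw [← MonoidHom.card_kerFinset] at this ⊢
  refine exists_normalised_trace _ (WInt.map_injective _) _ (fun h => WInt.map (galHom p h))
    (fun h hh b => WInt.map_extHom_of_mem_ker ((MonoidHom.mem_kerFinset).1 hh) b) (fun c => ?_) this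
  refine WInt.exists_map_of_fixed (K := K) _ fun g hg => ?_
  rw [map_sum]
  refine Eq.trans (Finset.sum_congr rfl fun h _ => ?_)
    (MonoidHom.sum_kerFinset_mul_left _ hg (fun h => WInt.map (galHom p h) c))
  rw [galHom_mul, WInt.map_comp]
  rfl

/-- The map `O_{L'} ⊗ A → O_{K'} ⊗ A` given by the normalised trace. -/
theorem exists_oRing_retraction (A : Type u) [CommRing A] [Algebra ℤ_[p] A]
    {t : OInt p L' →ₗ[ℤ_[p]] OInt p K'}
    (ht : ∀ b c, t (OInt.map (extHom p K' L') b * c) = b * t c) (ht1 : t 1 = 1)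
    (hcard : ∀ c, (Nat.card (galRes K K' L').ker : OInt p L') * OInt.map (extHom p K' L') (t c) =
      ∑ h ∈ (galRes K K' L').kerFinset, OInt.map (galHom p h) c) :
    ∃ T : GRing.Retraction (oRingExt K K' L' A), ∀ (x : OInt p L') (a : A),
      T.tr (x ⊗ₜ[ℤ_[p]] a) = t x ⊗ₜ[ℤ_[p]] a := by
  refine ⟨⟨(t.rTensor A).toAddMonoidHom, rTensor_tensMap_mul ht, ?_,
    natCast_mul_tensMap_rTensor hcard, isUnit_card_ker' hdeg (OInt p K' ⊗[ℤ_[p]] A)⟩, fun x a => rfl⟩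
  change t.rTensor A ((1 : OInt p L') ⊗ₜ (1 : A)) = _
  rw [LinearMap.rTensor_tmul, ht1]
  rfl

end Tame

section Series

variable [IsGalois K L'] [FiniteDimensional K L'] {ϖ : TameUniformiser p K K'}
  {ϖ' : TameUniformiser p K L'} (hϖ : ϖ.Compatible ϖ')

theorem TameUniformiser.sRing_act_coeff (A : Type u) [CommRing A] [Algebra ℤ_[p] A]
    (g : L' ≃ₐ[K] L') (F : PowerSeries (WCoeff p L' A)) (i : ℕ) :
    PowerSeries.coeff i ((ϖ'.sRing A).act g F : PowerSeries (WCoeff p L' A)) =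
      (ϖ'.teich g ^ i) ⊗ₜ 1 *
        tensMap (WInt.map (galHom p g)) (AlgHom.id ℤ_[p] A) (PowerSeries.coeff i F) := by
  have h1 : ((ϖ'.sRing A).act g F : PowerSeries (WCoeff p L' A)) =
      PowerSeries.rescale ((ϖ'.teich g) ⊗ₜ 1 : WCoeff p L' A)
        (PowerSeries.map (tensMap (WInt.map (galHom p g)) (AlgHom.id ℤ_[p] A)) F) :=
    PowerSeries.expand_one_apply _
  rw [h1, PowerSeries.coeff_rescale, PowerSeries.coeff_map, tmul_one_pow]

include hϖ

theorem TameUniformiser.Compatible.dvd_of_pow_mul_eq {n b : ℕ} {v : OInt p L'} (hv : IsUnit v)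
    {y : OInt p K'} (h : ϖ'.pi ^ n * v = OInt.map (extHom p K' L') y) (hb : b = ramIdx p K' L') :
    b ∣ n := by
  subst hb
  have hy : y ≠ 0 := by
    rintro rfl
    rw [map_zero] at h
    exact mul_ne_zero (pow_ne_zero n ϖ'.pi_ne_zero) hv.ne_zero h
  obtain ⟨k, w, rfl⟩ := OInt.exists_eq_pow_mul ϖ.span_pi hy
  have hϖ' : ϖ'.pi ^ ramIdx p K' L' = OInt.map (extHom p K' L') ϖ.pi := hϖ
  rw [map_mul, map_pow, ← hϖ', ← pow_mul] at h
  exact ⟨k, OInt.pow_mul_unit_injective ϖ'.span_pi hv (w.isUnit.map (OInt.map (extHom p K' L'))) h⟩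

theorem TameUniformiser.Compatible.sum_teich_pow_mul {i : ℕ} (hi : ¬ ramIdx p K' L' ∣ i)
    (w : WInt p L') : ∑ h ∈ (galRes K K' L').kerFinset,
      ϖ'.teich h ^ i * WInt.map (galHom p h) w = 0 := by
  set c := ∑ h ∈ (galRes K K' L').kerFinset, ϖ'.teich h ^ i * WInt.map (galHom p h) w with hc
  by_contra hne
  have h1 : OInt.ofWittAlg p L' c * ϖ'.pi ^ i = ∑ h ∈ (galRes K K' L').kerFinset,
      OInt.map (galHom p h) (OInt.ofWittAlg p L' w * ϖ'.pi ^ i) := by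
    rw [hc, map_sum, Finset.sum_mul]
    refine Finset.sum_congr rfl fun h _ => ?_
    rw [map_mul, map_pow, map_mul, map_pow, ϖ'.map_pi, OInt.map_ofWitt, ϖ'.ofWitt_teich]
    ring
  obtain ⟨y, hy⟩ : ∃ y, OInt.map (extHom p K' L') y = OInt.ofWittAlg p L' c * ϖ'.pi ^ i := by
    refine OInt.exists_map_of_fixed (K := K) _ fun g hg => ?_
    rw [h1, map_sum]
    exact MonoidHom.sum_kerFinset_mul_left _ hg
      (fun h => OInt.map (galHom p h) (OInt.ofWittAlg p L' w * ϖ'.pi ^ i))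
  obtain ⟨a, v, hv⟩ := WittVector.exists_eq_pow_p_mul' c hne
  obtain ⟨m, z, -, hz⟩ := OInt.exists_p_eq ϖ.span_pi
  have hϖ' : ϖ'.pi ^ ramIdx p K' L' = OInt.map (extHom p K' L') ϖ.pi := hϖ
  have hp : (p : OInt p L') = ϖ'.pi ^ (ramIdx p K' L' * m) * OInt.map (extHom p K' L') z := by
    rw [pow_mul, hϖ', ← map_pow, ← map_mul, ← hz, map_natCast]
  rw [hv, map_mul, map_pow, map_natCast, hp] at hy
  refine hi ((Nat.dvd_add_right (Dvd.intro (m * a) rfl)).1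
    (hϖ.dvd_of_pow_mul_eq (n := ramIdx p K' L' * (m * a) + i)
      (v := OInt.map (extHom p K' L') z ^ a * OInt.ofWittAlg p L' v) ?_ (y := y) ?_ rfl))
  · exact ((z.isUnit.map (OInt.map (extHom p K' L'))).pow a).mul
      (v.isUnit.map (OInt.ofWittAlg p L'))
  · rw [hy]
    ring

theorem TameUniformiser.Compatible.sRingExt_coeff_mul (A : Type u) [CommRing A] [Algebra ℤ_[p] A]
    (F : PowerSeries (WCoeff p K' A)) (j : ℕ) :
    PowerSeries.coeff (ramIdx p K' L' * j)
      ((hϖ.sRingExt A).toRingHom F : PowerSeries (WCoeff p L' A)) =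
      tensMap (WInt.map (extHom p K' L')) (AlgHom.id ℤ_[p] A) (PowerSeries.coeff j F) := by
  have h : ((hϖ.sRingExt A).toRingHom F : PowerSeries (WCoeff p L' A)) =
      PowerSeries.expand (ramIdx p K' L') hϖ.ramIdx_ne_zero (PowerSeries.rescale 1
        (PowerSeries.map (tensMap (WInt.map (extHom p K' L')) (AlgHom.id ℤ_[p] A)) F)) := rfl
  rw [h, PowerSeries.coeff_expand_mul, PowerSeries.rescale_one, RingHom.id_apply,
    PowerSeries.coeff_map]

theorem TameUniformiser.Compatible.sRingExt_coeff_of_not_dvd (A : Type u) [CommRing A]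
    [Algebra ℤ_[p] A] (F : PowerSeries (WCoeff p K' A)) {i : ℕ} (hi : ¬ ramIdx p K' L' ∣ i) :
    PowerSeries.coeff i ((hϖ.sRingExt A).toRingHom F : PowerSeries (WCoeff p L' A)) = 0 :=
  PowerSeries.coeff_expand_of_not_dvd _ hϖ.ramIdx_ne_zero _ hi

theorem TameUniformiser.Compatible.exists_sRing_retraction (hdeg : ¬ p ∣ Module.finrank K' L')
    (A : Type u) [CommRing A] [Algebra ℤ_[p] A] :
    Nonempty (GRing.Retraction (hϖ.sRingExt A).toHom) := by
  obtain ⟨t, ht, ht1, hcard⟩ := WInt.exists_trace (p := p) (K := K) (K' := K') (L' := L') hdeg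
  let e := ramIdx p K' L'
  have he : e ≠ 0 := hϖ.ramIdx_ne_zero
  let T : PowerSeries (WCoeff p L' A) →+ PowerSeries (WCoeff p K' A) :=
    { toFun := fun F => PowerSeries.mk fun j => t.rTensor A (PowerSeries.coeff (e * j) F)
      map_zero' := by ext j; simp
      map_add' := fun F G => by ext j; simp }
  have hT : ∀ F j, PowerSeries.coeff j (T F) = t.rTensor A (PowerSeries.coeff (e * j) F) :=
    fun F j => PowerSeries.coeff_mk j fun j => t.rTensor A (PowerSeries.coeff (e * j) F)
  refine ⟨⟨T, fun r y => ?_, ?_, fun y => ?_, ?_⟩⟩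
  · refine PowerSeries.ext fun j => ?_
    refine (hT _ j).trans (Eq.trans (congrArg (t.rTensor A) (PowerSeries.coeff_mul _ _ _)) ?_)
    refine Eq.trans ?_ (PowerSeries.coeff_mul _ _ _).symm
    rw [map_sum]
    symm
    refine Finset.sum_of_injOn (fun x => (e * x.1, e * x.2)) ?_ ?_ ?_ ?_
    · rintro ⟨a, b⟩ _ ⟨c, d⟩ _ h
      simp only [Prod.mk.injEq, mul_eq_mul_left_iff, he, or_false] at h
      exact Prod.ext h.1 h.2
    · rintro ⟨a, b⟩ h
      simp only [Finset.mem_coe, Finset.HasAntidiagonal.mem_antidiagonal] at h ⊢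
      rw [← mul_add, h]
    · rintro ⟨a, b⟩ h1 h2
      have : ¬ e ∣ a := by
        rintro ⟨c, rfl⟩
        rw [Finset.HasAntidiagonal.mem_antidiagonal] at h1
        obtain ⟨d, rfl⟩ : e ∣ b := (Nat.dvd_add_right (Dvd.intro c rfl)).1 (h1 ▸ Dvd.intro j rfl)
        refine h2 ⟨(c, d), ?_, rfl⟩
        simp only [Finset.mem_coe, Finset.HasAntidiagonal.mem_antidiagonal]
        exact Nat.eq_of_mul_eq_mul_left (Nat.pos_of_ne_zero he) (by rw [mul_add, h1])
      refine (congrArg (t.rTensor A) (congrArg (· * _)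
        (hϖ.sRingExt_coeff_of_not_dvd A r this))).trans ?_
      rw [zero_mul, map_zero]
    · rintro ⟨a, b⟩ _
      refine (congrArg (_ * ·) (hT y b)).trans ?_
      refine Eq.trans (rTensor_tensMap_mul ht _ _).symm (congrArg (t.rTensor A) (congrArg (· * _) ?_))
      exact (hϖ.sRingExt_coeff_mul A r a).symm
  · refine PowerSeries.ext fun j => ?_
    refine (hT 1 j).trans (Eq.trans (congrArg (t.rTensor A) (PowerSeries.coeff_one _)) ?_)
    refine Eq.trans ?_ (PowerSeries.coeff_one _).symm
    by_cases hj : j = 0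
    · subst hj
      rw [if_pos rfl, if_pos (mul_zero _)]
      change t.rTensor A ((1 : WInt p L') ⊗ₜ (1 : A)) = _
      rw [LinearMap.rTensor_tmul, ht1]
      rfl
    · rw [if_neg hj, if_neg (mul_ne_zero he hj), map_zero]
  · refine PowerSeries.ext fun i => ?_
    have h0 : ∀ F : PowerSeries (WCoeff p L' A), PowerSeries.coeff i
        ((Nat.card (galRes K K' L').ker : PowerSeries (WCoeff p L' A)) * F) =
        Nat.card (galRes K K' L').ker * PowerSeries.coeff i F := fun F => by
      rw [← nsmul_eq_mul, map_nsmul, nsmul_eq_mul]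
    refine (h0 _).trans ?_
    refine Eq.trans ?_ (map_sum (PowerSeries.coeff i) _ _).symm
    refine Eq.trans ?_ (Finset.sum_congr rfl fun h _ => (ϖ'.sRing_act_coeff A h y i).symm)
    by_cases hi : e ∣ i
    · obtain ⟨j, rfl⟩ := hi
      refine (congrArg (_ * ·) ((hϖ.sRingExt_coeff_mul A (T y) j).trans
        (congrArg _ (hT y j)))).trans ((natCast_mul_tensMap_rTensor hcard _).trans ?_)
      refine Finset.sum_congr rfl fun h hh => ?_
      rw [pow_mul, hϖ.teich_pow, MonoidHom.mem_kerFinset.1 hh, ϖ.teich_one, map_one, one_pow]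
      exact (one_mul _).symm
    · refine (congrArg (_ * ·) (hϖ.sRingExt_coeff_of_not_dvd A (T y) hi)).trans
        ((mul_zero _).trans ?_)
      symm
      generalize PowerSeries.coeff i y = z
      induction z using TensorProduct.induction_on with
      | zero => simp
      | add z z' hz hz' => simp only [map_add, mul_add, Finset.sum_add_distrib, hz, hz', add_zero]
      | tmul w a =>
        simp only [tensMap_tmul, Algebra.TensorProduct.tmul_mul_tmul, one_mul]
        rw [← TensorProduct.sum_tmul, hϖ.sum_teich_pow_mul hi, TensorProduct.zero_tmul]
  · have := (isUnit_card_ker' (p := p) (K := K) (K' := K') (L' := L') hdeg (WCoeff p K' A)).map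
      (PowerSeries.C : WCoeff p K' A →+* PowerSeries (WCoeff p K' A))
    rwa [map_natCast] at this

end Series

section Eisenstein

variable {ϖ : TameUniformiser p K K'} {ϖ' : TameUniformiser p K L'} (hϖ : ϖ.Compatible ϖ')

include hϖ in
theorem TameUniformiser.Compatible.eisenstein_eq : ϖ'.eisenstein =
    Polynomial.expand (WInt p L') (ramIdx p K' L')
      (ϖ.eisenstein.map (WInt.map (extHom p K' L')).toRingHom) := by
  obtain ⟨m, v, Q, hm, hv, hQ, hE⟩ := ϖ.exists_eisenstein_eq
  obtain ⟨m', v', Q', hm', hv', hQ', hE'⟩ := ϖ'.exists_eisenstein_eq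
  have hϖ' : ϖ'.pi ^ ramIdx p K' L' = OInt.map (extHom p K' L') ϖ.pi := hϖ
  have hp : (p : OInt p L') = ϖ'.pi ^ (ramIdx p K' L' * m) * OInt.map (extHom p K' L') v := by
    rw [pow_mul, hϖ', ← map_pow, ← map_mul, ← hv, map_natCast]
  have hmm : m' = ramIdx p K' L' * m := OInt.pow_mul_unit_injective ϖ'.span_pi v'.isUnit
    (v.isUnit.map (OInt.map (extHom p K' L'))) (hv'.symm.trans hp)
  have hmon : ϖ.eisenstein.Monic := hE ▸ Polynomial.monic_X_pow_sub_C_mul hQ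
  have hdeg : ϖ.eisenstein.natDegree = m :=
    Polynomial.natDegree_eq_of_degree_eq_some (hE ▸ Polynomial.degree_X_pow_sub_C_mul hQ)
  have hdeg' : ϖ'.eisenstein.degree = (m' : WithBot ℕ) :=
    hE' ▸ Polynomial.degree_X_pow_sub_C_mul hQ'
  have hmon2 := hmon.map (WInt.map (extHom p K' L')).toRingHom
  symm
  let _ := (OInt.ofWitt p L').toAlgebra
  have : FaithfulSMul (WInt p L') (OInt p L') :=
    (faithfulSMul_iff_algebraMap_injective _ _).2 OInt.ofWittAlg_injective
  refine minpoly.IsIntegrallyClosed.unique_of_degree_le_degree_minpoly (s := ϖ'.pi) 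
    (hmon2.expand (Nat.pos_of_ne_zero hϖ.ramIdx_ne_zero)) ?_ ?_
  · rw [Polynomial.expand_aeval, hϖ', Polynomial.aeval_def, Polynomial.eval₂_map]
    have h1 : (algebraMap (WInt p L') (OInt p L')).comp (WInt.map (extHom p K' L')).toRingHom =
        (OInt.map (extHom p K' L')).toRingHom.comp (OInt.ofWitt p K') :=
      RingHom.ext fun w => (OInt.map_ofWitt (extHom p K' L') w).symm
    rw [h1]
    refine (Polynomial.hom_eval₂ _ _ (OInt.map (extHom p K' L')).toRingHom _).symm.trans ?_
    let _ := (OInt.ofWitt p K').toAlgebra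
    have h : Polynomial.aeval ϖ.pi (minpoly (WInt p K') ϖ.pi) = 0 := minpoly.aeval _ _
    exact (congrArg _ h).trans (map_zero _)
  · refine le_trans ?_ hdeg'.ge
    rw [← Polynomial.natDegree_le_iff_degree_le, Polynomial.natDegree_expand, hmon.natDegree_map,
      hdeg, hmm, mul_comm]

theorem TameUniformiser.Compatible.sRingExt_eisensteinS (A : Type u) [CommRing A]
    [Algebra ℤ_[p] A] :
    (hϖ.sRingExt A).toRingHom (ϖ.eisensteinS A) = ϖ'.eisensteinS A := by
  rw [ϖ.eisensteinS_eq, ϖ'.eisensteinS_eq, hϖ.eisenstein_eq, Polynomial.map_expand]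
  refine (PowerSeries.twist_coe _ _ _ _).trans ?_
  rw [Polynomial.map_map, Polynomial.map_map]
  congr 3

end Eisenstein

end Galois

section NaturalIsos

variable {G H H' K : Type u} [Group G] [Group H] [Group H'] [Group K]

/-- Iterated base changes of pairs along the two sides of a commutative square, as functors. -/
theorem FilModule.exists_squareNatIso {X : GRing G} {Y : GRing H} {Y' : GRing H'}
    {Z : GRing K} {α : H →* G} {β : K →* H} {α' : H' →* G} {β' : K →* H'}
    (f : GRing.Hom α X Y) (g : GRing.Hom β Y Z) (f' : GRing.Hom α' X Y') (g' : GRing.Hom β' Y' Z)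
    (h : ∀ r, g.toRingHom (f.toRingHom r) = g'.toRingHom (f'.toRingHom r))
    (hα : ∀ k, α (β k) = α' (β' k)) :
    ∃ e : FilModule.baseChange f ⋙ FilModule.baseChange g ≅
        FilModule.baseChange f' ⋙ FilModule.baseChange g',
      ∀ (L : FilModule X) (m : L.carrier),
        (e.hom.app L).equiv (GModule.tmul g _ 1 (L.toGModule.tmul f 1 m)) =
          GModule.tmul g' _ 1 (L.toGModule.tmul f' 1 m) := by
  refine ⟨NatIso.ofComponents (fun L => (FilModule.squareIso f g f' g' h hα L).toIso)
    (fun {L L'} e => ?_), fun L m => ?_⟩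
  · exact FilModule.Iso.ext (ScalarExt.square_congr f.toRingHom g.toRingHom f'.toRingHom
      g'.toRingHom h e.equiv)
  · exact ScalarExt.square_of f.toRingHom g.toRingHom f'.toRingHom g'.toRingHom h m

/-- Iterated base changes of Frobenius modules along the two sides of a commutative square, as
functors. -/
theorem PhiModule.exists_squareNatIso {X : PhiRing G} {Y : PhiRing H} {Y' : PhiRing H'}
    {Z : PhiRing K} {α : H →* G} {β : K →* H} {α' : H' →* G} {β' : K →* H'}
    (f : PhiRing.Hom α X Y) (g : PhiRing.Hom β Y Z) (f' : PhiRing.Hom α' X Y')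
    (g' : PhiRing.Hom β' Y' Z)
    (h : ∀ r, g.toRingHom (f.toRingHom r) = g'.toRingHom (f'.toRingHom r))
    (hα : ∀ k, α (β k) = α' (β' k)) :
    ∃ e : PhiModule.baseChange f ⋙ PhiModule.baseChange g ≅
        PhiModule.baseChange f' ⋙ PhiModule.baseChange g',
      ∀ (M : PhiModule X) (m : M.carrier),
        (e.hom.app M).equiv (GModule.tmul g.toHom _ 1 (M.toGModule.tmul f.toHom 1 m)) =
          GModule.tmul g'.toHom _ 1 (M.toGModule.tmul f'.toHom 1 m) := by
  refine ⟨NatIso.ofComponents (fun L => (PhiModule.squareIso f g f' g' h hα L).toIso)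
    (fun {L L'} e => ?_), fun L m => ?_⟩
  · exact PhiModule.Iso.ext (ScalarExt.square_congr f.toRingHom g.toRingHom f'.toRingHom
      g'.toRingHom h e.equiv)
  · exact ScalarExt.square_of f.toRingHom g.toRingHom f'.toRingHom g'.toRingHom h m

/-- The pair attached to a base change of a Frobenius module. -/
noncomputable def PhiModule.toFilIso {X : PhiRing G} {Y : PhiRing H} {Y' : GRing H'} {Z : GRing K}
    {α : H →* G} {β : K →* H} {α' : H' →* G} {β' : K →* H'}
    (f : PhiRing.Hom α X Y) (g : GRing.Hom β Y.toGRing Z) (f' : GRing.Hom α' X.toGRing Y')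
    (g' : GRing.Hom β' Y' Z)
    (h : ∀ r, g.toRingHom (f.toRingHom r) = g'.toRingHom (f'.toRingHom r))
    (hα : ∀ k, α (β k) = α' (β' k)) (M : PhiModule X) :
    ((M.baseChangeObj f).imFil.baseChangeObj g).Iso ((M.imFil.baseChangeObj f').baseChangeObj g') where
  equiv := ScalarExt.square f.toRingHom g.toRingHom f'.toRingHom g'.toRingHom h M.carrier
  map_act := GModule.square_act f.toHom g f' g' h hα M.toGModule
  map_fil x := by
    have key : ((M.baseChangeObj f).imFil.baseChangeObj g).fil =
        ((M.imFil.baseChangeObj f.toHom).baseChangeObj g).fil := by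
      have := M.range_linPhi_baseChange f
      refine congrArg (fun V : Submodule Y.carrier (ScalarExt f.toRingHom M.carrier) =>
        Submodule.span Z.carrier (ScalarExt.tmul g.toRingHom 1 '' (V : Set (ScalarExt f.toRingHom M.carrier)))) this
    rw [key]
    exact (FilModule.squareIso f.toHom g f' g' h hα M.imFil).map_fil x

theorem PhiModule.exists_toFilNatIso {X : PhiRing G} {Y : PhiRing H} {Y' : GRing H'} {Z : GRing K}
    {α : H →* G} {β : K →* H} {α' : H' →* G} {β' : K →* H'}
    (f : PhiRing.Hom α X Y) (g : GRing.Hom β Y.toGRing Z) (f' : GRing.Hom α' X.toGRing Y')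
    (g' : GRing.Hom β' Y' Z)
    (h : ∀ r, g.toRingHom (f.toRingHom r) = g'.toRingHom (f'.toRingHom r))
    (hα : ∀ k, α (β k) = α' (β' k)) :
    ∃ e : PhiModule.baseChange f ⋙ PhiModule.toFil g ≅
        PhiModule.toFil f' ⋙ FilModule.baseChange g',
      ∀ (M : PhiModule X) (m : M.carrier),
        (e.hom.app M).equiv (GModule.tmul g _ 1 (M.toGModule.tmul f.toHom 1 m)) =
          GModule.tmul g' _ 1 (M.toGModule.tmul f' 1 m) := by
  refine ⟨NatIso.ofComponents (fun M => (PhiModule.toFilIso f g f' g' h hα M).toIso)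
    (fun {L L'} e => ?_), fun L m => ?_⟩
  · exact FilModule.Iso.ext (ScalarExt.square_congr f.toRingHom g.toRingHom f'.toRingHom
      g'.toRingHom h e.equiv)
  · exact ScalarExt.square_of f.toRingHom g.toRingHom f'.toRingHom g'.toRingHom h m

end NaturalIsos

section Contract

variable {R S : Type u} [CommRing R] [CommRing S] {f : R →+* S} {M : Type u} [AddCommGroup M]
  [Module R M]

/-- The map `s ⊗ m ↦ l(s) m` attached to an `R`-linear form `l : S → R`. -/
noncomputable def ScalarExt.contract (l : S →+ R) (hl : ∀ r s, l (f r * s) = r * l s) (M : Type u)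
    [AddCommGroup M] [Module R M] : ScalarExt f M →+ M :=
  ScalarExt.liftAdd (AddMonoidHom.mk' (fun s => AddMonoidHom.mk' (fun m => l s • m)
    (fun a b => smul_add _ a b)) (fun a b => by
      ext m
      change l (a + b) • m = l a • m + l b • m
      rw [map_add, add_smul])) (fun s r m => by
      change l (s * f r) • m = l s • r • m
      rw [mul_comm, hl, mul_comm, mul_smul])

theorem ScalarExt.contract_smul_of (l : S →+ R) (hl : ∀ r s, l (f r * s) = r * l s) (s : S)
    (m : M) : ScalarExt.contract l hl M (s • ScalarExt.of f M m) = l s • m := by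
  rw [← ScalarExt.tmul_eq]
  exact ScalarExt.liftAdd_tmul _ _ s m

theorem ScalarExt.contract_smul (l : S →+ R) (hl : ∀ r s, l (f r * s) = r * l s) (r : R)
    (x : ScalarExt f M) :
    ScalarExt.contract l hl M (f r • x) = r • ScalarExt.contract l hl M x := by
  induction x using ScalarExt.induction_of with
  | zero => rw [smul_zero, map_zero, smul_zero]
  | smul_of s m => rw [smul_smul, contract_smul_of, contract_smul_of, hl, mul_smul]
  | add x y hx hy => rw [smul_add, map_add, hx, hy, map_add, smul_add]

theorem ScalarExt.contract_mem (l : S →+ R) (hl : ∀ r s, l (f r * s) = r * l s)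
    {N : Submodule R M} {x : ScalarExt f M}
    (hx : x ∈ Submodule.span S (ScalarExt.tmul f 1 '' (N : Set M))) :
    ScalarExt.contract l hl M x ∈ N := by
  suffices ∀ s : S, ScalarExt.contract l hl M (s • x) ∈ N by simpa using this 1
  induction hx using Submodule.span_induction with
  | mem x hx =>
    obtain ⟨m, hm, rfl⟩ := hx
    intro s
    rw [← ScalarExt.of_apply, contract_smul_of]
    exact N.smul_mem _ hm
  | zero => intro s; rw [smul_zero, map_zero]; exact zero_mem _
  | add x y _ _ hx hy => intro s; rw [smul_add, map_add]; exact add_mem (hx s) (hy s)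
  | smul a x _ hx => intro s; rw [smul_smul]; exact hx _

theorem ScalarExt.sum_smul_of_contract {ι : Type*} {s : Finset ι} (l : ι → S →+ R)
    (hl : ∀ i r s, l i (f r * s) = r * l i s) (y : ι → S)
    (hy : ∀ c, ∑ i ∈ s, f (l i c) * y i = c) (x : ScalarExt f M) :
    ∑ i ∈ s, y i • ScalarExt.of f M (ScalarExt.contract (l i) (hl i) M x) = x := by
  induction x using ScalarExt.induction_of with
  | zero => simp
  | smul_of c m =>
    simp only [contract_smul_of, of_smul, smul_smul]
    rw [← Finset.sum_smul]
    congr 1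
    conv_rhs => rw [← hy c]
    exact Finset.sum_congr rfl fun i _ => mul_comm _ _
  | add x y hx hy => simp only [map_add, smul_add, Finset.sum_add_distrib, hx, hy]

variable {A : Type u} [CommRing A]

/-- Projectivity over `A` of the quotient of a base change along a finite projective extension. -/
theorem ScalarExt.projective_quotient {a : A →+* R} {b : A →+* S} (hab : ∀ x, f (a x) = b x)
    {ι : Type} [Fintype ι] (l : ι → S →+ R) (hl : ∀ i r s, l i (f r * s) = r * l i s) (y : ι → S)
    (hy : ∀ c, ∑ i, f (l i c) * y i = c) (N : Submodule R M)
    [hN : Module.Projective A (RestrictAlong a (M ⧸ N))] :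
    Module.Projective A (RestrictAlong b (ScalarExt f M ⧸
      Submodule.span S (ScalarExt.tmul f 1 '' (N : Set M)))) := by
  set N' := Submodule.span S (ScalarExt.tmul f 1 '' (N : Set M)) with hN'
  let I : RestrictAlong b (ScalarExt f M ⧸ N') →+ (ι → RestrictAlong a (M ⧸ N)) :=
    QuotientAddGroup.lift N'.toAddSubgroup
      (AddMonoidHom.pi fun i => (N.mkQ.toAddMonoidHom.comp (ScalarExt.contract (l i) (hl i) M)))
      (fun x hx => by
        ext i
        exact (Submodule.Quotient.mk_eq_zero N).2 (ScalarExt.contract_mem (l i) (hl i) hx))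
  have hI : ∀ x i, I (Submodule.Quotient.mk x) i =
      Submodule.Quotient.mk (ScalarExt.contract (l i) (hl i) M x) := fun _ _ => rfl
  let J : (M ⧸ N) →+ (ScalarExt f M ⧸ N') :=
    QuotientAddGroup.lift N.toAddSubgroup (N'.mkQ.toAddMonoidHom.comp (ScalarExt.of f M))
      (fun m hm => (Submodule.Quotient.mk_eq_zero N').2 (Submodule.subset_span ⟨m, hm, rfl⟩))
  have hJ : ∀ m, J (Submodule.Quotient.mk m) = Submodule.Quotient.mk (ScalarExt.of f M m) :=
    fun _ => rfl
  have hJs : ∀ r m, J (r • m) = f r • J m := by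
    intro r m
    obtain ⟨m, rfl⟩ := Submodule.Quotient.mk_surjective N m
    rw [← Submodule.Quotient.mk_smul, hJ, hJ, ScalarExt.of_smul, Submodule.Quotient.mk_smul]
  have hIs : ∀ (c : A) (x : RestrictAlong b (ScalarExt f M ⧸ N')), I (c • x) = c • I x := by
    intro c x
    obtain ⟨x, rfl⟩ := Submodule.Quotient.mk_surjective N' x
    ext i
    change Submodule.Quotient.mk (ScalarExt.contract (l i) (hl i) M (b c • x)) =
      Submodule.Quotient.mk (a c • ScalarExt.contract (l i) (hl i) M x)
    rw [← hab, contract_smul]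
  let I' : RestrictAlong b (ScalarExt f M ⧸ N') →ₗ[A] (ι → RestrictAlong a (M ⧸ N)) :=
    { I with map_smul' := hIs }
  let J' : (ι → RestrictAlong a (M ⧸ N)) →ₗ[A] RestrictAlong b (ScalarExt f M ⧸ N') :=
    { toFun := fun z => ∑ i, RestrictAlong.val.symm (y i • J (RestrictAlong.val (z i)))
      map_add' := fun z z' => by
        simp only [Pi.add_apply, map_add, smul_add, Finset.sum_add_distrib]
      map_smul' := fun c z => by
        rw [RingHom.id_apply, Finset.smul_sum]
        refine Finset.sum_congr rfl fun i _ => ?_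
        change y i • J (a c • RestrictAlong.val (z i)) = b c • (y i • J (RestrictAlong.val (z i)))
        rw [hJs, hab, smul_comm] }
  have : Module.Projective A (ι → RestrictAlong a (M ⧸ N)) := by
    classical
    exact Module.Projective.of_equiv
      (DirectSum.linearEquivFunOnFintype A ι fun _ => RestrictAlong a (M ⧸ N))
  refine Module.Projective.of_split I' J' (LinearMap.ext fun x => ?_)
  obtain ⟨x, rfl⟩ := Submodule.Quotient.mk_surjective N' x
  change ∑ i, y i • Submodule.Quotient.mk (p := N')
    (ScalarExt.of f M (ScalarExt.contract (l i) (hl i) M x)) = Submodule.Quotient.mk x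
  conv_rhs => rw [← ScalarExt.sum_smul_of_contract l hl y hy x]
  rw [← Submodule.mkQ_apply, map_sum]
  rfl

end Contract

section Integers

variable {p : ℕ} [Fact p.Prime]
  {K : Type u} [Field K] [Algebra ℚ_[p] K] [Algebra ℤ_[p] K]
  [IsScalarTower ℤ_[p] ℚ_[p] K] [FiniteDimensional ℚ_[p] K]
  {K' : Type u} [Field K'] [Algebra ℚ_[p] K'] [Algebra ℤ_[p] K']
  [IsScalarTower ℤ_[p] ℚ_[p] K'] [FiniteDimensional ℚ_[p] K']
  [Algebra K K'] [IsScalarTower ℤ_[p] K K']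
  {L' : Type u} [Field L'] [Algebra ℚ_[p] L'] [Algebra ℤ_[p] L']
  [IsScalarTower ℤ_[p] ℚ_[p] L'] [FiniteDimensional ℚ_[p] L']
  [Algebra K L'] [IsScalarTower ℤ_[p] K L'] [Algebra K' L'] [IsScalarTower ℤ_[p] K' L']
  [IsScalarTower K K' L'] [Normal K K']

theorem OInt.exists_dualBasis {π : OInt p K'}
    (hπ : Ideal.span {π} = IsLocalRing.maximalIdeal (OInt p K')) (g : K' →ₐ[ℤ_[p]] L') :
    ∃ (n : ℕ) (l : Fin n → OInt p L' →ₗ[ℤ_[p]] OInt p K') (y : Fin n → OInt p L'),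
      (∀ i b c, l i (OInt.map g b * c) = b * l i c) ∧
      ∀ c, ∑ i, OInt.map g (l i c) * y i = c := by
  have := OInt.isDiscreteValuationRing hπ
  let _ := (OInt.map g).toAlgebra
  have : IsScalarTower ℤ_[p] (OInt p K') (OInt p L') :=
    IsScalarTower.of_algebraMap_eq fun x => ((OInt.map g).commutes x).symm
  have : Module.Finite (OInt p K') (OInt p L') := Module.Finite.of_restrictScalars_finite ℤ_[p] _ _
  have : FaithfulSMul (OInt p K') (OInt p L') :=
    (faithfulSMul_iff_algebraMap_injective _ _).2 (OInt.map_injective g)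
  have : Module.IsTorsionFree (OInt p K') (OInt p L') := inferInstance
  let b := Module.finBasis (OInt p K') (OInt p L')
  refine ⟨_, fun i => (b.coord i).restrictScalars ℤ_[p], b, fun i r c => ?_, fun c => ?_⟩
  · have : OInt.map g r * c = r • c := (Algebra.smul_def r c).symm
    rw [this]
    exact (b.coord i).map_smul r c
  · refine Eq.trans (Finset.sum_congr rfl fun i _ => ?_) (b.sum_repr c)
    exact (Algebra.smul_def _ _).symm

variable {A : Type u} [CommRing A] [Algebra ℤ_[p] A]

instance wRing.instModule (L : GModule (wRing p K K' A)) :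
    Module (WCoeff p K' A) L.carrier := L.module

theorem FilModule.projective_quotient_baseChange {π : OInt p K'}
    (hπ : Ideal.span {π} = IsLocalRing.maximalIdeal (OInt p K'))
    (L : FilModule (oRing p K K' A))
    (h : Module.Projective A (RestrictAlong (oRing.ofCoeff p K K' A) (L.carrier ⧸ L.fil))) :
    Module.Projective A (RestrictAlong (oRing.ofCoeff p K L' A)
      ((L.baseChangeObj (oRingExt K K' L' A)).carrier ⧸
        (L.baseChangeObj (oRingExt K K' L' A)).fil)) := by
  obtain ⟨n, l, y, hl, hy⟩ := OInt.exists_dualBasis hπ (extHom p K' L')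
  refine ScalarExt.projective_quotient (a := oRing.ofCoeff p K K' A) (fun x => ?_)
    (fun i => ((l i).rTensor A).toAddMonoidHom) (fun i => rTensor_tensMap_mul (hl i))
    (fun i => oRing.ofInt p K L' A (y i)) (fun c => ?_) L.fil
  · exact (tensMap_tmul _ _ _ _).trans (by rw [map_one]; rfl)
  · change OInt p L' ⊗[ℤ_[p]] A at c
    change ∑ i, tensMap (OInt.map (extHom p K' L')) (AlgHom.id ℤ_[p] A) ((l i).rTensor A c) *
      (y i ⊗ₜ 1) = c
    induction c using TensorProduct.induction_on with
    | zero => simp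
    | add a b ha hb => simp only [map_add, add_mul, Finset.sum_add_distrib, ha, hb]
    | tmul x a =>
      simp only [LinearMap.rTensor_tmul, tensMap_tmul, Algebra.TensorProduct.tmul_mul_tmul,
        mul_one, AlgHom.id_apply]
      rw [← TensorProduct.sum_tmul, hy]

theorem FilModule.IsLM.baseChange {π : OInt p K'}
    (hπ : Ideal.span {π} = IsLocalRing.maximalIdeal (OInt p K')) {d : ℕ}
    {L : FilModule (oRing p K K' A)} (hL : L.IsLM d) :
    (L.baseChangeObj (oRingExt K K' L' A)).IsLM d := by
  obtain ⟨h1, h2, h3, h4⟩ := hL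
  refine ⟨ScalarExt.finite _, ScalarExt.projective _, fun P => ?_,
    L.projective_quotient_baseChange hπ h4⟩
  rw [← h3 (P.comap (oRingExt K K' L' A).toRingHom)]
  exact ScalarExt.rankAtStalk (oRingExt K K' L' A).toRingHom P

end Integers

section Induced

variable {C D : Type*} [Category C] [Category D] {T : C ⥤ D} {P : ObjectProperty C}
  {Q : ObjectProperty D}

theorem InducesFullyFaithful.of_full [T.Full] [T.Faithful] (h : ∀ X, P X → Q (T.obj X)) :
    InducesFullyFaithful T P Q :=
  ⟨h, inferInstance, inferInstance⟩

theorem InducesEquivalence.of_full [T.Full] [T.Faithful] (h : ∀ X, P X → Q (T.obj X))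
    (hs : ∀ Y, Q Y → ∃ X, P X ∧ Nonempty (T.obj X ≅ Y)) : InducesEquivalence T P Q := by
  refine ⟨h, { essSurj := ⟨fun Y => ?_⟩ }⟩
  obtain ⟨X, hX, ⟨e⟩⟩ := hs Y.obj Y.property
  exact ⟨⟨X, hX⟩, ⟨Q.ι.preimageIso e⟩⟩

end Induced

section Squares

variable {p : ℕ} [Fact p.Prime]
  {K : Type u} [Field K] [Algebra ℚ_[p] K] [Algebra ℤ_[p] K]
  [IsScalarTower ℤ_[p] ℚ_[p] K] [FiniteDimensional ℚ_[p] K]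
  {K' : Type u} [Field K'] [Algebra ℚ_[p] K'] [Algebra ℤ_[p] K']
  [IsScalarTower ℤ_[p] ℚ_[p] K'] [FiniteDimensional ℚ_[p] K']
  [Algebra K K'] [IsScalarTower ℤ_[p] K K']
  {L' : Type u} [Field L'] [Algebra ℚ_[p] L'] [Algebra ℤ_[p] L']
  [IsScalarTower ℤ_[p] ℚ_[p] L'] [FiniteDimensional ℚ_[p] L']
  [Algebra K L'] [IsScalarTower ℤ_[p] K L'] [Algebra K' L'] [IsScalarTower ℤ_[p] K' L']
  [IsScalarTower K K' L'] [Normal K K']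
  {ϖ : TameUniformiser p K K'} {ϖ' : TameUniformiser p K L'} (hϖ : ϖ.Compatible ϖ')
  {A B : Type u} [CommRing A] [Algebra ℤ_[p] A] [CommRing B] [Algebra ℤ_[p] B]

theorem oRingCoeff_oRingExt (f : A →ₐ[ℤ_[p]] B) (r : (oRing p K K' A).carrier) :
    (oRingCoeff K L' f).toRingHom ((oRingExt K K' L' A).toRingHom r) =
      (oRingExt K K' L' B).toRingHom ((oRingCoeff K K' f).toRingHom r) :=
  (tensMap_square (f := AlgHom.id ℤ_[p] (OInt p K')) (k := OInt.map (extHom p K' L'))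
    (f' := OInt.map (extHom p K' L')) (k' := AlgHom.id ℤ_[p] (OInt p L')) rfl r).symm

theorem TameUniformiser.Compatible.sRingCoeff_sRingExt (f : A →ₐ[ℤ_[p]] B)
    (r : (ϖ.sRing A).carrier) :
    (ϖ'.sRingCoeff f).toRingHom ((hϖ.sRingExt A).toRingHom r) =
      (hϖ.sRingExt B).toRingHom ((ϖ.sRingCoeff f).toRingHom r) := by
  refine (PowerSeries.twist_twist r).trans (Eq.trans ?_ (PowerSeries.twist_twist r).symm)
  refine PowerSeries.twist_congr ?_ ?_ (mul_comm _ _) r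
  · exact RingHom.ext fun r => (tensMap_square (f := AlgHom.id ℤ_[p] (WInt p K'))
      (k := WInt.map (extHom p K' L')) (f' := WInt.map (extHom p K' L'))
      (k' := AlgHom.id ℤ_[p] (WInt p L')) rfl r).symm
  · exact PowerSeries.twist_one_aux _ _ _ _

theorem TameUniformiser.Compatible.modE_sRingExt (hA : IsNilpotent (p : A))
    (r : (ϖ.sRing A).carrier) :
    (ϖ'.modE A hA).toRingHom ((hϖ.sRingExt A).toRingHom r) =
      (oRingExt K K' L' A).toRingHom ((ϖ.modE A hA).toRingHom r) := by
  refine PowerSeries.evalNil_twist (ha := ϖ.isNilpotent_pi A hA) (ha' := ϖ'.isNilpotent_pi A hA)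
    (fun r => tensMap_square (AlgHom.ext (OInt.map_ofWitt (extHom p K' L'))) r) ?_ r
  refine (tensMap_tmul_one _ _ _).trans ?_
  have hϖ' : ϖ'.pi ^ ramIdx p K' L' = OInt.map (extHom p K' L') ϖ.pi := hϖ
  rw [map_one, one_mul, ← tmul_one_pow, hϖ']

theorem TameUniformiser.Compatible.modU_sRingExt (r : (ϖ.sRing A).carrier) :
    (ϖ'.modU A).toRingHom ((hϖ.sRingExt A).toRingHom r) =
      tensMap (WInt.map (extHom p K' L')) (AlgHom.id ℤ_[p] A) ((ϖ.modU A).toRingHom r) :=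
  PowerSeries.constantCoeff_twist _ _ _ _ r

variable [IsGalois K L'] [FiniteDimensional K L'] (hdeg : ¬ p ∣ Module.finrank K' L')

include hdeg

theorem nonempty_oRing_retraction (A : Type u) [CommRing A] [Algebra ℤ_[p] A] :
    Nonempty (GRing.Retraction (oRingExt (p := p) K K' L' A)) := by
  obtain ⟨t, h1, h2, h3⟩ := OInt.exists_trace (p := p) (K := K) (K' := K') (L' := L') hdeg
  obtain ⟨T, _⟩ := exists_oRing_retraction hdeg A h1 h2 h3
  exact ⟨T⟩

theorem inducesFullyFaithful_Mloc {π : OInt p K'}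
    (hπ : Ideal.span {π} = IsLocalRing.maximalIdeal (OInt p K')) (d : ℕ) :
    InducesFullyFaithful (FilModule.baseChange (oRingExt K K' L' A))
      (Mloc p K K' A d) (Mloc p K L' A d) := by
  obtain ⟨t⟩ := nonempty_oRing_retraction (p := p) (K := K) (K' := K') (L' := L') hdeg A
  have := FilModule.full_baseChange t galRes_surjective
  have := FilModule.faithful_baseChange t
  exact InducesFullyFaithful.of_full fun L hL => FilModule.IsLM.baseChange hπ hL

include hϖ in
theorem TameUniformiser.Compatible.full_faithful (A : Type u) [CommRing A] [Algebra ℤ_[p] A] :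
    (PhiModule.baseChange (hϖ.sRingExt A)).Full ∧
      (PhiModule.baseChange (hϖ.sRingExt A)).Faithful := by
  obtain ⟨t⟩ := hϖ.exists_sRing_retraction hdeg A
  exact ⟨PhiModule.full_baseChange t galRes_surjective, PhiModule.faithful_baseChange t⟩

omit [IsGalois K L'] [FiniteDimensional K L'] hdeg in
theorem TameUniformiser.Compatible.isBK_baseChange (hA : IsNilpotent (p : A)) {d h : ℕ}
    {M : PhiModule (ϖ.sRing A)} (hM : ϖ.IsBK d h M) :
    ϖ'.IsBK d h (M.baseChangeObj (hϖ.sRingExt A)) :=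
  PhiModule.IsKisin.baseChange (E := ϖ.eisensteinS A) (E' := ϖ'.eisensteinS A) (v := 1)
    (hϖ.sRingExt A) hM (ϖ.eq_zero_of_eisensteinS_mul hA)
    (by rw [one_mul, hϖ.sRingExt_eisensteinS A])

theorem TameUniformiser.Compatible.isBK_of_baseChange {d h : ℕ}
    {M : PhiModule (ϖ.sRing A)} (h1 : Module.Finite (ϖ.sRing A).carrier M.carrier)
    (h2 : Module.Projective (ϖ.sRing A).carrier M.carrier)
    (hM : ϖ'.IsBK d h (M.baseChangeObj (hϖ.sRingExt A))) : ϖ.IsBK d h M := by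
  obtain ⟨t⟩ := hϖ.exists_sRing_retraction hdeg A
  exact PhiModule.IsKisin.of_baseChange (E := ϖ.eisensteinS A) (E' := ϖ'.eisensteinS A) (v := 1)
    (hϖ.sRingExt A) t hM isUnit_one (by rw [one_mul, hϖ.sRingExt_eisensteinS A])

end Squares

section Separability

instance finite_ringHom {k l : Type*} [NonAssocSemiring k] [NonAssocSemiring l] [Finite k]
    [Finite l] : Finite (k →+* l) :=
  Finite.of_injective (fun f : k →+* l => (f : k → l)) DFunLike.coe_injective

namespace WittVector

variable {p : ℕ} [Fact p.Prime] {k : Type u} [Field k] [CharP k p] [Finite k]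

/-- The character `r ↦ [r / γ(r)]` of the multiplicative group. -/
noncomputable def teichDiv (γ : k →+* k) : kˣ →* WittVector p k where
  toFun r := teichmuller p (r : k) * teichmuller p (γ (r⁻¹ : kˣ))
  map_one' := by simp
  map_mul' r s := by
    simp only [mul_inv, Units.val_mul, map_mul]
    ring

theorem teichDiv_eq_one_iff (γ : k →+* k) :
    teichDiv (p := p) γ = 1 ↔ γ = RingHom.id k := by
  constructor
  · intro h
    ext x
    by_cases hx : x = 0
    · rw [hx, map_zero, map_zero]
    have h1 := congrArg (fun w => coeff w 0) (DFunLike.congr_fun h (Units.mk0 x hx))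
    have h2 : x * γ x⁻¹ = 1 := by
      simpa [teichDiv, mul_coeff_zero, teichmuller_coeff_zero, one_coeff_zero] using h1
    have h3 : γ x ≠ 0 := (map_ne_zero γ).2 hx
    rw [map_inv₀] at h2
    field_simp at h2
    exact h2.symm
  · rintro rfl
    ext r
    simp only [teichDiv, MonoidHom.coe_mk, OneHom.coe_mk, RingHom.id_apply, MonoidHom.one_apply]
    rw [← map_mul, Units.mul_inv, map_one]

theorem sum_teichDiv [Fintype k] [DecidableEq k] (γ : k →+* k) [Decidable (γ = RingHom.id k)] :
    ∑ r : kˣ, teichmuller p (r : k) * mapAlg p γ (teichmuller p ((r⁻¹ : kˣ) : k)) =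
      if γ = RingHom.id k then ((Fintype.card kˣ : ℕ) : WittVector p k) else 0 := by
  classical
  have h := sum_hom_units (teichDiv (p := p) γ)
  simp only [teichDiv_eq_one_iff] at h
  rw [← Nat.cast_zero, ← Nat.cast_ite]
  convert h using 1
  · refine Finset.sum_congr rfl fun r _ => ?_
    exact congrArg (_ * ·) (mapAlg_teichmuller γ _)

theorem exists_algebraMap_of_frobenius {w : WittVector p k}
    (hw : ∀ i, w.coeff i ^ p = w.coeff i) : ∃ a : ℤ_[p], algebraMap ℤ_[p] (WittVector p k) a = w := by
  have h : ∀ i, ∃ a : ZMod p, ZMod.castHom (dvd_refl p) k a = w.coeff i := fun i => by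
    have := (Subfield.mem_bot_iff_pow_eq_self (F := k) (p := p)).2 (hw i)
    rw [← ZMod.fieldRange_castHom_eq_bot p] at this
    exact this
  choose a ha using h
  refine ⟨WittVector.equiv p (mk p a), ?_⟩
  change WittVector.map _ ((WittVector.equiv p).symm (WittVector.equiv p (mk p a))) = w
  rw [RingEquiv.symm_apply_apply]
  ext i
  exact ha i

theorem span_range_teichmuller [Module.Finite ℤ_[p] (WittVector p k)] :
    Submodule.span ℤ_[p] (Set.range fun r : kˣ => teichmuller p (r : k)) = ⊤ := by
  rw [eq_top_iff]
  refine Submodule.le_of_le_smul_of_le_jacobson_bot (I := IsLocalRing.maximalIdeal ℤ_[p])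
    Module.Finite.fg_top (IsLocalRing.maximalIdeal_le_jacobson _) fun w _ => ?_
  have h0 : (w - teichmuller p (w.coeff 0)).coeff 0 = 0 := by
    have : constantCoeff (w - teichmuller p (w.coeff 0)) = 0 := by
      rw [map_sub]
      exact sub_eq_zero.2 (teichmuller_coeff_zero p _).symm
    exact this
  obtain ⟨z, hz⟩ := Ideal.mem_span_singleton.1 ((mem_span_p_iff_coeff_zero_eq_zero _).2 h0)
  refine Submodule.mem_sup.2 ⟨teichmuller p (w.coeff 0), ?_, w - teichmuller p (w.coeff 0), ?_,
    by ring⟩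
  · by_cases h : w.coeff 0 = 0
    · rw [h, teichmuller_zero]
      exact zero_mem _
    · exact Submodule.subset_span ⟨Units.mk0 _ h, rfl⟩
  · have h2 : w - teichmuller p (w.coeff 0) = (p : ℤ_[p]) • z := by
      rw [hz, Algebra.smul_def, map_natCast]
    rw [h2]
    refine Submodule.smul_mem_smul ?_ trivial
    rw [PadicInt.maximalIdeal_eq_span_p]
    exact Ideal.mem_span_singleton_self _

/-- The separability idempotent of `W(k)` over `ℤ_p`, for a finite field `k`. -/
theorem exists_separability [Module.Finite ℤ_[p] (WittVector p k)] :
    ∃ (s : Finset kˣ) (x y : kˣ → WittVector p k),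
      (∑ i ∈ s, x i * y i = 1) ∧
      (∀ γ : k →+* k, γ ≠ RingHom.id k → ∑ i ∈ s, x i * mapAlg p γ (y i) = 0) ∧
      (∀ w, ∑ i ∈ s, (w * x i) ⊗ₜ[ℤ_[p]] y i = ∑ i ∈ s, x i ⊗ₜ[ℤ_[p]] (w * y i)) ∧
      ∀ w : WittVector p k, ∃ a : ℤ_[p],
        algebraMap ℤ_[p] _ a = ∑ᶠ γ : k →+* k, mapAlg p γ w := by
  classical
  have := Fintype.ofFinite k
  have hn : ¬ p ∣ Fintype.card kˣ := by
    intro h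
    rw [← CharP.cast_eq_zero_iff k p, Fintype.card_units,
      Nat.cast_sub Fintype.card_pos, FiniteField.cast_card_eq_zero] at h
    simp at h
  obtain ⟨c, hc⟩ := OInt.isUnit_algebraMap_natCast hn
  have hc' : (↑c⁻¹ : ℤ_[p]) * (Fintype.card kˣ : ℤ_[p]) = 1 := by rw [← hc, Units.inv_mul]
  have key : ∀ γ : k →+* k, ∑ i : kˣ, teichmuller p (i : k) *
      mapAlg p γ ((↑c⁻¹ : ℤ_[p]) • teichmuller p ((i⁻¹ : kˣ) : k)) =
        if γ = RingHom.id k then 1 else 0 := fun γ => by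
    simp only [map_smul, mul_smul_comm]
    rw [← Finset.smul_sum, sum_teichDiv]
    split_ifs
    · rw [Algebra.smul_def, ← map_natCast (algebraMap ℤ_[p] (WittVector p k)), ← map_mul, hc',
        map_one]
    · rw [smul_zero]
  refine ⟨Finset.univ, fun r => teichmuller p (r : k),
    fun r => (↑c⁻¹ : ℤ_[p]) • teichmuller p ((r⁻¹ : kˣ) : k), ?_, fun γ hγ => ?_, fun w => ?_,
    fun w => ?_⟩
  · have := key (RingHom.id k)
    rwa [if_pos rfl, mapAlg_id] at this
  · rw [key, if_neg hγ]
  · have hw : w ∈ Submodule.span ℤ_[p] (Set.range fun r : kˣ => teichmuller p (r : k)) := by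
      rw [span_range_teichmuller]
      trivial
    induction hw using Submodule.span_induction with
    | mem w hw =>
      obtain ⟨a, rfl⟩ := hw
      refine Fintype.sum_equiv (Equiv.mulLeft a) _ _ fun r => ?_
      simp only [Equiv.coe_mulLeft, mul_inv, Units.val_mul, map_mul, mul_smul_comm]
      rw [← mul_assoc, ← map_mul _ (a : k) ((a⁻¹ : kˣ) : k), Units.mul_inv, map_one, one_mul]
    | zero => simp
    | add v w _ _ hv hw => simp only [add_mul, TensorProduct.add_tmul, TensorProduct.tmul_add,
        Finset.sum_add_distrib, hv, hw]
    | smul b w _ hw => 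
      simp only [smul_mul_assoc, TensorProduct.tmul_smul, ← TensorProduct.smul_tmul', ← Finset.smul_sum] at hw ⊢
      rw [smul_comm, hw]
  · have : Fintype (k →+* k) := Fintype.ofFinite _
    rw [finsum_eq_sum_of_fintype]
    refine exists_algebraMap_of_frobenius fun i => ?_
    have h1 : mapAlg p (_root_.frobenius k p) (∑ γ : k →+* k, mapAlg p γ w) =
        ∑ γ : k →+* k, mapAlg p γ w := by
      rw [map_sum]
      refine Fintype.sum_bijective (fun γ => (_root_.frobenius k p).comp γ)
        (Finite.injective_iff_bijective.1 fun a b h => ?_) _ _ fun γ => ?_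
      · ext x
        exact (_root_.frobenius k p).injective (RingHom.congr_fun h x)
      · rw [← AlgHom.comp_apply, mapAlg_comp]
    exact congrArg (fun w => coeff w i) h1

end WittVector

end Separability

section Idempotents

variable {p : ℕ} [Fact p.Prime]
  {F : Type u} [Field F] [Algebra ℚ_[p] F] [Algebra ℤ_[p] F]
  [IsScalarTower ℤ_[p] ℚ_[p] F] [FiniteDimensional ℚ_[p] F]
  {A : Type u} [CommRing A] [Algebra ℤ_[p] A] {B : Type u} [CommRing B] [Algebra ℤ_[p] B]

instance WInt.finite : Module.Finite ℤ_[p] (WInt p F) :=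
  Module.Finite.of_injective (OInt.ofWittAlg p F).toLinearMap (OInt.ofWittAlg_injective)

/-- The homomorphism `W(k_F) ⊗ A → A` induced by `s : W(k_F) → A`. -/
noncomputable def wEval (s : WInt p F →ₐ[ℤ_[p]] A) : WCoeff p F A →ₐ[ℤ_[p]] A :=
  Algebra.TensorProduct.productMap s (AlgHom.id ℤ_[p] A)

theorem wEval_tmul (s : WInt p F →ₐ[ℤ_[p]] A) (w : WInt p F) (a : A) :
    wEval s (w ⊗ₜ a) = s w * a := rfl

theorem wEval_tensMap {F₂ : Type u} [Field F₂] [Algebra ℚ_[p] F₂] [Algebra ℤ_[p] F₂]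
    [IsScalarTower ℤ_[p] ℚ_[p] F₂] [FiniteDimensional ℚ_[p] F₂] (s : WInt p F₂ →ₐ[ℤ_[p]] A)
    (f : WInt p F →ₐ[ℤ_[p]] WInt p F₂) (r : WCoeff p F A) :
    wEval s (tensMap f (AlgHom.id ℤ_[p] A) r) = wEval (s.comp f) r := by
  induction r using TensorProduct.induction_on with
  | zero => simp only [map_zero]
  | add r s hr hs => simp only [map_add, hr, hs]
  | tmul w a => rfl

variable (p F) in
/-- The index set of a separability idempotent of `W(k_F)`. -/
noncomputable def sepSet : Finset (ResF p F)ˣ :=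
  (WittVector.exists_separability (p := p) (k := ResF p F)).choose

variable (p F) in
/-- The first components of a separability idempotent of `W(k_F)`. -/
noncomputable def sepX : (ResF p F)ˣ → WInt p F :=
  (WittVector.exists_separability (p := p) (k := ResF p F)).choose_spec.choose

variable (p F) in
/-- The second components of a separability idempotent of `W(k_F)`. -/
noncomputable def sepY : (ResF p F)ˣ → WInt p F :=
  (WittVector.exists_separability (p := p) (k := ResF p F)).choose_spec.choose_spec.choose

theorem sep_sum : ∑ i ∈ sepSet p F, sepX p F i * sepY p F i = 1 :=
  (WittVector.exists_separability (p := p) (k := ResF p F)).choose_spec.choose_spec.choose_spec.1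

theorem sep_sum_mapAlg {γ : ResF p F →+* ResF p F} (hγ : γ ≠ RingHom.id _) :
    ∑ i ∈ sepSet p F, sepX p F i * WittVector.mapAlg p γ (sepY p F i) = 0 :=
  (WittVector.exists_separability
    (p := p) (k := ResF p F)).choose_spec.choose_spec.choose_spec.2.1 γ hγ

theorem sep_mul (w : WInt p F) : ∑ i ∈ sepSet p F, (w * sepX p F i) ⊗ₜ[ℤ_[p]] sepY p F i =
    ∑ i ∈ sepSet p F, sepX p F i ⊗ₜ[ℤ_[p]] (w * sepY p F i) :=
  (WittVector.exists_separability
    (p := p) (k := ResF p F)).choose_spec.choose_spec.choose_spec.2.2.1 w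

theorem sep_trace (w : WInt p F) : ∃ a : ℤ_[p], algebraMap ℤ_[p] (WInt p F) a =
    ∑ᶠ γ : ResF p F →+* ResF p F, WittVector.mapAlg p γ w :=
  (WittVector.exists_separability
    (p := p) (k := ResF p F)).choose_spec.choose_spec.choose_spec.2.2.2 w

/-- The idempotent of `W(k_F) ⊗ A` attached to a homomorphism `s : W(k_F) → A`. -/
noncomputable def wIdem (s : WInt p F →ₐ[ℤ_[p]] A) : WCoeff p F A :=
  ∑ i ∈ sepSet p F, sepX p F i ⊗ₜ s (sepY p F i)

theorem wEval_wIdem (s : WInt p F →ₐ[ℤ_[p]] A) : wEval s (wIdem s) = 1 := by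
  rw [wIdem, map_sum]
  simp only [wEval_tmul, ← map_mul]
  rw [← map_sum, sep_sum, map_one]

theorem tmul_one_mul_wIdem (s : WInt p F →ₐ[ℤ_[p]] A) (w : WInt p F) :
    (w ⊗ₜ 1 : WCoeff p F A) * wIdem s = (1 ⊗ₜ s w) * wIdem s := by
  have h := congrArg (tensMap (AlgHom.id ℤ_[p] (WInt p F)) s) (sep_mul w)
  simp only [map_sum, tensMap_tmul, AlgHom.id_apply, map_mul] at h
  rw [wIdem, Finset.mul_sum, Finset.mul_sum]
  simpa only [Algebra.TensorProduct.tmul_mul_tmul, one_mul] using h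

theorem mul_wIdem (s : WInt p F →ₐ[ℤ_[p]] A) (r : WCoeff p F A) :
    r * wIdem s = (1 ⊗ₜ wEval s r) * wIdem s := by
  induction r using TensorProduct.induction_on with
  | zero => rw [map_zero, TensorProduct.tmul_zero]
  | add r t hr ht => rw [add_mul, hr, ht, map_add, TensorProduct.tmul_add, add_mul]
  | tmul w a =>
    have h : (w ⊗ₜ a : WCoeff p F A) = (1 ⊗ₜ a) * (w ⊗ₜ 1) := by
      rw [Algebra.TensorProduct.tmul_mul_tmul, one_mul, mul_one]
    rw [h, mul_assoc, tmul_one_mul_wIdem, ← mul_assoc, Algebra.TensorProduct.tmul_mul_tmul,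
      one_mul, ← h, wEval_tmul, mul_comm a]

theorem wIdem_mul_self (s : WInt p F →ₐ[ℤ_[p]] A) : wIdem s * wIdem s = wIdem s := by
  rw [mul_wIdem, wEval_wIdem]
  exact one_mul _

theorem tensMap_wIdem (f : A →ₐ[ℤ_[p]] B) (s : WInt p F →ₐ[ℤ_[p]] A) :
    tensMap (AlgHom.id ℤ_[p] (WInt p F)) f (wIdem s) = wIdem (f.comp s) := by
  rw [wIdem, map_sum]
  rfl

theorem eq_of_wEval_wIdem_ne_zero [IsDomain A] {s t : WInt p F →ₐ[ℤ_[p]] A}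
    (h : wEval s (wIdem t) ≠ 0) : s = t := by
  ext w
  have h1 := congrArg (wEval s) (tmul_one_mul_wIdem t w)
  rw [map_mul, map_mul, wEval_tmul, wEval_tmul, map_one, mul_one, one_mul] at h1
  exact mul_right_cancel₀ h h1

theorem sum_wIdem (s : WInt p F →ₐ[ℤ_[p]] A) :
    ∑ᶠ γ : ResF p F →+* ResF p F, wIdem (s.comp (WittVector.mapAlg p γ)) = 1 := by
  classical
  have : Fintype (ResF p F →+* ResF p F) := Fintype.ofFinite _
  rw [finsum_eq_sum_of_fintype]
  have h : ∀ i, ∃ a : ℤ_[p], algebraMap ℤ_[p] (WInt p F) a =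
      ∑ γ : ResF p F →+* ResF p F, WittVector.mapAlg p γ (sepY p F i) := fun i => by
    obtain ⟨a, ha⟩ := sep_trace (sepY p F i)
    exact ⟨a, by rw [ha, finsum_eq_sum_of_fintype]⟩
  choose a ha using h
  simp only [wIdem]
  rw [Finset.sum_comm]
  have h1 : ∀ i ∈ sepSet p F, ∑ γ : ResF p F →+* ResF p F,
      sepX p F i ⊗ₜ[ℤ_[p]] (s.comp (WittVector.mapAlg p γ)) (sepY p F i) =
        (∑ γ : ResF p F →+* ResF p F, sepX p F i * WittVector.mapAlg p γ (sepY p F i)) ⊗ₜ 1 := by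
    intro i _
    rw [← TensorProduct.tmul_sum, ← Finset.mul_sum, ← ha]
    simp only [AlgHom.comp_apply]
    rw [← map_sum, ← ha, AlgHom.commutes, Algebra.algebraMap_eq_smul_one,
      Algebra.algebraMap_eq_smul_one, ← TensorProduct.smul_tmul, mul_smul_comm, mul_one]
  rw [Finset.sum_congr rfl h1, ← TensorProduct.sum_tmul, Finset.sum_comm,
    Finset.sum_eq_single (RingHom.id _)]
  · rw [WittVector.mapAlg_id]
    simp only [AlgHom.id_apply]
    rw [sep_sum]
    rfl
  · intro γ _ hγ
    exact sep_sum_mapAlg hγ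
  · intro h
    exact absurd (Finset.mem_univ _) h

theorem eq_one_of_mul_wIdem {M : Type*} [AddCommGroup M] [Module (WCoeff p F A) M]
    (s : WInt p F →ₐ[ℤ_[p]] A) {x : M}
    (hx : ∀ γ : ResF p F →+* ResF p F, wIdem (s.comp (WittVector.mapAlg p γ)) • x = 0) :
    x = 0 := by
  have : Fintype (ResF p F →+* ResF p F) := Fintype.ofFinite _
  have h := sum_wIdem s
  rw [finsum_eq_sum_of_fintype] at h
  rw [← one_smul (WCoeff p F A) x, ← h, Finset.sum_smul]
  exact Finset.sum_eq_zero fun γ _ => hx γ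

section Galois

variable {K : Type u} [Field K] [Algebra ℚ_[p] K] [Algebra ℤ_[p] K]
  [IsScalarTower ℤ_[p] ℚ_[p] K] [FiniteDimensional ℚ_[p] K]
  {K' : Type u} [Field K'] [Algebra ℚ_[p] K'] [Algebra ℤ_[p] K']
  [IsScalarTower ℤ_[p] ℚ_[p] K'] [FiniteDimensional ℚ_[p] K']
  [Algebra K K'] [IsScalarTower ℤ_[p] K K']

theorem sum_sep_act_of_mem {g : K' ≃ₐ[K] K'} (hg : g ∈ inertiaSubgroup p K K') :
    ∑ i ∈ sepSet p K', sepX p K' i * WInt.map (galHom p g) (sepY p K' i) = 1 := by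
  simp only [WInt.map_of_mem_inertia hg]
  exact sep_sum

theorem sum_sep_act_of_notMem {g : K' ≃ₐ[K] K'} (hg : g ∉ inertiaSubgroup p K K') :
    ∑ i ∈ sepSet p K', sepX p K' i * WInt.map (galHom p g) (sepY p K' i) = 0 :=
  sep_sum_mapAlg hg

theorem wIdem_act_of_mem {g : K' ≃ₐ[K] K'} (hg : g ∈ inertiaSubgroup p K K')
    (s : WInt p K' →ₐ[ℤ_[p]] A) :
    tensMap (WInt.map (galHom p g)) (AlgHom.id ℤ_[p] A) (wIdem s) = wIdem s := by
  rw [wIdem, map_sum]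
  simp only [tensMap_tmul, WInt.map_of_mem_inertia hg]
  rfl

theorem wEval_act_wIdem_of_notMem {g : K' ≃ₐ[K] K'} (hg : g ∉ inertiaSubgroup p K K')
    (s : WInt p K' →ₐ[ℤ_[p]] A) :
    wEval s (tensMap (WInt.map (galHom p g)) (AlgHom.id ℤ_[p] A) (wIdem s)) = 0 := by
  have hg' : g⁻¹ ∉ inertiaSubgroup p K K' := fun h => hg (by simpa using inv_mem h)
  have h := congrArg (fun w => s (WInt.map (galHom p g) w)) (sum_sep_act_of_notMem hg')
  simp only [map_sum, map_mul, map_zero] at h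
  rw [wIdem, map_sum, map_sum]
  simp only [tensMap_tmul, wEval_tmul, AlgHom.id_apply]
  refine Eq.trans (Finset.sum_congr rfl fun i _ => ?_) h
  have h2 : WInt.map (galHom p g) (WInt.map (galHom p g⁻¹) (sepY p K' i)) = sepY p K' i := by
    rw [← AlgHom.comp_apply, ← WInt.map_comp, ← galHom_mul, mul_inv_cancel, galHom_one,
      WInt.map_id]
    rfl
  rw [h2]

theorem wIdem_mul_act_of_notMem {g : K' ≃ₐ[K] K'} (hg : g ∉ inertiaSubgroup p K K')
    (s : WInt p K' →ₐ[ℤ_[p]] A) :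
    tensMap (WInt.map (galHom p g)) (AlgHom.id ℤ_[p] A) (wIdem s) * wIdem s = 0 := by
  rw [mul_wIdem, wEval_act_wIdem_of_notMem hg, TensorProduct.tmul_zero, zero_mul]

variable {L' : Type u} [Field L'] [Algebra ℚ_[p] L'] [Algebra ℤ_[p] L']
  [IsScalarTower ℤ_[p] ℚ_[p] L'] [FiniteDimensional ℚ_[p] L']
  [Algebra K L'] [IsScalarTower ℤ_[p] K L'] [Algebra K' L'] [IsScalarTower ℤ_[p] K' L']
  [IsScalarTower K K' L'] [Normal K K'] [FiniteDimensional K L']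

variable (p K K' L') in
/-- The inertia subgroup of `Gal(L'/K')`, as a finite set of elements of `Gal(L'/K)`. -/
noncomputable def relInertia : Finset (L' ≃ₐ[K] L') :=
  open Classical in (galRes K K' L').kerFinset.filter (· ∈ inertiaSubgroup p K L')

end Galois

end Idempotents

section RelativeInertia

variable {p : ℕ} [Fact p.Prime]
  {K : Type u} [Field K] [Algebra ℚ_[p] K] [Algebra ℤ_[p] K]
  [IsScalarTower ℤ_[p] ℚ_[p] K] [FiniteDimensional ℚ_[p] K]
  {K' : Type u} [Field K'] [Algebra ℚ_[p] K'] [Algebra ℤ_[p] K']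
  [IsScalarTower ℤ_[p] ℚ_[p] K'] [FiniteDimensional ℚ_[p] K']
  [Algebra K K'] [IsScalarTower ℤ_[p] K K']
  {L' : Type u} [Field L'] [Algebra ℚ_[p] L'] [Algebra ℤ_[p] L']
  [IsScalarTower ℤ_[p] ℚ_[p] L'] [FiniteDimensional ℚ_[p] L']
  [Algebra K L'] [IsScalarTower ℤ_[p] K L'] [Algebra K' L'] [IsScalarTower ℤ_[p] K' L']
  [IsScalarTower K K' L'] [Normal K K'] [FiniteDimensional K L']
  {A : Type u} [CommRing A] [Algebra ℤ_[p] A]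

theorem mem_relInertia {g : L' ≃ₐ[K] L'} : g ∈ relInertia p K K' L' ↔
    galRes K K' L' g = 1 ∧ g ∈ inertiaSubgroup p K L' := by
  classical rw [relInertia, Finset.mem_filter, MonoidHom.mem_kerFinset]

theorem card_relInertia :
    (relInertia p K K' L').card = Nat.card ((galRes K K' L').ker ⊓ inertiaSubgroup p K L' :
      Subgroup (L' ≃ₐ[K] L')) := by
  rw [← Set.ncard_coe_finset, ← Nat.card_coe_set_eq]
  congr 2
  ext g
  exact mem_relInertia

theorem sum_relInertia {M : Type*} [AddCommMonoid M] (F G : (L' ≃ₐ[K] L') → M)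
    (h1 : ∀ g ∈ relInertia p K K' L', F g = G g)
    (h2 : ∀ g, g ∉ inertiaSubgroup p K L' → F g = 0) :
    ∑ h ∈ (galRes K K' L').kerFinset, F h = ∑ h ∈ relInertia p K K' L', G h := by
  classical
  rw [← Finset.sum_congr rfl h1]
  refine (Finset.sum_subset (fun g hg => MonoidHom.mem_kerFinset.2 (mem_relInertia.1 hg).1)
    fun g hg hg' => h2 g fun h => hg' (mem_relInertia.2 ⟨MonoidHom.mem_kerFinset.1 hg, h⟩)).symm

theorem sum_wEval_act_wIdem (s : WInt p L' →ₐ[ℤ_[p]] A) :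
    ∑ h ∈ (galRes K K' L').kerFinset,
      wEval s (tensMap (WInt.map (galHom p h)) (AlgHom.id ℤ_[p] A) (wIdem s)) =
        (relInertia p K K' L').card := by
  rw [sum_relInertia (p := p) (G := fun _ => 1), Finset.sum_const, nsmul_one]
  · intro g hg
    rw [wIdem_act_of_mem (mem_relInertia.1 hg).2, wEval_wIdem]
  · intro g hg
    exact wEval_act_wIdem_of_notMem hg s

variable [IsGalois K L'] (hdeg : ¬ p ∣ Module.finrank K' L')

include hdeg

variable (K) in
theorem isUnit_card_relInertia (B : Type*) [CommRing B] [Algebra ℤ_[p] B] :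
    IsUnit ((relInertia p K K' L').card : B) := by
  have h : (relInertia p K K' L').card ∣ Module.finrank K' L' := by
    rw [card_relInertia, ← card_ker_galRes (K := K)]
    exact Subgroup.card_dvd_of_le inf_le_left
  have := (OInt.isUnit_algebraMap_natCast (p := p)
    fun h2 => hdeg (h2.trans h)).map (algebraMap ℤ_[p] B)
  rwa [map_natCast] at this

theorem exists_comp_act_eq [IsDomain A] {s s' : WInt p L' →ₐ[ℤ_[p]] A}
    (h : s.comp (WInt.map (extHom p K' L')) = s'.comp (WInt.map (extHom p K' L'))) :
    ∃ g : L' ≃ₐ[K] L', galRes K K' L' g = 1 ∧ s'.comp (WInt.map (galHom p g)) = s := by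
  obtain ⟨t, -, -, h3⟩ := WInt.exists_trace (p := p) (K := K) (K' := K') (L' := L') hdeg
  have h4 := natCast_mul_tensMap_rTensor (A := A) h3 (wIdem s)
  have h5 := congrArg (wEval s) h4
  have h6 := congrArg (wEval s') h4
  rw [map_mul, map_natCast, wEval_tensMap, map_sum] at h5 h6
  rw [← h, h5, sum_wEval_act_wIdem] at h6
  by_contra hne
  push Not at hne
  refine (isUnit_card_relInertia (p := p) K hdeg A).ne_zero (h6.trans ?_)
  refine Finset.sum_eq_zero fun g hg => ?_
  rw [wEval_tensMap]
  by_contra h7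
  exact hne g (MonoidHom.mem_kerFinset.1 hg) (eq_of_wEval_wIdem_ne_zero h7)

theorem inertiaRes_surjective : Function.Surjective (inertiaRes p K K' L') := by
  rintro ⟨g, hg⟩
  obtain ⟨g', rfl⟩ := galRes_surjective (L' := L') g
  have h : (OInt.ofWittAlg p L').comp (WInt.map (extHom p K' L')) =
      ((OInt.ofWittAlg p L').comp (WInt.map (galHom p g'))).comp (WInt.map (extHom p K' L')) := by
    rw [AlgHom.comp_assoc, ← WInt.map_comp, galHom_comp_extHom, WInt.map_comp]
    ext w
    simp only [AlgHom.comp_apply]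
    rw [WInt.map_of_mem_inertia hg]
  obtain ⟨k, hk, hk'⟩ := exists_comp_act_eq (K := K) hdeg h
  have hmem : g' * k ∈ inertiaSubgroup p K L' := by
    refine RingHom.ext fun x => ?_
    have h2 := DFunLike.congr_fun hk' (WittVector.teichmuller p x)
    rw [AlgHom.comp_assoc, ← WInt.map_comp, ← galHom_mul] at h2
    have h3 := OInt.ofWittAlg_injective h2
    have h4 := congrArg (fun w => WittVector.coeff w 0) h3
    have h5 : ResF.map (galHom p (g' * k)) ((WittVector.teichmuller p x).coeff 0) =
        (WittVector.teichmuller p x).coeff 0 := h4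
    rwa [WittVector.teichmuller_coeff_zero] at h5
  refine ⟨⟨g' * k, hmem⟩, Subtype.ext ?_⟩
  change galRes K K' L' (g' * k) = _
  rw [map_mul, hk, mul_one]

variable (K) in
include K in
theorem exists_comp_extHom_eq [IsDomain A] (s : WInt p L' →ₐ[ℤ_[p]] A)
    (σ : WInt p K' →ₐ[ℤ_[p]] A) :
    ∃ s' : WInt p L' →ₐ[ℤ_[p]] A, s'.comp (WInt.map (extHom p K' L')) = σ := by
  obtain ⟨t, h1, h2, -⟩ := WInt.exists_trace (p := p) (K := K) (K' := K') (L' := L') hdeg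
  by_contra hne
  push Not at hne
  have h3 : tensMap (WInt.map (extHom p K' L')) (AlgHom.id ℤ_[p] A) (wIdem σ) = 0 := by
    refine eq_one_of_mul_wIdem s fun γ => ?_
    rw [smul_eq_mul, mul_comm, mul_wIdem, wEval_tensMap]
    have : wEval ((s.comp (WittVector.mapAlg p γ)).comp (WInt.map (extHom p K' L'))) (wIdem σ) = 0 := by
      by_contra h4
      exact hne _ (eq_of_wEval_wIdem_ne_zero h4)
    rw [this, TensorProduct.tmul_zero, zero_mul]
  have h4 := rTensor_tensMap_mul (A := A) h1 (wIdem σ) 1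
  rw [h3, zero_mul, map_zero, Algebra.TensorProduct.one_def, LinearMap.rTensor_tmul, h2,
    ← Algebra.TensorProduct.one_def, mul_one] at h4
  have h5 := wEval_wIdem σ
  rw [← h4, map_zero] at h5
  exact zero_ne_one h5

end RelativeInertia

section LocallyIsomorphic

variable {A X X' Y I I' : Type u} [CommRing A] [AddCommGroup X] [Module A X] [AddCommGroup X']
  [Module A X'] [AddCommGroup Y] [Module A Y]

theorem LocalizedModule.map_apply_mk (S : Submonoid A) (f : X →ₗ[A] Y) (x : X) (s : S) :
    LocalizedModule.map S f (LocalizedModule.mk x s) = LocalizedModule.mk (f x) s :=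
  IsLocalizedModule.map_LocalizedModules S f x s

/-- The localisation of a linear equivalence. -/
noncomputable def LocalizedModule.mapEquiv (S : Submonoid A) (e : X ≃ₗ[A] Y) :
    LocalizedModule S X ≃ₗ[Localization S] LocalizedModule S Y :=
  LinearEquiv.ofLinearMap (LocalizedModule.map S e.toLinearMap)
    (LocalizedModule.map S e.symm.toLinearMap)
    (LinearMap.ext fun x => by
      induction x using LocalizedModule.induction_on with
      | h m s => simp)
    (LinearMap.ext fun x => by
      induction x using LocalizedModule.induction_on with
      | h m s => simp)

theorem LocalizedModule.mapEquiv_map (S : Submonoid A) (e : X ≃ₗ[A] Y) (a : Module.End A X)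
    (b : Module.End A Y) (h : ∀ x, e (a x) = b (e x)) (x : LocalizedModule S X) :
    LocalizedModule.mapEquiv S e (LocalizedModule.map S a x) =
      LocalizedModule.map S b (LocalizedModule.mapEquiv S e x) := by
  induction x using LocalizedModule.induction_on with
  | h m s =>
    change LocalizedModule.map S e.toLinearMap (LocalizedModule.map S a _) =
      LocalizedModule.map S b (LocalizedModule.map S e.toLinearMap _)
    simp only [LocalizedModule.map_apply_mk, LinearEquiv.coe_coe, h]

theorem LocallyIsomorphic.congr {a : I → Module.End A X} {a' : I → Module.End A X'}
    {b : I → Module.End A Y} (h : LocallyIsomorphic a b) (e : X ≃ₗ[A] X')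
    (he : ∀ i x, e (a i x) = a' i (e x)) : LocallyIsomorphic a' b := by
  obtain ⟨s, hs, h⟩ := h
  refine ⟨s, hs, fun f hf => ?_⟩
  obtain ⟨e1, he1⟩ := h f hf
  refine ⟨(LocalizedModule.mapEquiv _ e).symm.trans e1, fun g x => ?_⟩
  rw [LinearEquiv.trans_apply, LinearEquiv.trans_apply, ← he1]
  congr 1
  rw [LinearEquiv.symm_apply_eq, LocalizedModule.mapEquiv_map _ _ _ _ (he g),
    LinearEquiv.apply_symm_apply]

theorem LocallyIsomorphic.comp {a : I → Module.End A X} {b : I → Module.End A Y}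
    (h : LocallyIsomorphic a b) (φ : I' → I) :
    LocallyIsomorphic (fun i => a (φ i)) (fun i => b (φ i)) := by
  obtain ⟨s, hs, h⟩ := h
  exact ⟨s, hs, fun f hf => (h f hf).imp fun e he g => he (φ g)⟩

theorem LocallyIsomorphic.of_comp {a : I → Module.End A X} {b : I → Module.End A Y} {φ : I' → I}
    (hφ : Function.Surjective φ)
    (h : LocallyIsomorphic (fun i => a (φ i)) (fun i => b (φ i))) : LocallyIsomorphic a b := by
  obtain ⟨s, hs, h⟩ := h
  refine ⟨s, hs, fun f hf => (h f hf).imp fun e he g => ?_⟩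
  obtain ⟨g, rfl⟩ := hφ g
  exact he g

theorem LocallyIsomorphic.apply_eq_self {a : I → Module.End A X} {b : I → Module.End A Y}
    (h : LocallyIsomorphic a b) {i : I} (hi : b i = 1) (x : X) : a i x = x := by
  obtain ⟨s, hs, h⟩ := h
  rw [← sub_eq_zero, ← Submodule.mem_bot A]
  refine Submodule.mem_of_span_eq_top_of_smul_pow_mem _ s hs _ fun ⟨f, hf⟩ => ?_
  obtain ⟨e, he⟩ := h f hf
  have h1 := he i (LocalizedModule.mk x 1)
  have h2 : ∀ y, LocalizedModule.map (Submonoid.powers f) (b i) y = y := fun y => by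
    induction y using LocalizedModule.induction_on with
    | h m s => rw [hi, LocalizedModule.map_apply_mk, Module.End.one_apply]
  rw [h2, EmbeddingLike.apply_eq_iff_eq, LocalizedModule.map_apply_mk, LocalizedModule.mk_eq] at h1
  obtain ⟨⟨_, n, rfl⟩, hu⟩ := h1
  refine ⟨n, ?_⟩
  rw [Submodule.mem_bot, smul_sub, sub_eq_zero]
  rw [one_smul, one_smul] at hu
  exact hu

end LocallyIsomorphic

section Component

variable {p : ℕ} [Fact p.Prime]
  {K : Type u} [Field K] [Algebra ℚ_[p] K] [Algebra ℤ_[p] K]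
  [IsScalarTower ℤ_[p] ℚ_[p] K] [FiniteDimensional ℚ_[p] K]
  {K' : Type u} [Field K'] [Algebra ℚ_[p] K'] [Algebra ℤ_[p] K']
  [IsScalarTower ℤ_[p] ℚ_[p] K'] [FiniteDimensional ℚ_[p] K']
  [Algebra K K'] [IsScalarTower ℤ_[p] K K']
  {E : Type u} [Field E] [Algebra ℚ_[p] E] [Algebra ℤ_[p] E]
  [IsScalarTower ℤ_[p] ℚ_[p] E] [FiniteDimensional ℚ_[p] E]
  {A : Type u} [CommRing A] [Algebra ℤ_[p] A] [Algebra (OInt p E) A]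
  [IsScalarTower ℤ_[p] (OInt p E) A]

/-- A homomorphism `W(k') → O_E` as a map of `ℤ_p`-algebras. -/
noncomputable def wittAlgHom (σ : WInt p K' →+* OInt p E) : WInt p K' →ₐ[ℤ_[p]] OInt p E where
  __ := σ
  commutes' x := RingHom.congr_fun (OInt.padicInt_hom_ext p E
    (σ.comp (algebraMap ℤ_[p] (WInt p K'))) (algebraMap ℤ_[p] (OInt p E))) x

variable (A) in
/-- The homomorphism `W(k') → A` induced by a homomorphism `W(k') → O_E`. -/
noncomputable def wittCoeff (σ : WInt p K' →+* OInt p E) : WInt p K' →ₐ[ℤ_[p]] A :=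
  (IsScalarTower.toAlgHom ℤ_[p] (OInt p E) A).comp (wittAlgHom σ)

theorem wittCoeff_apply (σ : WInt p K' →+* OInt p E) (w : WInt p K') :
    wittCoeff A σ w = algebraMap (OInt p E) A (σ w) := rfl

theorem wRing.ofWitt_mul_wIdem (σ : WInt p K' →+* OInt p E) (w : WInt p K') :
    wRing.ofWitt p K K' A w * wIdem (wittCoeff A σ) =
      wRing.ofCoeff p K K' A (algebraMap (OInt p E) A (σ w)) * wIdem (wittCoeff A σ) :=
  tmul_one_mul_wIdem (wittCoeff A σ) w

theorem GModule.wIdem_smul_mem_component (D : GModule (wRing p K K' A))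
    (σ : WInt p K' →+* OInt p E) (x : D.carrier) :
    RestrictAlong.val.symm ((wIdem (wittCoeff A σ) : (wRing p K K' A).carrier) • x) ∈
      D.component σ := by
  intro w
  rw [AddEquiv.apply_symm_apply, smul_smul, smul_smul]
  exact congrArg (· • x) (wRing.ofWitt_mul_wIdem (K := K) σ w)

theorem GModule.smul_of_mem_component (D : GModule (wRing p K K' A))
    {σ : WInt p K' →+* OInt p E} {x : RestrictAlong (wRing.ofCoeff p K K' A) D.carrier}
    (hx : x ∈ D.component σ) (r : (wRing p K K' A).carrier) :
    r • RestrictAlong.val x = wRing.ofCoeff p K K' A (wEval (wittCoeff A σ) r) •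
      RestrictAlong.val x := by
  induction r using TensorProduct.induction_on with
  | zero => rw [map_zero, map_zero, zero_smul]
  | add r t hr ht =>
    rw [map_add, map_add, add_smul, add_smul, hr, ht]
  | tmul w a =>
    have h : (w ⊗ₜ a : WCoeff p K' A) = wRing.ofCoeff p K K' A a * wRing.ofWitt p K K' A w := by
      refine Eq.trans ?_ (Algebra.TensorProduct.tmul_mul_tmul _ _ _ _).symm
      rw [one_mul, mul_one]
    rw [wEval_tmul, mul_comm, map_mul, mul_smul, wittCoeff_apply, ← hx w, ← mul_smul]
    exact congrArg (· • _) h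

theorem GModule.wIdem_smul_of_mem_component (D : GModule (wRing p K K' A))
    {σ : WInt p K' →+* OInt p E} {x : RestrictAlong (wRing.ofCoeff p K K' A) D.carrier}
    (hx : x ∈ D.component σ) :
    (wIdem (wittCoeff A σ) : (wRing p K K' A).carrier) • RestrictAlong.val x =
      RestrictAlong.val x := by
  rw [D.smul_of_mem_component hx, wEval_wIdem, map_one, one_smul]

/-- The isomorphism of components induced by an isomorphism of modules. -/
noncomputable def GModule.componentCongr {D D' : GModule (wRing p K K' A)}
    (e : D.carrier ≃ₗ[(wRing p K K' A).carrier] D'.carrier) (σ : WInt p K' →+* OInt p E) :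
    D.component σ ≃ₗ[A] D'.component σ where
  toFun x := ⟨RestrictAlong.val.symm (e (RestrictAlong.val x.1)), fun w => by
    rw [AddEquiv.apply_symm_apply, ← map_smul, x.2 w, map_smul]⟩
  invFun x := ⟨RestrictAlong.val.symm (e.symm (RestrictAlong.val x.1)), fun w => by
    rw [AddEquiv.apply_symm_apply, ← map_smul, x.2 w, map_smul]⟩
  left_inv x := Subtype.ext (e.symm_apply_apply (RestrictAlong.val x.1))
  right_inv x := Subtype.ext (e.apply_symm_apply (RestrictAlong.val x.1))
  map_add' x y := Subtype.ext (map_add e (RestrictAlong.val x.1) (RestrictAlong.val y.1))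
  map_smul' a x := Subtype.ext (map_smul e (wRing.ofCoeff p K K' A a) (RestrictAlong.val x.1))

theorem GModule.HasType.congr {V : Type u} [AddCommGroup V] [Module E V]
    {D D' : GModule (wRing p K K' A)} {ρ : Representation E (inertiaSubgroup p K K') V}
    (h : D.HasType ρ) (e : D.carrier ≃ₗ[(wRing p K K' A).carrier] D'.carrier)
    (he : ∀ g x, e (D.act g x) = D'.act g (e x)) : D'.HasType ρ := by
  obtain ⟨T, hT, hl, h⟩ := h
  exact ⟨T, hT, hl, fun σ => (h σ).congr (GModule.componentCongr e σ) fun g x =>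
    Subtype.ext (he g.1 (RestrictAlong.val x.1))⟩

section Extension

variable {L' : Type u} [Field L'] [Algebra ℚ_[p] L'] [Algebra ℤ_[p] L']
  [IsScalarTower ℤ_[p] ℚ_[p] L'] [FiniteDimensional ℚ_[p] L']
  [Algebra K L'] [IsScalarTower ℤ_[p] K L'] [Algebra K' L'] [IsScalarTower ℤ_[p] K' L']
  [IsScalarTower K K' L'] [Normal K K'] [FiniteDimensional K L']

variable (p K K' A L') in
/-- The map `W(k') ⊗ A → W(l') ⊗ A`. -/
noncomputable def wRingExt : GRing.Hom (galRes K K' L') (wRing p K K' A) (wRing p K L' A) where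
  toRingHom := tensMap (WInt.map (extHom p K' L')) (AlgHom.id ℤ_[p] A)
  map_act g r := by
    refine tensMap_square ?_ r
    rw [← WInt.map_comp, ← WInt.map_comp, galHom_comp_extHom]

theorem wEval_wRingExt (σ' : WInt p L' →+* OInt p E) (r : (wRing p K K' A).carrier) :
    wEval (wittCoeff A σ') ((wRingExt p K K' A L').toRingHom r) =
      wEval (wittCoeff A (σ'.comp (WInt.map (extHom p K' L') : WInt p K' →+* WInt p L'))) r :=
  wEval_tensMap (wittCoeff A σ') (WInt.map (extHom p K' L')) r

theorem wRingExt_ofCoeff (a : A) : (wRingExt p K K' A L').toRingHom (wRing.ofCoeff p K K' A a) =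
    wRing.ofCoeff p K L' A a :=
  (tensMap_tmul _ _ _ _).trans (by rw [map_one]; rfl)

/-- The projection of the base change of `D` to the `σ`-component of `D`, for a homomorphism `σ'`
which extends `σ`. -/
noncomputable def GModule.componentProj (D : GModule (wRing p K K' A))
    (σ' : WInt p L' →+* OInt p E) :
    ScalarExt (wRingExt p K K' A L').toRingHom D.carrier →+
      D.component (σ'.comp (WInt.map (extHom p K' L') : WInt p K' →+* WInt p L')) :=
  ScalarExt.slift (wRingExt p K K' A L').toRingHom (wEval (wittCoeff A σ')).toRingHom
    (AddMonoidHom.mk' (fun d => ⟨_, D.wIdem_smul_mem_component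
      (σ'.comp (WInt.map (extHom p K' L') : WInt p K' →+* WInt p L')) d⟩)
      fun a b => Subtype.ext (smul_add _ a b))
    (fun r m => Subtype.ext (by
      have h := mul_wIdem (wittCoeff A (σ'.comp
        (WInt.map (extHom p K' L') : WInt p K' →+* WInt p L'))) r
      refine (smul_smul _ r m).trans ?_
      rw [mul_comm]
      refine (congrArg (· • m) h).trans ?_
      rw [← wEval_wRingExt (K := K)]
      exact mul_smul _ _ m))


theorem GModule.componentProj_smul_of (D : GModule (wRing p K K' A))
    (σ' : WInt p L' →+* OInt p E) (r : (wRing p K L' A).carrier) (d : D.carrier) :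
    RestrictAlong.val (D.componentProj σ' (r • ScalarExt.of (wRingExt p K K' A L').toRingHom _ d)).1 =
      wRing.ofCoeff p K K' A (wEval (wittCoeff A σ') r) • (wIdem (wittCoeff A (σ'.comp
        (WInt.map (extHom p K' L') : WInt p K' →+* WInt p L'))) : (wRing p K K' A).carrier) • d :=
  congrArg (fun x => RestrictAlong.val (Subtype.val x)) (ScalarExt.slift_smul_of
    (wRingExt p K K' A L').toRingHom (wEval (wittCoeff A σ')).toRingHom _ _ r d)

theorem GModule.wIdem_smul_of_componentProj (D : GModule (wRing p K K' A))
    (σ' : WInt p L' →+* OInt p E) (x : (D.baseChange (wRingExt p K K' A L')).carrier) :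
    (wIdem (wittCoeff A σ') : (wRing p K L' A).carrier) •
      ScalarExt.of (wRingExt p K K' A L').toRingHom D.carrier
        (RestrictAlong.val (D.componentProj σ' x).1) =
      (wIdem (wittCoeff A σ') : (wRing p K L' A).carrier) • x := by
  induction x using ScalarExt.induction_of with
  | zero =>
    rw [map_zero]
    exact congrArg _ (map_zero (ScalarExt.of (wRingExt p K K' A L').toRingHom D.carrier))
  | add x y hx hy =>
    rw [map_add, smul_add, ← hx, ← hy, ← smul_add]
    exact congrArg _ (map_add (ScalarExt.of (wRingExt p K K' A L').toRingHom D.carrier) _ _)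
  | smul_of r d =>
    rw [componentProj_smul_of, ScalarExt.of_smul, ScalarExt.of_smul, wRingExt_ofCoeff, smul_smul,
      smul_smul, smul_smul]
    congr 1
    have h1 := mul_wIdem (wittCoeff A σ') ((wRingExt p K K' A L').toRingHom
      (wIdem (wittCoeff A (σ'.comp (WInt.map (extHom p K' L') : WInt p K' →+* WInt p L')))))
    rw [wEval_wRingExt, wEval_wIdem] at h1
    have h2 := mul_wIdem (wittCoeff A σ') r
    rw [mul_comm _ r, h2, mul_comm, ← mul_assoc, h1]
    rw [mul_comm]
    exact congrArg (_ * ·) (one_mul _)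

/-- The `σ`-component of `D` is the `σ'`-component of its base change, for every homomorphism `σ'`
which extends `σ`. -/
noncomputable def GModule.componentEquiv (D : GModule (wRing p K K' A))
    (σ' : WInt p L' →+* OInt p E) :
    D.component (σ'.comp (WInt.map (extHom p K' L') : WInt p K' →+* WInt p L')) ≃ₗ[A]
      (D.baseChange (wRingExt p K K' A L')).component σ' where
  toFun x := ⟨_, (D.baseChange (wRingExt p K K' A L')).wIdem_smul_mem_component σ'
    (ScalarExt.of (wRingExt p K K' A L').toRingHom D.carrier (RestrictAlong.val x.1))⟩
  invFun x := D.componentProj σ' (RestrictAlong.val x.1)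
  left_inv x := Subtype.ext (RestrictAlong.val.injective (by
    refine (D.componentProj_smul_of σ' _ _).trans ?_
    rw [wEval_wIdem, map_one, one_smul]
    exact D.wIdem_smul_of_mem_component x.2))
  right_inv x := Subtype.ext (RestrictAlong.val.injective (by
    refine (D.wIdem_smul_of_componentProj σ' (RestrictAlong.val x.1)).trans ?_
    exact (D.baseChange (wRingExt p K K' A L')).wIdem_smul_of_mem_component x.2))
  map_add' x y := Subtype.ext (by
    refine Eq.trans ?_ (smul_add (wIdem (wittCoeff A σ') : (wRing p K L' A).carrier)
      (ScalarExt.of (wRingExt p K K' A L').toRingHom D.carrier (RestrictAlong.val x.1))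
      (ScalarExt.of (wRingExt p K K' A L').toRingHom D.carrier (RestrictAlong.val y.1)))
    rw [← map_add]
    rfl)
  map_smul' a x := Subtype.ext (by
    refine Eq.trans ?_ (smul_comm (wIdem (wittCoeff A σ') : (wRing p K L' A).carrier)
      (wRing.ofCoeff p K L' A a)
      (ScalarExt.of (wRingExt p K K' A L').toRingHom D.carrier (RestrictAlong.val x.1)))
    rw [← wRingExt_ofCoeff (K := K) (K' := K'), ← ScalarExt.of_smul]
    rfl)

theorem wRing.act_wIdem {g : L' ≃ₐ[K] L'} (hg : g ∈ inertiaSubgroup p K L')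
    (s : WInt p L' →ₐ[ℤ_[p]] A) : (wRing p K L' A).act g (wIdem s) = wIdem s :=
  wIdem_act_of_mem hg s

theorem GModule.componentEquiv_act (D : GModule (wRing p K K' A))
    (σ' : WInt p L' →+* OInt p E) (g : inertiaSubgroup p K L')
    (x : D.component (σ'.comp (WInt.map (extHom p K' L') : WInt p K' →+* WInt p L'))) :
    D.componentEquiv σ' (D.componentAct _ (inertiaRes p K K' L' g) x) =
      (D.baseChange (wRingExt p K K' A L')).componentAct σ' g (D.componentEquiv σ' x) := by
  refine Subtype.ext (Eq.trans ?_ ((D.baseChange (wRingExt p K K' A L')).act_smul g.1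
    (wIdem (wittCoeff A σ')) (ScalarExt.of _ _ (RestrictAlong.val x.1))).symm)
  rw [D.baseChange_act_of, wRing.act_wIdem g.2]
  rfl

theorem GModule.HasType.baseChange {V : Type u} [AddCommGroup V] [Module E V]
    {D : GModule (wRing p K K' A)} {ρ : Representation E (inertiaSubgroup p K K') V}
    (h : D.HasType ρ) :
    (D.baseChange (wRingExt p K K' A L')).HasType (ρ.comp (inertiaRes p K K' L')) := by
  obtain ⟨T, hT, hl, h⟩ := h
  exact ⟨T, fun g => hT _, hl, fun σ' => ((h _).comp (inertiaRes p K K' L')).congr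
    (D.componentEquiv σ') (D.componentEquiv_act σ')⟩

end Extension

end Component

theorem PowerSeries.ker_constantCoeff_le_jacobson {R : Type*} [CommRing R] :
    RingHom.ker (PowerSeries.constantCoeff : PowerSeries R →+* R) ≤ Ideal.jacobson ⊥ := by
  intro x hx
  rw [RingHom.mem_ker] at hx
  rw [Ideal.mem_jacobson_bot]
  intro y
  rw [PowerSeries.isUnit_iff_constantCoeff, map_add, map_mul, hx, zero_mul, zero_add, map_one]
  exact isUnit_one

section Descent

variable {p : ℕ} [Fact p.Prime]
  {K : Type u} [Field K] [Algebra ℚ_[p] K] [Algebra ℤ_[p] K]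
  [IsScalarTower ℤ_[p] ℚ_[p] K] [FiniteDimensional ℚ_[p] K]
  {K' : Type u} [Field K'] [Algebra ℚ_[p] K'] [Algebra ℤ_[p] K']
  [IsScalarTower ℤ_[p] ℚ_[p] K'] [FiniteDimensional ℚ_[p] K']
  [Algebra K K'] [IsScalarTower ℤ_[p] K K']
  {L' : Type u} [Field L'] [Algebra ℚ_[p] L'] [Algebra ℤ_[p] L']
  [IsScalarTower ℤ_[p] ℚ_[p] L'] [FiniteDimensional ℚ_[p] L']
  [Algebra K L'] [IsScalarTower ℤ_[p] K L'] [Algebra K' L'] [IsScalarTower ℤ_[p] K' L']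
  [IsScalarTower K K' L'] [Normal K K'] [FiniteDimensional K L']
  {E : Type u} [Field E] [Algebra ℚ_[p] E] [Algebra ℤ_[p] E]
  [IsScalarTower ℤ_[p] ℚ_[p] E] [FiniteDimensional ℚ_[p] E]
  {A : Type u} [CommRing A] [Algebra ℤ_[p] A] [Algebra (OInt p E) A]
  [IsScalarTower ℤ_[p] (OInt p E) A]
  {V : Type u} [AddCommGroup V] [Module E V]

theorem GModule.HasType.act_eq_self {D : GModule (wRing p K L' A)}
    {ρ : Representation E (inertiaSubgroup p K K') V}
    (h : D.HasType (ρ.comp (inertiaRes p K K' L'))) (σ : WInt p L' →+* OInt p E)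
    {g : L' ≃ₐ[K] L'} (hg : g ∈ relInertia p K K' L') (x : D.carrier) : D.act g x = x := by
  obtain ⟨h1, h2⟩ := mem_relInertia.1 hg
  rw [← sub_eq_zero]
  refine eq_one_of_mul_wIdem (A := A) (wittCoeff A σ) fun γ => ?_
  obtain ⟨T, hT, -, h⟩ := h
  let σ' : WInt p L' →+* OInt p E := σ.comp (WittVector.map γ)
  have h3 := (h σ').apply_eq_self (i := ⟨g, h2⟩) (by
    have h5 : inertiaRes p K K' L' ⟨g, h2⟩ = 1 := Subtype.ext h1
    have h6 : (((ρ.comp (inertiaRes p K K' L')) ⟨g, h2⟩).restrictScalars (OInt p E)).restrict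
        (hT ⟨g, h2⟩) = LinearMap.id := LinearMap.ext fun v => Subtype.ext (by
      change ρ (inertiaRes p K K' L' ⟨g, h2⟩) v = v
      rw [h5, map_one, Module.End.one_apply])
    exact (congrArg (LinearMap.baseChange A) h6).trans LinearMap.baseChange_id) ⟨_, D.wIdem_smul_mem_component σ' x⟩
  have h4 : D.act g ((wIdem (wittCoeff A σ') : (wRing p K L' A).carrier) • x) =
      (wIdem (wittCoeff A σ') : (wRing p K L' A).carrier) • x :=
    congrArg (fun x => RestrictAlong.val (Subtype.val x)) h3
  rw [D.act_smul, wRing.act_wIdem h2] at h4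
  rw [smul_sub, sub_eq_zero]
  exact h4

variable [IsGalois K L'] (hdeg : ¬ p ∣ Module.finrank K' L')
  {ϖ : TameUniformiser p K K'} {ϖ' : TameUniformiser p K L'} (hϖ : ϖ.Compatible ϖ')

include hdeg

theorem GModule.HasType.of_baseChange {D : GModule (wRing p K K' A)}
    {ρ : Representation E (inertiaSubgroup p K K') V} (σ : WInt p L' →+* OInt p E)
    (h : (D.baseChange (wRingExt p K K' A L')).HasType (ρ.comp (inertiaRes p K K' L'))) :
    D.HasType ρ := by
  have hsurj := inertiaRes_surjective (p := p) (K := K) (K' := K') (L' := L') hdeg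
  obtain ⟨T, hT, hl, h⟩ := h
  have hT' : ∀ g, ∀ v ∈ T, ρ g v ∈ T := fun g v hv => by
    obtain ⟨g, rfl⟩ := hsurj g
    exact hT g v hv
  refine ⟨T, hT', hl, fun σ₁ => ?_⟩
  obtain ⟨s, hs⟩ := exists_comp_extHom_eq K hdeg (wittAlgHom σ) (wittAlgHom σ₁)
  have hs' : σ₁ = (s : WInt p L' →+* OInt p E).comp
      (WInt.map (extHom p K' L') : WInt p K' →+* WInt p L') :=
    RingHom.ext fun w => (DFunLike.congr_fun hs w).symm
  rw [hs']
  exact ((h _).congr (D.componentEquiv _).symm fun g x => by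
    rw [LinearEquiv.symm_apply_eq, D.componentEquiv_act, LinearEquiv.apply_symm_apply]).of_comp hsurj

theorem TameUniformiser.span_invVal_eq_top {M : PhiModule (ϖ'.sRing A)}
    [Module.Finite (ϖ'.sRing A).carrier M.carrier]
    (h : ∀ g ∈ relInertia p K K' L', ∀ x, (M.toGModule.baseChange (ϖ'.modU A)).act g x = x)
    {Y : PhiRing (K' ≃ₐ[K] K')} (f : GRing.Hom (galRes K K' L') Y.toGRing (ϖ'.sRing A).toGRing) :
    Submodule.span (ϖ'.sRing A).carrier (Set.range (M.invVal f)) = ⊤ := by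
  set S := (ϖ'.sRing A).carrier
  set N := Submodule.span S (Set.range (M.invVal f)) with hN
  have hsurj : Function.Surjective (ϖ'.modU A).toRingHom := fun r =>
    ⟨PowerSeries.C r, PowerSeries.constantCoeff_C r⟩
  let c : WInt p L' → S := fun w => (PowerSeries.C (w ⊗ₜ 1 : WCoeff p L' A) : PowerSeries _)
  have hc : ∀ w, (ϖ'.modU A).toRingHom (c w) = (w ⊗ₜ 1 : WCoeff p L' A) := fun w =>
    PowerSeries.constantCoeff_C _
  let o := ScalarExt.of (ϖ'.modU A).toRingHom M.carrier
  rw [eq_top_iff]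
  refine Submodule.le_of_le_smul_of_le_jacobson_bot (I := RingHom.ker (ϖ'.modU A).toRingHom)
    Module.Finite.fg_top PowerSeries.ker_constantCoeff_le_jacobson fun m _ => ?_
  obtain ⟨u, hu⟩ : IsUnit ((relInertia p K K' L').card : S) :=
    isUnit_card_relInertia (p := p) K hdeg (PowerSeries (WCoeff p L' A))
  let z := ∑ i ∈ sepSet p L', c (sepX p L' i) •
    ∑ g ∈ (galRes K K' L').kerFinset, M.act g (c (sepY p L' i) • m)
  have hz : z ∈ N := by
    refine Submodule.sum_mem _ fun i _ => Submodule.smul_mem _ _ ?_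
    obtain ⟨x, hx⟩ := M.exists_invVal f
      (∑ g ∈ (galRes K K' L').kerFinset, M.act g (c (sepY p L' i) • m)) fun g hg => by
        rw [map_sum]
        simp only [← M.act_mul]
        exact MonoidHom.sum_kerFinset_mul_left _ hg (fun g => M.act g (c (sepY p L' i) • m))
    rw [← hx]
    exact Submodule.subset_span ⟨x, rfl⟩
  have hoz : o z = o ((u : S) • m) := by
    have h1 : ∀ i, ∀ g, o (M.act g (c (sepY p L' i) • m)) =
        (WInt.map (galHom p g) (sepY p L' i) ⊗ₜ 1 : WCoeff p L' A) •
          (M.toGModule.baseChange (ϖ'.modU A)).act g (o m) := fun i g => by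
      refine (M.baseChange_act_of (ϖ'.modU A) g _).symm.trans ?_
      rw [ScalarExt.of_smul, hc]
      exact GModule.act_smul _ _ _ _
    have h2 : o z = ∑ g ∈ (galRes K K' L').kerFinset,
        ((∑ i ∈ sepSet p L', sepX p L' i * WInt.map (galHom p g) (sepY p L' i)) ⊗ₜ 1 :
          WCoeff p L' A) • (M.toGModule.baseChange (ϖ'.modU A)).act g (o m) := by
      simp only [TensorProduct.sum_tmul, Finset.sum_smul]
      rw [Finset.sum_comm]
      refine (map_sum o _ _).trans (Finset.sum_congr rfl fun i _ => ?_)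
      refine (ScalarExt.of_smul _ _ _).trans ?_
      rw [hc, map_sum, Finset.smul_sum]
      refine Finset.sum_congr rfl fun g _ => ?_
      refine (congrArg _ (h1 i g)).trans ?_
      rw [smul_smul]
      exact congrArg (· • _) (tmul_one_mul _ _).symm
    rw [h2, sum_relInertia (p := p) (G := fun _ => o m), Finset.sum_const, hu]
    · rw [Nat.cast_smul_eq_nsmul, map_nsmul]
    · intro g hg
      rw [sum_sep_act_of_mem (mem_relInertia.1 hg).2, h g hg]
      exact one_smul _ _
    · intro g hg
      rw [sum_sep_act_of_notMem hg, TensorProduct.zero_tmul, zero_smul]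
  have h3 : (u : S) • m - z ∈ RingHom.ker (ϖ'.modU A).toRingHom • (⊤ : Submodule S M.carrier) := by
    rw [← ScalarExt.of_eq_zero_iff hsurj]
    rw [map_sub, sub_eq_zero]
    exact hoz.symm
  have h4 : (u : S) • m ∈ N ⊔ RingHom.ker (ϖ'.modU A).toRingHom • (⊤ : Submodule S M.carrier) :=
    Submodule.mem_sup.2 ⟨z, hz, _, h3, by abel⟩
  have h5 := Submodule.smul_mem _ (↑u⁻¹ : S) h4
  rwa [smul_smul, Units.inv_mul, one_smul] at h5

omit [IsGalois K L'] hdeg in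
theorem TameUniformiser.Compatible.modU_sRingExt' (r : (ϖ.sRing A).carrier) :
    (wRingExt p K K' A L').toRingHom ((ϖ.modU A).toRingHom r) =
      (ϖ'.modU A).toRingHom ((hϖ.sRingExt A).toRingHom r) :=
  (hϖ.modU_sRingExt r).symm

omit [IsGalois K L'] hdeg in
theorem TameUniformiser.Compatible.hasType_baseChange {M : PhiModule (ϖ.sRing A)}
    {ρ : Representation E (inertiaSubgroup p K K') V} (h : ϖ.HasType ρ M) :
    ϖ'.HasType (ρ.comp (inertiaRes p K K' L')) (M.baseChangeObj (hϖ.sRingExt A)) :=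
  (GModule.HasType.baseChange (L' := L') h).congr
    (ScalarExt.square (ϖ.modU A).toRingHom (wRingExt p K K' A L').toRingHom
      (hϖ.sRingExt A).toRingHom (ϖ'.modU A).toRingHom hϖ.modU_sRingExt' M.carrier)
    fun g x => GModule.square_act (ϖ.modU A) (wRingExt p K K' A L') (hϖ.sRingExt A).toHom
      (ϖ'.modU A) hϖ.modU_sRingExt' (fun _ => rfl) M.toGModule g x

theorem TameUniformiser.Compatible.hasType_of_baseChange {M : PhiModule (ϖ.sRing A)}
    {ρ : Representation E (inertiaSubgroup p K K') V} (σ : WInt p L' →+* OInt p E)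
    (h : ϖ'.HasType (ρ.comp (inertiaRes p K K' L')) (M.baseChangeObj (hϖ.sRingExt A))) :
    ϖ.HasType ρ M :=
  GModule.HasType.of_baseChange hdeg σ (GModule.HasType.congr h
    (ScalarExt.square (hϖ.sRingExt A).toRingHom (ϖ'.modU A).toRingHom (ϖ.modU A).toRingHom
      (wRingExt p K K' A L').toRingHom (fun r => (hϖ.modU_sRingExt' r).symm) M.carrier)
    fun g x => GModule.square_act (hϖ.sRingExt A).toHom (ϖ'.modU A) (ϖ.modU A)
      (wRingExt p K K' A L') (fun r => (hϖ.modU_sRingExt' r).symm) (fun _ => rfl) M.toGModule g x)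

omit [IsGalois K L'] [FiniteDimensional K L'] hdeg [IsScalarTower K K' L'] [Normal K K'] in
theorem TameUniformiser.hasType_of_iso {M N : PhiModule (ϖ'.sRing A)} (e : M.Iso N)
    {ρ : Representation E (inertiaSubgroup p K L') V} (h : ϖ'.HasType ρ M) : ϖ'.HasType ρ N :=
  GModule.HasType.congr h (ScalarExt.congr (ϖ'.modU A).toRingHom e.equiv)
    (GModule.congr_act (ϖ'.modU A) e.equiv e.map_act)

/-- Every Breuil-Kisin module of an inflated type descends. -/
theorem TameUniformiser.Compatible.exists_descent (σ : WInt p L' →+* OInt p E) {d h : ℕ}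
    {ρ : Representation E (inertiaSubgroup p K K') V} {M : PhiModule (ϖ'.sRing A)}
    (hM : ϖ'.IsBK d h M) (hρ : ϖ'.HasType (ρ.comp (inertiaRes p K K' L')) M) :
    ∃ N : PhiModule (ϖ.sRing A), ϖ.IsBK d h N ∧ ϖ.HasType ρ N ∧
      Nonempty ((N.baseChangeObj (hϖ.sRingExt A)).Iso M) := by
  obtain ⟨t⟩ := hϖ.exists_sRing_retraction hdeg A
  have h1 : Module.Finite (ϖ'.sRing A).carrier M.carrier := hM.1
  have h2 : Module.Projective (ϖ'.sRing A).carrier M.carrier := hM.2.1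
  have h3 := span_invVal_eq_top hdeg (fun g hg x => hρ.act_eq_self σ hg x) (hϖ.sRingExt A).toHom
  let N := M.invariants (hϖ.sRingExt A) galRes_surjective
  let e : (N.baseChangeObj (hϖ.sRingExt A)).Iso M := PhiModule.descentIso t galRes_surjective M h3
  exact ⟨N, hϖ.isBK_of_baseChange hdeg (GModule.finite_inv t M.toGModule h3)
    (GModule.projective_inv t M.toGModule h3)
    (PhiModule.IsKisin.of_iso e.symm hM), hϖ.hasType_of_baseChange hdeg σ
    (hasType_of_iso e.symm hρ), ⟨e⟩⟩

end Descent

section FlatQuotient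

theorem Module.Projective.trans_algebra (R S M : Type u) [CommRing R] [CommRing S] [Algebra R S]
    [AddCommGroup M] [Module R M] [Module S M] [IsScalarTower R S M] [Module.Projective R S]
    [Module.Projective S M] : Module.Projective R M := by
  classical
  obtain ⟨f, hf⟩ := Module.projective_def'.1 (inferInstance : Module.Projective S M)
  have : Module.Projective R (M →₀ S) :=
    Module.Projective.of_equiv (finsuppLEquivDirectSum R S M).symm
  refine Module.Projective.of_split (f.restrictScalars R)
    ((Finsupp.linearCombination S id).restrictScalars R) ?_
  ext x
  exact LinearMap.congr_fun hf x

/-- If `N` is a submodule of a flat module `M` with `N ∩ I M ⊆ I N` for all finitely generated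
ideals `I`, then `M / N` is flat. -/
theorem Module.Flat.quotient_of_inf_smul_le {A M : Type u} [CommRing A] [AddCommGroup M]
    [Module A M] [Module.Flat A M] (N : Submodule A M)
    (h : ∀ I : Ideal A, I.FG → ∀ x ∈ N, x ∈ I • (⊤ : Submodule A M) → x ∈ I • N) :
    Module.Flat A (M ⧸ N) := by
  rw [Module.Flat.iff_lift_lsmul_comp_subtype_injective]
  intro I hI
  have hM := Module.Flat.iff_lift_lsmul_comp_subtype_injective.1 (inferInstance : Module.Flat A M) hI
  rw [← LinearMap.ker_eq_bot, LinearMap.ker_eq_bot']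
  intro z hz
  obtain ⟨y, rfl⟩ := LinearMap.lTensor_surjective I N.mkQ_surjective z
  have key : ∀ y : I ⊗[A] M, TensorProduct.lift ((LinearMap.lsmul A (M ⧸ N)).comp (Submodule.subtype I))
      (N.mkQ.lTensor I y) =
      N.mkQ (TensorProduct.lift ((LinearMap.lsmul A M).comp (Submodule.subtype I)) y) := by
    intro y
    induction y with
    | zero => simp only [map_zero]
    | add a b ha hb => simp only [map_add, ha, hb]
    | tmul a m => rfl
  rw [key, Submodule.mkQ_apply, Submodule.Quotient.mk_eq_zero] at hz
  have h1 : ∀ y : I ⊗[A] M, TensorProduct.lift ((LinearMap.lsmul A M).comp (Submodule.subtype I)) y ∈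
      I • (⊤ : Submodule A M) := by
    intro y
    induction y with
    | zero => rw [map_zero]; exact zero_mem _
    | add a b ha hb => rw [map_add]; exact add_mem ha hb
    | tmul a m => exact Submodule.smul_mem_smul a.2 trivial
  have h2 : ∀ x ∈ I • N, ∃ y : I ⊗[A] M, N.mkQ.lTensor I y = 0 ∧
      TensorProduct.lift ((LinearMap.lsmul A M).comp (Submodule.subtype I)) y = x := by
    intro x hx
    induction hx using Submodule.smul_induction_on' with
    | smul a ha n hn =>
      refine ⟨⟨a, ha⟩ ⊗ₜ n, ?_, rfl⟩
      rw [LinearMap.lTensor_tmul, Submodule.mkQ_apply, (Submodule.Quotient.mk_eq_zero N).2 hn,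
        TensorProduct.tmul_zero]
    | add a _ b _ ha hb =>
      obtain ⟨y, hy, rfl⟩ := ha
      obtain ⟨y', hy', rfl⟩ := hb
      exact ⟨y + y', by rw [map_add, hy, hy', add_zero], map_add _ _ _⟩
  obtain ⟨y', hy', h3⟩ := h2 _ (h I hI _ hz (h1 y))
  rw [← hM h3, hy']

theorem PowerSeries.mem_map_C_of_coeff_mem {R : Type*} [CommRing R] {J : Ideal R} (hJ : J.FG)
    {F : PowerSeries R} (h : ∀ i, PowerSeries.coeff i F ∈ J) :
    F ∈ J.map (PowerSeries.C : R →+* PowerSeries R) := by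
  obtain ⟨s, rfl⟩ := hJ
  have h1 : ∀ i, ∃ c : R → R, ∑ a ∈ s, c a * a = PowerSeries.coeff i F := fun i => by
    obtain ⟨c, -, hc⟩ := Submodule.mem_span_finset.1 (h i)
    exact ⟨c, hc⟩
  choose c hc using h1
  have h2 : F = ∑ a ∈ s, PowerSeries.mk (fun i => c i a) * PowerSeries.C a := by
    ext i
    rw [map_sum, ← hc]
    exact Finset.sum_congr rfl fun a _ => by rw [PowerSeries.coeff_mul_C, PowerSeries.coeff_mk]
  rw [h2]
  exact sum_mem fun a ha => Ideal.mul_mem_left _ _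
    (Ideal.mem_map_of_mem _ (Submodule.subset_span ha))

theorem PowerSeries.coeff_mem_of_mem_map_C {R : Type*} [CommRing R] {J : Ideal R}
    {F : PowerSeries R} (h : F ∈ J.map (PowerSeries.C : R →+* PowerSeries R)) (i : ℕ) :
    PowerSeries.coeff i F ∈ J := by
  induction h using Submodule.span_induction generalizing i with
  | mem x hx =>
    obtain ⟨a, ha, rfl⟩ := hx
    rw [PowerSeries.coeff_C]
    split_ifs
    · exact ha
    · exact zero_mem _
  | zero => rw [map_zero]; exact zero_mem _
  | add x y _ _ hx hy => rw [map_add]; exact add_mem (hx i) (hy i)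
  | smul s x _ hx =>
    rw [smul_eq_mul, PowerSeries.coeff_mul]
    exact sum_mem fun k _ => Ideal.mul_mem_left _ _ (hx _)

end FlatQuotient

section LocalModel

variable {p : ℕ} [Fact p.Prime]
  {K : Type u} [Field K] [Algebra ℚ_[p] K] [Algebra ℤ_[p] K]
  [IsScalarTower ℤ_[p] ℚ_[p] K] [FiniteDimensional ℚ_[p] K]
  {K' : Type u} [Field K'] [Algebra ℚ_[p] K'] [Algebra ℤ_[p] K']
  [IsScalarTower ℤ_[p] ℚ_[p] K'] [FiniteDimensional ℚ_[p] K']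
  [Algebra K K'] [IsScalarTower ℤ_[p] K K']
  {A : Type u} [CommRing A] [Algebra ℤ_[p] A]

theorem oRing.finite_projective_restrictAlong (L : Type u) [AddCommGroup L]
    [Module (oRing p K K' A).carrier L] [Module.Finite (oRing p K K' A).carrier L]
    [Module.Projective (oRing p K K' A).carrier L] :
    Module.Finite A (RestrictAlong (oRing.ofCoeff p K K' A) L) ∧
      Module.Projective A (RestrictAlong (oRing.ofCoeff p K K' A) L) := by
  let _ : Algebra A (oRing p K K' A).carrier := (oRing.ofCoeff p K K' A).toAlgebra
  let _ : Module (oRing p K K' A).carrier (RestrictAlong (oRing.ofCoeff p K K' A) L) :=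
    (inferInstance : Module (oRing p K K' A).carrier L)
  have : IsScalarTower A (oRing p K K' A).carrier (RestrictAlong (oRing.ofCoeff p K K' A) L) :=
    ⟨fun a s x => mul_smul (oRing.ofCoeff p K K' A a) s (RestrictAlong.val x)⟩
  let e : A ⊗[ℤ_[p]] OInt p K' ≃ₗ[A] (oRing p K K' A).carrier :=
    { (TensorProduct.comm ℤ_[p] A (OInt p K')).toAddEquiv with
      map_smul' := fun a x => by
        change TensorProduct.comm ℤ_[p] A (OInt p K') (a • x) =
          (1 ⊗ₜ[ℤ_[p]] a : OInt p K' ⊗[ℤ_[p]] A) * TensorProduct.comm ℤ_[p] A (OInt p K') x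
        induction x with
        | zero => rw [smul_zero, map_zero, mul_zero]
        | add x y hx hy => rw [smul_add, map_add, hx, hy, map_add, mul_add]
        | tmul b c =>
          change c ⊗ₜ[ℤ_[p]] (a * b) = (1 ⊗ₜ[ℤ_[p]] a : OInt p K' ⊗[ℤ_[p]] A) * (c ⊗ₜ b)
          rw [Algebra.TensorProduct.tmul_mul_tmul, one_mul] }
  have : Module.Finite A (oRing p K K' A).carrier := Module.Finite.equiv e
  have : FaithfulSMul ℤ_[p] (OInt p K') :=
    (faithfulSMul_iff_algebraMap_injective _ _).2 (OInt.algebraMap_injective p K')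
  have : Module.Free ℤ_[p] (OInt p K') := Module.free_of_finite_type_torsion_free'
  have : Module.Projective A (oRing p K K' A).carrier := Module.Projective.of_equiv e
  have : Module.Finite (oRing p K K' A).carrier (RestrictAlong (oRing.ofCoeff p K K' A) L) :=
    (inferInstance : Module.Finite (oRing p K K' A).carrier L)
  have : Module.Projective (oRing p K K' A).carrier (RestrictAlong (oRing.ofCoeff p K K' A) L) :=
    (inferInstance : Module.Projective (oRing p K K' A).carrier L)
  exact ⟨Module.Finite.trans (oRing p K K' A).carrier _,
    Module.Projective.trans_algebra A (oRing p K K' A).carrier _⟩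

/-- The projection `L → L / L⁺`, over `A`. -/
noncomputable def FilModule.quotMap (L : FilModule (oRing p K K' A)) :
    RestrictAlong (oRing.ofCoeff p K K' A) L.carrier →ₗ[A]
      RestrictAlong (oRing.ofCoeff p K K' A) (L.carrier ⧸ L.fil) where
  toFun x := RestrictAlong.val.symm (L.fil.mkQ (RestrictAlong.val x))
  map_add' _ _ := rfl
  map_smul' _ _ := rfl

theorem FilModule.quotMap_surjective (L : FilModule (oRing p K K' A)) :
    Function.Surjective L.quotMap := fun x => by
  obtain ⟨y, hy⟩ := L.fil.mkQ_surjective (RestrictAlong.val x)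
  exact ⟨RestrictAlong.val.symm y, hy⟩

theorem FilModule.quotMap_eq_zero (L : FilModule (oRing p K K' A))
    (x : RestrictAlong (oRing.ofCoeff p K K' A) L.carrier) :
    L.quotMap x = 0 ↔ RestrictAlong.val x ∈ L.fil :=
  Submodule.Quotient.mk_eq_zero L.fil

/-- The pairs `(L, L⁺)` with `L` finite projective and `L / L⁺` projective over `A`. -/
def FilModule.IsProjective (L : FilModule (oRing p K K' A)) : Prop :=
  Module.Finite (oRing p K K' A).carrier L.carrier ∧
  Module.Projective (oRing p K K' A).carrier L.carrier ∧
  Module.Projective A (RestrictAlong (oRing.ofCoeff p K K' A) (L.carrier ⧸ L.fil))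

theorem FilModule.exists_projection (L : FilModule (oRing p K K' A))
    [Module.Projective A (RestrictAlong (oRing.ofCoeff p K K' A) (L.carrier ⧸ L.fil))] :
    ∃ P : RestrictAlong (oRing.ofCoeff p K K' A) L.carrier →ₗ[A]
        RestrictAlong (oRing.ofCoeff p K K' A) L.carrier,
      (∀ x, RestrictAlong.val (P x) ∈ L.fil) ∧ ∀ x, RestrictAlong.val x ∈ L.fil → P x = x := by
  obtain ⟨s, hs⟩ := L.quotMap.exists_rightInverse_of_surjective
    (LinearMap.range_eq_top.2 L.quotMap_surjective)
  refine ⟨LinearMap.id - s.comp L.quotMap, fun x => (L.quotMap_eq_zero _).1 ?_, fun x hx => ?_⟩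
  · rw [LinearMap.sub_apply, LinearMap.id_apply, map_sub, LinearMap.comp_apply]
    exact sub_eq_zero.2 (LinearMap.congr_fun hs (L.quotMap x)).symm
  · rw [LinearMap.sub_apply, LinearMap.id_apply, LinearMap.comp_apply, (L.quotMap_eq_zero x).2 hx,
      map_zero, sub_zero]

namespace TameUniformiser

variable (ϖ : TameUniformiser p K K')

variable (A) in
/-- The homomorphism `A → 𝔖_A`. -/
noncomputable def ofCoeffS : A →+* (ϖ.sRing A).carrier :=
  (PowerSeries.C : WCoeff p K' A →+* PowerSeries (WCoeff p K' A)).comp (wRing.ofCoeff p K K' A)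

theorem modE_ofCoeffS (hA : IsNilpotent (p : A)) (a : A) :
    (ϖ.modE A hA).toRingHom (ϖ.ofCoeffS A a) = oRing.ofCoeff p K K' A a := by
  refine (ϖ.modE_C hA _).trans ?_
  refine (tensMap_tmul (OInt.ofWittAlg p K') (AlgHom.id ℤ_[p] A) 1 a).trans ?_
  rw [map_one]
  rfl

theorem mem_map_of_eisensteinS_mul_mem (hA : IsNilpotent (p : A)) {I : Ideal A} (hI : I.FG)
    (y : (ϖ.sRing A).carrier) (hy : ϖ.eisensteinS A * y ∈ I.map (ϖ.ofCoeffS A)) :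
    y ∈ I.map (ϖ.ofCoeffS A) := by
  have h : I.map (ϖ.ofCoeffS A) = ((I.map (wRing.ofCoeff p K K' A)).map PowerSeries.C :
      Ideal (PowerSeries (WCoeff p K' A))) := (Ideal.map_map _ _).symm
  rw [h] at hy ⊢
  exact PowerSeries.mem_map_C_of_coeff_mem (hI.map _)
    (ϖ.eisensteinS_coeff_mem hA y (PowerSeries.coeff_mem_of_mem_map_C hy))

theorem IsBK.isProjective {ϖ : TameUniformiser p K K'} (hA : IsNilpotent (p : A)) {d : ℕ}
    {M : PhiModule (ϖ.sRing A)} (hM : ϖ.IsBK d 1 M) :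
    (M.imFil.baseChangeObj (ϖ.modE A hA)).IsProjective := by
  obtain ⟨V, hV1, hV2⟩ := PhiModule.IsKisin.exists_verschiebung (E := ϖ.eisensteinS A) hM
    (ϖ.eq_zero_of_eisensteinS_mul hA)
  simp only [pow_one] at hV1 hV2
  have hf : Module.Finite (ϖ.sRing A).carrier M.carrier := hM.1
  have hp : Module.Projective (ϖ.sRing A).carrier M.carrier := hM.2.1
  set θ := (ϖ.modE A hA).toRingHom with hθ
  have hθs : Function.Surjective θ := ϖ.modE_surjective hA
  set L := M.imFil.baseChangeObj (ϖ.modE A hA) with hL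
  have hLf : Module.Finite (oRing p K K' A).carrier L.carrier := ScalarExt.finite _
  have hLp : Module.Projective (oRing p K K' A).carrier L.carrier := ScalarExt.projective _
  refine ⟨hLf, hLp, ?_⟩
  obtain ⟨h1, h2⟩ := oRing.finite_projective_restrictAlong (p := p) (K := K) (K' := K') (A := A)
    L.carrier
  have h3 : Module.Finite (oRing p K K' A).carrier
    (ScalarExt θ (ScalarExt (ϖ.sRing A).phi M.carrier)) := ScalarExt.finite _
  have h4 : Module.Projective (oRing p K K' A).carrier
    (ScalarExt θ (ScalarExt (ϖ.sRing A).phi M.carrier)) := ScalarExt.projective _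
  obtain ⟨h5, -⟩ := oRing.finite_projective_restrictAlong (p := p) (K := K) (K' := K') (A := A)
    (ScalarExt θ (ScalarExt (ϖ.sRing A).phi M.carrier))
  let o : M.carrier →+ L.carrier := ScalarExt.of θ M.carrier
  have ho : ∀ r m, o (r • m) = θ r • o m := ScalarExt.of_smul θ
  have hmem : ∀ y, o (M.linPhi y) ∈ L.fil := fun y =>
    FilModule.mem_baseChange_fil (ϖ.modE A hA) M.imFil ⟨y, rfl⟩
  have hex : ∀ x ∈ L.fil, ∃ y, o (M.linPhi y) = x := by
    intro x hx
    change x ∈ Submodule.span _ _ at hx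
    induction hx using Submodule.span_induction with
    | mem x hx =>
      obtain ⟨_, ⟨y, rfl⟩, rfl⟩ := hx
      exact ⟨y, rfl⟩
    | zero => exact ⟨0, by rw [map_zero, map_zero]⟩
    | add x y _ _ hx hy =>
      obtain ⟨a, rfl⟩ := hx
      obtain ⟨b, rfl⟩ := hy
      exact ⟨a + b, by rw [map_add, map_add]⟩
    | smul s x _ hx =>
      obtain ⟨a, rfl⟩ := hx
      obtain ⟨r, rfl⟩ := hθs s
      exact ⟨r • a, by rw [map_smul, ho]⟩
  let F : RestrictAlong (oRing.ofCoeff p K K' A)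
      (ScalarExt θ (ScalarExt (ϖ.sRing A).phi M.carrier)) →ₗ[A]
      RestrictAlong (oRing.ofCoeff p K K' A) L.carrier :=
    { toFun := fun x => RestrictAlong.val.symm (ScalarExt.mapLin θ M.linPhi (RestrictAlong.val x))
      map_add' := fun x y => map_add (ScalarExt.mapLin θ M.linPhi) _ _
      map_smul' := fun a x => map_smul (ScalarExt.mapLin θ M.linPhi) (oRing.ofCoeff p K K' A a) _ }
  have hF : LinearMap.range F = LinearMap.ker L.quotMap := by
    ext x
    rw [LinearMap.mem_ker, L.quotMap_eq_zero]
    constructor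
    · rintro ⟨z, rfl⟩
      obtain ⟨y, rfl⟩ := ScalarExt.of_surjective hθs z
      have := hmem y
      rw [← show ScalarExt.mapLin θ M.linPhi (ScalarExt.of θ _ y) = o (M.linPhi y) from
        ScalarExt.mapLin_of θ M.linPhi y] at this
      exact this
    · intro hx
      obtain ⟨y, hy⟩ := hex _ hx
      exact ⟨ScalarExt.of θ _ y, (ScalarExt.mapLin_of θ M.linPhi y).trans hy⟩
  have hfp : Module.FinitePresentation A
      (RestrictAlong (oRing.ofCoeff p K K' A) (L.carrier ⧸ L.fil)) := by
    have : Module.FinitePresentation A (RestrictAlong (oRing.ofCoeff p K K' A) L.carrier) :=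
      Module.finitePresentation_of_projective _ _
    refine Module.finitePresentation_of_surjective L.quotMap L.quotMap_surjective ?_
    rw [← hF]
    exact Module.Finite.iff_fg.1 inferInstance
  have hflat : Module.Flat A
      (RestrictAlong (oRing.ofCoeff p K K' A) L.carrier ⧸ LinearMap.ker L.quotMap) := by
    refine Module.Flat.quotient_of_inf_smul_le _ fun I hI x hx hx' => ?_
    obtain ⟨y, hy⟩ := hex _ ((L.quotMap_eq_zero x).1 hx)
    obtain ⟨m, hm, hmx⟩ : ∃ m ∈ I.map (ϖ.ofCoeffS A) • (⊤ : Submodule (ϖ.sRing A).carrier M.carrier),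
        o m = RestrictAlong.val x := by
      clear hx hy y
      induction hx' using Submodule.smul_induction_on' with
      | smul a ha n _ =>
        obtain ⟨m, hm⟩ := ScalarExt.of_surjective hθs (RestrictAlong.val n)
        refine ⟨ϖ.ofCoeffS A a • m, Submodule.smul_mem_smul (Ideal.mem_map_of_mem _ ha) trivial, ?_⟩
        rw [ho, hθ, ϖ.modE_ofCoeffS, RestrictAlong.val_smul, ← hm]
      | add a _ b _ ha hb =>
        obtain ⟨m, hm, hm'⟩ := ha
        obtain ⟨n, hn, hn'⟩ := hb
        exact ⟨m + n, add_mem hm hn, by rw [map_add, map_add, hm', hn']⟩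
    obtain ⟨m', hm'⟩ : ∃ m', M.linPhi y - m = ϖ.eisensteinS A • m' := by
      have h6 : o (M.linPhi y - m) = 0 := by rw [map_sub, hy, hmx, sub_self]
      have h7 := (ScalarExt.of_eq_zero_iff hθs _).1 h6
      clear h6
      generalize M.linPhi y - m = z at h7 ⊢
      induction h7 using Submodule.smul_induction_on' with
      | smul a ha n _ =>
        obtain ⟨b, rfl⟩ := (ϖ.mem_ker_modE hA a).1 ha
        exact ⟨b • n, mul_smul _ _ _⟩
      | add a _ b _ ha hb =>
        obtain ⟨m, hm⟩ := ha
        obtain ⟨n, hn⟩ := hb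
        exact ⟨m + n, by rw [smul_add, hm, hn]⟩
    have h8 : y - V m' ∈ I.map (ϖ.ofCoeffS A) •
        (⊤ : Submodule (ϖ.sRing A).carrier (ScalarExt (ϖ.sRing A).phi M.carrier)) := by
      refine Module.Projective.mem_smul_top_of_smul_mem (E := ϖ.eisensteinS A)
        (ϖ.mem_map_of_eisensteinS_mul_mem hA hI) ?_
      have h9 : ϖ.eisensteinS A • (y - V m') = V m := by
        rw [smul_sub, ← hV2, ← map_smul, ← map_sub, ← hm', sub_sub_cancel]
      rw [h9]
      have h10 := Submodule.mem_map_of_mem (f := V) hm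
      rw [Submodule.map_smul''] at h10
      exact Submodule.smul_mono le_rfl le_top h10
    have h11 : RestrictAlong.val x = o (M.linPhi (y - V m')) := by
      have h12 : θ (ϖ.eisensteinS A) = 0 := ϖ.modE_eisensteinS hA
      rw [map_sub M.linPhi, hV1, map_sub, hy, ho, h12, zero_smul, sub_zero]
    have h13 : ∀ z ∈ I.map (ϖ.ofCoeffS A) •
        (⊤ : Submodule (ϖ.sRing A).carrier (ScalarExt (ϖ.sRing A).phi M.carrier)),
        (RestrictAlong.val.symm (o (M.linPhi z)) :
          RestrictAlong (oRing.ofCoeff p K K' A) L.carrier) ∈ I • LinearMap.ker L.quotMap := by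
      intro z hz
      induction hz using Submodule.smul_induction_on' with
      | smul j hj n _ =>
        induction hj using Submodule.span_induction generalizing n with
        | mem j hj =>
          obtain ⟨a, ha, rfl⟩ := hj
          have h14 : (RestrictAlong.val.symm (o (M.linPhi (ϖ.ofCoeffS A a • n))) :
              RestrictAlong (oRing.ofCoeff p K K' A) L.carrier) =
              a • RestrictAlong.val.symm (o (M.linPhi n)) := by
            rw [map_smul, ho, hθ, ϖ.modE_ofCoeffS]
            rfl
          rw [h14]
          exact Submodule.smul_mem_smul ha ((L.quotMap_eq_zero _).2 (hmem n))
        | zero => rw [zero_smul, map_zero, map_zero, map_zero]; exact zero_mem _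
        | add a b _ _ ha hb =>
          rw [add_smul, map_add, map_add, map_add]
          exact add_mem (ha n trivial) (hb n trivial)
        | smul s a _ ha =>
          rw [smul_eq_mul, mul_comm, mul_smul]
          exact ha _ trivial
      | add a _ b _ ha hb =>
        rw [map_add, map_add, map_add]
        exact add_mem ha hb
    have h15 := h13 _ h8
    rwa [← h11] at h15
  have : Module.Flat A (RestrictAlong (oRing.ofCoeff p K K' A) (L.carrier ⧸ L.fil)) :=
    Module.Flat.of_linearEquiv
      (L.quotMap.quotKerEquivOfSurjective L.quotMap_surjective).symm
  exact Module.Flat.projective_of_finitePresentation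

end TameUniformiser

end LocalModel

section InertiaCharacter

variable {p : ℕ} [Fact p.Prime]
  {K : Type u} [Field K] [Algebra ℚ_[p] K] [Algebra ℤ_[p] K]
  [IsScalarTower ℤ_[p] ℚ_[p] K] [FiniteDimensional ℚ_[p] K]
  {K' : Type u} [Field K'] [Algebra ℚ_[p] K'] [Algebra ℤ_[p] K']
  [IsScalarTower ℤ_[p] ℚ_[p] K'] [FiniteDimensional ℚ_[p] K']
  [Algebra K K'] [IsScalarTower ℤ_[p] K K']

namespace TameUniformiser

variable (ϖ : TameUniformiser p K K')

theorem teich_mul_of_mem {g : K' ≃ₐ[K] K'} (hg : g ∈ inertiaSubgroup p K K') (h : K' ≃ₐ[K] K') :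
    ϖ.teich (g * h) = ϖ.teich g * ϖ.teich h := by
  rw [ϖ.teich_mul, WInt.map_of_mem_inertia hg, mul_comm]

/-- The character `g ↦ g(π) / π` of the inertia group. -/
noncomputable def inertiaChar : inertiaSubgroup p K K' →* WInt p K' where
  toFun g := ϖ.teich g.1
  map_one' := ϖ.teich_one
  map_mul' g h := ϖ.teich_mul_of_mem g.2 h.1

theorem inertiaChar_pow (g : inertiaSubgroup p K K') : ϖ.inertiaChar g ^ ramIdx p K K' = 1 := by
  apply OInt.ofWittAlg_injective
  rw [map_pow, map_one]
  refine Eq.trans ?_ (ϖ.cocycle_pow g.1)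
  rw [← ϖ.ofWitt_teich]
  rfl

theorem inertiaChar_injective : Function.Injective ϖ.inertiaChar := by
  rw [injective_iff_map_eq_one]
  intro g hg
  have hpi : OInt.map (galHom p g.1) ϖ.pi = ϖ.pi := by
    rw [ϖ.map_pi, ← ϖ.ofWitt_teich, show ϖ.teich g.1 = 1 from hg, map_one, one_mul]
  obtain ⟨m, v, -, hv⟩ := OInt.exists_p_eq ϖ.span_pi
  have hint : ∀ y : OInt p K', OInt.map (galHom p g.1) y = y := by
    intro y
    obtain ⟨w, hw⟩ := OInt.exists_eq_sum ϖ.span_pi hv y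
    rw [hw, map_sum]
    refine Finset.sum_congr rfl fun i _ => ?_
    rw [map_mul, map_pow, hpi, OInt.map_ofWitt, WInt.map_of_mem_inertia g.2]
  refine Subtype.ext (AlgEquiv.ext fun x => ?_)
  obtain ⟨y, z, ⟨hz, hz0⟩, hx⟩ : ∃ (y : OInt p K') (z : OInt p K'), (g.1 (z : K') = z ∧ (z : K') ≠ 0) ∧
      x * z = y := by
    have := integralClosure.isFractionRing_of_finite_extension (A := ℤ_[p]) ℚ_[p] K'
    obtain ⟨⟨y, z⟩, h⟩ := IsLocalization.surj (nonZeroDivisors (OInt p K'))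
      (S := K') (x : K')
    refine ⟨y, z.1, ⟨congrArg Subtype.val (hint z.1), ?_⟩, h⟩
    intro h0
    exact nonZeroDivisors.ne_zero z.2 (Subtype.ext h0)
  have h1 := congrArg Subtype.val (hint y)
  change g.1 (y : K') = y at h1
  rw [← hx, map_mul, hz] at h1
  exact mul_right_cancel₀ hz0 h1

include ϖ in
theorem not_dvd_card_inertia [FiniteDimensional K K'] : ¬ p ∣ Nat.card (inertiaSubgroup p K K') := by
  intro h
  obtain ⟨g, hg⟩ := exists_prime_orderOf_dvd_card' p h
  have h1 : ϖ.inertiaChar g ^ p = 1 := by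
    rw [← map_pow, orderOf_dvd_iff_pow_eq_one.1 (dvd_of_eq hg), map_one]
  have h2 : ϖ.inertiaChar g = 1 := by
    have h3 := orderOf_dvd_of_pow_eq_one h1
    have h4 := orderOf_dvd_of_pow_eq_one (ϖ.inertiaChar_pow g)
    have h5 := Nat.dvd_gcd h3 h4
    rw [((Nat.Prime.coprime_iff_not_dvd Fact.out).2 ϖ.tame).gcd_eq_one, Nat.dvd_one] at h5
    exact orderOf_eq_one_iff.1 h5
  rw [(injective_iff_map_eq_one ϖ.inertiaChar).1 ϖ.inertiaChar_injective g h2, orderOf_one] at hg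
  exact (Fact.out : p.Prime).one_lt.ne hg

include ϖ in
theorem isUnit_card_inertia [FiniteDimensional K K'] (B : Type*) [CommRing B] [Algebra ℤ_[p] B] :
    IsUnit (Nat.card (inertiaSubgroup p K K') : B) := by
  have h := (OInt.isUnit_algebraMap_natCast ϖ.not_dvd_card_inertia).map (algebraMap ℤ_[p] B)
  rwa [map_natCast] at h

end TameUniformiser

section Isotypic

variable {E : Type u} [Field E] [Algebra ℚ_[p] E] [Algebra ℤ_[p] E]
  [IsScalarTower ℤ_[p] ℚ_[p] E] [FiniteDimensional ℚ_[p] E]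
  {A : Type u} [CommRing A] [Algebra ℤ_[p] A] [Algebra (OInt p E) A]
  [IsScalarTower ℤ_[p] (OInt p E) A] [FiniteDimensional K K']

/-- The action of an element of the group, over `A`. -/
noncomputable def GModule.actLin (L : GModule (oRing p K K' A)) (g : K' ≃ₐ[K] K') :
    Module.End A (RestrictAlong (oRing.ofCoeff p K K' A) L.carrier) where
  toFun x := RestrictAlong.val.symm (L.act g (RestrictAlong.val x))
  map_add' x y := map_add (L.act g) (RestrictAlong.val x) (RestrictAlong.val y)
  map_smul' a x := (L.act_smul g _ _).trans
    (congrArg (· • L.act g (RestrictAlong.val x)) (oRing.act_ofCoeff g a))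

theorem GModule.actLin_mul (L : GModule (oRing p K K' A)) (g h : K' ≃ₐ[K] K')
    (x : RestrictAlong (oRing.ofCoeff p K K' A) L.carrier) :
    L.actLin (g * h) x = L.actLin g (L.actLin h x) := L.act_mul g h x

theorem FilModule.mem_isotypic (L : FilModule (oRing p K K' A))
    (ξ : inertiaSubgroup p K K' →* (OInt p E)ˣ)
    (x : RestrictAlong (oRing.ofCoeff p K K' A) L.carrier) :
    x ∈ L.isotypic ξ ↔ RestrictAlong.val x ∈ L.fil ∧
      ∀ g, L.actLin g.1 x = algebraMap (OInt p E) A (ξ g) • x := Iff.rfl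

theorem TameUniformiser.finite_projective_isotypic (ϖ : TameUniformiser p K K')
    {L : FilModule (oRing p K K' A)} (hL : L.IsProjective)
    (ξ : inertiaSubgroup p K K' →* (OInt p E)ˣ) :
    Module.Finite A (L.isotypic ξ) ∧ Module.Projective A (L.isotypic ξ) := by
  obtain ⟨h1, h2, h3⟩ := hL
  obtain ⟨h4, h5⟩ := oRing.finite_projective_restrictAlong (p := p) (K := K) (K' := K') (A := A)
    L.carrier
  obtain ⟨P, hP, hP'⟩ := L.exists_projection
  obtain ⟨c, hc⟩ := (ϖ.isUnit_card_inertia A).exists_left_inv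
  let _ : Fintype (inertiaSubgroup p K K') := Fintype.ofFinite _
  let Q : Module.End A (RestrictAlong (oRing.ofCoeff p K K' A) L.carrier) :=
    c • ∑ g : inertiaSubgroup p K K',
      algebraMap (OInt p E) A (↑(ξ g)⁻¹ : OInt p E) • L.actLin g.1
  have hQ : ∀ x, Q x = c • ∑ g : inertiaSubgroup p K K',
      algebraMap (OInt p E) A (↑(ξ g)⁻¹ : OInt p E) • L.actLin g.1 x := by
    intro x
    simp only [Q, LinearMap.smul_apply, LinearMap.sum_apply]
  have hQmem : ∀ x, RestrictAlong.val x ∈ L.fil → Q x ∈ L.isotypic ξ := by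
    intro x hx
    rw [L.mem_isotypic, hQ]
    constructor
    · rw [RestrictAlong.val_smul, map_sum]
      exact L.fil.smul_mem _ (sum_mem fun g _ => L.fil.smul_mem _ (L.act_fil _ _ hx))
    · intro h
      have key : ∑ g : inertiaSubgroup p K K',
          L.actLin h.1 (algebraMap (OInt p E) A (↑(ξ g)⁻¹ : OInt p E) • L.actLin g.1 x) =
          ∑ g : inertiaSubgroup p K K', algebraMap (OInt p E) A (ξ h) •
            (algebraMap (OInt p E) A (↑(ξ g)⁻¹ : OInt p E) • L.actLin g.1 x) := by
        rw [← Equiv.sum_comp (Equiv.mulLeft h) (fun g => algebraMap (OInt p E) A (ξ h) •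
            (algebraMap (OInt p E) A (↑(ξ g)⁻¹ : OInt p E) • L.actLin g.1 x))]
        refine Finset.sum_congr rfl fun g _ => ?_
        rw [map_smul, ← L.actLin_mul, Equiv.coe_mulLeft, smul_smul, ← map_mul, map_mul ξ, mul_inv,
          ← Units.val_mul, mul_inv_cancel_left]
        rfl
      rw [map_smul, map_sum, key, ← Finset.smul_sum, smul_comm]
  have hQid : ∀ x ∈ L.isotypic ξ, Q x = x := by
    intro x hx
    rw [L.mem_isotypic] at hx
    rw [hQ]
    have : ∀ g ∈ (Finset.univ : Finset (inertiaSubgroup p K K')),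
        algebraMap (OInt p E) A (↑(ξ g)⁻¹ : OInt p E) • L.actLin g.1 x = x := by
      intro g _
      rw [hx.2, smul_smul, ← map_mul, Units.inv_mul, map_one, one_smul]
    rw [Finset.sum_congr rfl this, Finset.sum_const, Finset.card_univ, ← Nat.card_eq_fintype_card,
      ← Nat.cast_smul_eq_nsmul A, smul_smul, hc, one_smul]
  let R : RestrictAlong (oRing.ofCoeff p K K' A) L.carrier →ₗ[A] L.isotypic ξ :=
    LinearMap.codRestrict _ (Q.comp P) fun x => hQmem _ (hP x)
  have hR : R.comp (L.isotypic ξ).subtype = LinearMap.id := by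
    ext x
    change Q (P x.1) = x.1
    rw [hP' _ x.2.1, hQid _ x.2]
  exact ⟨Module.Finite.of_surjective R fun x => ⟨x.1, LinearMap.congr_fun hR x⟩,
    Module.Projective.of_split _ _ hR⟩

end Isotypic

end InertiaCharacter

section Determinant

variable {p : ℕ} [Fact p.Prime]
  {K : Type u} [Field K] [Algebra ℚ_[p] K] [Algebra ℤ_[p] K]
  [IsScalarTower ℤ_[p] ℚ_[p] K] [FiniteDimensional ℚ_[p] K]
  {K' : Type u} [Field K'] [Algebra ℚ_[p] K'] [Algebra ℤ_[p] K']
  [IsScalarTower ℤ_[p] ℚ_[p] K'] [FiniteDimensional ℚ_[p] K']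
  [Algebra K K'] [IsScalarTower ℤ_[p] K K'] [IsScalarTower ℚ_[p] K K']
  {E : Type u} [Field E] [Algebra ℚ_[p] E] [Algebra ℤ_[p] E]
  [IsScalarTower ℤ_[p] ℚ_[p] E] [FiniteDimensional ℚ_[p] E]
  {A : Type u} [CommRing A] [Algebra ℤ_[p] A] [Algebra (OInt p E) A]
  [IsScalarTower ℤ_[p] (OInt p E) A]

variable {B : Type u} [CommRing B] [Algebra ℤ_[p] B] (v : B →ₐ[ℤ_[p]] OInt p K')
  (hv : ∀ g ∈ inertiaSubgroup p K K', (OInt.map (galHom p g)).comp v = v)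

theorem oRing.act_map_of_fixed {g : K' ≃ₐ[K] K'} (hg : (OInt.map (galHom p g)).comp v = v)
    (z : B ⊗[ℤ_[p]] A) : (oRing p K K' A).act g (oRing.map K A v z) = oRing.map K A v z := by
  refine (tensMap_tensMap _ _ _ _ z).trans ?_
  rw [hg]
  rfl

/-- The action of `B ⊗ A` on an isotypic part, for a map `B → O_{K'}` to the elements fixed by
inertia. -/
noncomputable def FilModule.isotypicHom (L : FilModule (oRing p K K' A))
    (ξ : inertiaSubgroup p K K' →* (OInt p E)ˣ) :
    B ⊗[ℤ_[p]] A →+* Module.End A (L.isotypic ξ) where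
  toFun z :=
    { toFun := fun x => ⟨RestrictAlong.val.symm (oRing.map K A v z • RestrictAlong.val x.1),
        L.fil.smul_mem _ x.2.1, fun g => by
        rw [AddEquiv.apply_symm_apply, L.act_smul, oRing.act_map_of_fixed v (hv g.1 g.2),
          x.2.2 g, smul_comm]⟩
      map_add' := fun x y => Subtype.ext (smul_add _ (RestrictAlong.val x.1) (RestrictAlong.val y.1))
      map_smul' := fun c x => Subtype.ext (smul_comm _ (oRing.ofCoeff p K K' A c)
        (RestrictAlong.val x.1)) }
  map_one' := LinearMap.ext fun x => Subtype.ext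
    ((congrArg (· • RestrictAlong.val x.1) (map_one (oRing.map K A v))).trans (one_smul _ _))
  map_mul' a b := LinearMap.ext fun x => Subtype.ext
    ((congrArg (· • RestrictAlong.val x.1) (map_mul (oRing.map K A v) a b)).trans (mul_smul _ _ _))
  map_zero' := LinearMap.ext fun x => Subtype.ext
    ((congrArg (· • RestrictAlong.val x.1) (map_zero (oRing.map K A v))).trans (zero_smul _ _))
  map_add' a b := LinearMap.ext fun x => Subtype.ext
    ((congrArg (· • RestrictAlong.val x.1) (map_add (oRing.map K A v) a b)).trans (add_smul _ _ _))

theorem FilModule.isotypicHom_tmul (L : FilModule (oRing p K K' A))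
    (ξ : inertiaSubgroup p K K' →* (OInt p E)ˣ) (b : B) (a : A) :
    L.isotypicHom v hv ξ (b ⊗ₜ a) = a • L.isotypicHom v hv ξ (b ⊗ₜ 1) := by
  have h : oRing.map K A v (b ⊗ₜ[ℤ_[p]] a) =
      oRing.ofCoeff p K K' A a * oRing.map K A v (b ⊗ₜ[ℤ_[p]] 1) := by
    refine Eq.trans ?_ (Algebra.TensorProduct.tmul_mul_tmul 1 (v b) a 1).symm
    rw [one_mul, mul_one]
    rfl
  exact LinearMap.ext fun x => Subtype.ext
    ((congrArg (fun s : (oRing p K K' A).carrier => s • RestrictAlong.val x.1) h).trans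
      (mul_smul _ _ _))

theorem FilModule.isotypicHom_comp {C : Type u} [CommRing C] [Algebra ℤ_[p] C]
    (f : C →ₐ[ℤ_[p]] B) (w : C →ₐ[ℤ_[p]] OInt p K')
    (hw : ∀ g ∈ inertiaSubgroup p K K', (OInt.map (galHom p g)).comp w = w) (hf : v.comp f = w)
    (L : FilModule (oRing p K K' A))
    (ξ : inertiaSubgroup p K K' →* (OInt p E)ˣ) (z : C ⊗[ℤ_[p]] A) :
    L.isotypicHom v hv ξ (tensMap f (AlgHom.id ℤ_[p] A) z) = L.isotypicHom w hw ξ z := by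
  subst hf
  refine LinearMap.ext fun x => Subtype.ext ?_
  refine congrArg (fun s : (oRing p K K' A).carrier => s • RestrictAlong.val x.1) ?_
  exact tensMap_tensMap _ _ _ _ z

section Extend

variable (R : Type u) [CommRing R] [Algebra A R] [Algebra ℤ_[p] R] [IsScalarTower ℤ_[p] A R]

/-- The action of `B ⊗ R` on the base change to `R` of an isotypic part. -/
noncomputable def FilModule.isotypicHomExt (L : FilModule (oRing p K K' A))
    (ξ : inertiaSubgroup p K K' →* (OInt p E)ˣ) :
    B ⊗[ℤ_[p]] R →ₐ[ℤ_[p]] Module.End R (R ⊗[A] L.isotypic ξ) :=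
  Algebra.TensorProduct.lift
    { toRingHom := ((Module.End.baseChangeHom A R (L.isotypic ξ)).toRingHom).comp
        ((L.isotypicHom v hv ξ).comp Algebra.TensorProduct.includeLeftRingHom)
      commutes' := fun c => by
        change (L.isotypicHom v hv ξ (algebraMap ℤ_[p] B c ⊗ₜ 1)).baseChange R = _
        rw [Algebra.algebraMap_eq_smul_one, TensorProduct.smul_tmul, L.isotypicHom_tmul]
        ext x
        change (1 : R) ⊗ₜ[A] ((c • (1 : A)) • (L.isotypicHom v hv ξ 1 x)) =
          c • ((1 : R) ⊗ₜ[A] x)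
        rw [map_one, Module.End.one_apply, ← TensorProduct.smul_tmul, TensorProduct.smul_tmul',
          smul_assoc, one_smul] }
    ((Algebra.ofId R (Module.End R (R ⊗[A] L.isotypic ξ))).restrictScalars ℤ_[p])
    (fun _ r => (Algebra.commutes r _).symm)

theorem FilModule.isotypicHomExt_tmul (L : FilModule (oRing p K K' A))
    (ξ : inertiaSubgroup p K K' →* (OInt p E)ˣ) (b : B) (r : R) :
    L.isotypicHomExt v hv R ξ (b ⊗ₜ r) = r • (L.isotypicHom v hv ξ (b ⊗ₜ 1)).baseChange R := by
  have h : L.isotypicHomExt v hv R ξ (b ⊗ₜ r) = (L.isotypicHom v hv ξ (b ⊗ₜ 1)).baseChange R *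
    algebraMap R (Module.End R (R ⊗[A] L.isotypic ξ)) r := rfl
  rw [h, ← Algebra.commutes, ← Algebra.smul_def]

theorem FilModule.isotypicHomExt_tensMap (L : FilModule (oRing p K K' A))
    (ξ : inertiaSubgroup p K K' →* (OInt p E)ˣ) (z : B ⊗[ℤ_[p]] A) :
    L.isotypicHomExt v hv R ξ
        (tensMap (AlgHom.id ℤ_[p] B) (IsScalarTower.toAlgHom ℤ_[p] A R) z) =
      (L.isotypicHom v hv ξ z).baseChange R := by
  induction z using TensorProduct.induction_on with
  | zero => rw [map_zero, map_zero, map_zero, LinearMap.baseChange_zero]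
  | add x y hx hy => rw [map_add, map_add, map_add, LinearMap.baseChange_add, hx, hy]
  | tmul b a =>
    rw [tensMap_tmul, AlgHom.id_apply, L.isotypicHomExt_tmul v hv R, L.isotypicHom_tmul v hv ξ b a,
      LinearMap.baseChange_smul, IsScalarTower.coe_toAlgHom', algebraMap_smul]

theorem FilModule.isotypicHomExt_comp {C : Type u} [CommRing C] [Algebra ℤ_[p] C]
    (f : C →ₐ[ℤ_[p]] B) (w : C →ₐ[ℤ_[p]] OInt p K')
    (hw : ∀ g ∈ inertiaSubgroup p K K', (OInt.map (galHom p g)).comp w = w) (hf : v.comp f = w)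
    (L : FilModule (oRing p K K' A))
    (ξ : inertiaSubgroup p K K' →* (OInt p E)ˣ) (z : C ⊗[ℤ_[p]] R) :
    L.isotypicHomExt v hv R ξ (tensMap f (AlgHom.id ℤ_[p] R) z) =
      L.isotypicHomExt w hw R ξ z := by
  induction z using TensorProduct.induction_on with
  | zero => simp only [map_zero]
  | add x y hx hy => rw [map_add, map_add, map_add, hx, hy]
  | tmul c r =>
    rw [tensMap_tmul, AlgHom.id_apply, L.isotypicHomExt_tmul v hv R, L.isotypicHomExt_tmul w hw R,
      ← L.isotypicHom_comp v hv f w hw hf ξ, tensMap_tmul, map_one]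

theorem FilModule.isotypicHomExt_localization (L : FilModule (oRing p K K' A))
    (ξ : inertiaSubgroup p K K' →* (OInt p E)ˣ) (R' : Type u) [CommRing R'] [Algebra A R']
    [Algebra ℤ_[p] R'] [IsScalarTower ℤ_[p] A R'] [Algebra R R'] [IsScalarTower A R R']
    [IsScalarTower ℤ_[p] R R'] (z : B ⊗[ℤ_[p]] R) :
    L.isotypicHomExt v hv R' ξ
        (tensMap (AlgHom.id ℤ_[p] B) (IsScalarTower.toAlgHom ℤ_[p] R R') z) =
      (TensorProduct.AlgebraTensorModule.cancelBaseChange A R R' R' (L.isotypic ξ)).toLinearMap ∘ₗ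
        (L.isotypicHomExt v hv R ξ z).baseChange R' ∘ₗ
        (TensorProduct.AlgebraTensorModule.cancelBaseChange A R R' R'
          (L.isotypic ξ)).symm.toLinearMap := by
  induction z using TensorProduct.induction_on with
  | zero =>
    rw [map_zero, map_zero (L.isotypicHomExt v hv R' ξ), map_zero (L.isotypicHomExt v hv R ξ),
      LinearMap.baseChange_zero, LinearMap.zero_comp, LinearMap.comp_zero]
  | add x y hx hy =>
    rw [map_add, map_add (L.isotypicHomExt v hv R' ξ), map_add (L.isotypicHomExt v hv R ξ),
      LinearMap.baseChange_add, hx, hy, LinearMap.add_comp, LinearMap.comp_add]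
  | tmul b r =>
    rw [tensMap_tmul, AlgHom.id_apply, L.isotypicHomExt_tmul v hv R', L.isotypicHomExt_tmul v hv R]
    generalize L.isotypicHom v hv ξ (b ⊗ₜ 1) = T
    ext x
    change algebraMap R R' r • ((1 : R') ⊗ₜ[A] T x) =
      TensorProduct.AlgebraTensorModule.cancelBaseChange A R R' R' (L.isotypic ξ)
        ((1 : R') ⊗ₜ[R] (r • ((1 : R) ⊗ₜ[A] T x)))
    rw [TensorProduct.smul_tmul', TensorProduct.smul_tmul',
      TensorProduct.AlgebraTensorModule.cancelBaseChange_tmul, smul_eq_mul, mul_one, smul_eq_mul,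
      mul_one, Algebra.smul_def, mul_one]

/-- A homomorphism `B → O_E` of `ℤ_p`-algebras, composed with `O_E → A → R`. -/
noncomputable def toCoeff (A : Type u) [CommRing A] [Algebra ℤ_[p] A] [Algebra (OInt p E) A]
    [IsScalarTower ℤ_[p] (OInt p E) A] (R : Type u) [CommRing R] [Algebra A R] [Algebra ℤ_[p] R]
    [IsScalarTower ℤ_[p] A R] {B : Type u} [CommRing B] [Algebra ℤ_[p] B]
    (f : B →ₐ[ℤ_[p]] OInt p E) : B →ₐ[ℤ_[p]] R :=
  ((IsScalarTower.toAlgHom ℤ_[p] A R).comp (IsScalarTower.toAlgHom ℤ_[p] (OInt p E) A)).comp f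

theorem toCoeff_apply {B : Type u} [CommRing B] [Algebra ℤ_[p] B] (f : B →ₐ[ℤ_[p]] OInt p E)
    (b : B) : toCoeff A R f b = algebraMap A R (algebraMap (OInt p E) A (f b)) := rfl

variable (A) in
/-- The polynomial function `a ↦ ∏ ψ(a)`, for a finite family of homomorphisms `ψ : B → O_E`. -/
noncomputable def coeffNorm {ι : Type*} [Fintype ι] (f : ι → B →ₐ[ℤ_[p]] OInt p E) :
    B ⊗[ℤ_[p]] R →* R where
  toFun z := ∏ i, Algebra.TensorProduct.productMap (toCoeff A R (f i)) (AlgHom.id ℤ_[p] R) z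
  map_one' := by simp only [map_one, Finset.prod_const_one]
  map_mul' x y := by simp only [map_mul, Finset.prod_mul_distrib]

theorem coeffNorm_apply {ι : Type*} [Fintype ι] (f : ι → B →ₐ[ℤ_[p]] OInt p E)
    (z : B ⊗[ℤ_[p]] R) : coeffNorm A R f z =
      ∏ i, Algebra.TensorProduct.productMap (toCoeff A R (f i)) (AlgHom.id ℤ_[p] R) z := rfl

theorem coeffNorm_localization {ι : Type*} [Fintype ι] (f : ι → B →ₐ[ℤ_[p]] OInt p E)
    (R' : Type u) [CommRing R'] [Algebra A R']
    [Algebra ℤ_[p] R'] [IsScalarTower ℤ_[p] A R'] [Algebra R R'] [IsScalarTower A R R']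
    [IsScalarTower ℤ_[p] R R'] (z : B ⊗[ℤ_[p]] R) :
    coeffNorm A R' f (tensMap (AlgHom.id ℤ_[p] B) (IsScalarTower.toAlgHom ℤ_[p] R R') z) =
      algebraMap R R' (coeffNorm A R f z) := by
  rw [coeffNorm_apply, coeffNorm_apply, map_prod]
  refine Finset.prod_congr rfl fun i _ => ?_
  induction z using TensorProduct.induction_on with
  | zero => simp only [map_zero]
  | add x y hx hy => simp only [map_add, hx, hy]
  | tmul b r =>
    rw [tensMap_tmul, Algebra.TensorProduct.productMap_apply_tmul,
      Algebra.TensorProduct.productMap_apply_tmul, map_mul, toCoeff_apply, toCoeff_apply,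
      ← IsScalarTower.algebraMap_apply A R R']
    rfl

end Extend

variable (p K K') in
/-- The inclusion of the ring of integers of `N = K ⬝ W(k')[1/p]` into the one of `K'`. -/
noncomputable def unramVal : integralClosure ℤ_[p] (unramField p K K') →ₐ[ℤ_[p]] OInt p K' :=
  (unramFieldVal p K K').mapIntegralClosure

theorem map_unramVal (g : K' ≃ₐ[K] K') (hg : g ∈ inertiaSubgroup p K K') :
    (OInt.map (galHom p g)).comp (unramVal p K K') = unramVal p K K' :=
  AlgHom.ext fun a => Subtype.ext (unramField_fixed hg a.1.2)

variable (p K K' E) in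
/-- The maps on rings of integers induced by the embeddings of `N` into `E`. -/
noncomputable def unramEmb (ψ : unramField p K K' →ₐ[ℚ_[p]] E) :
    integralClosure ℤ_[p] (unramField p K K') →ₐ[ℤ_[p]] OInt p E :=
  (ψ.restrictScalars ℤ_[p]).mapIntegralClosure

theorem FilModule.det_sum_isotypicMul (L : FilModule (oRing p K K' A))
    (ξ : inertiaSubgroup p K K' →* (OInt p E)ˣ) (R : Type u) [CommRing R] [Algebra A R]
    [Algebra ℤ_[p] R] [IsScalarTower ℤ_[p] A R] {n : ℕ}
    (a : Fin n → integralClosure ℤ_[p] (unramField p K K')) (r : Fin n → R) :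
    LinearMap.det (L.isotypicHomExt (unramVal p K K') map_unramVal R ξ (∑ i, a i ⊗ₜ r i)) =
      coeffNorm A R (unramEmb p K K' E) (∑ i, a i ⊗ₜ r i) ↔
    LinearMap.det (∑ i, r i • (L.isotypicMul ξ (a i)).baseChange R) =
      ∏ ψ : unramField p K K' →ₐ[ℚ_[p]] E, ∑ i, r i * algebraMap A R
        (algebraMap (OInt p E) A ((ψ.restrictScalars ℤ_[p]).mapIntegralClosure (a i))) := by
  have h1 : L.isotypicHomExt (unramVal p K K') map_unramVal R ξ (∑ i, a i ⊗ₜ r i) =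
      ∑ i, r i • (L.isotypicMul ξ (a i)).baseChange R := by
    refine (map_sum _ _ _).trans (Finset.sum_congr rfl fun i _ => ?_)
    exact L.isotypicHomExt_tmul _ _ R ξ (a i) (r i)
  have h2 : coeffNorm A R (unramEmb p K K' E) (∑ i, a i ⊗ₜ r i) =
      ∏ ψ : unramField p K K' →ₐ[ℚ_[p]] E, ∑ i, r i * algebraMap A R
        (algebraMap (OInt p E) A ((ψ.restrictScalars ℤ_[p]).mapIntegralClosure (a i))) := by
    refine Finset.prod_congr rfl fun ψ _ => (map_sum _ _ _).trans
      (Finset.sum_congr rfl fun i _ => ?_)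
    exact mul_comm _ _
  rw [h1, h2]

theorem FilModule.StrongDet.det_eq {L : FilModule (oRing p K K' A)} (h : L.StrongDet E)
    (ξ : inertiaSubgroup p K K' →* (OInt p E)ˣ) (R : Type u) [CommRing R] [Algebra A R]
    [Algebra ℤ_[p] R] [IsScalarTower ℤ_[p] A R] [Module.Free R (R ⊗[A] L.isotypic ξ)]
    (z : integralClosure ℤ_[p] (unramField p K K') ⊗[ℤ_[p]] R) :
    LinearMap.det (L.isotypicHomExt (unramVal p K K') map_unramVal R ξ z) =
      coeffNorm A R (unramEmb p K K' E) z := by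
  obtain ⟨s, rfl⟩ := TensorProduct.exists_finset z
  have h1 : (s.sum fun i => i.1 ⊗ₜ[ℤ_[p]] i.2) = ∑ i : Fin s.card,
      (s.equivFin.symm i).1.1 ⊗ₜ[ℤ_[p]] (s.equivFin.symm i).1.2 := by
    rw [← Finset.sum_coe_sort s]
    exact (Equiv.sum_comp s.equivFin.symm fun i : s => i.1.1 ⊗ₜ[ℤ_[p]] i.1.2).symm
  rw [h1]
  exact (L.det_sum_isotypicMul ξ R _ _).2 (h ξ R inferInstance s.card _ _)

theorem FilModule.StrongDet.of_local [FiniteDimensional K K'] (ϖ : TameUniformiser p K K')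
    {L : FilModule (oRing p K K' A)} (hL : L.IsProjective)
    (h : ∀ (ξ : inertiaSubgroup p K K' →* (OInt p E)ˣ) (R : Type u) [CommRing R] [Algebra A R]
      [Algebra ℤ_[p] R] [IsScalarTower ℤ_[p] A R] [IsLocalRing R]
      (z : integralClosure ℤ_[p] (unramField p K K') ⊗[ℤ_[p]] R),
      LinearMap.det (L.isotypicHomExt (unramVal p K K') map_unramVal R ξ z) =
        coeffNorm A R (unramEmb p K K' E) z) : L.StrongDet E := by
  intro ξ R _ _ hfree n a r
  obtain ⟨hf, -⟩ := ϖ.finite_projective_isotypic hL ξ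
  let _ : Algebra ℤ_[p] R := ((algebraMap A R).comp (algebraMap ℤ_[p] A)).toAlgebra
  have : IsScalarTower ℤ_[p] A R := IsScalarTower.of_algebraMap_eq fun _ => rfl
  refine (L.det_sum_isotypicMul ξ R a r).1 ?_
  generalize (∑ i, a i ⊗ₜ[ℤ_[p]] r i) = z
  rw [← sub_eq_zero]
  refine eq_zero_of_localization _ fun P hP => ?_
  rw [map_sub, sub_eq_zero, ← LinearMap.det_baseChange, ← coeffNorm_localization,
    ← h ξ (Localization.AtPrime P), L.isotypicHomExt_localization _ _ R, LinearMap.det_conj]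

end Determinant

theorem prod_one_add_sub_one_mul {ι R : Type*} [CommRing R] (S : Finset ι) (x e : ι → R)
    (he : ∀ i ∈ S, ∀ j ∈ S, i ≠ j → e i * e j = 0) :
    ∏ i ∈ S, (1 + (x i - 1) * e i) = 1 + ∑ i ∈ S, (x i - 1) * e i := by
  classical
  induction S using Finset.induction_on with
  | empty => simp
  | insert a S ha ih =>
    rw [Finset.prod_insert ha, Finset.sum_insert ha, ih fun i hi j hj => he i
      (Finset.mem_insert_of_mem hi) j (Finset.mem_insert_of_mem hj)]
    have h : e a * ∑ i ∈ S, (x i - 1) * e i = 0 := by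
      rw [Finset.mul_sum]
      refine Finset.sum_eq_zero fun i hi => ?_
      rw [mul_left_comm, he a (Finset.mem_insert_self _ _) i (Finset.mem_insert_of_mem hi)
        (fun h => ha (h ▸ hi)), mul_zero]
    linear_combination (x a - 1) * h

section

variable {p : ℕ} [Fact p.Prime]
  {F : Type u} [Field F] [Algebra ℚ_[p] F] [Algebra ℤ_[p] F]
  [IsScalarTower ℤ_[p] ℚ_[p] F] [FiniteDimensional ℚ_[p] F]
  {R : Type u} [CommRing R] [Algebra ℤ_[p] R]

theorem wEval_wIdem_of_ne (s : WInt p F →ₐ[ℤ_[p]] R) {γ δ : ResF p F →+* ResF p F} (h : γ ≠ δ) :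
    wEval (s.comp (WittVector.mapAlg p δ)) (wIdem (s.comp (WittVector.mapAlg p γ))) = 0 := by
  have hb : Function.Bijective δ := Finite.injective_iff_bijective.1 δ.injective
  let δ' := RingEquiv.ofBijective δ hb
  have h1 : δ.comp ((δ'.symm : ResF p F →+* ResF p F).comp γ) = γ :=
    RingHom.ext fun x => δ'.apply_symm_apply (γ x)
  have h2 : (δ'.symm : ResF p F →+* ResF p F).comp γ ≠ RingHom.id _ := by
    intro h3
    rw [h3] at h1
    exact h h1.symm
  have h4 := sep_sum_mapAlg h2
  have h5 := congrArg (fun w => s (WittVector.mapAlg p δ w)) h4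
  simp only [map_sum, map_mul, map_zero] at h5
  rw [wIdem, map_sum, ← h5]
  refine Finset.sum_congr rfl fun i _ => ?_
  rw [wEval_tmul, AlgHom.comp_apply, AlgHom.comp_apply]
  congr 2
  rw [← AlgHom.comp_apply, WittVector.mapAlg_comp, h1]

theorem wIdem_mul_of_ne (s : WInt p F →ₐ[ℤ_[p]] R) {γ δ : ResF p F →+* ResF p F} (h : γ ≠ δ) :
    wIdem (s.comp (WittVector.mapAlg p γ)) * wIdem (s.comp (WittVector.mapAlg p δ)) = 0 := by
  rw [mul_wIdem, wEval_wIdem_of_ne s h, TensorProduct.tmul_zero, zero_mul]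

/-- Two multiplicative functions on `B ⊗ R`, where `B` is generated by `C` and `W(k)`, agree as
soon as they agree on elements supported on one of the idempotents of `W(k) ⊗ R`. -/
theorem MonoidHom.eq_of_wIdem {B C : Type u} [CommRing B] [Algebra ℤ_[p] B] [CommRing C]
    [Algebra ℤ_[p] C] (k : C →ₐ[ℤ_[p]] B) (j : WInt p F →ₐ[ℤ_[p]] B)
    (hB : Function.Surjective (Algebra.TensorProduct.productMap k j))
    (s : WInt p F →ₐ[ℤ_[p]] R) {M : Type*} [CommMonoid M] (D N : B ⊗[ℤ_[p]] R →* M)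
    (h : ∀ (γ : ResF p F →+* ResF p F) (b : C ⊗[ℤ_[p]] R),
      D (1 + tensMap k (AlgHom.id ℤ_[p] R) b * tensMap j (AlgHom.id ℤ_[p] R)
        (wIdem (s.comp (WittVector.mapAlg p γ)))) =
      N (1 + tensMap k (AlgHom.id ℤ_[p] R) b * tensMap j (AlgHom.id ℤ_[p] R)
        (wIdem (s.comp (WittVector.mapAlg p γ))))) : D = N := by
  classical
  have : Fintype (ResF p F →+* ResF p F) := Fintype.ofFinite _
  set kR := tensMap k (AlgHom.id ℤ_[p] R) with hkR
  set jR := tensMap j (AlgHom.id ℤ_[p] R) with hjR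
  have hone : ∑ γ : ResF p F →+* ResF p F,
      jR (wIdem (s.comp (WittVector.mapAlg p γ))) = 1 := by
    rw [← map_sum, ← finsum_eq_sum_of_fintype, sum_wIdem, map_one]
  have key : ∀ z : B ⊗[ℤ_[p]] R, ∃ b : (ResF p F →+* ResF p F) → C ⊗[ℤ_[p]] R,
      z = ∑ γ, kR (b γ) * jR (wIdem (s.comp (WittVector.mapAlg p γ))) := by
    intro z
    induction z using TensorProduct.induction_on with
    | zero => exact ⟨0, by simp⟩
    | add x y hx hy =>
      obtain ⟨b, rfl⟩ := hx
      obtain ⟨c, rfl⟩ := hy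
      exact ⟨b + c, by simp only [Pi.add_apply, map_add, add_mul, Finset.sum_add_distrib]⟩
    | tmul y r =>
      obtain ⟨y, rfl⟩ := hB y
      induction y using TensorProduct.induction_on with
      | zero => exact ⟨0, by simp⟩
      | add x y hx hy =>
        obtain ⟨b, hb⟩ := hx
        obtain ⟨c, hc⟩ := hy
        refine ⟨b + c, ?_⟩
        rw [map_add, TensorProduct.add_tmul, hb, hc]
        simp only [Pi.add_apply, map_add, add_mul, Finset.sum_add_distrib]
      | tmul c w =>
        refine ⟨fun γ => c ⊗ₜ (r * s (WittVector.mapAlg p γ w)), ?_⟩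
        have h1 : (Algebra.TensorProduct.productMap k j (c ⊗ₜ w)) ⊗ₜ[ℤ_[p]] r =
            kR (c ⊗ₜ r) * jR (w ⊗ₜ 1) := by
          rw [hkR, hjR, tensMap_tmul, tensMap_tmul, Algebra.TensorProduct.productMap_apply_tmul,
            Algebra.TensorProduct.tmul_mul_tmul, map_one, mul_one]
          rfl
        rw [h1, ← mul_one (kR _ * _), ← hone, Finset.mul_sum]
        refine Finset.sum_congr rfl fun γ _ => ?_
        rw [mul_assoc, ← map_mul, tmul_one_mul_wIdem, map_mul, ← mul_assoc]
        congr 1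
        rw [hkR, hjR, tensMap_tmul, tensMap_tmul, tensMap_tmul,
            Algebra.TensorProduct.tmul_mul_tmul, map_one, mul_one]
        rfl
  refine MonoidHom.ext fun z => ?_
  obtain ⟨b, rfl⟩ := key z
  have h2 : ∑ γ, kR (b γ) * jR (wIdem (s.comp (WittVector.mapAlg p γ))) =
      ∏ γ, (1 + kR (b γ - 1) * jR (wIdem (s.comp (WittVector.mapAlg p γ)))) := by
    have h3 := prod_one_add_sub_one_mul Finset.univ (fun γ => kR (b γ))
      (fun γ => jR (wIdem (s.comp (WittVector.mapAlg p γ)))) (fun γ _ δ _ hγ => by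
        rw [← map_mul, wIdem_mul_of_ne s hγ, map_zero])
    simp only [map_sub, map_one]
    rw [h3]
    simp only [sub_mul, one_mul, Finset.sum_sub_distrib]
    rw [hone]
    ring
  rw [h2, map_prod, map_prod]
  exact Finset.prod_congr rfl fun γ _ => h γ _

end

section Unramified

variable {p : ℕ} [Fact p.Prime]
  {K : Type u} [Field K] [Algebra ℚ_[p] K] [Algebra ℤ_[p] K]
  [IsScalarTower ℤ_[p] ℚ_[p] K] [FiniteDimensional ℚ_[p] K]
  {K' : Type u} [Field K'] [Algebra ℚ_[p] K'] [Algebra ℤ_[p] K']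
  [IsScalarTower ℤ_[p] ℚ_[p] K'] [FiniteDimensional ℚ_[p] K']
  [Algebra K K'] [IsScalarTower ℤ_[p] K K'] [IsScalarTower ℚ_[p] K K']

theorem OInt.map_galHom_comp_extHom (g : K' ≃ₐ[K] K') :
    (OInt.map (galHom p g)).comp (OInt.map (extHom p K K')) = OInt.map (extHom p K K') :=
  AlgHom.ext fun x => Subtype.ext (g.commutes _)

theorem OInt.map_galHom_comp_ofWittAlg (g : K' ≃ₐ[K] K') (hg : g ∈ inertiaSubgroup p K K') :
    (OInt.map (galHom p g)).comp (OInt.ofWittAlg p K') = OInt.ofWittAlg p K' :=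
  AlgHom.ext fun w => (OInt.map_ofWitt (galHom p g) w).trans
    (congrArg _ (WInt.map_of_mem_inertia hg w))

/-- An element of `O_{K'}` fixed by inertia lies in the subring generated by `O_K` and `W(k')`. -/
theorem TameUniformiser.exists_productMap_of_fixed [IsGalois K K'] [FiniteDimensional K K']
    (ϖ : TameUniformiser p K K') (x : OInt p K')
    (hx : ∀ g ∈ inertiaSubgroup p K K', OInt.map (galHom p g) x = x) :
    ∃ y, Algebra.TensorProduct.productMap (OInt.map (extHom p K K')) (OInt.ofWittAlg p K') y =
      x := by
  classical
  have h1 : ∀ c : OInt p K', ∃ d : OInt p K, OInt.map (extHom p K K') d =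
      ∑ g : K' ≃ₐ[K] K', OInt.map (galHom p g) c := by
    intro c
    have h2 : ∀ g : K' ≃ₐ[K] K', OInt.map (galHom p g)
        (∑ g : K' ≃ₐ[K] K', OInt.map (galHom p g) c) =
          ∑ g : K' ≃ₐ[K] K', OInt.map (galHom p g) c := by
      intro g
      rw [map_sum]
      exact Fintype.sum_equiv (Equiv.mulLeft g) _ _ fun h => rfl
    obtain ⟨d, hd⟩ := (IsGalois.mem_range_algebraMap_iff_fixed
      ((∑ g : K' ≃ₐ[K] K', OInt.map (galHom p g) c : OInt p K') : K')).2
      fun g => congrArg Subtype.val (h2 g)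
    have hd' : extHom p K K' d = ((∑ g : K' ≃ₐ[K] K', OInt.map (galHom p g) c : OInt p K') : K') :=
      hd
    refine ⟨⟨d, ?_⟩, Subtype.ext hd⟩
    change IsIntegral ℤ_[p] d
    rw [← isIntegral_algHom_iff (extHom p K K') (extHom p K K').toRingHom.injective, hd']
    exact (∑ g : K' ≃ₐ[K] K', OInt.map (galHom p g) c : OInt p K').2
  choose d hd using h1
  have h3 : ∑ i ∈ sepSet p K', OInt.ofWittAlg p K' (sepX p K' i) *
      ∑ g : K' ≃ₐ[K] K', OInt.map (galHom p g) (OInt.ofWittAlg p K' (sepY p K' i) * x) =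
        (Nat.card (inertiaSubgroup p K K') : OInt p K') * x := by
    simp only [Finset.mul_sum]
    rw [Finset.sum_comm]
    have h4 : ∀ g : K' ≃ₐ[K] K', ∑ i ∈ sepSet p K', OInt.ofWittAlg p K' (sepX p K' i) *
        OInt.map (galHom p g) (OInt.ofWittAlg p K' (sepY p K' i) * x) =
          if g ∈ inertiaSubgroup p K K' then x else 0 := by
      intro g
      have h5 : ∀ i, OInt.ofWittAlg p K' (sepX p K' i) *
          OInt.map (galHom p g) (OInt.ofWittAlg p K' (sepY p K' i) * x) =
            OInt.ofWittAlg p K' (sepX p K' i * WInt.map (galHom p g) (sepY p K' i)) *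
              OInt.map (galHom p g) x := by
        intro i
        rw [map_mul, OInt.map_ofWitt, map_mul, mul_assoc]
      simp only [h5]
      rw [← Finset.sum_mul, ← map_sum]
      split_ifs with hg
      · rw [sum_sep_act_of_mem hg, map_one, one_mul, hx g hg]
      · rw [sum_sep_act_of_notMem hg, map_zero, zero_mul]
    rw [Finset.sum_congr rfl fun g _ => h4 g, ← Finset.sum_filter, Finset.sum_const, nsmul_eq_mul]
    congr 2
    rw [Nat.card_eq_fintype_card, Fintype.card_subtype]
  obtain ⟨u, hu⟩ := ϖ.isUnit_card_inertia ℤ_[p]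
  refine ⟨(↑u⁻¹ : ℤ_[p]) • ∑ i ∈ sepSet p K', d (OInt.ofWittAlg p K' (sepY p K' i) * x) ⊗ₜ
    sepX p K' i, ?_⟩
  rw [map_smul, map_sum]
  simp only [Algebra.TensorProduct.productMap_apply_tmul, hd]
  rw [Finset.sum_congr rfl fun i _ => mul_comm _ _, h3, Algebra.smul_def, ← mul_assoc,
    ← map_natCast (algebraMap ℤ_[p] (OInt p K')), ← hu, ← map_mul, Units.inv_mul, map_one, one_mul]

variable (p K K') in
/-- The inclusion `O_K → O_N`. -/
noncomputable def unramBase : OInt p K →ₐ[ℤ_[p]] integralClosure ℤ_[p] (unramField p K K') :=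
  ((Algebra.ofId K (unramField p K K')).restrictScalars ℤ_[p]).mapIntegralClosure

variable (p K K') in
/-- The embedding `W(k') → N`. -/
noncomputable def unramWittField : WInt p K' →ₐ[ℤ_[p]] unramField p K K' where
  toFun w := ⟨(OInt.ofWittAlg p K' w : K'), IntermediateField.subset_adjoin _ _ ⟨w, rfl⟩⟩
  map_one' := Subtype.ext (congrArg (Subtype.val : OInt p K' → K') (map_one (OInt.ofWittAlg p K')))
  map_mul' a b := Subtype.ext (congrArg (Subtype.val : OInt p K' → K') (map_mul (OInt.ofWittAlg p K') a b))
  map_zero' := Subtype.ext (congrArg (Subtype.val : OInt p K' → K') (map_zero (OInt.ofWittAlg p K')))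
  map_add' a b := Subtype.ext (congrArg (Subtype.val : OInt p K' → K') (map_add (OInt.ofWittAlg p K') a b))
  commutes' a := Subtype.ext (congrArg (Subtype.val : OInt p K' → K') (AlgHom.commutes (OInt.ofWittAlg p K') a))

variable (p K K') in
/-- The embedding `W(k') → O_N`. -/
noncomputable def unramWitt : WInt p K' →ₐ[ℤ_[p]] integralClosure ℤ_[p] (unramField p K K') :=
  (unramWittField p K K').codRestrict _ fun w => by
    have h := (OInt.ofWittAlg p K' w).2
    exact (isIntegral_algHom_iff (unramFieldVal p K K') Subtype.val_injective).1 h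

theorem unramVal_comp_unramBase :
    (unramVal p K K').comp (unramBase p K K') = OInt.map (extHom p K K') := rfl

theorem unramVal_comp_unramWitt :
    (unramVal p K K').comp (unramWitt p K K') = OInt.ofWittAlg p K' := rfl

theorem unramVal_injective : Function.Injective (unramVal p K K') := fun _ _ h =>
  Subtype.ext (Subtype.val_injective (congrArg (Subtype.val : OInt p K' → K') h))

theorem TameUniformiser.productMap_unram_surjective [IsGalois K K'] [FiniteDimensional K K']
    (ϖ : TameUniformiser p K K') : Function.Surjective
      (Algebra.TensorProduct.productMap (unramBase p K K') (unramWitt p K K')) := by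
  intro x
  obtain ⟨y, hy⟩ := ϖ.exists_productMap_of_fixed (unramVal p K K' x)
    fun g hg => AlgHom.congr_fun (map_unramVal g hg) x
  refine ⟨y, unramVal_injective (Eq.trans ?_ hy)⟩
  rw [← AlgHom.comp_apply]
  congr 1
  refine Algebra.TensorProduct.ext' fun a b => ?_
  rw [AlgHom.comp_apply, Algebra.TensorProduct.productMap_apply_tmul,
    Algebra.TensorProduct.productMap_apply_tmul, map_mul, ← AlgHom.comp_apply,
    ← AlgHom.comp_apply, unramVal_comp_unramBase, unramVal_comp_unramWitt]

end Unramified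

section

variable {p : ℕ} [Fact p.Prime]
  {K : Type u} [Field K] [Algebra ℚ_[p] K] [Algebra ℤ_[p] K]
  [IsScalarTower ℤ_[p] ℚ_[p] K] [FiniteDimensional ℚ_[p] K]
  {K' : Type u} [Field K'] [Algebra ℚ_[p] K'] [Algebra ℤ_[p] K']
  [IsScalarTower ℤ_[p] ℚ_[p] K'] [FiniteDimensional ℚ_[p] K']
  [Algebra K K'] [IsScalarTower ℤ_[p] K K'] [IsScalarTower ℚ_[p] K K']
  {E : Type u} [Field E] [Algebra ℚ_[p] E] [Algebra ℤ_[p] E]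
  [IsScalarTower ℤ_[p] ℚ_[p] E] [FiniteDimensional ℚ_[p] E]

variable (K) in
/-- The embeddings of `K` into `E` with an extension to `N = K ⬝ W(k')[1/p]` which restricts to a
given homomorphism on `W(k')`. -/
def embSet (σ : WInt p K' →ₐ[ℤ_[p]] OInt p E) : Set (K →ₐ[ℚ_[p]] E) :=
  {φ | ∃ ψ : unramField p K K' →ₐ[ℚ_[p]] E, (∀ x, ψ (algebraMap K _ x) = φ x) ∧
    (unramEmb p K K' E ψ).comp (unramWitt p K K') = σ}

theorem unramField_algHom_ext {ψ ψ' : unramField p K K' →ₐ[ℚ_[p]] E}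
    (h1 : ∀ x, ψ (algebraMap K _ x) = ψ' (algebraMap K _ x))
    (h2 : (unramEmb p K K' E ψ).comp (unramWitt p K K') =
      (unramEmb p K K' E ψ').comp (unramWitt p K K')) : ψ = ψ' := by
  refine AlgHom.ext fun x => ?_
  obtain ⟨x, hx⟩ := x
  refine IntermediateField.adjoin_induction (F := K)
    (p := fun x hx => ψ ⟨x, hx⟩ = ψ' ⟨x, hx⟩) ?_ ?_ ?_ ?_ ?_ hx
  · rintro _ ⟨w, rfl⟩
    exact congrArg Subtype.val (AlgHom.congr_fun h2 w)
  · intro x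
    exact h1 x
  · intro x y hx hy h3 h4
    have := map_add ψ ⟨x, hx⟩ ⟨y, hy⟩
    rw [h3, h4, ← map_add] at this
    exact this
  · intro x hx h3
    have := map_inv₀ ψ ⟨x, hx⟩
    rw [h3, ← map_inv₀] at this
    exact this
  · intro x y hx hy h3 h4
    have := map_mul ψ ⟨x, hx⟩ ⟨y, hy⟩
    rw [h3, h4, ← map_mul] at this
    exact this

variable {A : Type u} [CommRing A] [Algebra ℤ_[p] A] [Algebra (OInt p E) A]
  [IsScalarTower ℤ_[p] (OInt p E) A]
  {R : Type u} [CommRing R] [Algebra A R] [Algebra ℤ_[p] R] [IsScalarTower ℤ_[p] A R]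

theorem productMap_tensMap {B C : Type u} [CommRing B] [Algebra ℤ_[p] B] [CommRing C]
    [Algebra ℤ_[p] C] (f : B →ₐ[ℤ_[p]] R) (k : C →ₐ[ℤ_[p]] B) (z : C ⊗[ℤ_[p]] R) :
    Algebra.TensorProduct.productMap f (AlgHom.id ℤ_[p] R) (tensMap k (AlgHom.id ℤ_[p] R) z) =
      Algebra.TensorProduct.productMap (f.comp k) (AlgHom.id ℤ_[p] R) z := by
  induction z using TensorProduct.induction_on with
  | zero => simp only [map_zero]
  | add x y hx hy => simp only [map_add, hx, hy]
  | tmul c r => rfl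

theorem wEval_toCoeff_wIdem (σ τ : WInt p K' →ₐ[ℤ_[p]] OInt p E) :
    wEval (toCoeff A R τ) (wIdem (toCoeff A R σ)) =
      algebraMap A R (algebraMap (OInt p E) A (wEval τ (wIdem σ))) := by
  simp only [wIdem, map_sum, wEval_tmul, map_mul, toCoeff_apply]

variable (A) in
theorem productMap_one_add_mul_wIdem {B C : Type u} [CommRing B]
    [Algebra ℤ_[p] B] [CommRing C] [Algebra ℤ_[p] C] (f : B →ₐ[ℤ_[p]] OInt p E)
    (k : C →ₐ[ℤ_[p]] B) (j : WInt p K' →ₐ[ℤ_[p]] B) (σ : WInt p K' →ₐ[ℤ_[p]] OInt p E)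
    (b : C ⊗[ℤ_[p]] R) [Decidable (f.comp j = σ)] :
    Algebra.TensorProduct.productMap (toCoeff A R f) (AlgHom.id ℤ_[p] R)
      (1 + tensMap k (AlgHom.id ℤ_[p] R) b *
        tensMap j (AlgHom.id ℤ_[p] R) (wIdem (toCoeff A R σ))) =
    if f.comp j = σ then 1 + Algebra.TensorProduct.productMap
      (toCoeff A R (f.comp k)) (AlgHom.id ℤ_[p] R) b else 1 := by
  have h0 : (toCoeff A R f).comp j = toCoeff A R (f.comp j) := rfl
  have h1 := wEval_toCoeff_wIdem (A := A) (R := R) σ (f.comp j)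
  rw [wEval] at h1
  have h3 : Algebra.TensorProduct.productMap (toCoeff A R (f.comp k)) (AlgHom.id ℤ_[p] R) b =
    Algebra.TensorProduct.productMap ((toCoeff A R f).comp k) (AlgHom.id ℤ_[p] R) b := rfl
  rw [map_add, map_mul, map_one, productMap_tensMap, productMap_tensMap, h0, h1, h3]
  split_ifs with hσ
  · rw [hσ, wEval_wIdem, map_one, map_one, mul_one]
  · have h2 : wEval (f.comp j) (wIdem σ) = 0 := by
      by_contra h3
      exact hσ (eq_of_wEval_wIdem_ne_zero h3)
    rw [h2, map_zero, map_zero, mul_zero, add_zero]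

variable (A) in
open Classical in
/-- The value of the norm on elements supported on one idempotent. -/
theorem coeffNorm_unram_one_add_mul_wIdem (σ : WInt p K' →ₐ[ℤ_[p]] OInt p E)
    (b : OInt p K ⊗[ℤ_[p]] R) :
    coeffNorm A R (unramEmb p K K' E) (1 + tensMap (unramBase p K K') (AlgHom.id ℤ_[p] R) b *
      tensMap (unramWitt p K K') (AlgHom.id ℤ_[p] R) (wIdem (toCoeff A R σ))) =
    ∏ φ ∈ Finset.univ.filter (· ∈ embSet K σ), (1 + Algebra.TensorProduct.productMap
      (toCoeff A R (OInt.map (φ.restrictScalars ℤ_[p]))) (AlgHom.id ℤ_[p] R) b) := by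
  refine (Finset.prod_congr rfl fun ψ _ => productMap_one_add_mul_wIdem A (unramEmb p K K' E ψ)
    (unramBase p K K') (unramWitt p K K') σ b).trans ?_
  refine (Finset.prod_filter _ _).symm.trans ?_
  refine Finset.prod_bij
    (fun ψ _ => ψ.comp ((Algebra.ofId K (unramField p K K')).restrictScalars ℚ_[p])) ?_ ?_ ?_ ?_
  · intro ψ hψ
    exact Finset.mem_filter.2 ⟨Finset.mem_univ _, ψ, fun x => rfl, (Finset.mem_filter.1 hψ).2⟩
  · intro ψ hψ ψ' hψ' h1
    exact unramField_algHom_ext (fun x => AlgHom.congr_fun h1 x)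
      ((Finset.mem_filter.1 hψ).2.trans (Finset.mem_filter.1 hψ').2.symm)
  · intro φ hφ
    obtain ⟨ψ, h1, h2⟩ := (Finset.mem_filter.1 hφ).2
    exact ⟨ψ, Finset.mem_filter.2 ⟨Finset.mem_univ _, h2⟩, AlgHom.ext h1⟩
  · intro ψ _
    rfl

variable {L' : Type u} [Field L'] [Algebra ℚ_[p] L'] [Algebra ℤ_[p] L']
  [IsScalarTower ℤ_[p] ℚ_[p] L'] [FiniteDimensional ℚ_[p] L']
  [Algebra K L'] [IsScalarTower ℤ_[p] K L'] [Algebra K' L'] [IsScalarTower ℤ_[p] K' L']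
  [IsScalarTower K K' L'] [IsScalarTower ℚ_[p] K L'] [IsScalarTower ℚ_[p] K' L']

variable (p K K' L') in
/-- The inclusion `K ⬝ W(k')[1/p] → K ⬝ W(l')[1/p]`. -/
noncomputable def unramInclusion : unramField p K K' →ₐ[ℚ_[p]] unramField p K L' :=
  (((Algebra.ofId K' L').restrictScalars ℚ_[p]).comp
    ((unramField p K K').val.restrictScalars ℚ_[p])).codRestrict
      ((unramField p K L').toSubalgebra.restrictScalars ℚ_[p]) (by
    rintro ⟨x, hx⟩
    change algebraMap K' L' x ∈ unramField p K L'
    refine IntermediateField.adjoin_induction (F := K)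
      (p := fun x _ => algebraMap K' L' x ∈ unramField p K L') ?_ ?_ ?_ ?_ ?_ hx
    · rintro _ ⟨w, rfl⟩
      exact IntermediateField.subset_adjoin _ _ ⟨WInt.map (extHom p K' L') w,
        (congrArg (Subtype.val : OInt p L' → L') (OInt.map_ofWitt (extHom p K' L') w)).symm⟩
    · intro x
      rw [← IsScalarTower.algebraMap_apply K K' L']
      exact (unramField p K L').algebraMap_mem x
    · intro x y _ _ h1 h2
      rw [map_add]
      exact add_mem h1 h2
    · intro x _ h1
      rw [map_inv₀]
      exact inv_mem h1
    · intro x y _ _ h1 h2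
      rw [map_mul]
      exact mul_mem h1 h2)

theorem embSet_comp_extHom [IsGalois K K'] [FiniteDimensional K L'] [IsGalois K L']
    (hdeg : ¬ p ∣ Module.finrank K' L')
    (hE : ∀ (f : L' →ₐ[ℚ_[p]] AlgebraicClosure E) (x : L'),
      f x ∈ Set.range (algebraMap E (AlgebraicClosure E)))
    (σ : WInt p L' →ₐ[ℤ_[p]] OInt p E) :
    embSet K (σ.comp (WInt.map (extHom p K' L'))) = embSet K σ := by
  ext φ
  constructor
  · rintro ⟨ψ, h1, h2⟩
    have : IsScalarTower ℚ_[p] (unramField p K K') L' :=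
      IsScalarTower.of_algebraMap_eq (R := ℚ_[p]) (S := unramField p K K') (A := L')
        fun x => IsScalarTower.algebraMap_apply ℚ_[p] K' L' x
    let ψ₁ : unramField p K K' →ₐ[ℚ_[p]] AlgebraicClosure E :=
      (Algebra.ofId E (AlgebraicClosure E)).restrictScalars ℚ_[p] |>.comp ψ
    let _ : Algebra (unramField p K K') (AlgebraicClosure E) := ψ₁.toRingHom.toAlgebra
    have : IsScalarTower ℚ_[p] (unramField p K K') (AlgebraicClosure E) :=
      IsScalarTower.of_algebraMap_eq fun x => (ψ₁.commutes x).symm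
    have : Algebra.IsAlgebraic (unramField p K K') L' :=
      Algebra.IsAlgebraic.tower_top (K := ℚ_[p]) (unramField p K K')
    let Ψ₁ : L' →ₐ[unramField p K K'] AlgebraicClosure E := IsAlgClosed.lift
    have h3 : ∀ x : L', ∃ y : E, algebraMap E (AlgebraicClosure E) y = Ψ₁ x :=
      fun x => hE (Ψ₁.restrictScalars ℚ_[p]) x
    choose Ψ₂ hΨ using h3
    have hinj := (algebraMap E (AlgebraicClosure E)).injective
    let Ψ : L' →ₐ[ℚ_[p]] E :=
      { toFun := Ψ₂
        map_one' := hinj (by rw [hΨ, map_one, map_one])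
        map_mul' := fun x y => hinj (by rw [hΨ, map_mul, map_mul, hΨ, hΨ])
        map_zero' := hinj (by rw [hΨ, map_zero, map_zero])
        map_add' := fun x y => hinj (by rw [hΨ, map_add, map_add, hΨ, hΨ])
        commutes' := fun x => hinj (by
          rw [hΨ, ← IsScalarTower.algebraMap_apply]
          exact (Ψ₁.restrictScalars ℚ_[p]).commutes x) }
    have h4 : ∀ x : unramField p K K', Ψ (algebraMap K' L' x) = ψ x := fun x =>
      hinj ((hΨ _).trans (Ψ₁.commutes x))
    let s : WInt p L' →ₐ[ℤ_[p]] OInt p E :=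
      (OInt.map (Ψ.restrictScalars ℤ_[p])).comp (OInt.ofWittAlg p L')
    have h5 : σ.comp (WInt.map (extHom p K' L')) = s.comp (WInt.map (extHom p K' L')) := by
      rw [← h2]
      refine AlgHom.ext fun w => Subtype.ext ?_
      refine (h4 (unramWittField p K K' w)).symm.trans ?_
      exact congrArg Ψ (congrArg (Subtype.val : OInt p L' → L')
        (OInt.map_ofWitt (extHom p K' L') w))
    obtain ⟨g, hg, h6⟩ := exists_comp_act_eq (K := K) hdeg h5
    refine ⟨(Ψ.comp ((g : L' →ₐ[K] L').restrictScalars ℚ_[p])).comp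
      ((unramField p K L').val.restrictScalars ℚ_[p]), fun x => ?_, ?_⟩
    · change Ψ (g (algebraMap K L' x)) = φ x
      rw [g.commutes, IsScalarTower.algebraMap_apply K K' L', ← h1]
      exact h4 (algebraMap K _ x)
    · rw [← h6]
      refine AlgHom.ext fun w => Subtype.ext ?_
      exact congrArg Ψ (congrArg (Subtype.val : OInt p L' → L') (OInt.map_ofWitt (galHom p g) w))
  · rintro ⟨ψ, h1, rfl⟩
    refine ⟨ψ.comp (unramInclusion p K K' L'), fun x => ?_, ?_⟩
    · rw [← h1]
      exact congrArg ψ (Subtype.ext (IsScalarTower.algebraMap_apply K K' L' x).symm)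
    · refine AlgHom.ext fun w => Subtype.ext ?_
      exact congrArg ψ (Subtype.ext
        (congrArg (Subtype.val : OInt p L' → L') (OInt.map_ofWitt (extHom p K' L') w)))

end

section

variable {p : ℕ} [Fact p.Prime]
  {F : Type u} [Field F] [Algebra ℚ_[p] F] [Algebra ℤ_[p] F]
  [IsScalarTower ℤ_[p] ℚ_[p] F] [FiniteDimensional ℚ_[p] F]
  {A : Type u} [CommRing A] [Algebra ℤ_[p] A]

/-- The image of an idempotent of `W(k) ⊗ A` in `O ⊗ A`. -/
noncomputable def oIdem (s : WInt p F →ₐ[ℤ_[p]] A) : OInt p F ⊗[ℤ_[p]] A :=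
  tensMap (OInt.ofWittAlg p F) (AlgHom.id ℤ_[p] A) (wIdem s)

theorem oIdem_mul_self (s : WInt p F →ₐ[ℤ_[p]] A) : oIdem s * oIdem s = oIdem s := by
  rw [oIdem, ← map_mul, wIdem_mul_self]

theorem ofWitt_tmul_one_mul_oIdem (s : WInt p F →ₐ[ℤ_[p]] A) (w : WInt p F) :
    (OInt.ofWittAlg p F w ⊗ₜ 1) * oIdem s = (1 ⊗ₜ s w) * oIdem s := by
  have h := congrArg (tensMap (OInt.ofWittAlg p F) (AlgHom.id ℤ_[p] A)) (tmul_one_mul_wIdem s w)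
  rw [map_mul, map_mul, tensMap_tmul, tensMap_tmul, map_one, map_one] at h
  exact h

variable {K : Type u} [Field K] [Algebra ℚ_[p] K] [Algebra ℤ_[p] K]
  [IsScalarTower ℤ_[p] ℚ_[p] K] [FiniteDimensional ℚ_[p] K]
  {K' : Type u} [Field K'] [Algebra ℚ_[p] K'] [Algebra ℤ_[p] K']
  [IsScalarTower ℤ_[p] ℚ_[p] K'] [FiniteDimensional ℚ_[p] K']
  [Algebra K K'] [IsScalarTower ℤ_[p] K K']

theorem OInt.map_comp_ofWittAlg {F₂ : Type u} [Field F₂] [Algebra ℚ_[p] F₂] [Algebra ℤ_[p] F₂]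
    [IsScalarTower ℤ_[p] ℚ_[p] F₂] [FiniteDimensional ℚ_[p] F₂] (f : F →ₐ[ℤ_[p]] F₂) :
    (OInt.map f).comp (OInt.ofWittAlg p F) = (OInt.ofWittAlg p F₂).comp (WInt.map f) :=
  AlgHom.ext fun w => OInt.map_ofWitt f w

theorem tensMap_oIdem {F₂ : Type u} [Field F₂] [Algebra ℚ_[p] F₂] [Algebra ℤ_[p] F₂]
    [IsScalarTower ℤ_[p] ℚ_[p] F₂] [FiniteDimensional ℚ_[p] F₂] (f : F →ₐ[ℤ_[p]] F₂)
    (s : WInt p F →ₐ[ℤ_[p]] A) : tensMap (OInt.map f) (AlgHom.id ℤ_[p] A) (oIdem s) =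
      tensMap (OInt.ofWittAlg p F₂) (AlgHom.id ℤ_[p] A)
        (tensMap (WInt.map f) (AlgHom.id ℤ_[p] A) (wIdem s)) := by
  rw [oIdem, tensMap_tensMap, tensMap_tensMap, OInt.map_comp_ofWittAlg]

theorem oIdem_act_of_mem {g : K' ≃ₐ[K] K'} (hg : g ∈ inertiaSubgroup p K K')
    (s : WInt p K' →ₐ[ℤ_[p]] A) :
    tensMap (OInt.map (galHom p g)) (AlgHom.id ℤ_[p] A) (oIdem s) = oIdem s := by
  rw [tensMap_oIdem, wIdem_act_of_mem hg, oIdem]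

theorem oIdem_mul_act_of_notMem {g : K' ≃ₐ[K] K'} (hg : g ∉ inertiaSubgroup p K K')
    (s : WInt p K' →ₐ[ℤ_[p]] A) :
    tensMap (OInt.map (galHom p g)) (AlgHom.id ℤ_[p] A) (oIdem s) * oIdem s = 0 := by
  rw [tensMap_oIdem, oIdem, ← map_mul, wIdem_mul_act_of_notMem hg, map_zero]

variable {L' : Type u} [Field L'] [Algebra ℚ_[p] L'] [Algebra ℤ_[p] L']
  [IsScalarTower ℤ_[p] ℚ_[p] L'] [FiniteDimensional ℚ_[p] L']
  [Algebra K L'] [IsScalarTower ℤ_[p] K L'] [Algebra K' L'] [IsScalarTower ℤ_[p] K' L']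
  [IsScalarTower K K' L'] [Normal K K'] [FiniteDimensional K L']

theorem tensMap_wIdem_comp_mul_wIdem (s : WInt p L' →ₐ[ℤ_[p]] A) :
    tensMap (WInt.map (extHom p K' L')) (AlgHom.id ℤ_[p] A)
      (wIdem (s.comp (WInt.map (extHom p K' L')))) * wIdem s = wIdem s := by
  rw [mul_wIdem, wEval_tensMap, wEval_wIdem]
  exact one_mul _

theorem tensMap_oIdem_comp_mul_oIdem (s : WInt p L' →ₐ[ℤ_[p]] A) :
    tensMap (OInt.map (extHom p K' L')) (AlgHom.id ℤ_[p] A)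
      (oIdem (s.comp (WInt.map (extHom p K' L')))) * oIdem s = oIdem s := by
  rw [tensMap_oIdem, oIdem, ← map_mul, tensMap_wIdem_comp_mul_wIdem]

variable [IsGalois K L'] (hdeg : ¬ p ∣ Module.finrank K' L')

include hdeg

theorem sum_act_wIdem (s : WInt p L' →ₐ[ℤ_[p]] A) : ∑ h ∈ (galRes K K' L').kerFinset,
    tensMap (WInt.map (galHom p h)) (AlgHom.id ℤ_[p] A) (wIdem s) =
      ((relInertia p K K' L').card : WCoeff p L' A) *
        tensMap (WInt.map (extHom p K' L')) (AlgHom.id ℤ_[p] A)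
          (wIdem (s.comp (WInt.map (extHom p K' L')))) := by
  obtain ⟨t, h1, h2, h3⟩ := WInt.exists_trace (p := p) (K := K) (K' := K') (L' := L') hdeg
  set ι := tensMap (WInt.map (extHom p K' L')) (AlgHom.id ℤ_[p] A) with hι
  set s₀ := s.comp (WInt.map (extHom p K' L')) with hs₀
  set r := t.rTensor A (wIdem s) with hr
  have h4 := natCast_mul_tensMap_rTensor (A := A) h3 (wIdem s)
  have h5 : r = (1 ⊗ₜ wEval s₀ r) * wIdem s₀ := by
    rw [← mul_wIdem, mul_comm, hr, ← rTensor_tensMap_mul (A := A) h1,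
      tensMap_wIdem_comp_mul_wIdem]
  have h6 : (Nat.card (galRes K K' L').ker : A) * wEval s₀ r = (relInertia p K K' L').card := by
    have := congrArg (wEval s) h4
    rwa [map_mul, map_natCast, wEval_tensMap, map_sum, sum_wEval_act_wIdem] at this
  have h7 : (Nat.card (galRes K K' L').ker : WCoeff p K' A) * r =
      (relInertia p K K' L').card * wIdem s₀ := by
    rw [h5, ← mul_assoc]
    congr 1
    have h8 : ∀ n : ℕ, (n : WCoeff p K' A) = 1 ⊗ₜ (n : A) := fun n =>
      (map_natCast (Algebra.TensorProduct.includeRight : A →ₐ[ℤ_[p]] WCoeff p K' A) n).symm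
    rw [h8, h8, Algebra.TensorProduct.tmul_mul_tmul, h6, one_mul]
  rw [← h4, ← map_natCast ι, ← map_mul, h7, map_mul, map_natCast]

theorem sum_act_oIdem (s : WInt p L' →ₐ[ℤ_[p]] A) : ∑ h ∈ (galRes K K' L').kerFinset,
    tensMap (OInt.map (galHom p h)) (AlgHom.id ℤ_[p] A) (oIdem s) =
      ((relInertia p K K' L').card : OInt p L' ⊗[ℤ_[p]] A) *
        tensMap (OInt.map (extHom p K' L')) (AlgHom.id ℤ_[p] A)
          (oIdem (s.comp (WInt.map (extHom p K' L')))) := by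
  simp only [tensMap_oIdem]
  rw [← map_sum, sum_act_wIdem hdeg, map_mul, map_natCast]

omit [FiniteDimensional K L'] [IsGalois K L'] hdeg [Normal K K'] [IsScalarTower K K' L']
  [Algebra K L'] [IsScalarTower ℤ_[p] K L'] in
theorem OInt.dvd_of_map_dvd (ϖ : TameUniformiser p K K') (ϖ' : OInt p L')
    (hϖ' : Ideal.span {ϖ'} = IsLocalRing.maximalIdeal (OInt p L')) {y : OInt p K'}
    (h : ϖ' ∣ OInt.map (extHom p K' L') y) : ϖ.pi ∣ y := by
  rw [← Ideal.mem_span_singleton, ϖ.span_pi, IsLocalRing.mem_maximalIdeal, mem_nonunits_iff]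
  intro hy
  have h1 := hy.map (OInt.map (extHom p K' L'))
  rw [← Ideal.mem_span_singleton, hϖ', IsLocalRing.mem_maximalIdeal, mem_nonunits_iff] at h
  exact h h1

variable {ϖ : TameUniformiser p K K'} {ϖ' : TameUniformiser p K L'} (hϖ : ϖ.Compatible ϖ')

include hϖ

/-- The linear form `c ↦ tr(π'' ^ (e - j) c) / π'`. -/
theorem TameUniformiser.Compatible.exists_twisted_trace {j : ℕ} (hj : j < ramIdx p K' L') :
    ∃ t : OInt p L' →ₗ[ℤ_[p]] OInt p K', (∀ b c, t (OInt.map (extHom p K' L') b * c) = b * t c) ∧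
      (∀ c, (Nat.card (galRes K K' L').ker : OInt p L') *
        OInt.map (extHom p K' L') (t (ϖ'.pi ^ j * c)) =
          ∑ h ∈ (galRes K K' L').kerFinset, OInt.map (galHom p h) c) ∧
      ∀ c, (Nat.card (galRes K K' L').ker : OInt p L') * (ϖ'.pi ^ j *
        OInt.map (extHom p K' L') (t c)) = ∑ h ∈ (galRes K K' L').kerFinset,
          ϖ'.cocycle h ^ (ramIdx p K' L' - j) * OInt.map (galHom p h) c := by
  obtain ⟨t, h1, h2, h3⟩ := OInt.exists_trace (p := p) (K := K) (K' := K') (L' := L') hdeg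
  have hϖ' : ϖ'.pi ^ ramIdx p K' L' = OInt.map (extHom p K' L') ϖ.pi := hϖ
  set e := ramIdx p K' L' with he
  have hsum : ∀ c, ∑ h ∈ (galRes K K' L').kerFinset, OInt.map (galHom p h) (ϖ'.pi ^ (e - j) * c) =
      ϖ'.pi ^ (e - j) * ∑ h ∈ (galRes K K' L').kerFinset,
        ϖ'.cocycle h ^ (e - j) * OInt.map (galHom p h) c := by
    intro c
    rw [Finset.mul_sum]
    refine Finset.sum_congr rfl fun h _ => ?_
    rw [map_mul, map_pow, ϖ'.map_pi]
    ring
  have h4 : ∀ c, ∃ d, ϖ.pi * d = t (ϖ'.pi ^ (e - j) * c) := by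
    intro c
    obtain ⟨d, hd⟩ := OInt.dvd_of_map_dvd ϖ ϖ'.pi ϖ'.span_pi
      (y := t (ϖ'.pi ^ (e - j) * c)) (by
        obtain ⟨u, hu⟩ := isUnit_card_ker' (p := p) (K := K) (K' := K') (L' := L') hdeg (OInt p L')
        rw [← u.dvd_mul_left, hu, h3, hsum]
        exact (dvd_pow_self _ (by omega)).mul_right _)
    exact ⟨d, hd.symm⟩
  choose d hd using h4
  have hc := mul_right_injective₀ ϖ.pi_ne_zero
  refine ⟨⟨⟨d, fun a b => hc ?_⟩, fun r a => hc ?_⟩, fun b c => hc ?_, fun c => ?_, fun c => ?_⟩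
  · simp only [mul_add, hd, map_add]
  · simp only [RingHom.id_apply, mul_smul_comm, hd, map_smul]
  · change ϖ.pi * d _ = ϖ.pi * (b * d c)
    rw [hd, mul_left_comm, h1, ← hd, mul_left_comm]
  · have h5 : d (ϖ'.pi ^ j * c) = t c := hc (by
      simp only []
      rw [hd, ← mul_assoc, ← pow_add, Nat.sub_add_cancel hj.le, hϖ', h1])
    change _ * OInt.map (extHom p K' L') (d _) = _
    rw [h5, h3]
  · refine mul_left_injective₀ (pow_ne_zero (e - j) ϖ'.pi_ne_zero) ?_
    have h6 : ϖ'.pi ^ j * OInt.map (extHom p K' L') (d c) * ϖ'.pi ^ (e - j) =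
        OInt.map (extHom p K' L') (t (ϖ'.pi ^ (e - j) * c)) := by
      rw [← hd, map_mul, ← hϖ']
      conv_rhs => rw [← Nat.sub_add_cancel hj.le, pow_add]
      ring
    change _ * (_ * OInt.map (extHom p K' L') (d c)) * _ = _ * _
    rw [mul_assoc, h6, h3, hsum, mul_comm]

end

section

variable {G G' : Type u} [Group G] [Group G'] {α : G' →* G} {X : GRing G} {Y : GRing G'}
  (F : GRing.Hom α X Y) (Λ : Y.carrier →+ X.carrier)
  (hΛ : ∀ r s, Λ (F.toRingHom r * s) = r * Λ s)

/-- If `c F(Λ(s))` is a combination of the `h(s)`, then the contraction by `Λ` satisfies the same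
relation. -/
theorem GModule.smul_of_contract (M : GModule X) {c : Y.carrier} {S : Finset G'} {a : G' → Y.carrier}
    (hS : ∀ h ∈ S, α h = 1)
    (hc : ∀ s, c * F.toRingHom (Λ s) = ∑ h ∈ S, a h * Y.act h s) (y : (M.baseChange F).carrier) :
    c • ScalarExt.of F.toRingHom M.carrier (ScalarExt.contract Λ hΛ M.carrier y) =
      (∑ h ∈ S, a h • (M.baseChange F).act h y : (M.baseChange F).carrier) := by
  induction y using ScalarExt.induction_of with
  | zero => simp only [map_zero, smul_zero, Finset.sum_const_zero]
  | add x y hx hy =>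
    rw [map_add, map_add, smul_add, hx, hy, ← Finset.sum_add_distrib]
    refine Finset.sum_congr rfl fun h _ => ?_
    rw [← smul_add]
    exact congrArg _ (map_add _ _ _).symm
  | smul_of s m =>
    rw [ScalarExt.contract_smul_of, ScalarExt.of_smul, smul_smul, hc, Finset.sum_smul]
    refine Finset.sum_congr rfl fun h hh => ?_
    have h1 : (M.baseChange F).act h (s • ScalarExt.of F.toRingHom M.carrier m) =
        Y.act h s • ScalarExt.of F.toRingHom M.carrier m := by
      refine ((M.baseChange F).act_smul h s _).trans (congrArg _ ?_)
      rw [M.baseChange_act_of, hS h hh, M.act_one]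
    rw [h1, smul_smul]

end

section

variable {p : ℕ} [Fact p.Prime]
  {K : Type u} [Field K] [Algebra ℚ_[p] K] [Algebra ℤ_[p] K]
  [IsScalarTower ℤ_[p] ℚ_[p] K] [FiniteDimensional ℚ_[p] K]
  {K' : Type u} [Field K'] [Algebra ℚ_[p] K'] [Algebra ℤ_[p] K']
  [IsScalarTower ℤ_[p] ℚ_[p] K'] [FiniteDimensional ℚ_[p] K']
  [Algebra K K'] [IsScalarTower ℤ_[p] K K']
  {L' : Type u} [Field L'] [Algebra ℚ_[p] L'] [Algebra ℤ_[p] L']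
  [IsScalarTower ℤ_[p] ℚ_[p] L'] [FiniteDimensional ℚ_[p] L']
  [Algebra K L'] [IsScalarTower ℤ_[p] K L'] [Algebra K' L'] [IsScalarTower ℤ_[p] K' L']
  [IsScalarTower K K' L'] [Normal K K'] [FiniteDimensional K L'] [IsGalois K L']
  {A : Type u} [CommRing A] [Algebra ℤ_[p] A]
  (hdeg : ¬ p ∣ Module.finrank K' L')
  {ϖ : TameUniformiser p K K'} {ϖ' : TameUniformiser p K L'} (hϖ : ϖ.Compatible ϖ')

theorem natCast_mul_tmul_mul_tensMap_rTensor {B C ι : Type u} [CommRing B] [Algebra ℤ_[p] B]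
    [CommRing C] [Algebra ℤ_[p] C] {j : B →ₐ[ℤ_[p]] C} {t : C →ₗ[ℤ_[p]] B} {P : C} {n : ℕ}
    {s : Finset ι} {a : ι → C} {act : ι → C →ₐ[ℤ_[p]] C}
    (hn : ∀ c, (n : C) * (P * j (t c)) = ∑ h ∈ s, a h * act h c) (y : C ⊗[ℤ_[p]] A) :
    (n : C ⊗[ℤ_[p]] A) * ((P ⊗ₜ 1) * tensMap j (AlgHom.id ℤ_[p] A) (t.rTensor A y)) =
      ∑ h ∈ s, (a h ⊗ₜ 1) * tensMap (act h) (AlgHom.id ℤ_[p] A) y := by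
  induction y using TensorProduct.induction_on with
  | zero => simp only [map_zero, mul_zero, Finset.sum_const_zero]
  | add x y hx hy =>
    simp only [map_add, mul_add, Finset.sum_add_distrib]
    rw [hx, hy]
  | tmul x b =>
    rw [LinearMap.rTensor_tmul, tensMap_tmul, Algebra.TensorProduct.tmul_mul_tmul, one_mul,
      ← nsmul_eq_mul, TensorProduct.smul_tmul', nsmul_eq_mul, hn, TensorProduct.sum_tmul]
    refine Finset.sum_congr rfl fun h _ => ?_
    rw [tensMap_tmul, Algebra.TensorProduct.tmul_mul_tmul, one_mul]

theorem natCast_mul_tensMap_rTensor_mul {B C ι : Type u} [CommRing B] [Algebra ℤ_[p] B]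
    [CommRing C] [Algebra ℤ_[p] C] {j : B →ₐ[ℤ_[p]] C} {t : C →ₗ[ℤ_[p]] B} {P : C} {n : ℕ}
    {s : Finset ι} {act : ι → C →ₐ[ℤ_[p]] C}
    (hn : ∀ c, (n : C) * j (t (P * c)) = ∑ h ∈ s, act h c) (y : C ⊗[ℤ_[p]] A) :
    (n : C ⊗[ℤ_[p]] A) * tensMap j (AlgHom.id ℤ_[p] A) (t.rTensor A ((P ⊗ₜ 1) * y)) =
      ∑ h ∈ s, tensMap (act h) (AlgHom.id ℤ_[p] A) y := by
  rw [← natCast_mul_tensMap_rTensor (t := t.comp (LinearMap.mulLeft ℤ_[p] P)) hn y]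
  congr 2
  induction y using TensorProduct.induction_on with
  | zero => rw [mul_zero, map_zero, map_zero]
  | add x y hx hy => rw [mul_add, map_add, map_add, hx, hy]
  | tmul x a => rw [Algebra.TensorProduct.tmul_mul_tmul, one_mul]; rfl

theorem natCast_mul_one_tmul {B : Type u} [CommRing B] [Algebra ℤ_[p] B] {n : ℕ} {a : A}
    (h : (n : A) * a = 1) : (n : B ⊗[ℤ_[p]] A) * (1 ⊗ₜ a) = 1 := by
  rw [← map_natCast (Algebra.TensorProduct.includeRight : A →ₐ[ℤ_[p]] B ⊗[ℤ_[p]] A),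
    Algebra.TensorProduct.includeRight_apply, Algebra.TensorProduct.tmul_mul_tmul, h, one_mul,
    ← Algebra.TensorProduct.one_def]

theorem one_tmul_mul_one_tmul {B : Type u} [CommRing B] [Algebra ℤ_[p] B] (a b : A) :
    (1 ⊗ₜ a : B ⊗[ℤ_[p]] A) * (1 ⊗ₜ b) = 1 ⊗ₜ (a * b) := by
  rw [Algebra.TensorProduct.tmul_mul_tmul, one_mul]

theorem mul_idem_aux {R : Type*} [CommRing R] {v ε ε' q c y d : R} (hε : ε * ε = ε)
    (hε' : ε' = ε) (h : q * ε = c * ε) (hd : v * c = d) : v * (ε * (q * (ε' * y))) = d * ε * y := by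
  subst hε' hd
  linear_combination v * y * (q * hε + h)

theorem mul_idem_aux' {R : Type*} [CommRing R] {v ε ε' q y : R} (h : ε' * ε = 0) :
    v * (ε * (q * (ε' * y))) = 0 := by
  linear_combination v * y * q * h

theorem exists_contraction_of_trace {R S : Type*} [CommRing R] [CommRing S] {ι : R →+* S}
    (hι : Function.Injective ι) {t : S →+ R} (ht : ∀ r y, t (ι r * y) = r * t y) {ε P : S} {ε₀ : R}
    (hε : ε * ε = ε) {n m : ℕ} {v : R} (hmv : m * v = 1) {H I : S → S}
    (h1 : ∀ y, n * ι (t (P * y)) = H y) (h2 : H ε = m * ι ε₀)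
    (h3 : ∀ y, n * (P * ι (t (ε * y))) = I y) :
    ∃ Λ : S →+ R, (∀ r y, Λ (ι r * y) = r * Λ y) ∧ (∀ y, Λ (ε * y) = Λ y) ∧
      Λ (ε * P) = ε₀ ∧ ∀ y, ε * P * ι (Λ y) = ι v * (ε * I y) := by
  let Λ : S →+ R := (AddMonoidHom.mulLeft (n * v)).comp (t.comp (AddMonoidHom.mulLeft ε))
  have hΛ : ∀ y, Λ y = n * v * t (ε * y) := fun _ => rfl
  refine ⟨Λ, fun r y => ?_, fun y => ?_, hι ?_, fun y => ?_⟩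
  · rw [hΛ, hΛ, mul_left_comm ε, ht, mul_left_comm]
  · rw [hΛ, hΛ, ← mul_assoc, hε]
  · have h4 := h1 ε
    have h5 := congrArg ι hmv
    rw [hΛ, ← mul_assoc, hε, mul_comm ε, map_mul ι, map_mul ι, map_natCast]
    rw [h2] at h4
    rw [map_mul ι, map_one, map_natCast] at h5
    linear_combination ι v * h4 + ι ε₀ * h5
  · rw [hΛ, ← h3, map_mul ι, map_mul ι, map_natCast]
    ring

/-- A linear form `C ⊗ A → B ⊗ A` inducing, on the parts cut out by the idempotents `ε` and `ε₀`,
the inverse of multiplication by `P`. -/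
structure TensContraction {B C ι : Type u} [CommRing B] [Algebra ℤ_[p] B]
    [CommRing C] [Algebra ℤ_[p] C] (j : B →ₐ[ℤ_[p]] C) (act : ι → C →ₐ[ℤ_[p]] C) (P : C)
    (I : Finset ι) (c : ι → A) (ε : C ⊗[ℤ_[p]] A) (ε₀ : B ⊗[ℤ_[p]] A) where
  toFun : C ⊗[ℤ_[p]] A →+ B ⊗[ℤ_[p]] A
  map_mul : ∀ r y, toFun (tensMap j (AlgHom.id ℤ_[p] A) r * y) = r * toFun y
  map_idem_mul : ∀ y, toFun (ε * y) = toFun y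
  map_idem_mul_tmul : toFun (ε * (P ⊗ₜ 1)) = ε₀
  mul_tensMap : ∀ y, ε * (P ⊗ₜ 1) * tensMap j (AlgHom.id ℤ_[p] A) (toFun y) =
    ∑ h ∈ I, (1 ⊗ₜ c h) * ε * tensMap (act h) (AlgHom.id ℤ_[p] A) y

theorem nonempty_tensContraction {B C ι : Type u} [CommRing B] [Algebra ℤ_[p] B]
    [CommRing C] [Algebra ℤ_[p] C] {j : B →ₐ[ℤ_[p]] C} {t : C →ₗ[ℤ_[p]] B} {P : C} {n m : ℕ}
    {s I : Finset ι} {a : ι → C} {act : ι → C →ₐ[ℤ_[p]] C}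
    (hj : Function.Injective (tensMap j (AlgHom.id ℤ_[p] A)))
    (ht : ∀ b c, t (j b * c) = b * t c)
    (h1 : ∀ c, (n : C) * j (t (P * c)) = ∑ h ∈ s, act h c)
    (h2 : ∀ c, (n : C) * (P * j (t c)) = ∑ h ∈ s, a h * act h c) {v : A} (hv : m * v = 1)
    {ε : C ⊗[ℤ_[p]] A} (hε : ε * ε = ε) {ε₀ : B ⊗[ℤ_[p]] A}
    (h3 : ∑ h ∈ s, tensMap (act h) (AlgHom.id ℤ_[p] A) ε =
      (m : C ⊗[ℤ_[p]] A) * tensMap j (AlgHom.id ℤ_[p] A) ε₀) (hI : I ⊆ s) {c : ι → A}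
    (h4 : ∀ h ∈ I, tensMap (act h) (AlgHom.id ℤ_[p] A) ε = ε)
    (h5 : ∀ h ∈ I, (a h ⊗ₜ 1) * ε = (1 ⊗ₜ c h) * ε)
    (h6 : ∀ h ∈ s, h ∉ I → tensMap (act h) (AlgHom.id ℤ_[p] A) ε * ε = 0) :
    Nonempty (TensContraction j act P I (fun h => v * c h) ε ε₀) := by
  obtain ⟨Λ, g1, g2, g3, g4⟩ := exists_contraction_of_trace
    hj (t := (t.rTensor A).toAddMonoidHom)
    (rTensor_tensMap_mul ht) (P := P ⊗ₜ 1) hε (natCast_mul_one_tmul hv)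
    (natCast_mul_tensMap_rTensor_mul h1) h3
    (fun y => natCast_mul_tmul_mul_tensMap_rTensor h2 (ε * y))
  refine ⟨⟨Λ, g1, g2, g3, fun y => ?_⟩⟩
  rw [g4, tensMap_tmul, map_one, Finset.mul_sum, Finset.mul_sum, ← Finset.sum_subset hI]
  · refine Finset.sum_congr rfl fun h hh => ?_
    rw [map_mul, AlgHom.id_apply]
    exact mul_idem_aux hε (h4 h hh) (h5 h hh) (one_tmul_mul_one_tmul _ _)
  · intro h hh hI
    rw [map_mul]
    exact mul_idem_aux' (h6 h hh hI)

include hdeg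

variable (K) in
include K in
theorem tensMap_extHom_injective : Function.Injective
    (tensMap (OInt.map (extHom p K' L')) (AlgHom.id ℤ_[p] A)) := by
  obtain ⟨t, h1, h2, -⟩ := OInt.exists_trace (p := p) (K := K) (K' := K') (L' := L') hdeg
  refine Function.LeftInverse.injective (g := t.rTensor A) fun r => ?_
  have h3 := rTensor_tensMap_mul (A := A) h1 r 1
  rwa [mul_one, Algebra.TensorProduct.one_def, LinearMap.rTensor_tmul, h2,
    ← Algebra.TensorProduct.one_def, mul_one] at h3

include hϖ

theorem TameUniformiser.Compatible.exists_tensContraction {j : ℕ} (hj : j < ramIdx p K' L')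
    (s : WInt p L' →ₐ[ℤ_[p]] A) : ∃ u : A, (relInertia p K K' L').card * u = 1 ∧
      Nonempty (TensContraction (OInt.map (extHom p K' L')) (fun h : L' ≃ₐ[K] L' =>
        OInt.map (galHom p h)) (ϖ'.pi ^ j) (relInertia p K K' L')
        (fun h => u * s (ϖ'.teich h) ^ (ramIdx p K' L' - j)) (oIdem s)
        (oIdem (s.comp (WInt.map (extHom p K' L'))))) := by
  obtain ⟨t, h1, h2, h3⟩ := hϖ.exists_twisted_trace hdeg hj
  obtain ⟨v, hv⟩ := isUnit_card_relInertia (p := p) (K' := K') (L' := L') K hdeg A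
  have hv' : ((relInertia p K K' L').card : A) * (↑v⁻¹ : A) = 1 := by rw [← hv, Units.mul_inv]
  refine ⟨↑v⁻¹, hv', nonempty_tensContraction (tensMap_extHom_injective (A := A) K hdeg)
    h1 h2 h3 hv' (oIdem_mul_self s) (sum_act_oIdem hdeg s)
    (fun h hh => MonoidHom.mem_kerFinset.2 (mem_relInertia.1 hh).1)
    (fun h hh => oIdem_act_of_mem (mem_relInertia.1 hh).2 s) (fun h _ => ?_)
    (fun h hh hI => oIdem_mul_act_of_notMem (fun hi => hI (mem_relInertia.2
      ⟨MonoidHom.mem_kerFinset.1 hh, hi⟩)) s)⟩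
  have h5 := ofWitt_tmul_one_mul_oIdem s (ϖ'.teich h ^ (ramIdx p K' L' - j))
  rwa [map_pow, map_pow, ϖ'.ofWitt_teich] at h5

end

section

variable {G G' : Type u} [Group G] [Group G'] {α : G' →* G} {X : GRing G} {Y : GRing G'}
  (F : GRing.Hom α X Y) (Λ : Y.carrier →+ X.carrier)
  (hΛ : ∀ r s, Λ (F.toRingHom r * s) = r * Λ s) {ε q P : Y.carrier} {ε₀ : X.carrier}

include hΛ in
theorem GModule.idem_smul_contract (M : GModule X) (h1 : ∀ y, Λ (ε * y) = Λ y)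
    (h2 : F.toRingHom ε₀ * ε = ε) (y : (M.baseChange F).carrier) :
    ε₀ • ScalarExt.contract Λ hΛ M.carrier y = ScalarExt.contract Λ hΛ M.carrier y := by
  induction y using ScalarExt.induction_of with
  | zero => rw [map_zero, smul_zero]
  | add x y hx hy => rw [map_add, smul_add, hx, hy]
  | smul_of s m =>
    rw [ScalarExt.contract_smul_of, smul_smul, ← hΛ, ← h1, mul_left_comm, ← mul_assoc, h2, h1]

theorem GModule.act_contract (M : GModule X) {g : G'} {r : X.carrier} (hq : IsUnit q)
    (h1 : ∀ y, Λ (ε * y) = Λ y) (h2 : F.toRingHom ε₀ * ε = ε) (h3 : Λ P = ε₀)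
    (hε : Y.act g ε = ε) (hP : Y.act g P = q * P) (hε₀ : X.act (α g) ε₀ = ε₀)
    {y : (M.baseChange F).carrier} (hy : (M.baseChange F).act g y = (q * F.toRingHom r) • y)
    (hf : P • ScalarExt.of F.toRingHom M.carrier (ScalarExt.contract Λ hΛ M.carrier y) =
      (ε • y : (M.baseChange F).carrier)) :
    M.act (α g) (ScalarExt.contract Λ hΛ M.carrier y) =
      r • ScalarExt.contract Λ hΛ M.carrier y := by
  set z := ScalarExt.contract Λ hΛ M.carrier y with hz
  have h4 := congrArg ((M.baseChange F).act g) hf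
  have h5 : (M.baseChange F).act g (P • ScalarExt.of F.toRingHom M.carrier z) =
      q • P • ScalarExt.of F.toRingHom M.carrier (M.act (α g) z) := by
    refine ((M.baseChange F).act_smul g _ _).trans ?_
    rw [M.baseChange_act_of, hP, mul_smul]
  have h6 : (M.baseChange F).act g (ε • y : (M.baseChange F).carrier) =
      q • P • ScalarExt.of F.toRingHom M.carrier (r • z) := by
    refine ((M.baseChange F).act_smul g _ _).trans ?_
    rw [hy, hε, smul_smul, mul_comm, mul_smul, ← hf, ScalarExt.of_smul, mul_smul,
      smul_comm P (F.toRingHom r)]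
  have h7 := (h5.symm.trans h4).trans h6
  obtain ⟨v, rfl⟩ := hq
  have h8 : P • ScalarExt.of F.toRingHom M.carrier (M.act (α g) z) =
      P • ScalarExt.of F.toRingHom M.carrier (r • z) := by
    have := congrArg (fun w => (↑v⁻¹ : Y.carrier) • w) h7
    simpa only [smul_smul, ← mul_assoc, Units.inv_mul, one_mul] using this
  have h9 := congrArg (ScalarExt.contract Λ hΛ M.carrier) h8
  have h10 := M.idem_smul_contract F Λ hΛ h1 h2 y
  rw [← hz] at h10
  rw [ScalarExt.contract_smul_of, ScalarExt.contract_smul_of, h3, smul_comm, h10] at h9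
  rw [← h9]
  conv_lhs => rw [← h10, M.act_smul, hε₀]

end

section

variable {p : ℕ} [Fact p.Prime]
  {K : Type u} [Field K] [Algebra ℚ_[p] K] [Algebra ℤ_[p] K]
  [IsScalarTower ℤ_[p] ℚ_[p] K] [FiniteDimensional ℚ_[p] K]
  {K' : Type u} [Field K'] [Algebra ℚ_[p] K'] [Algebra ℤ_[p] K']
  [IsScalarTower ℤ_[p] ℚ_[p] K'] [FiniteDimensional ℚ_[p] K']
  [Algebra K K'] [IsScalarTower ℤ_[p] K K'] [IsScalarTower ℚ_[p] K K']
  {L' : Type u} [Field L'] [Algebra ℚ_[p] L'] [Algebra ℤ_[p] L']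
  [IsScalarTower ℤ_[p] ℚ_[p] L'] [FiniteDimensional ℚ_[p] L']
  [Algebra K L'] [IsScalarTower ℤ_[p] K L'] [Algebra K' L'] [IsScalarTower ℤ_[p] K' L']
  [IsScalarTower K K' L'] [Normal K K'] [FiniteDimensional K L'] [IsGalois K L']
  [IsScalarTower ℚ_[p] K L']
  {E : Type u} [Field E] [Algebra ℚ_[p] E] [Algebra ℤ_[p] E]
  [IsScalarTower ℤ_[p] ℚ_[p] E] [FiniteDimensional ℚ_[p] E]
  {A : Type u} [CommRing A] [Algebra ℤ_[p] A] [Algebra (OInt p E) A]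
  [IsScalarTower ℤ_[p] (OInt p E) A]
  (hdeg : ¬ p ∣ Module.finrank K' L')
  {ϖ : TameUniformiser p K K'} {ϖ' : TameUniformiser p K L'} (hϖ : ϖ.Compatible ϖ')

variable (K A) in
/-- The idempotent `oIdem s` of `O_{L'} ⊗ A` multiplied by the `j`-th power of the uniformiser. -/
noncomputable def oRing.idemPow (ϖ' : TameUniformiser p K L') (s : WInt p L' →ₐ[ℤ_[p]] A) (j : ℕ) :
    (oRing p K L' A).carrier :=
  (oIdem s * ((ϖ'.pi ^ j) ⊗ₜ 1) : OInt p L' ⊗[ℤ_[p]] A)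

variable (K) in
/-- The idempotent `oIdem s` as an element of `oRing`. -/
noncomputable def oRing.idem (s : WInt p L' →ₐ[ℤ_[p]] A) : (oRing p K L' A).carrier :=
  oIdem s

theorem oIdem_mul_act_pow {g : L' ≃ₐ[K] L'} (hg : g ∈ inertiaSubgroup p K L') (j : ℕ)
    (s : WInt p L' →ₐ[ℤ_[p]] A) :
    (oRing p K L' A).act g (oRing.idemPow K A ϖ' s j) =
      oRing.ofCoeff p K L' A (s (ϖ'.teich g) ^ j) * oRing.idemPow K A ϖ' s j := by
  have h1 : (oRing p K L' A).act g (oRing.idemPow K A ϖ' s j) =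
      (oIdem s * ((OInt.ofWittAlg p L' (ϖ'.teich g ^ j)) ⊗ₜ 1 * ((ϖ'.pi ^ j) ⊗ₜ 1)) :
        OInt p L' ⊗[ℤ_[p]] A) := by
    refine (map_mul _ _ _).trans ?_
    refine congrArg₂ (· * ·) (oIdem_act_of_mem hg s) ?_
    refine (tensMap_tmul _ _ _ _).trans ?_
    rw [map_pow, ϖ'.map_pi, Algebra.TensorProduct.tmul_mul_tmul, map_pow, ϖ'.ofWitt_teich, mul_pow,
      map_one, one_mul]
  have h2 := ofWitt_tmul_one_mul_oIdem s (ϖ'.teich g ^ j)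
  rw [map_pow s] at h2
  have h3 : (oIdem s * ((OInt.ofWittAlg p L' (ϖ'.teich g ^ j)) ⊗ₜ 1 * ((ϖ'.pi ^ j) ⊗ₜ 1)) :
      OInt p L' ⊗[ℤ_[p]] A) =
        (1 ⊗ₜ (s (ϖ'.teich g) ^ j)) * (oIdem s * ((ϖ'.pi ^ j) ⊗ₜ 1)) := by
    rw [← mul_assoc, mul_comm (oIdem s), h2, mul_assoc]
  exact h1.trans h3

variable (p) in
/-- The characters `ξ` of `I(K'/K)` and `ξ'` of `I(L'/K)` differ by the `j`-th power of the character
of `I(L'/K)` on `π''`. -/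
def TwistedInflation (ϖ' : TameUniformiser p K L') (σ' : WInt p L' →ₐ[ℤ_[p]] OInt p E) (j : ℕ)
    (ξ : inertiaSubgroup p K K' →* (OInt p E)ˣ) (ξ' : inertiaSubgroup p K L' →* (OInt p E)ˣ) :
    Prop :=
  ∀ g, (ξ' g : OInt p E) = σ' (ϖ'.teich g.1) ^ j * (ξ (inertiaRes p K K' L' g) : OInt p E)

variable {σ' : WInt p L' →ₐ[ℤ_[p]] OInt p E} {j : ℕ} {ξ : inertiaSubgroup p K K' →* (OInt p E)ˣ}
  {ξ' : inertiaSubgroup p K L' →* (OInt p E)ˣ} (hξ : TwistedInflation p ϖ' σ' j ξ ξ')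
  {s : WInt p L' →ₐ[ℤ_[p]] A} (hs : ∀ w, s w = algebraMap (OInt p E) A (σ' w))

include hξ hs in
theorem TwistedInflation.ofCoeff_eq (g : inertiaSubgroup p K L') :
    oRing.ofCoeff p K L' A (algebraMap (OInt p E) A (ξ' g)) =
      oRing.ofCoeff p K L' A (s (ϖ'.teich g.1) ^ j) * (oRingExt K K' L' A).toRingHom
        (oRing.ofCoeff p K K' A (algebraMap (OInt p E) A (ξ (inertiaRes p K K' L' g)))) := by
  have h1 : ∀ a, (oRingExt K K' L' A).toRingHom (oRing.ofCoeff p K K' A a) =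
      oRing.ofCoeff p K L' A a := fun a =>
    (tensMap_tmul _ _ _ _).trans (by rw [map_one]; rfl)
  rw [h1, hξ g, map_mul, map_pow, map_mul, hs, map_pow]

include hξ hs in
theorem TwistedInflation.mem_isotypic (L : FilModule (oRing p K K' A)) (x : L.isotypic ξ) :
    RestrictAlong.val.symm (oRing.idemPow K A ϖ' s j •
      ScalarExt.of (oRingExt K K' L' A).toRingHom L.carrier (RestrictAlong.val x.1)) ∈
        (L.baseChangeObj (oRingExt K K' L' A)).isotypic ξ' := by
  refine ⟨Submodule.smul_mem _ _ (L.mem_baseChange_fil _ x.2.1), fun g => ?_⟩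
  rw [AddEquiv.apply_symm_apply, hξ.ofCoeff_eq hs g]
  refine ((L.toGModule.baseChange (oRingExt K K' L' A)).act_smul g.1 _ _).trans ?_
  have h2 : L.act (galRes K K' L' g.1) (RestrictAlong.val x.1) = _ :=
    x.2.2 (inertiaRes p K K' L' g)
  rw [oIdem_mul_act_pow g.2, L.baseChange_act_of, h2, ScalarExt.of_smul, smul_smul, smul_smul]
  exact congrArg (· • _) (mul_right_comm _ _ _)

include hξ hs hϖ in
theorem TwistedInflation.sum_act (hj : j ≤ ramIdx p K' L') {u : A}
    (hu : (relInertia p K K' L').card * u = 1) (L : GModule (oRing p K L' A))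
    {y : L.carrier} (hy : ∀ g : inertiaSubgroup p K L', L.act g.1 y =
      oRing.ofCoeff p K L' A (algebraMap (OInt p E) A (ξ' g)) • y) :
    ∑ h ∈ relInertia p K K' L', (oRing.ofCoeff p K L' A (u * s (ϖ'.teich h) ^ (ramIdx p K' L' - j)) *
        oRing.idem K s) • L.act h y = oRing.idem K s • y := by
  have h1 : ∀ h ∈ relInertia p K K' L',
      (oRing.ofCoeff p K L' A (u * s (ϖ'.teich h) ^ (ramIdx p K' L' - j)) *
        oRing.idem K s) • L.act h y = oRing.ofCoeff p K L' A u •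
        oRing.idem K s • y := by
    intro h hh
    obtain ⟨h2, h3⟩ := mem_relInertia.1 hh
    have h4 : inertiaRes p K K' L' ⟨h, h3⟩ = 1 := Subtype.ext h2
    have h5 : s (ϖ'.teich h) ^ (ramIdx p K' L' - j) *
        algebraMap (OInt p E) A (ξ' ⟨h, h3⟩) = 1 := by
      rw [hξ ⟨h, h3⟩, h4, map_one, Units.val_one, mul_one, map_pow, ← hs, ← pow_add,
        Nat.sub_add_cancel hj, ← map_pow, hϖ.teich_pow, h2, ϖ.teich_one, map_one, map_one]
    rw [hy ⟨h, h3⟩, smul_smul, smul_smul]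
    refine congrArg (· • y) ?_
    have h6 : oRing.ofCoeff p K L' A (u * s (ϖ'.teich h) ^ (ramIdx p K' L' - j)) *
        oRing.ofCoeff p K L' A (algebraMap (OInt p E) A (ξ' ⟨h, h3⟩)) =
          oRing.ofCoeff p K L' A u := by
      rw [← map_mul, mul_assoc, h5, mul_one]
    refine Eq.trans ?_ (congrArg (· * oRing.idem K s) h6)
    exact mul_right_comm _ _ _
  rw [Finset.sum_congr rfl h1, Finset.sum_const, ← Nat.cast_smul_eq_nsmul (oRing p K L' A).carrier,
    smul_smul, ← map_natCast (oRing.ofCoeff p K L' A), ← map_mul, hu, map_one, one_smul]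


include hdeg hϖ hξ hs in
/-- Multiplication by `π'' ^ j` induces, on the parts cut out by idempotents, an isomorphism between
isotypic parts of a module and of its base change. -/
theorem TwistedInflation.exists_isotypic_maps (hj : j < ramIdx p K' L')
    (L : FilModule (oRing p K K' A)) :
    ∃ (f : L.isotypic ξ →ₗ[A] (L.baseChangeObj (oRingExt K K' L' A)).isotypic ξ')
      (g : (L.baseChangeObj (oRingExt K K' L' A)).isotypic ξ' →ₗ[A] L.isotypic ξ),
      g ∘ₗ f = L.isotypicHom (OInt.ofWittAlg p K') OInt.map_galHom_comp_ofWittAlg ξ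
        (wIdem (s.comp (WInt.map (extHom p K' L')))) ∧
      f ∘ₗ g = (L.baseChangeObj (oRingExt K K' L' A)).isotypicHom (OInt.ofWittAlg p L')
        OInt.map_galHom_comp_ofWittAlg ξ' (wIdem s) ∧
      ∀ b : OInt p K, f ∘ₗ L.isotypicHom (OInt.map (extHom p K K'))
          (fun g _ => OInt.map_galHom_comp_extHom g) ξ (b ⊗ₜ 1) =
        (L.baseChangeObj (oRingExt K K' L' A)).isotypicHom (OInt.map (extHom p K L'))
          (fun g _ => OInt.map_galHom_comp_extHom g) ξ' (b ⊗ₜ 1) ∘ₗ f := by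
  obtain ⟨u, hu, ⟨c⟩⟩ := hϖ.exists_tensContraction hdeg hj s
  set F := oRingExt (p := p) K K' L' A with hF
  set M := L.toGModule.baseChange F with hM
  let Λ : (oRing p K L' A).carrier →+ (oRing p K K' A).carrier := c.toFun
  have hΛ : ∀ r y, Λ (F.toRingHom r * y) = r * Λ y := c.map_mul
  let P : (oRing p K L' A).carrier := oRing.idemPow K A ϖ' s j
  let ε : (oRing p K L' A).carrier := oIdem s
  let ε₀ : (oRing p K K' A).carrier := oIdem (s.comp (WInt.map (extHom p K' L')))
  let con := ScalarExt.contract Λ hΛ L.carrier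
  have hΛε : ∀ y, Λ (ε * y) = Λ y := c.map_idem_mul
  have hΛP : Λ P = ε₀ := c.map_idem_mul_tmul
  have hε : F.toRingHom ε₀ * ε = ε := tensMap_oIdem_comp_mul_oIdem s
  have hcoeff : ∀ a, F.toRingHom (oRing.ofCoeff p K K' A a) = oRing.ofCoeff p K L' A a := fun a =>
    (tensMap_tmul _ _ _ _).trans (by rw [map_one]; rfl)
  have hcon : ∀ y : (L.baseChangeObj F).isotypic ξ', P • ScalarExt.of F.toRingHom L.carrier
      (con (RestrictAlong.val y.1)) = ε • RestrictAlong.val y.1 := by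
    intro y
    refine (L.toGModule.smul_of_contract F Λ hΛ
      (fun h hh => (mem_relInertia.1 hh).1) c.mul_tensMap _).trans ?_
    exact hξ.sum_act hϖ hs hj.le hu M y.2.2
  let f₀ : L.carrier →+ M.carrier :=
    (DistribSMul.toAddMonoidHom M.carrier P).comp (ScalarExt.of F.toRingHom L.carrier)
  have hf₀ : ∀ r z, f₀ (r • z) = F.toRingHom r • f₀ z := fun r z =>
    (congrArg (fun w : M.carrier => P • w) (ScalarExt.of_smul F.toRingHom r z)).trans
      (smul_comm P (F.toRingHom r) (ScalarExt.of F.toRingHom L.carrier z : M.carrier))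
  let f : L.isotypic ξ →ₗ[A] (L.baseChangeObj F).isotypic ξ' :=
    { toFun := fun x => ⟨RestrictAlong.val.symm (f₀ (RestrictAlong.val x.1)),
        hξ.mem_isotypic hs L x⟩
      map_add' := fun x y => Subtype.ext (map_add f₀ (RestrictAlong.val x.1)
        (RestrictAlong.val y.1))
      map_smul' := fun a x => Subtype.ext ((hf₀ (oRing.ofCoeff p K K' A a)
        (RestrictAlong.val x.1)).trans
          (congrArg (fun r => r • f₀ (RestrictAlong.val x.1)) (hcoeff a))) }
  let g : (L.baseChangeObj F).isotypic ξ' →ₗ[A] L.isotypic ξ :=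
    { toFun := fun y => ⟨RestrictAlong.val.symm (con (RestrictAlong.val y.1)),
        ScalarExt.contract_mem Λ hΛ y.2.1, fun g => by
        obtain ⟨g, rfl⟩ := inertiaRes_surjective (p := p) hdeg g
        refine L.toGModule.act_contract F Λ hΛ (q := oRing.ofCoeff p K L' A (s (ϖ'.teich g.1) ^ j))
          ?_ hΛε hε hΛP (oIdem_act_of_mem g.2 s) (oIdem_mul_act_pow g.2 j s) ?_ ?_ (hcon y)
        · refine (IsUnit.pow j ?_).map (oRing.ofCoeff p K L' A)
          exact ((Group.isUnit g).map ϖ'.inertiaChar).map s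
        · exact oIdem_act_of_mem (inertiaRes p K K' L' g).2 _
        · exact (y.2.2 g).trans (congrArg (· • _) (hξ.ofCoeff_eq hs g))⟩
      map_add' := fun x y => Subtype.ext (map_add con (RestrictAlong.val x.1)
        (RestrictAlong.val y.1))
      map_smul' := fun a y => Subtype.ext (by
        refine Eq.trans ?_ (ScalarExt.contract_smul Λ hΛ (oRing.ofCoeff p K K' A a)
          (RestrictAlong.val y.1))
        exact congrArg (fun r => con (r • RestrictAlong.val y.1)) (hcoeff a).symm) }
  refine ⟨f, g, LinearMap.ext fun x => Subtype.ext ?_, LinearMap.ext fun y => Subtype.ext ?_,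
    fun b => LinearMap.ext fun x => Subtype.ext ?_⟩
  · refine (ScalarExt.contract_smul_of Λ hΛ P (RestrictAlong.val x.1)).trans ?_
    exact congrArg (· • RestrictAlong.val x.1) hΛP
  · exact hcon y
  · refine (hf₀ (tensMap (OInt.map (extHom p K K')) (AlgHom.id ℤ_[p] A) (b ⊗ₜ 1))
      (RestrictAlong.val x.1)).trans
        (congrArg (fun r => r • f₀ (RestrictAlong.val x.1)) ?_)
    refine (tensMap_tensMap _ _ _ _ _).trans ?_
    refine congrArg (fun v => tensMap v (AlgHom.id ℤ_[p] A) (b ⊗ₜ 1)) ?_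
    exact AlgHom.ext fun x => Subtype.ext (IsScalarTower.algebraMap_apply K K' L' (x : K)).symm

end

/-- If `c` embeds the kernel of the surjection `π` into a domain, then every character is the
product of the inflation of a character along `π` and a power of `c`. -/
theorem MonoidHom.exists_pow_mul_inflation {G' G D : Type*} [Group G'] [Finite G'] [Group G]
    [CommRing D] [IsDomain D] {π : G' →* G} (hπ : Function.Surjective π) (c : G' →* D)
    (hc : ∀ g, π g = 1 → c g = 1 → g = 1) {e : ℕ} (he : e ≠ 0) (hce : ∀ g, π g = 1 → c g ^ e = 1)
    (ξ' : G' →* Dˣ) :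
    ∃ j < e, ∃ ξ : G →* Dˣ, ∀ g, (ξ' g : D) = c g ^ j * (ξ (π g) : D) := by
  have hinj : Function.Injective (c.comp π.ker.subtype) := by
    rw [injective_iff_map_eq_one]
    exact fun g hg => Subtype.ext (hc g.1 g.2 hg)
  have : IsCyclic π.ker := isCyclic_of_injective_ringHom _ hinj
  obtain ⟨h₀, hh⟩ := IsCyclic.exists_generator (α := π.ker)
  have hm0 : orderOf h₀ ≠ 0 := (orderOf_pos h₀).ne'
  have : NeZero (orderOf h₀) := ⟨hm0⟩
  have hprim : IsPrimitiveRoot (c h₀.1) (orderOf h₀) := by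
    have h1 := IsPrimitiveRoot.orderOf (c h₀.1)
    have h2 : orderOf (c h₀.1) = orderOf h₀ := orderOf_injective (c.comp π.ker.subtype) hinj h₀
    rwa [h2] at h1
  have hpow : (ξ' h₀.1 : D) ^ orderOf h₀ = 1 := by
    rw [← Units.val_pow_eq_pow_val, ← map_pow, ← SubgroupClass.coe_pow, pow_orderOf_eq_one,
      OneMemClass.coe_one, map_one, Units.val_one]
  obtain ⟨j, hj, hj'⟩ := hprim.eq_pow_of_pow_eq_one hpow
  have hle : orderOf h₀ ≤ e := Nat.le_of_dvd (Nat.pos_of_ne_zero he)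
    (hprim.dvd_of_pow_eq_one _ (hce _ h₀.2))
  let χ : G' →* Dˣ := ξ' * (c.toHomUnits ^ j)⁻¹
  have hχ : π.ker ≤ χ.ker := by
    intro g hg
    obtain ⟨n, hn⟩ := Subgroup.mem_zpowers_iff.1 (hh ⟨g, hg⟩)
    have h1 : χ h₀.1 = 1 := by
      change ξ' h₀.1 * (c.toHomUnits h₀.1 ^ j)⁻¹ = 1
      rw [mul_inv_eq_one]
      exact Units.ext hj'.symm
    have h2 : g = h₀.1 ^ n := (congrArg Subtype.val hn).symm
    rw [MonoidHom.mem_ker, h2, map_zpow, h1, one_zpow]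
  refine ⟨j, hj.trans_le hle, π.liftOfSurjective hπ ⟨χ, hχ⟩, fun g => ?_⟩
  have h3 : π.liftOfSurjective hπ ⟨χ, hχ⟩ (π g) = χ g :=
    π.liftOfRightInverse_comp_apply _ _ ⟨χ, hχ⟩ g
  rw [h3]
  change _ = ((c.toHomUnits g ^ j * (ξ' g * (c.toHomUnits g ^ j)⁻¹) : Dˣ) : D)
  rw [mul_comm (ξ' g), mul_inv_cancel_left]

theorem LinearMap.det_one_add_comp_comm {R U V : Type*} [CommRing R] [AddCommGroup U] [Module R U]
    [AddCommGroup V] [Module R V] [Module.Free R U] [Module.Finite R U] [Module.Free R V]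
    [Module.Finite R V] (f : U →ₗ[R] V) (g : V →ₗ[R] U) :
    LinearMap.det (1 + g ∘ₗ f) = LinearMap.det (1 + f ∘ₗ g) := by
  classical
  let b := Module.Free.chooseBasis R U
  let b' := Module.Free.chooseBasis R V
  rw [← LinearMap.det_toMatrix b, ← LinearMap.det_toMatrix b', map_add, map_add,
    LinearMap.toMatrix_comp b b' b, LinearMap.toMatrix_comp b' b b', LinearMap.toMatrix_one,
    LinearMap.toMatrix_one, Matrix.det_one_add_mul_comm]

theorem LinearMap.det_one_add_mul_of_intertwine {R U V : Type*} [CommRing R] [AddCommGroup U]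
    [Module R U] [AddCommGroup V] [Module R V] [Module.Free R U] [Module.Finite R U]
    [Module.Free R V] [Module.Finite R V] (f : U →ₗ[R] V) (g : V →ₗ[R] U) (b : Module.End R U)
    (b' : Module.End R V) (h : f ∘ₗ b = b' ∘ₗ f) :
    LinearMap.det (1 + b * (g ∘ₗ f)) = LinearMap.det (1 + b' * (f ∘ₗ g)) := by
  have h1 := LinearMap.det_one_add_comp_comm f (b ∘ₗ g)
  rw [← LinearMap.comp_assoc, h] at h1
  exact h1

section

variable {p : ℕ} [Fact p.Prime]
  {K : Type u} [Field K] [Algebra ℚ_[p] K] [Algebra ℤ_[p] K]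
  [IsScalarTower ℤ_[p] ℚ_[p] K] [FiniteDimensional ℚ_[p] K]
  {K' : Type u} [Field K'] [Algebra ℚ_[p] K'] [Algebra ℤ_[p] K']
  [IsScalarTower ℤ_[p] ℚ_[p] K'] [FiniteDimensional ℚ_[p] K']
  [Algebra K K'] [IsScalarTower ℤ_[p] K K'] [IsScalarTower ℚ_[p] K K']
  {L' : Type u} [Field L'] [Algebra ℚ_[p] L'] [Algebra ℤ_[p] L']
  [IsScalarTower ℤ_[p] ℚ_[p] L'] [FiniteDimensional ℚ_[p] L']
  [Algebra K L'] [IsScalarTower ℤ_[p] K L'] [Algebra K' L'] [IsScalarTower ℤ_[p] K' L']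
  [IsScalarTower K K' L'] [FiniteDimensional K L'] [IsGalois K L']
  [IsScalarTower ℚ_[p] K L']
  {E : Type u} [Field E] [Algebra ℚ_[p] E] [Algebra ℤ_[p] E]
  [IsScalarTower ℤ_[p] ℚ_[p] E] [FiniteDimensional ℚ_[p] E]
  {A : Type u} [CommRing A] [Algebra ℤ_[p] A] [Algebra (OInt p E) A]
  [IsScalarTower ℤ_[p] (OInt p E) A]

theorem wittHom_injective (s : WInt p K' →ₐ[ℤ_[p]] OInt p E) : Function.Injective s := by
  rw [injective_iff_map_eq_zero]
  intro w hw
  by_contra h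
  obtain ⟨n, v, rfl⟩ := WittVector.exists_eq_pow_p_mul' w h
  rw [map_mul, map_pow, map_natCast] at hw
  exact mul_ne_zero (pow_ne_zero n OInt.p_ne_zero) ((v.isUnit.map s).ne_zero) hw

variable (hdeg : ¬ p ∣ Module.finrank K' L')
  {ϖ : TameUniformiser p K K'} {ϖ' : TameUniformiser p K L'} (hϖ : ϖ.Compatible ϖ')

include hdeg hϖ in
theorem exists_twistedInflation [Normal K K'] (σ' : WInt p L' →ₐ[ℤ_[p]] OInt p E)
    (ξ' : inertiaSubgroup p K L' →* (OInt p E)ˣ) :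
    ∃ j < ramIdx p K' L', ∃ ξ : inertiaSubgroup p K K' →* (OInt p E)ˣ,
      TwistedInflation p ϖ' σ' j ξ ξ' := by
  refine MonoidHom.exists_pow_mul_inflation (inertiaRes_surjective (p := p) hdeg)
    ((σ' : WInt p L' →* OInt p E).comp ϖ'.inertiaChar) (fun g _ hg => ?_) hϖ.ramIdx_ne_zero
    (fun g hg => ?_) ξ'
  · refine (injective_iff_map_eq_one ϖ'.inertiaChar).1 ϖ'.inertiaChar_injective g
      (wittHom_injective σ' ?_)
    rw [map_one]
    exact hg
  · have h1 : galRes K K' L' g.1 = 1 := congrArg Subtype.val hg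
    change σ' (ϖ'.teich g.1) ^ ramIdx p K' L' = 1
    rw [← map_pow, hϖ.teich_pow, h1, ϖ.teich_one, map_one, map_one]

theorem twistedInflation_comp_inertiaRes [Normal K K'] (ϖ' : TameUniformiser p K L')
    (σ' : WInt p L' →ₐ[ℤ_[p]] OInt p E) (ξ : inertiaSubgroup p K K' →* (OInt p E)ˣ) :
    TwistedInflation p ϖ' σ' 0 ξ (ξ.comp (inertiaRes p K K' L')) := fun g => by
  rw [pow_zero, one_mul]
  rfl

variable (R : Type u) [CommRing R] [Algebra A R] [Algebra ℤ_[p] R] [IsScalarTower ℤ_[p] A R]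

/-- The determinant on an isotypic part of `1 + b e`, where `b ∈ O_K ⊗ R` and `e` is the idempotent
given by `σ`. -/
noncomputable def FilModule.detIdem (L : FilModule (oRing p K K' A))
    (ξ : inertiaSubgroup p K K' →* (OInt p E)ˣ) (σ : WInt p K' →ₐ[ℤ_[p]] OInt p E)
    (b : OInt p K ⊗[ℤ_[p]] R) : R :=
  LinearMap.det (1 + L.isotypicHomExt (OInt.map (extHom p K K'))
      (fun g _ => OInt.map_galHom_comp_extHom g) R ξ b *
    L.isotypicHomExt (OInt.ofWittAlg p K') OInt.map_galHom_comp_ofWittAlg R ξ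
      (wIdem (toCoeff A R σ)))

variable (A) in
open Classical in
/-- The function `b ↦ ∏ (1 + φ(b))` on `O_K ⊗ R`, for a set of embeddings of `K` into `E`. -/
noncomputable def embProd (S : Set (K →ₐ[ℚ_[p]] E)) (b : OInt p K ⊗[ℤ_[p]] R) : R :=
  ∏ φ ∈ Finset.univ.filter (· ∈ S), (1 + Algebra.TensorProduct.productMap
      (toCoeff A R (OInt.map (φ.restrictScalars ℤ_[p]))) (AlgHom.id ℤ_[p] R) b)

theorem FilModule.detIdem_eq_det (L : FilModule (oRing p K K' A))
    (ξ : inertiaSubgroup p K K' →* (OInt p E)ˣ) (σ : WInt p K' →ₐ[ℤ_[p]] OInt p E)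
    (b : OInt p K ⊗[ℤ_[p]] R) :
    LinearMap.det (L.isotypicHomExt (unramVal p K K') map_unramVal R ξ
      (1 + tensMap (unramBase p K K') (AlgHom.id ℤ_[p] R) b *
        tensMap (unramWitt p K K') (AlgHom.id ℤ_[p] R) (wIdem (toCoeff A R σ)))) =
      L.detIdem R ξ σ b := by
  refine congrArg LinearMap.det ?_
  rw [map_add, map_mul, map_one, L.isotypicHomExt_comp _ _ R (unramBase p K K') _
    (fun g _ => OInt.map_galHom_comp_extHom g) rfl, L.isotypicHomExt_comp _ _ R (unramWitt p K K') _
    OInt.map_galHom_comp_ofWittAlg rfl]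

theorem Module.free_baseChange_of_isLocalRing {A : Type*} [CommRing A] (R : Type*) [CommRing R]
    [Algebra A R] [IsLocalRing R] (M : Type*) [AddCommGroup M] [Module A M] [Module.Finite A M]
    [Module.Projective A M] : Module.Free R (R ⊗[A] M) :=
  Module.free_of_flat_of_isLocalRing

theorem FilModule.strongDet_iff_detIdem [IsGalois K K'] [FiniteDimensional K K']
    (ϖ : TameUniformiser p K K') (σ₀ : WInt p K' →ₐ[ℤ_[p]] OInt p E)
    {L : FilModule (oRing p K K' A)} (hL : L.IsProjective) :
    L.StrongDet E ↔ ∀ (ξ : inertiaSubgroup p K K' →* (OInt p E)ˣ) (R : Type u) [CommRing R]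
      [Algebra A R] [Algebra ℤ_[p] R] [IsScalarTower ℤ_[p] A R] [IsLocalRing R]
      (σ : WInt p K' →ₐ[ℤ_[p]] OInt p E) (b : OInt p K ⊗[ℤ_[p]] R),
      L.detIdem R ξ σ b = embProd A R (embSet K σ) b := by
  constructor
  · intro h ξ R _ _ _ _ _ σ b
    obtain ⟨h1, h2⟩ := ϖ.finite_projective_isotypic hL ξ
    have := Module.free_baseChange_of_isLocalRing (A := A) R (L.isotypic ξ)
    rw [← L.detIdem_eq_det R, h.det_eq ξ R]
    exact coeffNorm_unram_one_add_mul_wIdem A σ b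
  · intro h
    refine FilModule.StrongDet.of_local ϖ hL fun ξ R _ _ _ _ _ z => ?_
    refine DFunLike.congr_fun (MonoidHom.eq_of_wIdem (unramBase p K K') (unramWitt p K K')
      ϖ.productMap_unram_surjective (toCoeff A R σ₀)
      (LinearMap.det.comp (L.isotypicHomExt (unramVal p K K') map_unramVal R ξ).toRingHom.toMonoidHom)
      (coeffNorm A R (unramEmb p K K' E)) fun γ b => ?_) z
    refine (L.detIdem_eq_det R ξ (σ₀.comp (WittVector.mapAlg p γ)) b).trans ?_
    refine (h ξ R _ b).trans ?_
    exact (coeffNorm_unram_one_add_mul_wIdem A (σ₀.comp (WittVector.mapAlg p γ)) b).symm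

variable {R} in
theorem FilModule.isotypicHomExt_wIdem (L : FilModule (oRing p K K' A))
    (ξ : inertiaSubgroup p K K' →* (OInt p E)ˣ) (σ : WInt p K' →ₐ[ℤ_[p]] OInt p E) :
    L.isotypicHomExt (OInt.ofWittAlg p K') OInt.map_galHom_comp_ofWittAlg R ξ
      (wIdem (toCoeff A R σ)) = (L.isotypicHom (OInt.ofWittAlg p K')
        OInt.map_galHom_comp_ofWittAlg ξ
        (wIdem ((IsScalarTower.toAlgHom ℤ_[p] (OInt p E) A).comp σ))).baseChange R := by
  rw [← L.isotypicHomExt_tensMap _ _ R, tensMap_wIdem]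
  rfl

include hdeg hϖ in
theorem TwistedInflation.detIdem_eq [IsGalois K K'] [FiniteDimensional K K'] [IsLocalRing R]
    {σ' : WInt p L' →ₐ[ℤ_[p]] OInt p E} {j : ℕ} {ξ : inertiaSubgroup p K K' →* (OInt p E)ˣ}
    {ξ' : inertiaSubgroup p K L' →* (OInt p E)ˣ} (hξ : TwistedInflation p ϖ' σ' j ξ ξ')
    (hj : j < ramIdx p K' L') {L : FilModule (oRing p K K' A)} (hL : L.IsProjective)
    (hL' : (L.baseChangeObj (oRingExt K K' L' A)).IsProjective) (b : OInt p K ⊗[ℤ_[p]] R) :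
    L.detIdem R ξ (σ'.comp (WInt.map (extHom p K' L'))) b =
      (L.baseChangeObj (oRingExt K K' L' A)).detIdem R ξ' σ' b := by
  obtain ⟨f, g, h1, h2, h3⟩ := hξ.exists_isotypic_maps hdeg hϖ
    (s := (IsScalarTower.toAlgHom ℤ_[p] (OInt p E) A).comp σ') (fun _ => rfl) hj L
  obtain ⟨h4, h5⟩ := ϖ.finite_projective_isotypic hL ξ
  obtain ⟨h6, h7⟩ := ϖ'.finite_projective_isotypic hL' ξ'
  have := Module.free_baseChange_of_isLocalRing (A := A) R (L.isotypic ξ)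
  have := Module.free_baseChange_of_isLocalRing (A := A) R
    ((L.baseChangeObj (oRingExt K K' L' A)).isotypic ξ')
  have h8 := (L.isotypicHomExt_wIdem (R := R) ξ (σ'.comp (WInt.map (extHom p K' L')))).trans
    ((congrArg (LinearMap.baseChange R) h1.symm).trans (LinearMap.baseChange_comp _ _))
  have h9 := ((L.baseChangeObj (oRingExt K K' L' A)).isotypicHomExt_wIdem (R := R) ξ' σ').trans
    ((congrArg (LinearMap.baseChange R) h2.symm).trans (LinearMap.baseChange_comp _ _))
  have h10 : f.baseChange R ∘ₗ L.isotypicHomExt (OInt.map (extHom p K K'))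
      (fun g _ => OInt.map_galHom_comp_extHom g) R ξ b =
      (L.baseChangeObj (oRingExt K K' L' A)).isotypicHomExt (OInt.map (extHom p K L'))
      (fun g _ => OInt.map_galHom_comp_extHom g) R ξ' b ∘ₗ f.baseChange R := by
    induction b using TensorProduct.induction_on with
    | zero => rw [map_zero, map_zero, LinearMap.comp_zero, LinearMap.zero_comp]
    | add x y hx hy => rw [map_add, map_add, LinearMap.comp_add, LinearMap.add_comp, hx, hy]
    | tmul b r =>
      rw [L.isotypicHomExt_tmul _ _ R, FilModule.isotypicHomExt_tmul _ _ R, LinearMap.comp_smul,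
        LinearMap.smul_comp, ← LinearMap.baseChange_comp, ← LinearMap.baseChange_comp, h3]
  refine (congrArg (fun e => LinearMap.det (1 + _ * e)) h8).trans ?_
  refine Eq.trans ?_ (congrArg (fun e => LinearMap.det (1 + _ * e)) h9).symm
  exact LinearMap.det_one_add_mul_of_intertwine _ _ _ _ h10

end

section

variable {p : ℕ} [Fact p.Prime]
  {K : Type u} [Field K] [Algebra ℚ_[p] K] [Algebra ℤ_[p] K]
  [IsScalarTower ℤ_[p] ℚ_[p] K] [FiniteDimensional ℚ_[p] K]
  {K' : Type u} [Field K'] [Algebra ℚ_[p] K'] [Algebra ℤ_[p] K']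
  [IsScalarTower ℤ_[p] ℚ_[p] K'] [FiniteDimensional ℚ_[p] K']
  [Algebra K K'] [IsScalarTower ℤ_[p] K K'] [IsScalarTower ℚ_[p] K K']
  {E : Type u} [Field E] [Algebra ℚ_[p] E] [Algebra ℤ_[p] E]
  [IsScalarTower ℤ_[p] ℚ_[p] E] [FiniteDimensional ℚ_[p] E]
  {A : Type u} [CommRing A] [Algebra ℤ_[p] A] [Algebra (OInt p E) A]
  [IsScalarTower ℤ_[p] (OInt p E) A]

/-- An isomorphism of pairs induces isomorphisms of isotypic parts. -/
noncomputable def FilModule.Iso.isotypicEquiv {L M : FilModule (oRing p K K' A)} (e : L.Iso M)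
    (ξ : inertiaSubgroup p K K' →* (OInt p E)ˣ) : L.isotypic ξ ≃ₗ[A] M.isotypic ξ where
  toFun x := ⟨RestrictAlong.val.symm (e.equiv (RestrictAlong.val x.1)),
    (e.map_fil _).2 x.2.1, fun g => by
      rw [AddEquiv.apply_symm_apply, ← e.map_act, x.2.2 g, map_smul]⟩
  invFun y := ⟨RestrictAlong.val.symm (e.equiv.symm (RestrictAlong.val y.1)),
    (e.map_fil _).1 (by
      rw [AddEquiv.apply_symm_apply, LinearEquiv.apply_symm_apply]
      exact y.2.1), fun g => e.equiv.injective (by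
      rw [AddEquiv.apply_symm_apply, e.map_act, LinearEquiv.apply_symm_apply, y.2.2 g, map_smul,
        LinearEquiv.apply_symm_apply])⟩
  map_add' x y := Subtype.ext (map_add e.equiv (RestrictAlong.val x.1) (RestrictAlong.val y.1))
  map_smul' a x := Subtype.ext (map_smul e.equiv (oRing.ofCoeff p K K' A a)
    (RestrictAlong.val x.1))
  left_inv x := Subtype.ext (e.equiv.symm_apply_apply (RestrictAlong.val x.1))
  right_inv y := Subtype.ext (e.equiv.apply_symm_apply (RestrictAlong.val y.1))

theorem FilModule.Iso.strongDet {L M : FilModule (oRing p K K' A)} (e : L.Iso M)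
    (h : L.StrongDet E) : M.StrongDet E := by
  intro ξ R _ _ hfree n a r
  let f := (e.isotypicEquiv ξ).baseChange A R
  have : Module.Free R (R ⊗[A] L.isotypic ξ) := Module.Free.of_equiv f.symm
  rw [← h ξ R this n a r, ← LinearMap.det_conj _ f]
  refine congrArg LinearMap.det (LinearMap.ext fun x => ?_)
  induction x using TensorProduct.induction_on with
  | zero => simp only [map_zero]
  | add x y hx hy => simp only [map_add, hx, hy]
  | tmul s y =>
    obtain ⟨x, rfl⟩ := (e.isotypicEquiv ξ).surjective y
    have h1 : f.symm (s ⊗ₜ e.isotypicEquiv ξ x) = s ⊗ₜ x :=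
      (LinearEquiv.symm_apply_eq _).2 rfl
    simp only [LinearMap.comp_apply, LinearEquiv.coe_coe, LinearMap.sum_apply,
      LinearMap.smul_apply, LinearMap.baseChange_tmul, h1, map_sum, map_smul]
    refine Finset.sum_congr rfl fun i _ => ?_
    refine congrArg (fun z => r i • s ⊗ₜ[A] z) (Subtype.ext ?_)
    exact (map_smul e.equiv (oRing.ofInt p K K' A
      ((unramFieldVal p K K').mapIntegralClosure (a i))) (RestrictAlong.val x.1)).symm

variable {L' : Type u} [Field L'] [Algebra ℚ_[p] L'] [Algebra ℤ_[p] L']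
  [IsScalarTower ℤ_[p] ℚ_[p] L'] [FiniteDimensional ℚ_[p] L']
  [Algebra K L'] [IsScalarTower ℤ_[p] K L'] [Algebra K' L'] [IsScalarTower ℤ_[p] K' L']
  [IsScalarTower K K' L']

theorem FilModule.IsProjective.baseChange [Normal K K'] {π : OInt p K'}
    (hπ : Ideal.span {π} = IsLocalRing.maximalIdeal (OInt p K'))
    {L : FilModule (oRing p K K' A)} (hL : L.IsProjective) :
    (L.baseChangeObj (oRingExt K K' L' A)).IsProjective := by
  obtain ⟨h1, h2, h4⟩ := hL
  exact ⟨ScalarExt.finite _, ScalarExt.projective _, L.projective_quotient_baseChange hπ h4⟩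

variable [FiniteDimensional K L'] [IsGalois K K'] [IsGalois K L'] [IsScalarTower ℚ_[p] K L']
  [IsScalarTower ℚ_[p] K' L']
  {ϖ : TameUniformiser p K K'} {ϖ' : TameUniformiser p K L'}

theorem exists_wittHom_of_embeddings (hE : ∀ (f : L' →ₐ[ℚ_[p]] AlgebraicClosure E) (x : L'),
      f x ∈ Set.range (algebraMap E (AlgebraicClosure E))) :
    Nonempty (WInt p L' →ₐ[ℤ_[p]] OInt p E) := by
  let Ψ₁ : L' →ₐ[ℚ_[p]] AlgebraicClosure E := IsAlgClosed.lift
  choose Ψ₂ hΨ using hE Ψ₁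
  have hinj := (algebraMap E (AlgebraicClosure E)).injective
  let Ψ : L' →ₐ[ℚ_[p]] E :=
    { toFun := Ψ₂
      map_one' := hinj (by rw [hΨ, map_one, map_one])
      map_mul' := fun x y => hinj (by rw [hΨ, map_mul, map_mul, hΨ, hΨ])
      map_zero' := hinj (by rw [hΨ, map_zero, map_zero])
      map_add' := fun x y => hinj (by rw [hΨ, map_add, map_add, hΨ, hΨ])
      commutes' := fun x => hinj (by
        rw [hΨ, ← IsScalarTower.algebraMap_apply]
        exact Ψ₁.commutes x) }
  exact ⟨(OInt.map (Ψ.restrictScalars ℤ_[p])).comp (OInt.ofWittAlg p L')⟩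

/-- The strong determinant condition may be checked after base change to `L'`. -/
theorem TameUniformiser.Compatible.strongDet_baseChange_iff [FiniteDimensional K K']
    (hϖ : ϖ.Compatible ϖ') (hdeg : ¬ p ∣ Module.finrank K' L')
    (hE : ∀ (f : L' →ₐ[ℚ_[p]] AlgebraicClosure E) (x : L'),
      f x ∈ Set.range (algebraMap E (AlgebraicClosure E)))
    {L : FilModule (oRing p K K' A)} (hL : L.IsProjective) :
    (L.baseChangeObj (oRingExt K K' L' A)).StrongDet E ↔ L.StrongDet E := by
  obtain ⟨s⟩ := exists_wittHom_of_embeddings (p := p) (L' := L') hE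
  have hL' := FilModule.IsProjective.baseChange (L' := L') ϖ.span_pi hL
  rw [FilModule.strongDet_iff_detIdem ϖ' s hL',
    FilModule.strongDet_iff_detIdem ϖ (s.comp (WInt.map (extHom p K' L'))) hL]
  constructor
  · intro h ξ R _ _ _ _ _ σ b
    obtain ⟨σ', rfl⟩ := exists_comp_extHom_eq (p := p) K hdeg s σ
    have h1 := twistedInflation_comp_inertiaRes ϖ' σ' ξ
    rw [h1.detIdem_eq hdeg hϖ R (Nat.pos_of_ne_zero hϖ.ramIdx_ne_zero) hL hL' b, h,
      embSet_comp_extHom hdeg hE]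
  · intro h ξ' R _ _ _ _ _ σ' b
    obtain ⟨j, hj, ξ, hξ⟩ := exists_twistedInflation hdeg hϖ σ' ξ'
    rw [← hξ.detIdem_eq hdeg hϖ R hj hL hL' b, h, embSet_comp_extHom hdeg hE]

theorem TameUniformiser.Compatible.strongDet_psi_iff [FiniteDimensional K K']
    (hϖ : ϖ.Compatible ϖ') (hdeg : ¬ p ∣ Module.finrank K' L')
    (hE : ∀ (f : L' →ₐ[ℚ_[p]] AlgebraicClosure E) (x : L'),
      f x ∈ Set.range (algebraMap E (AlgebraicClosure E)))
    (hA : IsTestAlg p E A) {d : ℕ} {M : PhiModule (ϖ.sRing A)} (hM : ϖ.IsBK d 1 M) :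
    ((ϖ'.Psi hA).obj (M.baseChangeObj (hϖ.sRingExt A))).StrongDet E ↔
      ((ϖ.Psi hA).obj M).StrongDet E := by
  let e : ((ϖ'.Psi hA).obj (M.baseChangeObj (hϖ.sRingExt A))).Iso
      (((ϖ.Psi hA).obj M).baseChangeObj (oRingExt K K' L' A)) :=
    PhiModule.toFilIso (hϖ.sRingExt A) (ϖ'.modE A hA.isNilpotent) (ϖ.modE A hA.isNilpotent)
      (oRingExt K K' L' A) (hϖ.modE_sRingExt hA.isNilpotent) (fun _ => rfl) M
  exact Iff.trans ⟨e.strongDet, e.symm.strongDet⟩ (hϖ.strongDet_baseChange_iff hdeg hE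
    (TameUniformiser.IsBK.isProjective hA.isNilpotent hM))

end

section

variable {p : ℕ} [Fact p.Prime]
  {K : Type u} [Field K] [Algebra ℚ_[p] K] [Algebra ℤ_[p] K]
  [IsScalarTower ℤ_[p] ℚ_[p] K] [FiniteDimensional ℚ_[p] K]
  {K' : Type u} [Field K'] [Algebra ℚ_[p] K'] [Algebra ℤ_[p] K']
  [IsScalarTower ℤ_[p] ℚ_[p] K'] [FiniteDimensional ℚ_[p] K']
  [Algebra K K'] [IsScalarTower ℤ_[p] K K'] [IsScalarTower ℚ_[p] K K']
  {E : Type u} [Field E] [Algebra ℚ_[p] E] [Algebra ℤ_[p] E]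
  [IsScalarTower ℤ_[p] ℚ_[p] E] [FiniteDimensional ℚ_[p] E]
  {A : Type u} [CommRing A] [Algebra ℤ_[p] A] [Algebra (OInt p E) A]
  [IsScalarTower ℤ_[p] (OInt p E) A]

theorem TameUniformiser.strongDet_psi_of_iso {ϖ : TameUniformiser p K K'} (hA : IsTestAlg p E A)
    {M N : PhiModule (ϖ.sRing A)} (e : M.Iso N) (h : ((ϖ.Psi hA).obj M).StrongDet E) :
    ((ϖ.Psi hA).obj N).StrongDet E :=
  FilModule.Iso.strongDet ((ϖ.Psi hA).map e) h

end

theorem proposition4p3p1 (p : ℕ) [Fact p.Prime]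
    (K K' L' E : Type u) [Field K] [Field K'] [Field L'] [Field E]
    [Algebra ℚ_[p] K] [Algebra ℚ_[p] K'] [Algebra ℚ_[p] L'] [Algebra ℚ_[p] E]
    [FiniteDimensional ℚ_[p] K] [FiniteDimensional ℚ_[p] K'] [FiniteDimensional ℚ_[p] L']
    [FiniteDimensional ℚ_[p] E]
    [Algebra ℤ_[p] K] [Algebra ℤ_[p] K'] [Algebra ℤ_[p] L'] [Algebra ℤ_[p] E]
    [IsScalarTower ℤ_[p] ℚ_[p] K] [IsScalarTower ℤ_[p] ℚ_[p] K']
    [IsScalarTower ℤ_[p] ℚ_[p] L'] [IsScalarTower ℤ_[p] ℚ_[p] E]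
    [Algebra K K'] [Algebra K L'] [Algebra K' L'] [IsScalarTower K K' L']
    [IsScalarTower ℤ_[p] K K'] [IsScalarTower ℤ_[p] K L'] [IsScalarTower ℤ_[p] K' L']
    [IsScalarTower ℚ_[p] K K'] [IsScalarTower ℚ_[p] K L'] [IsScalarTower ℚ_[p] K' L']
    [IsGalois K K'] [IsGalois K L']
    (hdeg : ¬ p ∣ Module.finrank K' L')
    (hE : ∀ (f : L' →ₐ[ℚ_[p]] AlgebraicClosure E) (x : L'),
      f x ∈ Set.range (algebraMap E (AlgebraicClosure E)))
    (ϖ : TameUniformiser p K K') (ϖ' : TameUniformiser p K L') (hϖ : ϖ.Compatible ϖ') :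
    (∀ (A : Type u) [CommRing A] [Algebra ℤ_[p] A] [Algebra (OInt p E) A]
        [IsScalarTower ℤ_[p] (OInt p E) A] (hA : IsTestAlg p E A),
      (∀ d : ℕ, InducesFullyFaithful (FilModule.baseChange (oRingExt K K' L' A))
        (Mloc p K K' A d) (Mloc p K L' A d)) ∧
      (∀ d h : ℕ, InducesFullyFaithful (PhiModule.baseChange (hϖ.sRingExt A))
        (ϖ.Cdd A d h) (ϖ'.Cdd A d h)) ∧
      (∃ e : PhiModule.baseChange (hϖ.sRingExt A) ⋙ ϖ'.Psi hA ≅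
          ϖ.Psi hA ⋙ FilModule.baseChange (oRingExt K K' L' A),
        ∀ (M : PhiModule (ϖ.sRing A)) (m : M.carrier),
          (e.hom.app M).equiv (GModule.tmul (ϖ'.modE A hA.isNilpotent) _ 1
              (M.toGModule.tmul (hϖ.sRingExt A).toHom 1 m)) =
            GModule.tmul (oRingExt K K' L' A) _ 1
              (M.toGModule.tmul (ϖ.modE A hA.isNilpotent) 1 m)) ∧
      (∀ (d h : ℕ) (V : Type u) [AddCommGroup V] [Module E V] [FiniteDimensional E V]
        (τ : Representation E (inertiaSubgroup p K K') V), Module.finrank E V = d →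
        InducesEquivalence (PhiModule.baseChange (hϖ.sRingExt A))
          (ϖ.Ctype A d h τ) (ϖ'.Ctype A d h (τ.comp (inertiaRes p K K' L')))) ∧
      InducesFullyFaithful (PhiModule.baseChange (hϖ.sRingExt A)) (ϖ.CddBT hA) (ϖ'.CddBT hA) ∧
      (∀ (V : Type u) [AddCommGroup V] [Module E V] [FiniteDimensional E V]
        (τ : Representation E (inertiaSubgroup p K K') V), Module.finrank E V = 2 →
        InducesEquivalence (PhiModule.baseChange (hϖ.sRingExt A))
          (ϖ.CtypeBT hA τ) (ϖ'.CtypeBT hA (τ.comp (inertiaRes p K K' L'))))) ∧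
    (∀ (A B : Type u) [CommRing A] [Algebra ℤ_[p] A] [Algebra (OInt p E) A]
        [IsScalarTower ℤ_[p] (OInt p E) A] [CommRing B] [Algebra ℤ_[p] B] [Algebra (OInt p E) B]
        [IsScalarTower ℤ_[p] (OInt p E) B] (f : A →ₐ[OInt p E] B),
      IsTestAlg p E A → IsTestAlg p E B →
      (∃ e : FilModule.baseChange (oRingExt K K' L' A) ⋙
            FilModule.baseChange (oRingCoeff K L' (f.restrictScalars ℤ_[p])) ≅
          FilModule.baseChange (oRingCoeff K K' (f.restrictScalars ℤ_[p])) ⋙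
            FilModule.baseChange (oRingExt K K' L' B),
        ∀ (L : FilModule (oRing p K K' A)) (m : L.carrier),
          (e.hom.app L).equiv (GModule.tmul (oRingCoeff K L' (f.restrictScalars ℤ_[p])) _ 1
              (L.toGModule.tmul (oRingExt K K' L' A) 1 m)) =
            GModule.tmul (oRingExt K K' L' B) _ 1
              (L.toGModule.tmul (oRingCoeff K K' (f.restrictScalars ℤ_[p])) 1 m)) ∧
      (∃ e : PhiModule.baseChange (hϖ.sRingExt A) ⋙
            PhiModule.baseChange (ϖ'.sRingCoeff (f.restrictScalars ℤ_[p])) ≅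
          PhiModule.baseChange (ϖ.sRingCoeff (f.restrictScalars ℤ_[p])) ⋙
            PhiModule.baseChange (hϖ.sRingExt B),
        ∀ (M : PhiModule (ϖ.sRing A)) (m : M.carrier),
          (e.hom.app M).equiv
              (GModule.tmul (ϖ'.sRingCoeff (f.restrictScalars ℤ_[p])).toHom _ 1
                (M.toGModule.tmul (hϖ.sRingExt A).toHom 1 m)) =
            GModule.tmul (hϖ.sRingExt B).toHom _ 1
              (M.toGModule.tmul (ϖ.sRingCoeff (f.restrictScalars ℤ_[p])).toHom 1 m))) := by
  have : FiniteDimensional K K' := Module.Finite.of_restrictScalars_finite ℚ_[p] K K'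
  have : FiniteDimensional K L' := Module.Finite.of_restrictScalars_finite ℚ_[p] K L'
  obtain ⟨σ⟩ := exists_wittHom_of_embeddings (p := p) (L' := L') hE
  refine ⟨fun A _ _ _ _ hA => ?_, fun A B _ _ _ _ _ _ _ _ f _ _ => ⟨?_, ?_⟩⟩
  · obtain ⟨h1, h2⟩ := hϖ.full_faithful hdeg A
    refine ⟨fun d => inducesFullyFaithful_Mloc hdeg ϖ.span_pi d, fun d h => ?_, ?_,
      fun d h V _ _ _ τ _ => ?_, ?_, fun V _ _ _ τ _ => ?_⟩
    · exact InducesFullyFaithful.of_full fun M hM => hϖ.isBK_baseChange hA.isNilpotent hM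
    · exact PhiModule.exists_toFilNatIso (hϖ.sRingExt A) (ϖ'.modE A hA.isNilpotent)
        (ϖ.modE A hA.isNilpotent) (oRingExt K K' L' A) (hϖ.modE_sRingExt hA.isNilpotent)
        (fun _ => rfl)
    · refine InducesEquivalence.of_full (fun M hM => ⟨hϖ.isBK_baseChange hA.isNilpotent hM.1,
        hϖ.hasType_baseChange hM.2⟩) fun M hM => ?_
      obtain ⟨N, h3, h4, ⟨e⟩⟩ := hϖ.exists_descent hdeg (σ : WInt p L' →+* OInt p E) hM.1 hM.2
      exact ⟨N, ⟨h3, h4⟩, ⟨e.toIso⟩⟩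
    · exact InducesFullyFaithful.of_full fun M hM => ⟨hϖ.isBK_baseChange hA.isNilpotent hM.1,
        (hϖ.strongDet_psi_iff hdeg hE hA hM.1).2 hM.2⟩
    · refine InducesEquivalence.of_full (fun M hM => ⟨hϖ.isBK_baseChange hA.isNilpotent hM.1,
        hϖ.hasType_baseChange hM.2.1, (hϖ.strongDet_psi_iff hdeg hE hA hM.1).2 hM.2.2⟩)
        fun M hM => ?_
      obtain ⟨N, h3, h4, ⟨e⟩⟩ := hϖ.exists_descent hdeg (σ : WInt p L' →+* OInt p E) hM.1 hM.2.1
      exact ⟨N, ⟨h3, h4, (hϖ.strongDet_psi_iff hdeg hE hA h3).1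
        (TameUniformiser.strongDet_psi_of_iso hA e.symm hM.2.2)⟩, ⟨e.toIso⟩⟩
  · exact FilModule.exists_squareNatIso _ _ _ _ (oRingCoeff_oRingExt (f.restrictScalars ℤ_[p]))
      (fun _ => rfl)
  · exact PhiModule.exists_squareNatIso _ _ _ _
      (hϖ.sRingCoeff_sRingExt (f.restrictScalars ℤ_[p])) (fun _ => rfl)
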